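/- Let $p\ge 1$ and $d$ be integers, $M$ a smooth $d$-manifold with a Riemannian metric $g$, and $N$ a smooth $p$-manifold. For a smooth family of immersions $X(\cdot,t):N\to M$ (defined for $(z,t)$ in an open subset of $N\times\mathbb R$) put, in local coordinates, $e_a^\mu=\partial_aX^\mu$, $\gamma_{ab}=g_{\mu\nu}e_a^\mu e_b^\nu$, $\mathrm{II}^\mu_{ab}=\nabla_a e_b^\mu$ (second fundamental form), $\mathrm{II}^\mu=\gamma^{ab}\mathrm{II}^\mu_{ab}$, and $$E_g^\mu[X]=\nabla_t^2X^\mu+\tfrac2p\,\partial_tX^\mu\,\partial_tX^\sigma\,\mathrm{II}_\sigma-\tfrac1p(\partial_tX)^2\,\mathrm{II}^\mu+\tfrac12\,\partial_aX^\mu\,\partial^a(\partial_tX)^2 ,$$ where $\nabla_t^2X^\mu=\partial_t^2X^\mu+\Gamma^\mu_{\alpha\beta}\partial_tX^\alpha\partial_tX^\beta$ and $\partial^a=\gamma^{ab}\partial_b$. Consider the equation $E_g[X]=0$ with initial data $X(z,0)=X_1(z)$, $\partial_tX(z,0)=v(z)$, where $X_1:N\to M$ is a smooth immersion and $v$ a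 smooth section of $X_1^*TM$. 1. (Weyl invariance.) Let $g'=e^{2\omega}g$ with $\omega$ smooth. At every point $(z,t)$ at which $\partial_tX\cdot\partial_aX=0$ for all $a$, one has $E_{g'}[X]=E_g[X]$. If $E_g[X]=0$, then $$\partial_t(\partial_tX\cdot\partial_aX)=-\tfrac2p\,(\partial_tX^\nu\,\mathrm{II}_\nu)\,(\partial_tX\cdot\partial_aX).$$ Suppose the domain of $X$ contains with $(z,t)$ all $(z,s)$ with $s$ between $0$ and $t$, and that $v$ is normal to $X_1$. Then for every solution $\partial_tX\cdot\partial_aX=0$ on the whole domain, and $X$ solves the equation for $g$ if and only if it solves it for $g'$. 2. (Diffeomorphism invariance.) $E_g[X]$ is a vector field along $X$, natural under diffeomorphisms: if $\Phi:M\to M'$ and $\Psi:N'\to N$ are diffeomorphisms and $g=\Phi^*g'$, then $E_{g'}[\Phi\circ X\circ(\Psi\times\mathrm{id})]=d\Phi(E_g[X]\circ(\Psi\times\mathrm{id}))$, in arbitrary charts. 3. (Solution order by order.) There are local operators $A_0,A_1,A_2,\dots$, depending only on $p$ and $d$, such that in any charts $A_n[v](z)$ is a homogeneous polynomial of degree $n$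 in the derivatives of $v$ at $z$ of order at most $n+1$, whose coefficients are smooth functions of the $(n+1)$-jets of $X_1$ at $z$ and of $g$ at $X_1(z)$ (on the open set of jets where $(g_{\mu\nu})$ and $(\gamma_{ab})$ are invertible), with the following properties. (a) For every $m$ and every $z_0\in N$ there is a smooth family $X$ of immersions, defined near $(z_0,0)$, with initial data $(X_1,v)$ and $\partial_t^jE_g[X]|_{t=0}=0$ for all $j<m$. Any $X$ with these properties satisfies $\partial_t^kX|_{t=0}=k!\,A_k[v]$ for all $k<m+2$, in all charts. (b) $\sum_{n\le2}A_n[v]^\mu=X_1^\mu+v^\mu-\tfrac12\Gamma^\mu_{\alpha\beta}v^\alpha v^\beta-\tfrac1p v^\mu v^\sigma\mathrm{II}_\sigma+\tfrac1{2p}v^2\,\mathrm{II}^\mu-\tfrac14\,\partial_aX_1^\mu\,\partial^a(v^2)$. (c) If $v$ is normal to $X_1$, then every $A_n[v]$ is the same for $g$ and for $e^{2\omega}g$. (d) Under diffeomorphisms $\Phi,\Psi$ as in 2, and under changes of charts, the formal series $\sum_n t^nA_n[v]$ transforms as a formal curve of maps: to every order in $t$, $\Phi\big(\sum_n t^nA_n[v]\circ\Psi\big)$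 is the series for the data $g'$, $\Phi\circ X_1\circ\Psi$, $d\Phi(v\circ\Psi)$. 4. (Parametrisation.) Write $X_{1,v}=\sum_nA_n[v]$ as a formal series in $v$. Let $X_2(z,\varepsilon)$ be a smooth family of maps, defined near $N\times\{0\}$, with $X_2(\cdot,0)=X_1$. Then there is exactly one formal series $v(\varepsilon)=\sum_{k\ge1}\varepsilon^kv_k$ of smooth normal fields along $X_1$ such that, to every order $m$ in $\varepsilon$ and near every point of $N$, $X_{1,v(\varepsilon)}(z)=X_2(\rho(z,\varepsilon),\varepsilon)+O(\varepsilon^{m+1})$ for some smooth local reparametrisation $\rho$ with $\rho(z,0)=z$ (equality of Taylor coefficients in all charts). The series $v(\varepsilon)$ is the same for $g$ and for $e^{2\omega}g$. -/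

import Mathlib

open scoped Manifold ContDiff

universe u₁ u₂ u₃ u₄

namespace Defect

noncomputable section

/-! ### Local differential geometry of a family of immersions, in components -/

/-- Coordinate space of dimension `n`. -/
abbrev Coord (n : ℕ) := EuclideanSpace ℝ (Fin n)

section Coordinates

variable {n p d : ℕ}

/-- The partial derivative `∂ᵢ f` at `y`. -/
def pderiv {F : Type*} [NormedAddCommGroup F] [NormedSpace ℝ F]
    (i : Fin n) (f : Coord n → F) (y : Coord n) : F :=
  fderiv ℝ f y (EuclideanSpace.single i 1)

/-- Components `Gⁱʲ` of the inverse of the matrix `Gᵢⱼ`. -/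
def inv (G : Fin n → Fin n → ℝ) (i j : Fin n) : ℝ := (Matrix.of G)⁻¹ i j

/-- The Christoffel symbols `Γᵏᵢⱼ` of the metric with components `g`. -/
def christoffel (g : Coord n → Fin n → Fin n → ℝ) (y : Coord n) (k i j : Fin n) : ℝ :=
  1 / 2 * ∑ l, inv (g y) k l *
    (pderiv i (fun y' => g y' l j) y + pderiv j (fun y' => g y' l i) y
      - pderiv l (fun y' => g y' i j) y)

/-- The inner product `G(ξ, η) = G_{μν} ξ^μ η^ν`. -/
def dot (G : Fin d → Fin d → ℝ) (ξ η : Fin d → ℝ) : ℝ := ∑ μ, ∑ ν, G μ ν * ξ μ * η ν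

/-- The tangent vectors `e_a^μ = ∂_a Y^μ` of a parametrised submanifold `Y`. -/
def frame (Y : Coord p → Coord d) (u : Coord p) (a : Fin p) (μ : Fin d) : ℝ :=
  pderiv a (fun u' => Y u' μ) u

/-- The induced metric `γ_{ab} = g_{μν} e_a^μ e_b^ν`. -/
def inducedMetric (g : Coord d → Fin d → Fin d → ℝ) (Y : Coord p → Coord d)
    (u : Coord p) (a b : Fin p) : ℝ :=
  dot (g (Y u)) (frame Y u a) (frame Y u b)

/-- The second fundamental form `II^μ_{ab} = ∇_a e_b^μ`, where `∇` acts on `μ` through the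
Levi-Civita connection of `g` and on `b` through that of the induced metric. -/
def secondFF (g : Coord d → Fin d → Fin d → ℝ) (Y : Coord p → Coord d)
    (u : Coord p) (a b : Fin p) (μ : Fin d) : ℝ :=
  pderiv a (fun u' => frame Y u' b μ) u
    + ∑ α, ∑ β, christoffel g (Y u) μ α β * frame Y u a α * frame Y u b β
    - ∑ c, christoffel (inducedMetric g Y) u c a b * frame Y u c μ

/-- The trace `II^μ = γ^{ab} II^μ_{ab}`. -/
def traceFF (g : Coord d → Fin d → Fin d → ℝ) (Y : Coord p → Coord d)
    (u : Coord p) (μ : Fin d) : ℝ :=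
  ∑ a, ∑ b, inv (inducedMetric g Y u) a b * secondFF g Y u a b μ

/-- The tangential gradient `∂_a Y^μ ∂^a f = e_a^μ γ^{ab} ∂_b f` of a function `f` on the
submanifold, as an ambient vector. -/
def tangGrad (g : Coord d → Fin d → Fin d → ℝ) (Y : Coord p → Coord d)
    (f : Coord p → ℝ) (u : Coord p) (μ : Fin d) : ℝ :=
  ∑ a, ∑ b, frame Y u a μ * inv (inducedMetric g Y u) a b * pderiv b f u

/-- The velocity `∂_t x^μ` of a family `x(u, t)`. -/
def vel (x : Coord p → ℝ → Coord d) (u : Coord p) (t : ℝ) (μ : Fin d) : ℝ :=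
  deriv (fun s => x u s μ) t

/-- The covariant acceleration `∇_t² x^μ = ∂_t² x^μ + Γ^μ_{αβ} ∂_t x^α ∂_t x^β`. -/
def accel (g : Coord d → Fin d → Fin d → ℝ) (x : Coord p → ℝ → Coord d)
    (u : Coord p) (t : ℝ) (μ : Fin d) : ℝ :=
  deriv (fun s => vel x u s μ) t
    + ∑ α, ∑ β, christoffel g (x u t) μ α β * vel x u t α * vel x u t β

/-- The left-hand side of the evolution equation,
`∇_t² x^μ + (2/p) ∂_t x^μ ∂_t x^σ II_σ - (1/p) (∂_t x)² II^μ + (1/2) ∂_a x^μ ∂^a (∂_t x)²`. -/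
def evolutionLHS (g : Coord d → Fin d → Fin d → ℝ) (x : Coord p → ℝ → Coord d)
    (u : Coord p) (t : ℝ) : Coord d :=
  WithLp.toLp 2 fun μ =>
    accel g x u t μ
      + 2 / (p : ℝ) * vel x u t μ *
          dot (g (x u t)) (vel x u t) (traceFF g (fun u' => x u' t) u)
      - 1 / (p : ℝ) * dot (g (x u t)) (vel x u t) (vel x u t) *
          traceFF g (fun u' => x u' t) u μ
      + 1 / 2 * tangGrad g (fun u' => x u' t)
          (fun u' => dot (g (x u' t)) (vel x u' t) (vel x u' t)) u μ

/-- The displaced submanifold to second order in the displacement field `V`: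
`Y^μ + V^μ - (1/2) Γ^μ_{αβ} V^α V^β - (1/p) V^μ V^σ II_σ + (1/(2p)) V² II^μ
  - (1/4) ∂_a Y^μ ∂^a (V²)`. -/
def secondOrderDisplacement (g : Coord d → Fin d → Fin d → ℝ) (Y V : Coord p → Coord d)
    (u : Coord p) : Coord d :=
  WithLp.toLp 2 fun μ =>
    Y u μ + V u μ
      - 1 / 2 * ∑ α, ∑ β, christoffel g (Y u) μ α β * V u α * V u β
      - 1 / (p : ℝ) * V u μ * dot (g (Y u)) (V u) (traceFF g Y u)
      + 1 / (2 * (p : ℝ)) * dot (g (Y u)) (V u) (V u) * traceFF g Y u μ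
      - 1 / 4 * tangGrad g Y (fun u' => dot (g (Y u')) (V u') (V u')) u μ

/-! ### Jets and local operators -/

/-- Jets of order `k` of maps from `Coord n` to `F`: the value and the derivatives up to
order `k` at a point. -/
abbrev Jet (n : ℕ) (F : Type) [NormedAddCommGroup F] [NormedSpace ℝ F] (k : ℕ) :=
  (j : Fin (k + 1)) → Coord n [×(j : ℕ)]→L[ℝ] F

/-- The `k`-jet of `f` at `y`. -/
def jet {F : Type} [NormedAddCommGroup F] [NormedSpace ℝ F] (k : ℕ)
    (f : Coord n → F) (y : Coord n) : Jet n F k :=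
  fun j => iteratedFDeriv ℝ j f y

/-- A sequence of local differential operators on displacement fields. The `n`-th one sends a
field `V` along `Y` to a field whose value at a point is a homogeneous polynomial of degree `n` (a
multilinear map on the diagonal) in the derivatives of `V` at this point. The coefficients
depend on a jet of the metric components and on a jet of `Y`. -/
abbrev LocalOperators (p d : ℕ) :=
  (n : ℕ) → Jet d (Fin d → Fin d → ℝ) (n + 1) → Jet p (Coord d) (n + 1) →
    ContinuousMultilinearMap ℝ (fun _ : Fin n => Jet p (Coord d) (n + 1)) (Coord d)

/-- The pairs of jets (of metric components and of a parametrised submanifold) for which the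
matrices `g_{μν}` and `γ_{ab}` are invertible. -/
def nondegenerateJets (p d k : ℕ) :
    Set (Jet d (Fin d → Fin d → ℝ) (k + 1) × Jet p (Coord d) (k + 1)) :=
  {J | (Matrix.of (J.1 0 fun _ => 0)).det ≠ 0 ∧
    (Matrix.of fun a b : Fin p => dot (J.1 0 fun _ => 0)
      (J.2 1 fun _ => EuclideanSpace.single a 1)
      (J.2 1 fun _ => EuclideanSpace.single b 1)).det ≠ 0}

/-- The coefficients of the operators are smooth functions of the jets. -/
def LocalOperators.Smooth {p d : ℕ} (A : LocalOperators p d) : Prop :=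
  ∀ n, ContDiffOn ℝ ∞ (fun J : Jet d (Fin d → Fin d → ℝ) (n + 1) × Jet p (Coord d) (n + 1) =>
    A n J.1 J.2) (nondegenerateJets p d n)

end Coordinates

/-! ### Manifolds -/

section Manifolds

variable {p d : ℕ}
  {M : Type*} [TopologicalSpace M] [ChartedSpace (Coord d) M] [IsManifold (𝓡 d) ∞ M]
  {M' : Type*} [TopologicalSpace M'] [ChartedSpace (Coord d) M'] [IsManifold (𝓡 d) ∞ M']
  {N : Type*} [TopologicalSpace N] [ChartedSpace (Coord p) N] [IsManifold (𝓡 p) ∞ N]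
  {N' : Type*} [TopologicalSpace N'] [ChartedSpace (Coord p) N'] [IsManifold (𝓡 p) ∞ N']

/-- Smooth Riemannian metrics on `M`. -/
abbrev Metric (d : ℕ) (M : Type*) [TopologicalSpace M] [ChartedSpace (Coord d) M]
    [IsManifold (𝓡 d) ∞ M] :=
  Bundle.ContMDiffRiemannianMetric (𝓡 d) ∞ (Coord d) (fun x : M => TangentSpace (𝓡 d) x)

/-- `e` is a smooth chart of `M` (a member of the maximal smooth atlas). -/
def IsChart {n : ℕ} {P : Type*} [TopologicalSpace P] [ChartedSpace (Coord n) P]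
    (e : OpenPartialHomeomorph P (Coord n)) : Prop :=
  e ∈ IsManifold.maximalAtlas (𝓡 n) ∞ P

/-- `g' = e^{2σ} g` with a smooth function `σ`. -/
def IsWeylRescaling (g g' : Metric d M) (σ : M → ℝ) : Prop :=
  ContMDiff (𝓡 d) 𝓘(ℝ, ℝ) ∞ σ ∧
    ∀ (x : M) (ξ η : TangentSpace (𝓡 d) x),
      g'.inner x ξ η = Real.exp (2 * σ x) * g.inner x ξ η

/-- `Φ` maps the metric `g` to the metric `g'`, that is, `g = Φ^* g'`. -/
def IsPullback (Φ : M ≃ₘ^∞⟮𝓡 d, 𝓡 d⟯ M') (g : Metric d M) (g' : Metric d M') : Prop :=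
  ∀ (x : M) (ξ η : TangentSpace (𝓡 d) x),
    g'.inner (Φ x) (mfderiv (𝓡 d) (𝓡 d) Φ x ξ) (mfderiv (𝓡 d) (𝓡 d) Φ x η) = g.inner x ξ η

/-- The components of the metric `g` in the chart `φ`. -/
def chartMetric (g : Metric d M) (φ : OpenPartialHomeomorph M (Coord d))
    (y : Coord d) (μ ν : Fin d) : ℝ :=
  g.inner (φ.symm y)
    (mfderiv (𝓡 d) (𝓡 d) φ.symm y (EuclideanSpace.single μ 1 : Coord d))
    (mfderiv (𝓡 d) (𝓡 d) φ.symm y (EuclideanSpace.single ν 1 : Coord d))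

/-- The coordinate expression of a map `Y : N → M`. -/
def chartMap (ψ : OpenPartialHomeomorph N (Coord p)) (φ : OpenPartialHomeomorph M (Coord d))
    (Y : N → M) (u : Coord p) : Coord d :=
  φ (Y (ψ.symm u))

/-- The coordinate expression of a family of maps `X(·, t) : N → M`. -/
def chartFamily (ψ : OpenPartialHomeomorph N (Coord p)) (φ : OpenPartialHomeomorph M (Coord d))
    (X : N → ℝ → M) (u : Coord p) (t : ℝ) : Coord d :=
  φ (X (ψ.symm u) t)

/-- The components, in the chart `φ`, of a vector field `v` along `Y : N → M`. -/
def chartField (ψ : OpenPartialHomeomorph N (Coord p)) (φ : OpenPartialHomeomorph M (Coord d))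
    (Y : N → M) (v : ∀ z, TangentSpace (𝓡 d) (Y z)) (u : Coord p) : Coord d :=
  mfderiv (𝓡 d) (𝓡 d) φ (Y (ψ.symm u)) (v (ψ.symm u))

variable (p) in
/-- Smooth vector fields along `Y : N → M` (sections of `Y^* TM`). -/
def IsSmoothField (Y : N → M) (v : ∀ z, TangentSpace (𝓡 d) (Y z)) : Prop :=
  ContMDiff (𝓡 p) (𝓡 d).tangent ∞ fun z => (⟨Y z, v z⟩ : TangentBundle (𝓡 d) M)

variable (p) in
/-- The field `v` along `Y` is orthogonal to `Y`. -/
def IsNormalField (g : Metric d M) (Y : N → M) (v : ∀ z, TangentSpace (𝓡 d) (Y z)) : Prop :=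
  ∀ (z : N) (w : TangentSpace (𝓡 p) z), g.inner (Y z) (v z) (mfderiv (𝓡 p) (𝓡 d) Y z w) = 0

variable (p d) in
/-- `Y` is a smooth immersion. -/
def IsSmoothImmersion (Y : N → M) : Prop :=
  ContMDiff (𝓡 p) (𝓡 d) ∞ Y ∧ ∀ z, Function.Injective (mfderiv (𝓡 p) (𝓡 d) Y z)

variable (p d) in
/-- `X(z, t)` is defined and smooth for `(z, t)` in the open set `W`, and each `X(·, t)` is an
immersion there. -/
structure IsSmoothFamily (X : N → ℝ → M) (W : Set (N × ℝ)) : Prop where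
  isOpen : IsOpen W
  smooth : ContMDiffOn ((𝓡 p).prod 𝓘(ℝ, ℝ)) (𝓡 d) ∞ (Function.uncurry X) W
  immersive : ∀ z t, (z, t) ∈ W →
    Function.Injective (mfderiv (𝓡 p) (𝓡 d) (fun z' => X z' t) z)

/-- The velocity `∂_t X(z, t)`. -/
def velocity (X : N → ℝ → M) (z : N) (t : ℝ) : TangentSpace (𝓡 d) (X z t) :=
  mfderiv 𝓘(ℝ, ℝ) (𝓡 d) (fun s => X z s) t (1 : ℝ)

variable (p) in
/-- The velocity `∂_t X` is orthogonal to the submanifold `X(·, t)` at `(z, t)`. -/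
def IsOrthogonalAt (g : Metric d M) (X : N → ℝ → M) (z : N) (t : ℝ) : Prop :=
  ∀ w : TangentSpace (𝓡 p) z,
    g.inner (X z t) (velocity X z t) (mfderiv (𝓡 p) (𝓡 d) (fun z' => X z' t) z w) = 0

/-- The initial conditions `X(z, 0) = X₁(z)`, `∂_t X(z, 0) = v(z)` on the slice `t = 0` of `W`. -/
def HasInitialData (X : N → ℝ → M) (W : Set (N × ℝ)) (X₁ : N → M)
    (v : ∀ z, TangentSpace (𝓡 d) (X₁ z)) : Prop :=
  ∀ z, (z, (0 : ℝ)) ∈ W →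
    (⟨X z 0, velocity X z 0⟩ : TangentBundle (𝓡 d) M) = ⟨X₁ z, v z⟩

/-- The left-hand side of the evolution equation for `X`, in the charts `ψ` and `φ`, at the point
with coordinates `u` and at time `t`. -/
def chartLHS (g : Metric d M) (X : N → ℝ → M) (ψ : OpenPartialHomeomorph N (Coord p))
    (φ : OpenPartialHomeomorph M (Coord d)) (u : Coord p) (t : ℝ) : Coord d :=
  evolutionLHS (chartMetric g φ) (chartFamily ψ φ X) u t

variable (p) in
/-- `X` solves the evolution equation in `W`. -/
def SolvesEvolution (g : Metric d M) (X : N → ℝ → M) (W : Set (N × ℝ)) : Prop :=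
  ∀ (ψ : OpenPartialHomeomorph N (Coord p)) (φ : OpenPartialHomeomorph M (Coord d)),
    IsChart ψ → IsChart φ → ∀ z t, (z, t) ∈ W → z ∈ ψ.source → X z t ∈ φ.source →
      chartLHS g X ψ φ (ψ z) t = 0

variable (p) in
/-- `X` solves the evolution equation up to terms of order `t^m`: the `t`-derivatives of the
left-hand side of orders less than `m` vanish on the slice `t = 0` of `W`. -/
def SolvesToOrder (g : Metric d M) (X : N → ℝ → M) (W : Set (N × ℝ)) (m : ℕ) : Prop :=
  ∀ (ψ : OpenPartialHomeomorph N (Coord p)) (φ : OpenPartialHomeomorph M (Coord d)),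
    IsChart ψ → IsChart φ → ∀ z, (z, (0 : ℝ)) ∈ W → z ∈ ψ.source → X z 0 ∈ φ.source →
      ∀ j < m, iteratedDeriv j (fun t => chartLHS g X ψ φ (ψ z) t) 0 = 0

/-- The value at the point with coordinates `u` of the `n`-th operator of `A`, for the metric `g`,
the submanifold `X₁` and the field `v`, in the charts `ψ` and `φ`. -/
def term (A : LocalOperators p d) (g : Metric d M) (X₁ : N → M)
    (v : ∀ z, TangentSpace (𝓡 d) (X₁ z)) (ψ : OpenPartialHomeomorph N (Coord p))
    (φ : OpenPartialHomeomorph M (Coord d)) (n : ℕ) (u : Coord p) : Coord d :=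
  A n (jet (n + 1) (chartMetric g φ) (chartMap ψ φ X₁ u)) (jet (n + 1) (chartMap ψ φ X₁) u)
    fun _ => jet (n + 1) (chartField ψ φ X₁ v) u

/-- The expansion `∑_{n ≤ m} tⁿ Aₙ[v]` of the deformation of `X₁`, in charts. Its value at
`t = 1` is the displaced submanifold `X_{1,v}` up to terms of order `m + 1` in `v`. -/
def expansion (A : LocalOperators p d) (g : Metric d M) (X₁ : N → M)
    (v : ∀ z, TangentSpace (𝓡 d) (X₁ z)) (ψ : OpenPartialHomeomorph N (Coord p))
    (φ : OpenPartialHomeomorph M (Coord d)) (m : ℕ) (t : ℝ) (u : Coord p) : Coord d :=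
  ∑ n ∈ Finset.range (m + 1), t ^ n • term A g X₁ v ψ φ n u

/-- The formal normal field `v(ε) = ∑_{k ≥ 0} ε^{k+1} w_k` gives the position, relative to `X₁`, of
the submanifolds `X₂(·, ε)`: to every order `m`, and up to a local reparametrisation
`z ↦ ρ(z, ε)` with `ρ(z, 0) = z`, the submanifold `X₁` displaced by `v(ε)` agrees with
`X₂(·, ε)` up to `O(ε^{m+1})`. -/
def IsRelativePosition (A : LocalOperators p d) (g : Metric d M) (X₁ : N → M)
    (X₂ : N → ℝ → M) (w : ℕ → ∀ z, TangentSpace (𝓡 d) (X₁ z)) : Prop :=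
  (∀ k, IsSmoothField p X₁ (w k) ∧ IsNormalField p g X₁ (w k)) ∧
  ∀ (m : ℕ) (z₀ : N), ∃ (O : Set (N × ℝ)) (ρ : N → ℝ → N),
    IsOpen O ∧ (z₀, (0 : ℝ)) ∈ O ∧
    ContMDiffOn ((𝓡 p).prod 𝓘(ℝ, ℝ)) (𝓡 p) ∞ (Function.uncurry ρ) O ∧
    ∀ z, (z, (0 : ℝ)) ∈ O → ρ z 0 = z ∧
      ∀ (ψ : OpenPartialHomeomorph N (Coord p)) (φ : OpenPartialHomeomorph M (Coord d)),
        IsChart ψ → IsChart φ → z ∈ ψ.source → X₁ z ∈ φ.source → ∀ k ≤ m,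
          iteratedDeriv k (fun ε : ℝ => φ (X₂ (ρ z ε) ε)) 0 =
          iteratedDeriv k (fun ε : ℝ => expansion A g X₁
            (fun z' => ∑ j ∈ Finset.range m, ε ^ (j + 1) • w j z') ψ φ m 1 (ψ z)) 0

end Manifolds

end

end Defect

open Defect

/-!
All local statements are proved for coordinate expressions, families `x : Coord p → ℝ → Coord d` in
an open set with a metric `g`, and are then carried to manifolds through charts.

**The geometry.** The trace of the second fundamental form is the trace of the covariant Hessian of
the parametrisation up to a tangential vector (`ImmersionNear.traceFF_eq`), and it is normal
(`ImmersionNear.inner_traceFF`), by the Koszul formula along maps. As a normal vector is determined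
by its class modulo tangential vectors (`ImmersionNear.normal_unique`), every computation with it can
be done up to tangential corrections. This gives its behaviour under isometries and
reparametrisations, hence the covariance of the equation (`RelatedFamilies.evolutionLHS_eq`), and
under Weyl rescalings `g' = e^{2σ} g`: the left-hand side of the equation changes by twice the
product of the velocity with the tangential gradient of `σ`, times the velocity
(`WeylNear.evolutionLHS_eq`). It does not change where the velocity is normal. For a solution, the
products of the velocity with the tangent vectors `∂_a x` satisfy a linear homogeneous ordinary
differential equation in time (`FamilyNear.hasDerivAt_inner_velocity`). So an initially normal
velocity remains normal (`isOrthogonalAt_of_solves`), and the same differential equation, read as a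
recursion for Taylor coefficients, shows this to every order for approximate solutions
(`FamilyNear.jetEq_weyl`).

**Formal solutions.** The equation has the form `∂_t² x + L = 0` with `L` a smooth function of the
metric, its first derivatives, and the derivatives of `x` that contain at most one time derivative
(`evo`, `LowerJet.lowerTerm`). Hence the Taylor coefficients in time of order `k + 2` are determined
by the lower ones: `approx` is the recursive solution, and `sliceEq_of_evo` its uniqueness. The
operators are the Taylor coefficients of `approx`. They are local, with the stated orders of the
jets, since the derivatives lost in each step of the recursion are regained from the power of `t`
by which the new term is multiplied (`JetEq.approx`); they can therefore be computed from the
polynomials that represent the jets (`jetCoeff`), and depend smoothly on them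
(`approx_smooth_param`). As the equation is homogeneous of degree two in `∂_t`, rescaling the
velocity amounts to rescaling time (`DataNear.approx_smul`), so that the `n`-th coefficient is
homogeneous of degree `n` in the velocity. A smooth function homogeneous of degree `n` is the
restriction to the diagonal of its `n`-th derivative at zero, divided by `n!`; this multilinear form
is the operator (`operators`, `operators_diag`). Uniqueness of formal solutions turns covariance and
Weyl invariance of the equation into those of the operators (`jetEq_series_related`, `coeff_weyl`).

**Relative position.** The deformation by a field `ε U` is `Y + ε U` to first order in the field, so
a change of the field at order `ε^{k+1}` changes the deformed submanifold at this order by the same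
vector, while a change of the reparametrisation adds a tangential vector. The field and the
reparametrisation are found by recursion: at each order the mismatch between `X₂` and the deformed
submanifold is decomposed into its normal part, which is added to the field, and its tangential part,
which is absorbed by the reparametrisation (`placement`, `PlacementNear.jetEq_placement`). The same
decomposition proves uniqueness (`normal_eq_of_jetEq`). Uniqueness implies that the field does not
depend on the charts (`RelatedPlacements.posField_eq`), so that it is a global field on the manifold
(`position`), and the Weyl invariance of the operators on normal fields implies that it is the same
for all metrics in the Weyl class (`IsRelativePosition.weyl`).
-/

namespace Defect

open Filter Topology

/-! ### Equality of jets -/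

section Jets

variable {E F G : Type*} [NormedAddCommGroup E] [NormedSpace ℝ E]
  [NormedAddCommGroup F] [NormedSpace ℝ F] [NormedAddCommGroup G] [NormedSpace ℝ G]
  {E' : Type*} [NormedAddCommGroup E'] [NormedSpace ℝ E']

/-- `f` at `x` and `f'` at `x'` have the same derivatives of all orders *less than* `r`. The strict
inequality makes the case `r = 0` vacuous, so that truncated subtraction of orders is harmless. -/
def JetEq (r : ℕ) (f : E → F) (x : E) (f' : E → F) (x' : E) : Prop :=
  ∀ j < r, iteratedFDeriv ℝ j f x = iteratedFDeriv ℝ j f' x'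

/-- `f` is smooth at all points near `x`. (Smoothness `ContDiffAt ℝ ∞` at `x` itself does not imply
this.) -/
def SmoothNear (f : E → F) (x : E) : Prop := ∀ᶠ y in 𝓝 x, ContDiffAt ℝ ∞ f y

theorem SmoothNear.contDiffAt {f : E → F} {x : E} (h : SmoothNear f x) : ContDiffAt ℝ ∞ f x :=
  h.self_of_nhds

theorem SmoothNear.eventually {f : E → F} {x : E} (h : SmoothNear f x) :
    ∀ᶠ y in 𝓝 x, SmoothNear f y := eventually_eventually_nhds.2 h

theorem SmoothNear.congr {f f' : E → F} {x : E} (h : SmoothNear f x) (hf : f' =ᶠ[𝓝 x] f) :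
    SmoothNear f' x := by
  filter_upwards [h, hf.eventuallyEq_nhds] with y h1 h2 using h1.congr_of_eventuallyEq h2

theorem smoothNear_of_contDiff {f : E → F} {x : E} (h : ContDiff ℝ ∞ f) : SmoothNear f x :=
  Eventually.of_forall fun _ => h.contDiffAt

theorem SmoothNear.comp {g : F → G} {f : E → F} {x : E} (hg : SmoothNear g (f x))
    (hf : SmoothNear f x) : SmoothNear (fun y => g (f y)) x := by
  filter_upwards [hf, hf.contDiffAt.continuousAt.eventually hg] with y h1 h2 using h2.comp y h1

theorem SmoothNear.prodMk {g : E → G} {f : E → F} {x : E} (hf : SmoothNear f x)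
    (hg : SmoothNear g x) : SmoothNear (fun y => (f y, g y)) x := by
  filter_upwards [hf, hg] with y h1 h2 using h1.prodMk h2

theorem SmoothNear.fderiv {f : E → F} {x : E} (hf : SmoothNear f x) :
    SmoothNear (fderiv ℝ f) x := by
  filter_upwards [hf] with y h1 using h1.fderiv_right (by simp)

theorem SmoothNear.clm_comp {f : E → F} {x : E} (hf : SmoothNear f x) (L : F →L[ℝ] G) :
    SmoothNear (fun y => L (f y)) x := by
  filter_upwards [hf] with y h1 using L.contDiff.contDiffAt.comp y h1

theorem SmoothNear.add {f f' : E → F} {x : E} (hf : SmoothNear f x) (hf' : SmoothNear f' x) :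
    SmoothNear (fun y => f y + f' y) x := by
  filter_upwards [hf, hf'] with y h1 h2 using h1.add h2

theorem SmoothNear.sub {f f' : E → F} {x : E} (hf : SmoothNear f x) (hf' : SmoothNear f' x) :
    SmoothNear (fun y => f y - f' y) x := by
  filter_upwards [hf, hf'] with y h1 h2 using h1.sub h2

theorem SmoothNear.smul {c : E → ℝ} {f : E → F} {x : E} (hc : SmoothNear c x)
    (hf : SmoothNear f x) : SmoothNear (fun y => c y • f y) x := by
  filter_upwards [hc, hf] with y h1 h2 using h1.smul h2

namespace JetEq

variable {r s : ℕ} {f f' f'' : E → F} {x x' x'' : E}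

theorem refl (f : E → F) (x : E) : JetEq r f x f x := fun _ _ => rfl

theorem symm (h : JetEq r f x f' x') : JetEq r f' x' f x := fun j hj => (h j hj).symm

theorem trans (h : JetEq r f x f' x') (h' : JetEq r f' x' f'' x'') : JetEq r f x f'' x'' :=
  fun j hj => (h j hj).trans (h' j hj)

theorem mono (h : JetEq r f x f' x') (hs : s ≤ r) : JetEq s f x f' x' :=
  fun j hj => h j (hj.trans_le hs)

theorem zero : JetEq 0 f x f' x' := fun _ hj => absurd hj (Nat.not_lt_zero _)

theorem of_eventuallyEq (h : f =ᶠ[𝓝 x] f') : JetEq r f x f' x :=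
  fun j _ => (h.iteratedFDeriv ℝ j).eq_of_nhds

theorem value (h : JetEq r f x f' x') (hr : 0 < r) : f x = f' x' := by
  have := congrArg (fun m => m (fun _ => 0)) (h 0 hr)
  simpa using this

theorem comp {g g' : F → G} (hgj : JetEq r g (f x) g' (f' x')) (hfj : JetEq r f x f' x')
    (hg : ContDiffAt ℝ ∞ g (f x)) (hg' : ContDiffAt ℝ ∞ g' (f' x'))
    (hf : ContDiffAt ℝ ∞ f x) (hf' : ContDiffAt ℝ ∞ f' x') :
    JetEq r (fun y => g (f y)) x (fun y => g' (f' y)) x' := by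
  intro j hj
  have e1 := iteratedFDeriv_comp (n := ∞) hg hf (i := j) (by exact_mod_cast le_top)
  have e2 := iteratedFDeriv_comp (n := ∞) hg' hf' (i := j) (by exact_mod_cast le_top)
  refine e1.trans (Eq.trans ?_ e2.symm)
  simp only [FormalMultilinearSeries.taylorComp]
  refine Finset.sum_congr rfl fun c _ => ?_
  have h1 : ftaylorSeries ℝ g (f x) c.length = ftaylorSeries ℝ g' (f' x') c.length :=
    hgj _ (c.length_le.trans_lt hj)
  have h2 : ∀ i, ftaylorSeries ℝ f x (c.partSize i) = ftaylorSeries ℝ f' x' (c.partSize i) :=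
    fun i => hfj _ ((c.partSize_le i).trans_lt hj)
  ext v
  simp only [FormalMultilinearSeries.compAlongOrderedFinpartition_apply, h1]
  congr 1
  ext i
  simp [OrderedFinpartition.applyOrderedFinpartition, h2]

/-- Composition with one and the same smooth function on the left. -/
theorem comp_left (g : F → G) (hfj : JetEq r f x f' x')
    (hg : ContDiffAt ℝ ∞ g (f x)) (hf : ContDiffAt ℝ ∞ f x) (hf' : ContDiffAt ℝ ∞ f' x') :
    JetEq r (fun y => g (f y)) x (fun y => g (f' y)) x' := by
  rcases r.eq_zero_or_pos with rfl | hr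
  · exact zero
  · have hv := hfj.value hr
    exact comp (hv ▸ refl g (f x)) hfj hg (hv ▸ hg) hf hf'

theorem clm_comp (L : F →L[ℝ] G) (hfj : JetEq r f x f' x')
    (hf : ContDiffAt ℝ ∞ f x) (hf' : ContDiffAt ℝ ∞ f' x') :
    JetEq r (fun y => L (f y)) x (fun y => L (f' y)) x' :=
  comp_left L hfj L.contDiff.contDiffAt hf hf'

theorem prodMk {g g' : E → G} (hfj : JetEq r f x f' x') (hgj : JetEq r g x g' x')
    (hf : ContDiffAt ℝ ∞ f x) (hf' : ContDiffAt ℝ ∞ f' x')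
    (hg : ContDiffAt ℝ ∞ g x) (hg' : ContDiffAt ℝ ∞ g' x') :
    JetEq r (fun y => (f y, g y)) x (fun y => (f' y, g' y)) x' := by
  intro j hj
  rw [iteratedFDeriv_prodMk hf hg (by exact_mod_cast le_top),
    iteratedFDeriv_prodMk hf' hg' (by exact_mod_cast le_top), hfj j hj, hgj j hj]

theorem succ_iff : JetEq (r + 1) f x f' x' ↔
    f x = f' x' ∧ JetEq r (fderiv ℝ f) x (fderiv ℝ f') x' := by
  constructor
  · refine fun h => ⟨h.value r.succ_pos, fun j hj => ?_⟩
    have := h (j + 1) (by omega)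
    rw [iteratedFDeriv_succ_eq_comp_right, iteratedFDeriv_succ_eq_comp_right] at this
    exact (LinearIsometryEquiv.injective _ this)
  · rintro ⟨h0, h⟩ j hj
    cases j with
    | zero => ext m; simpa using h0
    | succ j =>
      rw [iteratedFDeriv_succ_eq_comp_right, iteratedFDeriv_succ_eq_comp_right]
      simp only [Function.comp_apply]
      rw [h j (by omega)]

theorem fderiv_succ (h : JetEq (r + 1) f x f' x') : JetEq r (fderiv ℝ f) x (fderiv ℝ f') x' :=
  (succ_iff.1 h).2

theorem fderiv_pred (h : JetEq r f x f' x') : JetEq (r - 1) (fderiv ℝ f) x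
    (fderiv ℝ f') x' := by
  cases r with
  | zero => exact zero
  | succ r => exact h.fderiv_succ

theorem add {h h' : E → F} (hfj : JetEq r f x f' x') (hgj : JetEq r h x h' x')
    (hf : ContDiffAt ℝ ∞ f x) (hf' : ContDiffAt ℝ ∞ f' x')
    (hg : ContDiffAt ℝ ∞ h x) (hg' : ContDiffAt ℝ ∞ h' x') :
    JetEq r (fun y => f y + h y) x (fun y => f' y + h' y) x' :=
  comp_left (fun q : F × F => q.1 + q.2) (hfj.prodMk hgj hf hf' hg hg')
    (contDiff_fst.add contDiff_snd).contDiffAt (hf.prodMk hg) (hf'.prodMk hg')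

theorem sub {h h' : E → F} (hfj : JetEq r f x f' x') (hgj : JetEq r h x h' x')
    (hf : ContDiffAt ℝ ∞ f x) (hf' : ContDiffAt ℝ ∞ f' x')
    (hg : ContDiffAt ℝ ∞ h x) (hg' : ContDiffAt ℝ ∞ h' x') :
    JetEq r (fun y => f y - h y) x (fun y => f' y - h' y) x' :=
  comp_left (fun q : F × F => q.1 - q.2) (hfj.prodMk hgj hf hf' hg hg')
    (contDiff_fst.sub contDiff_snd).contDiffAt (hf.prodMk hg) (hf'.prodMk hg')

theorem smul {c c' : E → ℝ} (hcj : JetEq r c x c' x') (hfj : JetEq r f x f' x')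
    (hc : ContDiffAt ℝ ∞ c x) (hc' : ContDiffAt ℝ ∞ c' x')
    (hf : ContDiffAt ℝ ∞ f x) (hf' : ContDiffAt ℝ ∞ f' x') :
    JetEq r (fun y => c y • f y) x (fun y => c' y • f' y) x' :=
  comp_left (fun q : ℝ × F => q.1 • q.2) (hcj.prodMk hfj hc hc' hf hf')
    (contDiff_fst.smul contDiff_snd).contDiffAt (hc.prodMk hf) (hc'.prodMk hf')

theorem iff_iteratedDeriv {f f' : ℝ → F} {x x' : ℝ} :
    JetEq r f x f' x' ↔ ∀ j < r, iteratedDeriv j f x = iteratedDeriv j f' x' := by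
  refine forall₂_congr fun j _ => ?_
  rw [iteratedDeriv_eq_equiv_comp, iteratedDeriv_eq_equiv_comp, Function.comp_apply,
    Function.comp_apply, EmbeddingLike.apply_eq_iff_eq]

end JetEq

theorem fderiv_smul_linear {f : E → F} {x : E} (ℓ : E →L[ℝ] ℝ) (hf : DifferentiableAt ℝ f x) :
    fderiv ℝ (fun y => ℓ y • f y) x = ℓ x • fderiv ℝ f x + ℓ.smulRight (f x) :=
  (ℓ.hasFDerivAt.smul hf.hasFDerivAt).fderiv

end Jets

section Universe

universe u
variable {E F G : Type u} [NormedAddCommGroup E] [NormedSpace ℝ E]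
  [NormedAddCommGroup F] [NormedSpace ℝ F] [NormedAddCommGroup G] [NormedSpace ℝ G]

/-- Multiplication by a linear form that vanishes at the base points raises the order of agreement
by one. -/
theorem JetEq.linear_smul {r : ℕ} {f f' : E → F} {x x' : E} (ℓ : E →L[ℝ] ℝ) (hx : ℓ x = 0)
    (hx' : ℓ x' = 0) (hf : ContDiffAt ℝ ∞ f x) (hf' : ContDiffAt ℝ ∞ f' x')
    (h : JetEq r f x f' x') :
    JetEq (r + 1) (fun y => ℓ y • f y) x (fun y => ℓ y • f' y) x' := by
  induction r generalizing F with
  | zero =>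
    intro j hj
    obtain rfl : j = 0 := by omega
    ext m
    simp [hx, hx']
  | succ r ih =>
    refine JetEq.succ_iff.2 ⟨by simp [hx, hx'], ?_⟩
    have key : ∀ {k : E → F} {y : E}, ContDiffAt ℝ ∞ k y →
        fderiv ℝ (fun y => ℓ y • k y) =ᶠ[𝓝 y] fun y => ℓ y • fderiv ℝ k y + ℓ.smulRight (k y) := by
      intro k y hk
      filter_upwards [(hk.of_le (m := 1) (by simp)).eventually (by simp)] with z hz
      exact fderiv_smul_linear ℓ (hz.differentiableAt (by simp))
    refine (JetEq.of_eventuallyEq (key hf)).trans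
      (JetEq.trans ?_ (JetEq.of_eventuallyEq (key hf')).symm)
    have hD := hf.fderiv_right (m := ∞) (by simp)
    have hD' := hf'.fderiv_right (m := ∞) (by simp)
    have e1 := ih hD hD' h.fderiv_succ
    have e2 := h.clm_comp (ContinuousLinearMap.smulRightL ℝ E F ℓ) hf hf'
    exact e1.add e2 (ℓ.contDiff.contDiffAt.smul hD) (ℓ.contDiff.contDiffAt.smul hD')
      ((ContinuousLinearMap.smulRightL ℝ E F ℓ).contDiff.contDiffAt.comp _ hf)
      ((ContinuousLinearMap.smulRightL ℝ E F ℓ).contDiff.contDiffAt.comp _ hf')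

theorem JetEq.linear_pow_smul {r : ℕ} {f f' : E → F} {x x' : E} (ℓ : E →L[ℝ] ℝ) (hx : ℓ x = 0)
    (hx' : ℓ x' = 0) (hf : ContDiffAt ℝ ∞ f x) (hf' : ContDiffAt ℝ ∞ f' x')
    (h : JetEq r f x f' x') (k : ℕ) :
    JetEq (r + k) (fun y => ℓ y ^ k • f y) x (fun y => ℓ y ^ k • f' y) x' := by
  induction k with
  | zero => simpa using h
  | succ k ih =>
    have := JetEq.linear_smul ℓ hx hx' ((ℓ.contDiff.contDiffAt.pow k).smul hf)
      ((ℓ.contDiff.contDiffAt.pow k).smul hf') ih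
    rw [← add_assoc]
    simpa only [smul_smul, ← pow_succ', Pi.smul_apply'] using this

/-- The value of the iterated derivative at a tuple with at most two different entries does not
depend on the position of the exceptional one. -/
theorem iteratedFDeriv_update {f : E → F} {j : ℕ} {x : E} (hf : ContDiffAt ℝ (j + 1 : ℕ) f x)
    (h a : E) (i : Fin (j + 1)) :
    iteratedFDeriv ℝ (j + 1) f x (Function.update (fun _ => h) i a) =
      iteratedFDeriv ℝ (j + 1) f x (Function.update (fun _ => h) (Fin.last j) a) := by
  induction j generalizing x with
  | zero => rw [Fin.fin_one_eq_zero i]; rfl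
  | succ j ih =>
    have tl : ∀ i : Fin (j + 1), Fin.tail (Function.update (fun _ : Fin (j + 2) => h) i.succ a) =
        Function.update (fun _ => h) i a := by
      intro i; rw [Fin.tail_update_succ]; rfl
    have hd : DifferentiableAt ℝ (iteratedFDeriv ℝ (j + 1) f) x :=
      (hf.differentiableAt_iteratedFDeriv (by exact_mod_cast Nat.lt_succ_self _))
    have hsucc : ∀ i : Fin (j + 1),
        iteratedFDeriv ℝ (j + 2) f x (Function.update (fun _ => h) i.succ a) =
        iteratedFDeriv ℝ (j + 2) f x (Function.update (fun _ => h) (Fin.last (j + 1)) a) := by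
      intro i
      rw [← Fin.succ_last, iteratedFDeriv_succ_apply_left, iteratedFDeriv_succ_apply_left, tl, tl,
        Function.update_of_ne (Fin.succ_ne_zero _).symm,
        Function.update_of_ne (Fin.succ_ne_zero _).symm,
        ← fderiv_continuousMultilinear_apply_const_apply hd,
        ← fderiv_continuousMultilinear_apply_const_apply hd]
      have : (fun y => iteratedFDeriv ℝ (j + 1) f y (Function.update (fun _ => h) i a)) =ᶠ[𝓝 x]
          fun y => iteratedFDeriv ℝ (j + 1) f y (Function.update (fun _ => h) (Fin.last j) a) := by
        filter_upwards [(hf.of_le (m := (j + 1 : ℕ))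
          (by exact_mod_cast Nat.le_succ _)).eventually (by simp)] with y hy
        exact ih hy i
      rw [this.fderiv_eq]
    rcases Fin.eq_zero_or_eq_succ i with rfl | ⟨i, rfl⟩
    · rw [← hsucc 0]
      have h2 : ContDiffAt ℝ 2 (iteratedFDeriv ℝ j f) x :=
        hf.iteratedFDeriv_right (by norm_cast; omega)
      have hd' : DifferentiableAt ℝ (fderiv ℝ (iteratedFDeriv ℝ j f)) x :=
        (h2.fderiv_right (m := 1) (by norm_num [one_add_one_eq_two])).differentiableAt (by simp)
      have hs := h2.isSymmSndFDerivAt (by simp)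
      have gen : ∀ m : Fin (j + 2) → E, iteratedFDeriv ℝ (j + 2) f x m =
          fderiv ℝ (fderiv ℝ (iteratedFDeriv ℝ j f)) x (m 0) (m 1) (Fin.tail (Fin.tail m)) := by
        intro m
        rw [iteratedFDeriv_succ_apply_left, ← fderiv_continuousMultilinear_apply_const_apply hd]
        have : (fun y => iteratedFDeriv ℝ (j + 1) f y (Fin.tail m)) =
            fun y => fderiv ℝ (iteratedFDeriv ℝ j f) y (m 1) (Fin.tail (Fin.tail m)) := by
          ext y; rw [iteratedFDeriv_succ_apply_left]; rfl
        rw [this]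
        have e : HasFDerivAt (fun y => fderiv ℝ (iteratedFDeriv ℝ j f) y (m 1)
            (Fin.tail (Fin.tail m))) _ x :=
          ((hd'.hasFDerivAt.clm_apply (hasFDerivAt_const (m 1) x)).continuousMultilinear_apply_const
            (Fin.tail (Fin.tail m)))
        rw [e.fderiv]
        simp
      rw [gen, gen, tl 0]
      have t0 : Fin.tail (Function.update (fun _ : Fin (j + 2) => h) 0 a) = fun _ => h := by
        ext; simp [Fin.tail]
      have t1 : Fin.tail (Function.update (fun _ : Fin (j + 1) => h) 0 a) = fun _ => h := by
        ext; simp [Fin.tail]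
      have t2 : Fin.tail (fun _ : Fin (j + 1) => h) = fun _ => h := by ext; simp [Fin.tail]
      rw [t0, t1, t2, hs.eq]
      have : (0 : Fin (j + 1)).succ = 1 := rfl
      simp [this]
    · exact hsucc i

/-- The Taylor polynomial of `f` at `x`, with terms of degree less than `r`. -/
noncomputable def taylorPoly (r : ℕ) (f : E → F) (x : E) (h : E) : F :=
  ∑ j ∈ Finset.range r, (j.factorial : ℝ)⁻¹ • iteratedFDeriv ℝ j f x fun _ => h

theorem hasFDerivAt_diag {j : ℕ} (m : E [×j]→L[ℝ] F) (h : E) :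
    ∃ D : E →L[ℝ] F, HasFDerivAt (fun h : E => m fun _ => h) D h ∧
      ∀ a, D a = ∑ i, m (Function.update (fun _ => h) i a) := by
  have hm := m.hasFDerivAt (x := fun _ => h)
  have hh : HasFDerivAt (fun h : E => fun _ : Fin j => h)
    (ContinuousLinearMap.pi fun _ => ContinuousLinearMap.id ℝ E) h :=
      hasFDerivAt_pi.2 fun _ => hasFDerivAt_id h
  exact ⟨_, hm.comp h hh, fun a => by simp⟩

theorem fderiv_taylorPoly {r : ℕ} {f : E → F} {x : E} (hf : ContDiffAt ℝ r f x) :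
    fderiv ℝ (taylorPoly (r + 1) f x) = taylorPoly r (fderiv ℝ f) x := by
  ext h a
  have hder : ∀ j ∈ Finset.range (r + 1), HasFDerivAt
      (fun h : E => (j.factorial : ℝ)⁻¹ • iteratedFDeriv ℝ j f x fun _ => h)
      ((j.factorial : ℝ)⁻¹ • (hasFDerivAt_diag (iteratedFDeriv ℝ j f x) h).choose) h :=
    fun j _ => (hasFDerivAt_diag (iteratedFDeriv ℝ j f x) h).choose_spec.1.const_smul _
  have := HasFDerivAt.fun_sum hder
  rw [show taylorPoly (r + 1) f x = fun h => ∑ j ∈ Finset.range (r + 1),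
    (j.factorial : ℝ)⁻¹ • iteratedFDeriv ℝ j f x fun _ => h from rfl, this.fderiv]
  simp only [taylorPoly, sum_apply, smul_apply]
  rw [Finset.sum_range_succ']
  have h0 : (hasFDerivAt_diag (iteratedFDeriv ℝ 0 f x) h).choose a = 0 := by
    rw [(hasFDerivAt_diag (iteratedFDeriv ℝ 0 f x) h).choose_spec.2]; simp
  rw [h0, smul_zero, add_zero]
  refine Finset.sum_congr rfl fun j hj => ?_
  rw [(hasFDerivAt_diag (iteratedFDeriv ℝ (j + 1) f x) h).choose_spec.2,
    Finset.sum_congr rfl fun i _ => iteratedFDeriv_update (hf.of_le (by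
      exact_mod_cast Finset.mem_range.1 hj)) h a i]
  rw [Finset.sum_const, Finset.card_univ, Fintype.card_fin, iteratedFDeriv_succ_apply_right,
    ← Nat.cast_smul_eq_nsmul ℝ, smul_smul]
  congr 1
  · rw [Nat.factorial_succ]; push_cast; field_simp
  · have : Fin.init (Function.update (fun _ : Fin (j + 1) => h) (Fin.last j) a) = fun _ => h := by
      ext i; simp [Fin.init, (Fin.castSucc_lt_last i).ne]
    rw [this]; simp

/-- A function and its Taylor polynomial have the same jet. -/
theorem jetEq_taylorPoly {r : ℕ} {f : E → F} {x : E} (hf : ContDiffAt ℝ ∞ f x) :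
    JetEq r f x (taylorPoly r f x) 0 := by
  induction r generalizing F with
  | zero => exact JetEq.zero
  | succ r ih =>
    refine JetEq.succ_iff.2 ⟨?_, ?_⟩
    · rw [taylorPoly, Finset.sum_range_succ', Finset.sum_eq_zero]
      · simp
      · intro j _
        rw [(iteratedFDeriv ℝ (j + 1) f x).map_coord_zero 0 rfl, smul_zero]
    · rw [fderiv_taylorPoly (hf.of_le (by exact_mod_cast le_top))]
      exact ih (hf.fderiv_right (by simp))

end Universe

/-! ### Functions of position and time: jets along the slice `t = 0` -/

section SpaceTime

set_option linter.unusedSectionVars false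

variable {H F G : Type*} [NormedAddCommGroup H] [NormedSpace ℝ H]
  [NormedAddCommGroup F] [NormedSpace ℝ F] [NormedAddCommGroup G] [NormedSpace ℝ G]

theorem two_le_infty : (2 : ℕ∞ω) ≤ ∞ :=
  show ((2 : ℕ∞) : ℕ∞ω) ≤ ((⊤ : ℕ∞) : ℕ∞ω) from WithTop.coe_le_coe.2 le_top

/-- The time derivative of a function on space-time. -/
noncomputable def tderiv (y : H × ℝ → F) (q : H × ℝ) : F := fderiv ℝ y q (0, 1)

theorem SmoothNear.tderiv {y : H × ℝ → F} {q : H × ℝ} (hy : SmoothNear y q) :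
    SmoothNear (tderiv y) q :=
  hy.fderiv.clm_comp (ContinuousLinearMap.apply ℝ F ((0, 1) : H × ℝ))

theorem SmoothNear.tderiv_iterate {y : H × ℝ → F} {q : H × ℝ} (hy : SmoothNear y q) (j : ℕ) :
    SmoothNear (Defect.tderiv^[j] y) q := by
  induction j with
  | zero => exact hy
  | succ j ih => rw [Function.iterate_succ_apply']; exact ih.tderiv

theorem hasDerivAt_slice {y : H × ℝ → F} {q : H × ℝ} (hy : DifferentiableAt ℝ y q) :
    HasDerivAt (fun s => y (q.1, s)) (tderiv y q) q.2 := by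
  have h1 : HasDerivAt (fun s : ℝ => (q.1, s)) ((0 : H), (1 : ℝ)) q.2 :=
    (hasDerivAt_const _ _).prodMk (hasDerivAt_id _)
  exact (show HasFDerivAt y _ (q.1, q.2) from hy.hasFDerivAt).comp_hasDerivAt q.2 h1

theorem hasFDerivAt_space {y : H × ℝ → F} {q : H × ℝ} (hy : DifferentiableAt ℝ y q) :
    HasFDerivAt (fun u => y (u, q.2)) ((fderiv ℝ y q).comp (.inl ℝ H ℝ)) q.1 := by
  have h1 : HasFDerivAt (fun u : H => (u, q.2)) (.inl ℝ H ℝ) q.1 :=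
    (hasFDerivAt_id _).prodMk (hasFDerivAt_const _ _)
  exact (show HasFDerivAt y _ (q.1, q.2) from hy.hasFDerivAt).comp q.1 h1

theorem SmoothNear.differentiableAt {f : H → F} {x : H} (h : SmoothNear f x) :
    DifferentiableAt ℝ f x := h.contDiffAt.differentiableAt (by simp)

theorem SmoothNear.slice {y : H × ℝ → F} {q : H × ℝ} (hy : SmoothNear y q) :
    SmoothNear (fun s => y (q.1, s)) q.2 :=
  SmoothNear.comp (f := fun s => (q.1, s)) hy (smoothNear_of_contDiff (contDiff_const.prodMk contDiff_id))

theorem SmoothNear.space {y : H × ℝ → F} {q : H × ℝ} (hy : SmoothNear y q) :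
    SmoothNear (fun u => y (u, q.2)) q.1 :=
  SmoothNear.comp (f := fun s => (s, q.2)) hy (smoothNear_of_contDiff (contDiff_id.prodMk contDiff_const))

theorem iteratedDeriv_slice {y : H × ℝ → F} {p : H × ℝ} (hy : SmoothNear y p) (j : ℕ) :
    ∀ᶠ q in 𝓝 p, iteratedDeriv j (fun s => y (q.1, s)) q.2 = (tderiv^[j] y) q := by
  induction j with
  | zero => exact Eventually.of_forall fun q => by simp
  | succ j ih =>
    filter_upwards [eventually_eventually_nhds.2 ih, hy.eventually] with q hq hyq
    rw [iteratedDeriv_succ, Function.iterate_succ_apply']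
    have hc : Tendsto (fun s : ℝ => (q.1, s)) (𝓝 q.2) (𝓝 q) :=
      (Continuous.prodMk_right q.1).tendsto' _ _ rfl
    have he : iteratedDeriv j (fun s => y (q.1, s)) =ᶠ[𝓝 q.2] fun s => (tderiv^[j] y) (q.1, s) :=
      hc.eventually hq
    rw [he.deriv_eq]
    exact (hasDerivAt_slice (hyq.tderiv_iterate j).differentiableAt).deriv

theorem tderiv_congr {y y' : H × ℝ → F} {p : H × ℝ} (h : y =ᶠ[𝓝 p] y') :
    tderiv y =ᶠ[𝓝 p] tderiv y' := by
  filter_upwards [h.eventuallyEq_nhds] with q hq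
  rw [tderiv, tderiv, hq.fderiv_eq]

theorem tderiv_fderiv {y : H × ℝ → F} {p : H × ℝ} (hy : SmoothNear y p) (j : ℕ) :
    tderiv^[j] (fderiv ℝ y) =ᶠ[𝓝 p] fderiv ℝ (tderiv^[j] y) := by
  induction j with
  | zero => exact EventuallyEq.rfl
  | succ j ih =>
    simp only [Function.iterate_succ_apply']
    refine (tderiv_congr ih).trans ?_
    filter_upwards [hy.eventually] with q hq
    have hZ := hq.tderiv_iterate j
    have hs := hZ.contDiffAt.isSymmSndFDerivAt (by
      rw [minSmoothness_of_isRCLikeNormedField]; exact two_le_infty)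
    have h1 := hZ.fderiv.differentiableAt.hasFDerivAt.clm_apply
      (hasFDerivAt_const ((0, 1) : H × ℝ) q)
    have h2 : fderiv ℝ (tderiv (tderiv^[j] y)) q = _ := h1.fderiv
    ext a
    · rw [h2]; simp [tderiv, hs.eq]
    · rw [h2]; simp [tderiv]

/-- Near `(u₀, 0)`, the functions `y` and `y'` have the same time derivatives of orders less than
`r` along the slice `t = 0`. -/
def SliceEq (r : ℕ) (y y' : H × ℝ → F) (u₀ : H) : Prop :=
  ∀ᶠ u in 𝓝 u₀, JetEq r (fun s => y (u, s)) 0 (fun s => y' (u, s)) 0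

/-- The time derivatives of orders less than `r` of `y` along the slice `t = 0`, and the spatial
derivatives of the time derivatives, agree with those of `y'`. -/
theorem SliceEq.eventually_iterate {r : ℕ} {y y' : H × ℝ → F} {u₀ : H} (h : SliceEq r y y' u₀)
    (hy : SmoothNear y (u₀, 0)) (hy' : SmoothNear y' (u₀, 0)) :
    ∀ᶠ u in 𝓝 u₀, ∀ j < r, (tderiv^[j] y) (u, 0) = (tderiv^[j] y') (u, 0) := by
  have hc : Tendsto (fun u : H => (u, (0 : ℝ))) (𝓝 u₀) (𝓝 (u₀, 0)) :=
    (Continuous.prodMk_left 0).tendsto' _ _ rfl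
  refine (eventually_all_finite (Set.finite_lt_nat r)).2 fun j hj => ?_
  filter_upwards [h, hc.eventually (iteratedDeriv_slice hy j),
    hc.eventually (iteratedDeriv_slice hy' j)] with u h1 h2 h3
  rw [← h2, ← h3]
  exact JetEq.iff_iteratedDeriv.1 h1 j hj

theorem sliceEq_iff {r : ℕ} {y y' : H × ℝ → F} {u₀ : H}
    (hy : SmoothNear y (u₀, 0)) (hy' : SmoothNear y' (u₀, 0)) : SliceEq r y y' u₀ ↔
    ∀ᶠ u in 𝓝 u₀, ∀ j < r, (tderiv^[j] y) (u, 0) = (tderiv^[j] y') (u, 0) := by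
  refine ⟨fun h => h.eventually_iterate hy hy', fun h => ?_⟩
  have hc : Tendsto (fun u : H => (u, (0 : ℝ))) (𝓝 u₀) (𝓝 (u₀, 0)) :=
    (Continuous.prodMk_left 0).tendsto' _ _ rfl
  have : ∀ᶠ u in 𝓝 u₀, ∀ j < r,
      iteratedDeriv j (fun s => y (u, s)) 0 = iteratedDeriv j (fun s => y' (u, s)) 0 := by
    refine (eventually_all_finite (Set.finite_lt_nat r)).2 fun j hj => ?_
    filter_upwards [h, hc.eventually (iteratedDeriv_slice hy j),
      hc.eventually (iteratedDeriv_slice hy' j)] with u h1 h2 h3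
    exact h2.trans ((h1 j hj).trans h3.symm)
  filter_upwards [this] with u hu using JetEq.iff_iteratedDeriv.2 hu

theorem SliceEq.fderiv_inl {r : ℕ} {y y' : H × ℝ → F} {u₀ : H} (h : SliceEq r y y' u₀)
    (hy : SmoothNear y (u₀, 0)) (hy' : SmoothNear y' (u₀, 0)) :
    ∀ᶠ u in 𝓝 u₀, ∀ j < r, (fderiv ℝ (tderiv^[j] y) (u, 0)).comp (.inl ℝ H ℝ) =
      (fderiv ℝ (tderiv^[j] y') (u, 0)).comp (.inl ℝ H ℝ) := by
  have hc : Tendsto (fun u : H => (u, (0 : ℝ))) (𝓝 u₀) (𝓝 (u₀, 0)) :=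
    (Continuous.prodMk_left 0).tendsto' _ _ rfl
  filter_upwards [eventually_eventually_nhds.2 (h.eventually_iterate hy hy'),
    hc.eventually hy.eventually, hc.eventually hy'.eventually] with u h1 h2 h3 j hj
  have e1 := hasFDerivAt_space (h2.tderiv_iterate j).differentiableAt
  have e2 := hasFDerivAt_space (h3.tderiv_iterate j).differentiableAt
  exact e1.unique (e2.congr_of_eventuallyEq (h1.mono fun v hv => hv j hj))

/-- A full derivative costs one order in time. -/
theorem SliceEq.fderiv_succ {r : ℕ} {y y' : H × ℝ → F} {u₀ : H} (h : SliceEq (r + 1) y y' u₀)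
    (hy : SmoothNear y (u₀, 0)) (hy' : SmoothNear y' (u₀, 0)) :
    SliceEq r (fderiv ℝ y) (fderiv ℝ y') u₀ := by
  rw [sliceEq_iff hy.fderiv hy'.fderiv]
  have hc : Tendsto (fun u : H => (u, (0 : ℝ))) (𝓝 u₀) (𝓝 (u₀, 0)) :=
    (Continuous.prodMk_left 0).tendsto' _ _ rfl
  refine (eventually_all_finite (Set.finite_lt_nat r)).2 fun j (hj : j < r) => ?_
  filter_upwards [h.eventually_iterate hy hy', h.fderiv_inl hy hy',
    hc.eventually (tderiv_fderiv hy j), hc.eventually (tderiv_fderiv hy' j)] with u h1 h2 h3 h4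
  rw [h3, h4]
  ext a
  · exact DFunLike.congr_fun (h2 j (by omega)) a
  · have := h1 (j + 1) (by omega)
    simpa [Function.iterate_succ_apply', tderiv] using this

/-- Spatial derivatives do not cost an order in time. -/
theorem SliceEq.space_fderiv {r : ℕ} {y y' : H × ℝ → F} {u₀ : H} (h : SliceEq r y y' u₀)
    (hy : SmoothNear y (u₀, 0)) (hy' : SmoothNear y' (u₀, 0)) :
    SliceEq r (fun q => (fderiv ℝ y q).comp (.inl ℝ H ℝ))
      (fun q => (fderiv ℝ y' q).comp (.inl ℝ H ℝ)) u₀ := by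
  set L : (H × ℝ →L[ℝ] F) →L[ℝ] (H →L[ℝ] F) :=
    (ContinuousLinearMap.compL ℝ H (H × ℝ) F).flip (.inl ℝ H ℝ)
  have key : ∀ {y : H × ℝ → F} {q : H × ℝ} (j : ℕ), SmoothNear y q →
      tderiv^[j] (fun q => L (fderiv ℝ y q)) =ᶠ[𝓝 q]
        fun q => L (fderiv ℝ (tderiv^[j] y) q) := by
    intro y q j hy
    induction j with
    | zero => exact EventuallyEq.rfl
    | succ j ih =>
      simp only [Function.iterate_succ_apply']
      refine (tderiv_congr ih).trans ?_
      filter_upwards [hy.eventually] with q hq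
      have hZ := hq.tderiv_iterate j
      have h1 : tderiv (fderiv ℝ (tderiv^[j] y)) q = fderiv ℝ (tderiv (tderiv^[j] y)) q :=
        (tderiv_fderiv hZ 1).self_of_nhds
      have h3 : HasFDerivAt (fun q => L (fderiv ℝ (tderiv^[j] y) q)) _ q :=
        L.hasFDerivAt.comp q hZ.fderiv.differentiableAt.hasFDerivAt
      rw [← h1, tderiv, h3.fderiv]
      rfl
  change SliceEq r (fun q => L (fderiv ℝ y q)) (fun q => L (fderiv ℝ y' q)) u₀
  rw [sliceEq_iff (hy.fderiv.clm_comp L) (hy'.fderiv.clm_comp L)]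
  have hc : Tendsto (fun u : H => (u, (0 : ℝ))) (𝓝 u₀) (𝓝 (u₀, 0)) :=
    (Continuous.prodMk_left 0).tendsto' _ _ rfl
  refine (eventually_all_finite (Set.finite_lt_nat r)).2 fun j (hj : j < r) => ?_
  filter_upwards [h.fderiv_inl hy hy', hc.eventually (key j hy), hc.eventually (key j hy')]
    with u h1 h2 h3
  exact h2.trans ((h1 j hj).trans h3.symm)

theorem SliceEq.prodMk {r : ℕ} {y y' : H × ℝ → F} {z z' : H × ℝ → G} {u₀ : H}
    (h : SliceEq r y y' u₀) (hz : SliceEq r z z' u₀)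
    (h1 : SmoothNear y (u₀, 0)) (h2 : SmoothNear y' (u₀, 0))
    (h3 : SmoothNear z (u₀, 0)) (h4 : SmoothNear z' (u₀, 0)) :
    SliceEq r (fun q => (y q, z q)) (fun q => (y' q, z' q)) u₀ := by
  have hc : Tendsto (fun u : H => (u, (0 : ℝ))) (𝓝 u₀) (𝓝 (u₀, 0)) :=
    (Continuous.prodMk_left 0).tendsto' _ _ rfl
  filter_upwards [h, hz, hc.eventually h1.eventually, hc.eventually h2.eventually,
    hc.eventually h3.eventually, hc.eventually h4.eventually] with u a1 a2 a3 a4 a5 a6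
  exact JetEq.prodMk a1 a2 a3.slice.contDiffAt a4.slice.contDiffAt a5.slice.contDiffAt
    a6.slice.contDiffAt

theorem SliceEq.comp_left {r : ℕ} {y y' : H × ℝ → F} {u₀ : H} (g : F → G)
    (h : SliceEq r y y' u₀) (hg : SmoothNear g (y (u₀, 0)))
    (h1 : SmoothNear y (u₀, 0)) (h2 : SmoothNear y' (u₀, 0)) :
    SliceEq r (fun q => g (y q)) (fun q => g (y' q)) u₀ := by
  have hc : Tendsto (fun u : H => (u, (0 : ℝ))) (𝓝 u₀) (𝓝 (u₀, 0)) :=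
    (Continuous.prodMk_left 0).tendsto' _ _ rfl
  filter_upwards [h, hc.eventually h1.eventually, hc.eventually h2.eventually,
    hc.eventually (h1.contDiffAt.continuousAt.eventually hg)] with u a1 a2 a3 a4
  exact JetEq.comp_left g a1 a4 a2.slice.contDiffAt a3.slice.contDiffAt

theorem SliceEq.mono {r s : ℕ} {y y' : H × ℝ → F} {u₀ : H} (h : SliceEq r y y' u₀) (hs : s ≤ r) :
    SliceEq s y y' u₀ := Eventually.mono h fun _ hu => hu.mono hs

theorem SliceEq.trans {r : ℕ} {y y' y'' : H × ℝ → F} {u₀ : H} (h : SliceEq r y y' u₀)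
    (h' : SliceEq r y' y'' u₀) : SliceEq r y y'' u₀ := by
  filter_upwards [h, h'] with u h1 h2 using h1.trans h2

theorem SliceEq.symm {r : ℕ} {y y' : H × ℝ → F} {u₀ : H} (h : SliceEq r y y' u₀) :
    SliceEq r y' y u₀ := Eventually.mono h fun _ hu => hu.symm

/-- Smooth dependence of the derivatives in the time variable. -/
theorem contDiffAt_iteratedDeriv {f : H × ℝ → F} {q : H × ℝ} (hf : ContDiffAt ℝ ∞ f q) (k : ℕ) :
    ContDiffAt ℝ ∞ (fun p : H × ℝ => iteratedDeriv k (fun s => f (p.1, s)) p.2) q := by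
  induction k with
  | zero => simpa using hf
  | succ k ih =>
    simp only [iteratedDeriv_succ]
    change ContDiffAt ℝ ∞ (fun p : H × ℝ =>
      fderiv ℝ (iteratedDeriv k fun s => f (p.1, s)) p.2 1) q
    have h1 : ContDiffAt ℝ ∞ (Function.uncurry fun (p : H × ℝ) (s : ℝ) =>
        iteratedDeriv k (fun s => f (p.1, s)) s) (q, q.2) := by
      have : ContDiffAt ℝ ∞ (fun w : (H × ℝ) × ℝ => (w.1.1, w.2)) (q, q.2) := by fun_prop
      exact ContDiffAt.comp (q, q.2) (f := fun w : (H × ℝ) × ℝ => (w.1.1, w.2)) ih this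
    exact (h1.fderiv contDiffAt_snd (by simp)).clm_apply contDiffAt_const

theorem contDiffAt_iteratedDeriv_zero {f : H × ℝ → F} {u : H} (hf : ContDiffAt ℝ ∞ f (u, 0))
    (k : ℕ) : ContDiffAt ℝ ∞ (fun v : H => iteratedDeriv k (fun s => f (v, s)) 0) u :=
  (contDiffAt_iteratedDeriv hf k).comp u (f := fun v => (v, (0 : ℝ)))
    (contDiffAt_id.prodMk contDiffAt_const)

end SpaceTime

section SliceJet

universe u v
variable {H : Type} {F : Type u} [NormedAddCommGroup H] [NormedSpace ℝ H]
  [NormedAddCommGroup F] [NormedSpace ℝ F]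

/-- Agreement of the time derivatives along a slice implies agreement of all derivatives. -/
theorem SliceEq.jetEq {r : ℕ} {y y' : H × ℝ → F} {u₀ : H} (h : SliceEq r y y' u₀)
    (h1 : SmoothNear y (u₀, 0)) (h2 : SmoothNear y' (u₀, 0)) :
    JetEq r y (u₀, 0) y' (u₀, 0) := by
  induction r generalizing F with
  | zero => exact JetEq.zero
  | succ r ih =>
    refine JetEq.succ_iff.2 ⟨?_, ih (h.fderiv_succ h1 h2) h1.fderiv h2.fderiv⟩
    exact (h.self_of_nhds).value r.succ_pos

theorem contDiffAt_deriv {f : ℝ → F} {t : ℝ} (hf : ContDiffAt ℝ ∞ f t) :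
    ContDiffAt ℝ ∞ (deriv f) t :=
  (hf.fderiv_right (m := ∞) (by simp)).clm_apply contDiffAt_const

theorem jetEq_bilin_flat {n : ℕ} {E : Type u} [NormedAddCommGroup E] [NormedSpace ℝ E]
    {A : ℝ → E →L[ℝ] F} {φ : ℝ → E} {t : ℝ} (hA : ContDiffAt ℝ ∞ A t) (hφ : ContDiffAt ℝ ∞ φ t)
    (h : JetEq n φ t (fun _ => 0) t) : JetEq n (fun s => A s (φ s)) t (fun _ => 0) t := by
  have := JetEq.comp_left (fun q : (E →L[ℝ] F) × E => q.1 q.2)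
    ((JetEq.refl A t).prodMk h hA hA hφ contDiffAt_const)
    (isBoundedBilinearMap_apply.contDiff.contDiffAt) (hA.prodMk hφ) (hA.prodMk contDiffAt_const)
  simpa using this

/-- The leading derivative of a product with a factor that vanishes to order `n`. -/
theorem iteratedDeriv_clm_apply_flat {n : ℕ} {E : Type u} [NormedAddCommGroup E]
    [NormedSpace ℝ E] {A : ℝ → E →L[ℝ] F} {φ : ℝ → E} {t : ℝ} (hA : ContDiffAt ℝ ∞ A t)
    (hφ : ContDiffAt ℝ ∞ φ t) (h : JetEq n φ t (fun _ => 0) t) :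
    iteratedDeriv n (fun s => A s (φ s)) t = A t (iteratedDeriv n φ t) := by
  induction n generalizing A φ with
  | zero => simp
  | succ n ih =>
    have hev : deriv (fun s => A s (φ s)) =ᶠ[𝓝 t] fun s => deriv A s (φ s) + A s (deriv φ s) := by
      filter_upwards [(hA.of_le (m := 1) (by simp)).eventually (by simp),
        (hφ.of_le (m := 1) (by simp)).eventually (by simp)] with s h1 h2
      exact ((h1.differentiableAt (by simp)).hasDerivAt.clm_apply
        (h2.differentiableAt (by simp)).hasDerivAt).deriv
    have hA' : ContDiffAt ℝ ∞ (deriv A) t := by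
      exact contDiffAt_deriv hA
    have hφ' : ContDiffAt ℝ ∞ (deriv φ) t := by
      exact contDiffAt_deriv hφ
    have h' : JetEq n (deriv φ) t (fun _ => 0) t := by
      refine JetEq.iff_iteratedDeriv.2 fun j hj => ?_
      have := JetEq.iff_iteratedDeriv.1 h (j + 1) (by omega)
      rw [iteratedDeriv_succ'] at this
      rw [this]
      simp
    rw [iteratedDeriv_succ', iteratedDeriv_succ', hev.iteratedDeriv_eq n, ← ih hA hφ' h']
    have e := iteratedDeriv_add (n := n) (x := t) (f := fun s => deriv A s (φ s))
      (g := fun s => A s (deriv φ s))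
      ((hA'.clm_apply hφ).of_le (by exact_mod_cast le_top))
      ((hA.clm_apply hφ').of_le (by exact_mod_cast le_top))
    have z := JetEq.iff_iteratedDeriv.1 (jetEq_bilin_flat hA' hφ h) n (Nat.lt_succ_self n)
    rw [show (fun s => deriv A s (φ s) + A s (deriv φ s)) =
      (fun s => deriv A s (φ s)) + fun s => A s (deriv φ s) from rfl, e, z]
    simp

/-- If two curves agree to order `n ≥ 1`, the first derivatives in which their images under a
smooth map can differ are related by the differential of the map. -/
theorem iteratedDeriv_comp_sub {n : ℕ} (hn : 0 < n) {E : Type u} [NormedAddCommGroup E]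
    [NormedSpace ℝ E] {k : E → F} {f f' : ℝ → E} {t : ℝ} (h : JetEq n f t f' t)
    (hk : ContDiffAt ℝ ∞ k (f t)) (hf : ContDiffAt ℝ ∞ f t) (hf' : ContDiffAt ℝ ∞ f' t) :
    iteratedDeriv n (fun s => k (f s)) t - iteratedDeriv n (fun s => k (f' s)) t =
      fderiv ℝ k (f t) (iteratedDeriv n f t - iteratedDeriv n f' t) := by
  obtain ⟨n, rfl⟩ : ∃ m, n = m + 1 := ⟨n - 1, by omega⟩
  have hv : f t = f' t := h.value hn
  have hk' : ContDiffAt ℝ ∞ k (f' t) := hv ▸ hk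
  have der : ∀ {f : ℝ → E}, ContDiffAt ℝ ∞ k (f t) → ContDiffAt ℝ ∞ f t →
      deriv (fun s => k (f s)) =ᶠ[𝓝 t] fun s => fderiv ℝ k (f s) (deriv f s) := by
    intro f hk hf
    filter_upwards [(hf.of_le (m := 1) (by simp)).eventually (by simp),
      hf.continuousAt.eventually ((hk.of_le (m := 1) (by simp)).eventually (by simp))] with s h1 h2
    exact ((h2.differentiableAt (by simp)).hasFDerivAt.comp_hasDerivAt s
      (h1.differentiableAt (by simp)).hasDerivAt).deriv
  have hd : ∀ {f : ℝ → E}, ContDiffAt ℝ ∞ f t → ContDiffAt ℝ ∞ (deriv f) t := fun hf => by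
    exact contDiffAt_deriv hf
  have hA : ∀ {f : ℝ → E}, ContDiffAt ℝ ∞ k (f t) → ContDiffAt ℝ ∞ f t →
      ContDiffAt ℝ ∞ (fun s => fderiv ℝ k (f s)) t := fun hk hf =>
    (hk.fderiv_right (m := ∞) (by simp)).comp t hf
  have hdj : JetEq n (fun s => deriv f s - deriv f' s) t (fun _ => 0) t := by
    refine JetEq.iff_iteratedDeriv.2 fun j hj => ?_
    have := JetEq.iff_iteratedDeriv.1 h (j + 1) (by omega)
    rw [iteratedDeriv_succ', iteratedDeriv_succ'] at this
    have e := iteratedDeriv_sub (n := j) (x := t) ((hd hf).of_le (by exact_mod_cast le_top))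
      ((hd hf').of_le (by exact_mod_cast le_top))
    rw [show (fun s => deriv f s - deriv f' s) = deriv f - deriv f' from rfl, e, this]
    simp
  have hAj : JetEq (n + 1) (fun s => fderiv ℝ k (f s) - fderiv ℝ k (f' s)) t (fun _ => 0) t := by
    have h1 := JetEq.comp_left (fderiv ℝ k) h (hk.fderiv_right (m := ∞) (by simp)) hf hf'
    have := h1.sub (JetEq.refl (fun s => fderiv ℝ k (f' s)) t) (hA hk hf) (hA hk' hf') (hA hk' hf')
      (hA hk' hf')
    simpa using this
  have hflip : JetEq (n + 1) (fun s => (fderiv ℝ k (f s) - fderiv ℝ k (f' s)) (deriv f' s)) t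
      (fun _ => 0) t :=
    jetEq_bilin_flat (A := fun s => ContinuousLinearMap.apply ℝ F (deriv f' s))
      (contDiffAt_const.clm_apply (hd hf'))
      ((hA hk hf).sub (hA hk' hf')) hAj
  have s1 : ContDiffAt ℝ ∞ (fun s => fderiv ℝ k (f s) (deriv f s - deriv f' s)) t :=
    (hA hk hf).clm_apply ((hd hf).sub (hd hf'))
  have s2 : ContDiffAt ℝ ∞ (fun s => (fderiv ℝ k (f s) - fderiv ℝ k (f' s)) (deriv f' s)) t :=
    ((hA hk hf).sub (hA hk' hf')).clm_apply (hd hf')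
  rw [iteratedDeriv_succ', iteratedDeriv_succ', (der hk hf).iteratedDeriv_eq,
    (der hk' hf').iteratedDeriv_eq, iteratedDeriv_succ', iteratedDeriv_succ',
    ← iteratedDeriv_sub (((hA hk hf).clm_apply (hd hf)).of_le (by exact_mod_cast le_top))
      (((hA hk' hf').clm_apply (hd hf')).of_le (by exact_mod_cast le_top)),
    ← iteratedDeriv_sub ((hd hf).of_le (by exact_mod_cast le_top))
      ((hd hf').of_le (by exact_mod_cast le_top))]
  rw [show ((fun s => fderiv ℝ k (f s) (deriv f s)) - fun s => fderiv ℝ k (f' s) (deriv f' s)) =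
    (fun s => fderiv ℝ k (f s) (deriv f s - deriv f' s)) +
      fun s => (fderiv ℝ k (f s) - fderiv ℝ k (f' s)) (deriv f' s) by
      ext s; simp,
    iteratedDeriv_add (s1.of_le (by exact_mod_cast le_top)) (s2.of_le (by exact_mod_cast le_top)),
    JetEq.iff_iteratedDeriv.1 hflip n (Nat.lt_succ_self n)]
  have := iteratedDeriv_clm_apply_flat (n := n) (hA hk hf) ((hd hf).sub (hd hf')) hdj
  rw [this]
  simp
  rfl

end SliceJet

/-! ### Linear algebra of inner products given by matrices -/

section LinearAlgebra

variable {n p d : ℕ}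

/-- The `i`-th vector of the standard basis. -/
noncomputable abbrev basisVec (i : Fin n) : Coord n := EuclideanSpace.single i 1

set_option synthInstance.maxHeartbeats 200000 in
/-- The inner product `G_{μν} ξ^μ η^ν` as a continuous trilinear map of `G`, `ξ` and `η`. -/
noncomputable def innerL (d : ℕ) :
    (Fin d → Fin d → ℝ) →L[ℝ] Coord d →L[ℝ] Coord d →L[ℝ] ℝ :=
  LinearMap.toContinuousLinearMap
    { toFun := fun G => ∑ μ, ∑ ν, G μ ν •
        (EuclideanSpace.proj μ : Coord d →L[ℝ] ℝ).smulRight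
          (EuclideanSpace.proj ν : Coord d →L[ℝ] ℝ)
      map_add' := fun G G' => by
        ext ξ η
        simp [sum_apply, add_mul, Finset.sum_add_distrib]
      map_smul' := fun c G => by
        ext ξ η
        simp [sum_apply, Finset.mul_sum, mul_assoc] }

theorem innerL_apply (G : Fin d → Fin d → ℝ) (ξ η : Coord d) :
    innerL d G ξ η = dot G ξ η := by
  simp [innerL, dot, sum_apply, mul_assoc]

theorem innerL_basis (G : Fin d → Fin d → ℝ) (μ ν : Fin d) :
    innerL d G (basisVec μ) (basisVec ν) = G μ ν := by
  rw [innerL_apply, dot, Finset.sum_eq_single μ, Finset.sum_eq_single ν] <;> simp +contextual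

theorem sum_basis (ξ : Coord n) : ∑ i, ξ i • basisVec i = ξ := by
  ext j
  simp [Pi.single_apply]

theorem clm_eq_sum {F : Type*} [AddCommGroup F] [Module ℝ F] [TopologicalSpace F]
    (L : Coord n →L[ℝ] F) (ξ : Coord n) : L ξ = ∑ i, ξ i • L (basisVec i) := by
  conv_lhs => rw [← sum_basis ξ, map_sum]
  simp

theorem clm_ext_basis {F : Type*} [AddCommGroup F] [Module ℝ F] [TopologicalSpace F]
    {L L' : Coord n →L[ℝ] F} (h : ∀ i, L (basisVec i) = L' (basisVec i)) : L = L' := by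
  ext ξ
  rw [clm_eq_sum, clm_eq_sum L']
  simp [h]

/-- `G` is a symmetric positive definite matrix. -/
structure IsMetric (G : Fin d → Fin d → ℝ) : Prop where
  symm : ∀ ξ η, innerL d G ξ η = innerL d G η ξ
  pos : ∀ ξ, ξ ≠ 0 → 0 < innerL d G ξ ξ

theorem IsMetric.eq_of_inner {G : Fin d → Fin d → ℝ} (hG : IsMetric G) {ξ η : Coord d}
    (h : ∀ ζ, innerL d G ξ ζ = innerL d G η ζ) : ξ = η := by
  by_contra hne
  have := hG.pos (ξ - η) (sub_ne_zero.2 hne)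
  rw [map_sub (innerL d G), sub_apply, h, sub_self] at this
  exact lt_irrefl _ this

theorem IsMetric.entry_symm {G : Fin d → Fin d → ℝ} (hG : IsMetric G) (μ ν : Fin d) :
    G μ ν = G ν μ := by
  rw [← innerL_basis G, ← innerL_basis G, hG.symm]

theorem IsMetric.det_ne_zero {G : Fin d → Fin d → ℝ} (hG : IsMetric G) :
    (Matrix.of G).det ≠ 0 := by
  intro h
  obtain ⟨v, hv, hv0⟩ := Matrix.exists_mulVec_eq_zero_iff.2 h
  have h1 : innerL d G (WithLp.toLp 2 v) (WithLp.toLp 2 v) = 0 := by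
    rw [innerL_apply]
    have : ∀ μ, ∑ ν, G μ ν * v μ * v ν = v μ * (Matrix.of G).mulVec v μ := by
      intro μ
      rw [Matrix.mulVec, dotProduct, Finset.mul_sum]
      exact Finset.sum_congr rfl fun ν _ => by simp; ring
    simp only [dot]
    simp [this, hv0]
  refine (hG.pos (WithLp.toLp 2 v) ?_).ne' h1
  intro h0
  exact hv (by simpa using congrArg WithLp.ofLp h0)

theorem sum_mul_inv {G : Fin d → Fin d → ℝ} (hG : (Matrix.of G).det ≠ 0) (i k : Fin d) :
    ∑ j, G i j * inv G j k = if i = k then 1 else 0 := by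
  have := congrFun (congrFun (Matrix.mul_nonsing_inv (Matrix.of G) (isUnit_iff_ne_zero.2 hG)) i) k
  rw [Matrix.mul_apply, Matrix.one_apply] at this
  exact this

theorem sum_inv_mul {G : Fin d → Fin d → ℝ} (hG : (Matrix.of G).det ≠ 0) (i k : Fin d) :
    ∑ j, inv G i j * G j k = if i = k then 1 else 0 := by
  have := congrFun (congrFun (Matrix.nonsing_inv_mul (Matrix.of G) (isUnit_iff_ne_zero.2 hG)) i) k
  rw [Matrix.mul_apply, Matrix.one_apply] at this
  exact this

/-- The vector `G^{kl} ℓ_l` that represents the covector `ℓ`. -/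
noncomputable def raise (G : Fin d → Fin d → ℝ) (ℓ : Coord d →L[ℝ] ℝ) : Coord d :=
  WithLp.toLp 2 fun k => ∑ l, inv G k l * ℓ (basisVec l)

theorem IsMetric.inner_raise {G : Fin d → Fin d → ℝ} (hG : IsMetric G) (ℓ : Coord d →L[ℝ] ℝ)
    (ζ : Coord d) : innerL d G (raise G ℓ) ζ = ℓ ζ := by
  suffices h : innerL d G (raise G ℓ) = ℓ by rw [h]
  refine clm_ext_basis fun ν => ?_
  rw [innerL_apply, dot, Finset.sum_comm, Finset.sum_eq_single ν]
  · simp only [raise, PiLp.single_apply, if_true, mul_one, Finset.mul_sum]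
    rw [Finset.sum_comm]
    simp_rw [← mul_assoc, hG.entry_symm _ ν, ← Finset.sum_mul, sum_mul_inv hG.det_ne_zero]
    simp
  · intro μ _ hμ; simp [hμ]
  · simp

/-- The pullback of the inner product `G` under a linear map. -/
noncomputable def pullG (G : Fin d → Fin d → ℝ) (L : Coord p →L[ℝ] Coord d) (a b : Fin p) : ℝ :=
  innerL d G (L (basisVec a)) (L (basisVec b))

theorem innerL_pullG (G : Fin d → Fin d → ℝ) (L : Coord p →L[ℝ] Coord d) (w z : Coord p) :
    innerL p (pullG G L) w z = innerL d G (L w) (L z) := by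
  have : innerL p (pullG G L) =
      (ContinuousLinearMap.compL ℝ (Coord p) (Coord d) ℝ).flip L ∘L (innerL d G) ∘L L := by
    refine clm_ext_basis fun a => clm_ext_basis fun b => ?_
    rw [innerL_basis]; rfl
  rw [this]; rfl

theorem IsMetric.pullG {G : Fin d → Fin d → ℝ} (hG : IsMetric G) {L : Coord p →L[ℝ] Coord d}
    (hL : Function.Injective L) : IsMetric (pullG G L) where
  symm w z := by rw [innerL_pullG, innerL_pullG, hG.symm]
  pos w hw := by
    rw [innerL_pullG]
    exact hG.pos _ (by rwa [Ne, map_eq_zero_iff L hL])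

/-- The trace of a bilinear map with respect to the inner product `G`. -/
noncomputable def traceB {F : Type*} [AddCommGroup F] [Module ℝ F] (G : Fin p → Fin p → ℝ)
    (B : Coord p → Coord p → F) : F :=
  ∑ a, ∑ b, inv G a b • B (basisVec a) (basisVec b)

theorem traceB_congr_basis {G : Fin p → Fin p → ℝ} {B B' : Coord p → Coord p → Coord d}
    (h : ∀ a b, B (basisVec a) (basisVec b) = B' (basisVec a) (basisVec b)) :
    traceB G B = traceB G B' := by simp [traceB, h]

theorem traceB_self {G : Fin p → Fin p → ℝ} (hG : IsMetric G) :
    traceB G (fun a b => innerL p G a b) = p := by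
  simp only [traceB, innerL_basis, smul_eq_mul]
  have : ∀ a, ∑ b, inv G a b * G a b = 1 := fun a => by
    have h := sum_inv_mul hG.det_ne_zero a a
    rw [if_pos rfl] at h
    rw [← h]
    exact Finset.sum_congr rfl fun b _ => by rw [hG.entry_symm]
  rw [Finset.sum_congr rfl fun a _ => this a]
  simp

theorem traceB_smul_const {F : Type*} [AddCommGroup F] [Module ℝ F] (G : Fin p → Fin p → ℝ)
    (B : Coord p → Coord p → ℝ) (v : F) :
    traceB G (fun a b => B a b • v) = traceB G B • v := by
  simp [traceB, Finset.sum_smul, smul_smul]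

theorem inv_smul (c : ℝ) (hc : c ≠ 0) {G : Fin p → Fin p → ℝ} (hG : (Matrix.of G).det ≠ 0)
    (a b : Fin p) : inv (c • G) a b = c⁻¹ * inv G a b := by
  have h : (Matrix.of (c • G))⁻¹ = c⁻¹ • (Matrix.of G)⁻¹ := by
    refine Matrix.inv_eq_left_inv ?_
    change (c⁻¹ • (Matrix.of G)⁻¹) * (c • Matrix.of G) = 1
    rw [Matrix.smul_mul, Matrix.mul_smul, smul_smul, inv_mul_cancel₀ hc,
      Matrix.nonsing_inv_mul _ (isUnit_iff_ne_zero.2 hG), one_smul]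
  rw [inv, h]; rfl

theorem traceB_smul {F : Type*} [AddCommGroup F] [Module ℝ F] (c : ℝ) (hc : c ≠ 0)
    {G : Fin p → Fin p → ℝ} (hG : (Matrix.of G).det ≠ 0) (B : Coord p → Coord p → F) :
    traceB (c • G) B = c⁻¹ • traceB G B := by
  simp [traceB, inv_smul c hc hG, Finset.smul_sum, smul_smul]

/-- The trace is invariant under linear changes of variables. -/
theorem traceB_comp {F : Type*} [NormedAddCommGroup F] [NormedSpace ℝ F] {G : Fin p → Fin p → ℝ}
    {S : Coord p →L[ℝ] Coord p} (hS : Function.Injective S)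
    {B : Coord p → Coord p → F}
    (hB : ∀ ξ η, B ξ η = ∑ i, ∑ j, (ξ i * η j) • B (basisVec i) (basisVec j)) :
    traceB (pullG G S) (fun a b => B (S a) (S b)) = traceB G fun a b => B a b := by
  classical
  set s : Matrix (Fin p) (Fin p) ℝ := Matrix.of fun i a => S (basisVec a) i with hs
  have hsu : IsUnit s.det := by
    rw [isUnit_iff_ne_zero]
    intro h
    obtain ⟨v, hv, hv0⟩ := Matrix.exists_mulVec_eq_zero_iff.2 h
    have h1 : S (WithLp.toLp 2 v) = 0 := by
      rw [clm_eq_sum]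
      ext i
      have := congrFun hv0 i
      rw [Matrix.mulVec, dotProduct] at this
      simpa [hs, mul_comm] using this
    rw [map_eq_zero_iff S hS] at h1
    exact hv (by simpa using congrArg WithLp.ofLp h1)
  have hpull : Matrix.of (pullG G S) = s.transpose * Matrix.of G * s := by
    ext a b
    simp only [Matrix.of_apply, pullG, innerL_apply, dot, Matrix.mul_apply,
      Matrix.transpose_apply, Finset.sum_mul, hs]
    rw [Finset.sum_comm]
    exact Finset.sum_congr rfl fun ν _ => Finset.sum_congr rfl fun μ _ => by ring
  have hinv : s * (Matrix.of (pullG G S))⁻¹ * s.transpose = (Matrix.of G)⁻¹ := by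
    have hst : IsUnit s.transpose.det := by rwa [Matrix.det_transpose]
    rw [hpull, Matrix.mul_inv_rev, Matrix.mul_inv_rev, ← mul_assoc, ← mul_assoc,
      Matrix.mul_nonsing_inv _ hsu, one_mul, mul_assoc, Matrix.nonsing_inv_mul _ hst, mul_one]
  have hent : ∀ i j, inv G i j = ∑ a, ∑ b, s i a * inv (pullG G S) a b * s j b := by
    intro i j
    rw [inv, ← hinv, Matrix.mul_apply, Finset.sum_comm]
    refine Finset.sum_congr rfl fun b _ => ?_
    rw [Matrix.mul_apply, Finset.sum_mul]
    rfl
  simp only [traceB, fun a b => hB (S (basisVec a)) (S (basisVec b)), hent, Finset.smul_sum, Finset.sum_smul, smul_smul]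
  calc _ = ∑ a, ∑ i, ∑ b, ∑ j, (inv (pullG G S) a b * (s i a * s j b)) •
          B (basisVec i) (basisVec j) := Finset.sum_congr rfl fun a _ => Finset.sum_comm
    _ = ∑ i, ∑ a, ∑ j, ∑ b, (inv (pullG G S) a b * (s i a * s j b)) •
          B (basisVec i) (basisVec j) := by
        rw [Finset.sum_comm]
        exact Finset.sum_congr rfl fun i _ => Finset.sum_congr rfl fun a _ => Finset.sum_comm
    _ = _ := by
        refine Finset.sum_congr rfl fun i _ => ?_
        rw [Finset.sum_comm]
        refine Finset.sum_congr rfl fun j _ => Finset.sum_congr rfl fun a _ =>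
          Finset.sum_congr rfl fun b _ => ?_
        congr 1
        ring

end LinearAlgebra

/-! ### The Levi-Civita connection along maps -/

section Connection

variable {n p d : ℕ} {E : Type*} [NormedAddCommGroup E] [NormedSpace ℝ E]

/-- The Christoffel symbols as functions of the metric `G` and its differential `DG` at a point. -/
noncomputable def christoffelJ (G : Fin d → Fin d → ℝ) (DG : Coord d →L[ℝ] Fin d → Fin d → ℝ)
    (k i j : Fin d) : ℝ :=
  1 / 2 * ∑ l, inv G k l *
    (DG (basisVec i) l j + DG (basisVec j) l i - DG (basisVec l) i j)

theorem christoffel_eq {g : Coord d → Fin d → Fin d → ℝ} {y : Coord d}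
    (hg : DifferentiableAt ℝ g y) (k i j : Fin d) :
    christoffel g y k i j = christoffelJ (g y) (fderiv ℝ g y) k i j := by
  have h : ∀ μ ν, ∀ ξ, fderiv ℝ (fun y' => g y' μ ν) y ξ = fderiv ℝ g y ξ μ ν := by
    intro μ ν ξ
    have h1 := hasFDerivAt_pi'.1 (hasFDerivAt_pi'.1 hg.hasFDerivAt μ) ν
    rw [h1.fderiv]
    rfl
  simp only [christoffel, christoffelJ, pderiv, h]

/-- The vector `Γ(ξ, η)`. -/
noncomputable def chrV (G : Fin d → Fin d → ℝ) (DG : Coord d →L[ℝ] Fin d → Fin d → ℝ)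
    (ξ η : Coord d) : Coord d :=
  WithLp.toLp 2 fun k => ∑ i, ∑ j, christoffelJ G DG k i j * ξ i * η j

theorem bilin_eq_sum (B : Coord d →L[ℝ] Coord d →L[ℝ] ℝ) (ξ η : Coord d) :
    B ξ η = ∑ i, ∑ j, ξ i * η j * B (basisVec i) (basisVec j) := by
  rw [clm_eq_sum B ξ, sum_apply]
  refine Finset.sum_congr rfl fun i _ => ?_
  rw [smul_apply, clm_eq_sum (B (basisVec i)), Finset.smul_sum]
  exact Finset.sum_congr rfl fun j _ => by simp [mul_assoc]

/-- The Koszul formula for `Γ(ξ, η)`. -/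
theorem inner_chrV {G : Fin d → Fin d → ℝ} {DG : Coord d →L[ℝ] Fin d → Fin d → ℝ}
    (hG : IsMetric G) (hD : ∀ ξ η ζ, innerL d (DG ξ) η ζ = innerL d (DG ξ) ζ η)
    (ξ η ζ : Coord d) :
    innerL d G (chrV G DG ξ η) ζ =
      1 / 2 * (innerL d (DG ξ) η ζ + innerL d (DG η) ξ ζ - innerL d (DG ζ) ξ η) := by
  set T : Coord d →L[ℝ] Coord d →L[ℝ] Coord d →L[ℝ] ℝ := (innerL d).comp DG
  set ℓ : Coord d →L[ℝ] ℝ := (1 / 2 : ℝ) • (T ξ η + T η ξ - (T.flip ξ).flip η)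
  have hℓ : ∀ ζ, ℓ ζ = 1 / 2 * (innerL d (DG ξ) η ζ + innerL d (DG η) ξ ζ -
    innerL d (DG ζ) ξ η) := fun ζ => rfl
  rw [← hℓ, ← hG.inner_raise ℓ ζ]
  congr 2
  ext k
  simp only [chrV, raise, christoffelJ]
  have e : ∀ l, ℓ (basisVec l) = ∑ i, ∑ j, 1 / 2 * (DG (basisVec i) l j + DG (basisVec j) l i
      - DG (basisVec l) i j) * (ξ i * η j) := by
    intro l
    rw [hℓ, hD, hD η]
    have e1 : innerL d (DG ξ) (basisVec l) η =
        ∑ i, ∑ j, ξ i * η j * DG (basisVec i) l j := by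
      refine (bilin_eq_sum (T.flip (basisVec l)) ξ η).trans ?_
      exact Finset.sum_congr rfl fun i _ => Finset.sum_congr rfl fun j _ => by
        rw [← innerL_basis (DG _)]; rfl
    have e2 : innerL d (DG η) (basisVec l) ξ =
        ∑ i, ∑ j, ξ i * η j * DG (basisVec j) l i := by
      refine (bilin_eq_sum (T.flip (basisVec l)).flip ξ η).trans ?_
      exact Finset.sum_congr rfl fun i _ => Finset.sum_congr rfl fun j _ => by
        rw [← innerL_basis (DG _)]; rfl
    have e3 : innerL d (DG (basisVec l)) ξ η =
        ∑ i, ∑ j, ξ i * η j * DG (basisVec l) i j := by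
      refine (bilin_eq_sum (T (basisVec l)) ξ η).trans ?_
      exact Finset.sum_congr rfl fun i _ => Finset.sum_congr rfl fun j _ => by
        rw [← innerL_basis (DG _)]; rfl
    rw [e1, e2, e3, ← Finset.sum_add_distrib, ← Finset.sum_sub_distrib, Finset.mul_sum]
    refine Finset.sum_congr rfl fun i _ => ?_
    rw [← Finset.sum_add_distrib, ← Finset.sum_sub_distrib, Finset.mul_sum]
    exact Finset.sum_congr rfl fun j _ => by ring
  simp only [e, Finset.mul_sum, Finset.sum_mul]
  calc _ = ∑ i, ∑ l, ∑ j, 1 / 2 * (inv G k l * (DG (basisVec i) l j + DG (basisVec j) l i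
      - DG (basisVec l) i j)) * ξ i * η j := Finset.sum_congr rfl fun i _ => Finset.sum_comm
    _ = _ := by
      rw [Finset.sum_comm]
      refine Finset.sum_congr rfl fun l _ => Finset.sum_congr rfl fun i _ =>
        Finset.sum_congr rfl fun j _ => ?_
      ring

theorem hasFDerivAt_innerL {G : E → Fin d → Fin d → ℝ} {ξ η : E → Coord d} {u : E}
    {G' : E →L[ℝ] Fin d → Fin d → ℝ} {ξ' η' : E →L[ℝ] Coord d}
    (hG : HasFDerivAt G G' u) (hξ : HasFDerivAt ξ ξ' u) (hη : HasFDerivAt η η' u) :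
    ∃ D : E →L[ℝ] ℝ, HasFDerivAt (fun v => innerL d (G v) (ξ v) (η v)) D u ∧
      ∀ c, D c = innerL d (G' c) (ξ u) (η u) + innerL d (G u) (ξ' c) (η u) +
        innerL d (G u) (ξ u) (η' c) := by
  have hG1 : ∀ μ ν, HasFDerivAt (fun v => G v μ ν)
      ((ContinuousLinearMap.proj ν).comp ((ContinuousLinearMap.proj μ).comp G')) u := fun μ ν =>
    hasFDerivAt_pi'.1 (hasFDerivAt_pi'.1 hG μ) ν
  have hξ1 : ∀ μ, HasFDerivAt (fun v => ξ v μ)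
      ((EuclideanSpace.proj μ : Coord d →L[ℝ] ℝ).comp ξ') u := fun μ =>
    (EuclideanSpace.proj μ : Coord d →L[ℝ] ℝ).hasFDerivAt.comp u hξ
  have hη1 : ∀ μ, HasFDerivAt (fun v => η v μ)
      ((EuclideanSpace.proj μ : Coord d →L[ℝ] ℝ).comp η') u := fun μ =>
    (EuclideanSpace.proj μ : Coord d →L[ℝ] ℝ).hasFDerivAt.comp u hη
  simp only [innerL_apply, dot]
  refine ⟨_, HasFDerivAt.fun_sum fun μ _ => HasFDerivAt.fun_sum fun ν _ =>
    ((hG1 μ ν).mul (hξ1 μ)).mul (hη1 ν), fun c => ?_⟩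
  simp only [sum_apply, ← Finset.sum_add_distrib]
  refine Finset.sum_congr rfl fun μ _ => Finset.sum_congr rfl fun ν _ => ?_
  simp
  ring

/-- `g` is a smooth Riemannian metric in a neighbourhood of `y`. -/
structure MetricNear (g : Coord d → Fin d → Fin d → ℝ) (y : Coord d) : Prop where
  smooth : SmoothNear g y
  metric : ∀ᶠ y' in 𝓝 y, IsMetric (g y')

theorem MetricNear.isMetric {g : Coord d → Fin d → Fin d → ℝ} {y : Coord d}
    (h : MetricNear g y) : IsMetric (g y) := h.metric.self_of_nhds

theorem MetricNear.eventually {g : Coord d → Fin d → Fin d → ℝ} {y : Coord d}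
    (h : MetricNear g y) : ∀ᶠ y' in 𝓝 y, MetricNear g y' := by
  filter_upwards [h.smooth.eventually, eventually_eventually_nhds.2 h.metric] with y' h1 h2
    using ⟨h1, h2⟩

theorem MetricNear.fderiv_symm {g : Coord d → Fin d → Fin d → ℝ} {y : Coord d}
    (h : MetricNear g y) (ξ η ζ : Coord d) :
    innerL d (fderiv ℝ g y ξ) η ζ = innerL d (fderiv ℝ g y ξ) ζ η := by
  obtain ⟨D, hD, hD'⟩ := hasFDerivAt_innerL h.smooth.differentiableAt.hasFDerivAt
    (hasFDerivAt_const η y) (hasFDerivAt_const ζ y)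
  obtain ⟨C, hC, hC'⟩ := hasFDerivAt_innerL h.smooth.differentiableAt.hasFDerivAt
    (hasFDerivAt_const ζ y) (hasFDerivAt_const η y)
  have he : (fun y => innerL d (g y) η ζ) =ᶠ[𝓝 y] fun y => innerL d (g y) ζ η :=
    h.metric.mono fun y' hy' => hy'.symm η ζ
  have := DFunLike.congr_fun (hD.unique (hC.congr_of_eventuallyEq he)) ξ
  rw [hD', hC'] at this
  simpa using this

/-- The covariant Hessian `∇_a ∂_b x` of a map `x` into a Riemannian manifold (with flat
source). -/
noncomputable def covHess (g : Coord d → Fin d → Fin d → ℝ) (x : E → Coord d) (u a b : E) :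
    Coord d :=
  fderiv ℝ (fderiv ℝ x) u a b +
    chrV (g (x u)) (fderiv ℝ g (x u)) (fderiv ℝ x u a) (fderiv ℝ x u b)

/-- The pullback of the metric `g` under `x`, evaluated on the constant vector fields `a`, `b`. -/
noncomputable def gram (g : Coord d → Fin d → Fin d → ℝ) (x : E → Coord d) (a b : E) (u : E) : ℝ :=
  innerL d (g (x u)) (fderiv ℝ x u a) (fderiv ℝ x u b)

theorem fderiv_gram {g : Coord d → Fin d → Fin d → ℝ} {x : E → Coord d} {u : E}
    (hg : SmoothNear g (x u)) (hx : SmoothNear x u) (a b c : E) :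
    fderiv ℝ (gram g x a b) u c =
      innerL d (fderiv ℝ g (x u) (fderiv ℝ x u c)) (fderiv ℝ x u a) (fderiv ℝ x u b) +
      innerL d (g (x u)) (fderiv ℝ (fderiv ℝ x) u c a) (fderiv ℝ x u b) +
      innerL d (g (x u)) (fderiv ℝ x u a) (fderiv ℝ (fderiv ℝ x) u c b) := by
  have h2 : ∀ a, HasFDerivAt (fun v => fderiv ℝ x v a)
      ((ContinuousLinearMap.apply ℝ (Coord d) a).comp (fderiv ℝ (fderiv ℝ x) u)) u := fun a =>
    (ContinuousLinearMap.apply ℝ (Coord d) a).hasFDerivAt.comp u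
      hx.fderiv.differentiableAt.hasFDerivAt
  obtain ⟨D, hD, hD'⟩ := hasFDerivAt_innerL
    (hg.differentiableAt.hasFDerivAt.comp u hx.differentiableAt.hasFDerivAt) (h2 a) (h2 b)
  rw [show fderiv ℝ (gram g x a b) u = D from hD.fderiv, hD' c]
  rfl

/-- The Koszul formula along a map: the tangential components of the covariant Hessian are
determined by the pulled back metric. -/
theorem inner_covHess {g : Coord d → Fin d → Fin d → ℝ} {x : E → Coord d} {u : E}
    (hg : MetricNear g (x u)) (hx : SmoothNear x u) (a b c : E) :
    innerL d (g (x u)) (covHess g x u a b) (fderiv ℝ x u c) =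
      1 / 2 * (fderiv ℝ (gram g x b c) u a + fderiv ℝ (gram g x a c) u b -
        fderiv ℝ (gram g x a b) u c) := by
  have hs : ∀ a b, fderiv ℝ (fderiv ℝ x) u a b = fderiv ℝ (fderiv ℝ x) u b a :=
    hx.contDiffAt.isSymmSndFDerivAt (by
      rw [minSmoothness_of_isRCLikeNormedField]; exact two_le_infty)
  rw [covHess, map_add, add_apply, inner_chrV hg.isMetric hg.fderiv_symm,
    fderiv_gram hg.smooth hx, fderiv_gram hg.smooth hx, fderiv_gram hg.smooth hx, hs c a, hs c b,
    hs b a, hg.isMetric.symm (fderiv ℝ (fderiv ℝ x) u a c)]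
  ring

/-- `F` maps the metric `g` to the metric `g'` in a neighbourhood of `y`. -/
structure LocalIsometry (g g' : Coord d → Fin d → Fin d → ℝ) (F : Coord d → Coord d)
    (y : Coord d) : Prop where
  smooth : SmoothNear F y
  isometry : ∀ᶠ y' in 𝓝 y, ∀ ξ η,
    innerL d (g' (F y')) (fderiv ℝ F y' ξ) (fderiv ℝ F y' η) = innerL d (g y') ξ η

theorem LocalIsometry.injective {g g' : Coord d → Fin d → Fin d → ℝ} {F : Coord d → Coord d}
    {y : Coord d} (h : LocalIsometry g g' F y) (hg : IsMetric (g y)) :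
    Function.Injective (fderiv ℝ F y) := by
  refine (injective_iff_map_eq_zero _).2 fun ξ hξ => ?_
  by_contra hne
  have := hg.pos ξ hne
  rw [← h.isometry.self_of_nhds, hξ] at this
  simp at this

theorem LocalIsometry.surjective {g g' : Coord d → Fin d → Fin d → ℝ} {F : Coord d → Coord d}
    {y : Coord d} (h : LocalIsometry g g' F y) (hg : IsMetric (g y)) :
    Function.Surjective (fderiv ℝ F y) :=
  (LinearMap.injective_iff_surjective (f := (fderiv ℝ F y : Coord d →ₗ[ℝ] Coord d))).1
    (h.injective hg)

theorem covHess_id {g : Coord d → Fin d → Fin d → ℝ} (y ξ η : Coord d) :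
    covHess g (fun y => y) y ξ η = chrV (g y) (fderiv ℝ g y) ξ η := by
  have : fderiv ℝ (fun y : Coord d => y) = fun _ => ContinuousLinearMap.id ℝ _ := by
    ext1 y; exact fderiv_fun_id
  rw [covHess, this]
  simp

/-- The transformation law of the Christoffel symbols. -/
theorem LocalIsometry.covHess_eq {g g' : Coord d → Fin d → Fin d → ℝ} {F : Coord d → Coord d}
    {y : Coord d} (h : LocalIsometry g g' F y) (hg : MetricNear g y) (hg' : MetricNear g' (F y))
    (ξ η : Coord d) :
    covHess g' F y ξ η = fderiv ℝ F y (chrV (g y) (fderiv ℝ g y) ξ η) := by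
  refine hg'.isMetric.eq_of_inner fun ζ' => ?_
  obtain ⟨ζ, rfl⟩ := h.surjective hg.isMetric ζ'
  have hid : fderiv ℝ (fun y : Coord d => y) = fun _ => ContinuousLinearMap.id ℝ _ := by
    ext1 y; exact fderiv_fun_id
  have hgram : ∀ a b, gram g' F a b =ᶠ[𝓝 y] gram g (fun y => y) a b := by
    intro a b
    filter_upwards [h.isometry] with y' hy'
    rw [gram, hy', gram, hid]
    rfl
  have h2 := inner_covHess (x := fun y : Coord d => y) hg (smoothNear_of_contDiff contDiff_id) ξ η ζ
  rw [covHess_id, hid] at h2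
  rw [inner_covHess hg' h.smooth, h.isometry.self_of_nhds, (hgram _ _).fderiv_eq,
    (hgram _ _).fderiv_eq, (hgram _ _).fderiv_eq]
  exact h2.symm

theorem fderiv_fderiv_comp {E' F' : Type*} [NormedAddCommGroup E'] [NormedSpace ℝ E']
    [NormedAddCommGroup F'] [NormedSpace ℝ F'] {f : E → E'} {k : E' → F'} {u : E}
    (hk : SmoothNear k (f u)) (hf : SmoothNear f u) (a b : E) :
    fderiv ℝ (fderiv ℝ fun v => k (f v)) u a b =
      fderiv ℝ (fderiv ℝ k) (f u) (fderiv ℝ f u a) (fderiv ℝ f u b) +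
        fderiv ℝ k (f u) (fderiv ℝ (fderiv ℝ f) u a b) := by
  have he : fderiv ℝ (fun v => k (f v)) =ᶠ[𝓝 u] fun v => (fderiv ℝ k (f v)).comp (fderiv ℝ f v) := by
    filter_upwards [hf.eventually, hf.contDiffAt.continuousAt.eventually hk.eventually] with v h1 h2
    exact fderiv_comp v h2.differentiableAt h1.differentiableAt
  have h1 : HasFDerivAt (fun v => fderiv ℝ k (f v)) _ u :=
    hk.fderiv.differentiableAt.hasFDerivAt.comp u hf.differentiableAt.hasFDerivAt
  rw [he.fderiv_eq, (h1.clm_comp hf.fderiv.differentiableAt.hasFDerivAt).fderiv]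
  simp [add_comm]

theorem fderiv_comp_near {E' F' : Type*} [NormedAddCommGroup E'] [NormedSpace ℝ E']
    [NormedAddCommGroup F'] [NormedSpace ℝ F'] {f : E → E'} {k : E' → F'} {u : E}
    (hk : SmoothNear k (f u)) (hf : SmoothNear f u) :
    fderiv ℝ (fun v => k (f v)) u = (fderiv ℝ k (f u)).comp (fderiv ℝ f u) :=
  fderiv_comp u hk.differentiableAt hf.differentiableAt

theorem covHess_comp {E' : Type*} [NormedAddCommGroup E'] [NormedSpace ℝ E']
    {g : Coord d → Fin d → Fin d → ℝ} {x : E' → Coord d} {f : E → E'} {u : E}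
    (hx : SmoothNear x (f u)) (hf : SmoothNear f u) (a b : E) :
    covHess g (fun v => x (f v)) u a b =
      covHess g x (f u) (fderiv ℝ f u a) (fderiv ℝ f u b) +
        fderiv ℝ x (f u) (fderiv ℝ (fderiv ℝ f) u a b) := by
  rw [covHess, fderiv_fderiv_comp hx hf, fderiv_comp_near hx hf, covHess]
  simp only [ContinuousLinearMap.comp_apply]
  abel

/-- Isometries commute with the covariant Hessian. -/
theorem LocalIsometry.covHess_comp {g g' : Coord d → Fin d → Fin d → ℝ} {F : Coord d → Coord d}
    {x : E → Coord d} {u : E} (h : LocalIsometry g g' F (x u)) (hg : MetricNear g (x u))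
    (hg' : MetricNear g' (F (x u))) (hx : SmoothNear x u) (a b : E) :
    covHess g' (fun v => F (x v)) u a b = fderiv ℝ F (x u) (covHess g x u a b) := by
  rw [Defect.covHess_comp h.smooth hx, h.covHess_eq hg hg', ← map_add, covHess, add_comm]

end Connection

/-! ### Submanifolds: the trace of the second fundamental form and the tangential gradient -/

section Submanifold

variable {n p d : ℕ} {E : Type*} [NormedAddCommGroup E] [NormedSpace ℝ E]

theorem contDiffAt_coord {ξ : E → Coord d} {u : E} (hξ : ContDiffAt ℝ ∞ ξ u) (μ : Fin d) :
    ContDiffAt ℝ ∞ (fun v => ξ v μ) u :=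
  (EuclideanSpace.proj μ : Coord d →L[ℝ] ℝ).contDiff.contDiffAt.comp u hξ

theorem contDiffAt_entry {G : E → Fin d → Fin n → ℝ} {u : E} (hG : ContDiffAt ℝ ∞ G u)
    (μ : Fin d) (ν : Fin n) : ContDiffAt ℝ ∞ (fun v => G v μ ν) u :=
  contDiffAt_pi.1 (contDiffAt_pi.1 hG μ) ν

theorem contDiffAt_innerL {G : E → Fin d → Fin d → ℝ} {ξ η : E → Coord d} {u : E}
    (hG : ContDiffAt ℝ ∞ G u) (hξ : ContDiffAt ℝ ∞ ξ u) (hη : ContDiffAt ℝ ∞ η u) :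
    ContDiffAt ℝ ∞ (fun v => innerL d (G v) (ξ v) (η v)) u := by
  simp only [innerL_apply, dot]
  exact ContDiffAt.sum fun μ _ => ContDiffAt.sum fun ν _ =>
    ((contDiffAt_entry hG μ ν).mul (contDiffAt_coord hξ μ)).mul (contDiffAt_coord hη ν)

theorem SmoothNear.innerL {G : E → Fin d → Fin d → ℝ} {ξ η : E → Coord d} {u : E}
    (hG : SmoothNear G u) (hξ : SmoothNear ξ u) (hη : SmoothNear η u) :
    SmoothNear (fun v => innerL d (G v) (ξ v) (η v)) u := by
  filter_upwards [hG, hξ, hη] with v h1 h2 h3 using contDiffAt_innerL h1 h2 h3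

theorem chrV_basis (G : Fin d → Fin d → ℝ) (DG : Coord d →L[ℝ] Fin d → Fin d → ℝ)
    (i j k : Fin d) : chrV G DG (basisVec i) (basisVec j) k = christoffelJ G DG k i j := by
  simp only [chrV]
  rw [Finset.sum_eq_single i, Finset.sum_eq_single j] <;> simp +contextual

theorem fderiv_coord {Y : E → Coord d} {u : E} (hY : DifferentiableAt ℝ Y u) (μ : Fin d) (a : E) :
    fderiv ℝ (fun u' => Y u' μ) u a = fderiv ℝ Y u a μ := by
  have := ((EuclideanSpace.proj μ : Coord d →L[ℝ] ℝ).hasFDerivAt.comp u hY.hasFDerivAt).fderiv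
  exact DFunLike.congr_fun this a

theorem frame_eq {Y : Coord p → Coord d} {u : Coord p} (hY : DifferentiableAt ℝ Y u) (a : Fin p) :
    frame Y u a = fderiv ℝ Y u (basisVec a) := by
  ext μ
  exact fderiv_coord hY μ _

theorem inducedMetric_eq (g : Coord d → Fin d → Fin d → ℝ) {Y : Coord p → Coord d} {u : Coord p}
    (hY : DifferentiableAt ℝ Y u) :
    inducedMetric g Y u = pullG (g (Y u)) (fderiv ℝ Y u) := by
  ext a b
  rw [inducedMetric, frame_eq hY, frame_eq hY, pullG, innerL_apply]

/-- `Y` is a smooth map near `u`, immersive at `u`, into a space with the smooth metric `g`. -/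
structure ImmersionNear (g : Coord d → Fin d → Fin d → ℝ) (Y : Coord p → Coord d) (u : Coord p) :
    Prop where
  smooth : SmoothNear Y u
  metric : MetricNear g (Y u)
  injective : Function.Injective (fderiv ℝ Y u)

theorem eventually_injective {P : Type*} [TopologicalSpace P] {L : P → E →L[ℝ] Coord d} {u : P}
    [FiniteDimensional ℝ E] (hL : ContinuousAt L u) (h : Function.Injective (L u)) :
    ∀ᶠ v in 𝓝 u, Function.Injective (L v) :=
  hL.eventually (ContinuousLinearMap.isOpen_injective.mem_nhds h)

namespace ImmersionNear

variable {g : Coord d → Fin d → Fin d → ℝ} {Y : Coord p → Coord d} {u : Coord p}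

theorem eventually (h : ImmersionNear g Y u) : ∀ᶠ v in 𝓝 u, ImmersionNear g Y v := by
  filter_upwards [h.smooth.eventually, h.smooth.contDiffAt.continuousAt.eventually
    h.metric.eventually, eventually_injective h.smooth.fderiv.contDiffAt.continuousAt h.injective]
    with v h1 h2 h3 using ⟨h1, h2, h3⟩

theorem inducedMetric_eventuallyEq (h : ImmersionNear g Y u) :
    inducedMetric g Y =ᶠ[𝓝 u] fun v => pullG (g (Y v)) (fderiv ℝ Y v) :=
  h.smooth.eventually.mono fun _ hv => inducedMetric_eq g hv.differentiableAt

theorem metricNear_inducedMetric (h : ImmersionNear g Y u) :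
    MetricNear (inducedMetric g Y) u where
  smooth := by
    refine SmoothNear.congr ?_ h.inducedMetric_eventuallyEq
    filter_upwards [h.eventually] with v hv
    refine contDiffAt_pi.2 fun a => contDiffAt_pi.2 fun b => ?_
    exact contDiffAt_innerL (hv.metric.smooth.contDiffAt.comp v hv.smooth.contDiffAt)
      (hv.smooth.fderiv.contDiffAt.clm_apply contDiffAt_const)
      (hv.smooth.fderiv.contDiffAt.clm_apply contDiffAt_const)
  metric := by
    filter_upwards [h.eventually, h.inducedMetric_eventuallyEq] with v hv h1
    rw [h1]
    exact hv.metric.isMetric.pullG hv.injective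

theorem inner_fderiv (h : ImmersionNear g Y u) (w z : Coord p) :
    innerL d (g (Y u)) (fderiv ℝ Y u w) (fderiv ℝ Y u z) = innerL p (inducedMetric g Y u) w z := by
  rw [inducedMetric_eq g h.smooth.differentiableAt, innerL_pullG]

/-- A tangential vector that is also normal vanishes. -/
theorem eq_zero_of_normal (h : ImmersionNear g Y u) {w : Coord p}
    (hw : ∀ z, innerL d (g (Y u)) (fderiv ℝ Y u w) (fderiv ℝ Y u z) = 0) : fderiv ℝ Y u w = 0 := by
  by_contra hne
  exact (h.metric.isMetric.pos _ hne).ne' (hw w)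

/-- The second fundamental form is the covariant Hessian up to a tangential correction. -/
theorem secondFF_eq (h : ImmersionNear g Y u) (a b : Fin p) :
    WithLp.toLp 2 (secondFF g Y u a b) = covHess g Y u (basisVec a) (basisVec b) -
      fderiv ℝ Y u (chrV (inducedMetric g Y u) (fderiv ℝ (inducedMetric g Y) u)
        (basisVec a) (basisVec b)) := by
  ext μ
  have e1 : pderiv a (fun u' => frame Y u' b μ) u =
      fderiv ℝ (fderiv ℝ Y) u (basisVec a) (basisVec b) μ := by
    have he : (fun u' => frame Y u' b μ) =ᶠ[𝓝 u] fun u' => fderiv ℝ Y u' (basisVec b) μ := by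
      filter_upwards [h.smooth.eventually] with v hv
      rw [frame_eq hv.differentiableAt]
    have h2 : HasFDerivAt (fun u' => fderiv ℝ Y u' (basisVec b)) _ u :=
      h.smooth.fderiv.differentiableAt.hasFDerivAt.clm_apply (hasFDerivAt_const _ _)
    rw [pderiv, he.fderiv_eq, fderiv_coord h2.differentiableAt, h2.fderiv]
    simp
  have e3 : fderiv ℝ Y u (chrV (inducedMetric g Y u) (fderiv ℝ (inducedMetric g Y) u)
        (basisVec a) (basisVec b)) μ =
      ∑ c, christoffel (inducedMetric g Y) u c a b * frame Y u c μ := by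
    rw [clm_eq_sum]
    simp [chrV_basis, christoffel_eq h.metricNear_inducedMetric.smooth.differentiableAt,
      frame_eq h.smooth.differentiableAt]
  simp only [secondFF, e1, covHess, chrV, PiLp.sub_apply, PiLp.add_apply]
  rw [← e3, frame_eq h.smooth.differentiableAt, frame_eq h.smooth.differentiableAt]
  simp only [christoffel_eq h.metric.smooth.differentiableAt, chrV]

/-- The trace of the second fundamental form is the trace of the covariant Hessian up to a tangential
vector. -/
theorem traceFF_eq (h : ImmersionNear g Y u) :
    (WithLp.toLp 2 (traceFF g Y u) : Coord d) = traceB (inducedMetric g Y u) (covHess g Y u) -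
      fderiv ℝ Y u (traceB (inducedMetric g Y u)
        (chrV (inducedMetric g Y u) (fderiv ℝ (inducedMetric g Y) u))) := by
  have : (WithLp.toLp 2 (traceFF g Y u) : Coord d) = ∑ a, ∑ b, inv (inducedMetric g Y u) a b •
      (WithLp.toLp 2 (secondFF g Y u a b) : Coord d) := by
    ext μ
    simp [traceFF]
  rw [this]
  simp only [h.secondFF_eq, smul_sub, Finset.sum_sub_distrib, traceB, map_sum, map_smul]

/-- The second fundamental form is normal, by the Koszul formula for the submanifold and for the
induced metric. -/
theorem inner_secondFF (h : ImmersionNear g Y u) (a b : Fin p) (w : Coord p) :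
    innerL d (g (Y u)) (WithLp.toLp 2 (secondFF g Y u a b)) (fderiv ℝ Y u w) = 0 := by
  have hm := h.metricNear_inducedMetric
  have hid : fderiv ℝ (fun y : Coord p => y) = fun _ => ContinuousLinearMap.id ℝ _ := by
    ext1 y; exact fderiv_fun_id
  have h1 := inner_covHess h.metric h.smooth (basisVec a) (basisVec b) w
  have h2 := inner_covHess (x := fun v : Coord p => v) hm (smoothNear_of_contDiff contDiff_id)
    (basisVec a) (basisVec b) w
  have hgr : ∀ w z, gram (inducedMetric g Y) (fun v => v) w z =ᶠ[𝓝 u] gram g Y w z := by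
    intro w z
    filter_upwards [h.eventually] with v hv
    rw [gram, gram, hv.inner_fderiv, hid]
    rfl
  rw [covHess_id, (hgr _ _).fderiv_eq, (hgr _ _).fderiv_eq, (hgr _ _).fderiv_eq, hid] at h2
  rw [h.secondFF_eq, map_sub, sub_apply, h1, h.inner_fderiv, ← h2]
  exact sub_self _

theorem inner_traceFF (h : ImmersionNear g Y u) (w : Coord p) :
    innerL d (g (Y u)) (WithLp.toLp 2 (traceFF g Y u)) (fderiv ℝ Y u w) = 0 := by
  have : (WithLp.toLp 2 (traceFF g Y u) : Coord d) = ∑ a, ∑ b, inv (inducedMetric g Y u) a b •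
      (WithLp.toLp 2 (secondFF g Y u a b) : Coord d) := by
    ext μ
    simp [traceFF]
  rw [this]
  simp only [map_sum, map_smul, sum_apply, smul_apply, h.inner_secondFF]
  simp

/-- Two normal vectors that differ by a tangential vector are equal. -/
theorem normal_unique (h : ImmersionNear g Y u) {ξ η : Coord d}
    (hξ : ∀ w, innerL d (g (Y u)) ξ (fderiv ℝ Y u w) = 0)
    (hη : ∀ w, innerL d (g (Y u)) η (fderiv ℝ Y u w) = 0) {z : Coord p}
    (hz : ξ = η + fderiv ℝ Y u z) : ξ = η := by
  have : fderiv ℝ Y u z = 0 := h.eq_zero_of_normal fun w => by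
    rw [show fderiv ℝ Y u z = ξ - η by rw [hz, add_sub_cancel_left], map_sub, sub_apply, hξ, hη,
      sub_zero]
  rw [hz, this, add_zero]

end ImmersionNear

/-- The vector form of the tangential gradient. -/
theorem tangGrad_eq (g : Coord d → Fin d → Fin d → ℝ) {Y : Coord p → Coord d} {u : Coord p}
    (hY : DifferentiableAt ℝ Y u) (f : Coord p → ℝ) :
    (WithLp.toLp 2 (tangGrad g Y f u) : Coord d) =
      fderiv ℝ Y u (raise (inducedMetric g Y u) (fderiv ℝ f u)) := by
  rw [clm_eq_sum]
  ext μ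
  simp only [tangGrad, raise, frame_eq hY, pderiv, WithLp.ofLp_sum, WithLp.ofLp_smul,
    Finset.sum_apply, Pi.smul_apply, smul_eq_mul, Finset.sum_mul]
  exact Finset.sum_congr rfl fun a _ => Finset.sum_congr rfl fun b _ => by ring

/-- `Γ` as a bilinear map. -/
noncomputable def chrVL (G : Fin d → Fin d → ℝ) (DG : Coord d →L[ℝ] Fin d → Fin d → ℝ) :
    Coord d →ₗ[ℝ] Coord d →ₗ[ℝ] Coord d :=
  LinearMap.mk₂ ℝ (chrV G DG)
    (fun ξ ξ' η => by ext k; simp [chrV, mul_add, add_mul, Finset.sum_add_distrib])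
    (fun c ξ η => by
      ext k
      simp only [chrV, PiLp.smul_apply, smul_eq_mul, Finset.mul_sum]
      exact Finset.sum_congr rfl fun _ _ => Finset.sum_congr rfl fun _ _ => by ring)
    (fun ξ η η' => by ext k; simp [chrV, mul_add, Finset.sum_add_distrib])
    (fun c ξ η => by
      ext k
      simp only [chrV, PiLp.smul_apply, smul_eq_mul, Finset.mul_sum]
      exact Finset.sum_congr rfl fun _ _ => Finset.sum_congr rfl fun _ _ => by ring)

theorem chrVL_apply (G : Fin d → Fin d → ℝ) (DG : Coord d →L[ℝ] Fin d → Fin d → ℝ)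
    (ξ η : Coord d) : chrVL G DG ξ η = chrV G DG ξ η := rfl

theorem covHess_eq_sum (g : Coord d → Fin d → Fin d → ℝ) (Y : Coord p → Coord d) (u : Coord p)
    (ξ η : Coord p) : covHess g Y u ξ η =
      ∑ i, ∑ j, (ξ i * η j) • covHess g Y u (basisVec i) (basisVec j) := by
  have h1 : fderiv ℝ (fderiv ℝ Y) u ξ η = ∑ i, ∑ j, (ξ i * η j) •
      fderiv ℝ (fderiv ℝ Y) u (basisVec i) (basisVec j) := by
    rw [clm_eq_sum (fderiv ℝ (fderiv ℝ Y) u) ξ, sum_apply]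
    refine Finset.sum_congr rfl fun i _ => ?_
    rw [smul_apply, clm_eq_sum _ η, Finset.smul_sum]
    exact Finset.sum_congr rfl fun j _ => smul_smul _ _ _
  have h2 : chrV (g (Y u)) (fderiv ℝ g (Y u)) (fderiv ℝ Y u ξ) (fderiv ℝ Y u η) =
      ∑ i, ∑ j, (ξ i * η j) • chrV (g (Y u)) (fderiv ℝ g (Y u)) (fderiv ℝ Y u (basisVec i))
        (fderiv ℝ Y u (basisVec j)) := by
    rw [← chrVL_apply, clm_eq_sum (fderiv ℝ Y u) ξ, map_sum (chrVL _ _), LinearMap.sum_apply]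
    refine Finset.sum_congr rfl fun i _ => ?_
    rw [clm_eq_sum (fderiv ℝ Y u) η, map_sum]
    refine Finset.sum_congr rfl fun j _ => ?_
    rw [map_smul, map_smul, LinearMap.smul_apply, smul_smul, mul_comm, chrVL_apply]
  rw [covHess, h1, h2, ← Finset.sum_add_distrib]
  refine Finset.sum_congr rfl fun i _ => ?_
  rw [← Finset.sum_add_distrib]
  exact Finset.sum_congr rfl fun j _ => by rw [covHess, smul_add]

/-! ### Invariance under isometries and reparametrisations -/

/-- The data of two immersions related by a local isometry `F` and a reparametrisation `f`. -/
structure RelatedImmersions (g g' : Coord d → Fin d → Fin d → ℝ) (F : Coord d → Coord d)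
    (f : Coord p → Coord p) (Y Y' : Coord p → Coord d) (u : Coord p) : Prop where
  imm : ImmersionNear g Y (f u)
  imm' : ImmersionNear g' Y' u
  isom : LocalIsometry g g' F (Y (f u))
  repar : SmoothNear f u
  eq : Y' =ᶠ[𝓝 u] fun v => F (Y (f v))

namespace RelatedImmersions

variable {g g' : Coord d → Fin d → Fin d → ℝ} {F : Coord d → Coord d}
    {f : Coord p → Coord p} {Y Y' : Coord p → Coord d} {u : Coord p}

theorem fderiv_eq (h : RelatedImmersions g g' F f Y Y' u) (w : Coord p) :
    fderiv ℝ Y' u w = fderiv ℝ F (Y (f u)) (fderiv ℝ Y (f u) (fderiv ℝ f u w)) := by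
  rw [h.eq.fderiv_eq, fderiv_comp_near (f := fun v => Y (f v)) h.isom.smooth
    (h.imm.smooth.comp h.repar), fderiv_comp_near h.imm.smooth h.repar]
  rfl

theorem value_eq (h : RelatedImmersions g g' F f Y Y' u) : Y' u = F (Y (f u)) := h.eq.self_of_nhds

theorem injective (h : RelatedImmersions g g' F f Y Y' u) :
    Function.Injective (fderiv ℝ f u) := by
  refine (injective_iff_map_eq_zero _).2 fun w hw => ?_
  refine (map_eq_zero_iff _ h.imm'.injective).1 ?_
  rw [h.fderiv_eq, hw, map_zero, map_zero]

theorem surjective (h : RelatedImmersions g g' F f Y Y' u) :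
    Function.Surjective (fderiv ℝ f u) :=
  (LinearMap.injective_iff_surjective (f := (fderiv ℝ f u : Coord p →ₗ[ℝ] Coord p))).1 h.injective

theorem inner_eq (h : RelatedImmersions g g' F f Y Y' u) (ξ η : Coord d) :
    innerL d (g' (Y' u)) (fderiv ℝ F (Y (f u)) ξ) (fderiv ℝ F (Y (f u)) η) =
      innerL d (g (Y (f u))) ξ η := by
  rw [h.value_eq, h.isom.isometry.self_of_nhds]

theorem inducedMetric_eq (h : RelatedImmersions g g' F f Y Y' u) :
    inducedMetric g' Y' u = pullG (inducedMetric g Y (f u)) (fderiv ℝ f u) := by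
  ext a b
  rw [Defect.inducedMetric_eq g' h.imm'.smooth.differentiableAt, pullG, pullG, h.fderiv_eq,
    h.fderiv_eq, h.inner_eq, h.imm.inner_fderiv]

/-- Covariance of the trace of the second fundamental form: the second derivatives of the
reparametrisation contribute only tangential vectors. -/
theorem traceFF_eq (h : RelatedImmersions g g' F f Y Y' u) :
    (WithLp.toLp 2 (traceFF g' Y' u) : Coord d) =
      fderiv ℝ F (Y (f u)) (WithLp.toLp 2 (traceFF g Y (f u))) := by
  have hcov : ∀ a b, covHess g' Y' u a b =
      fderiv ℝ F (Y (f u)) (covHess g Y (f u) (fderiv ℝ f u a) (fderiv ℝ f u b)) +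
        fderiv ℝ F (Y (f u)) (fderiv ℝ Y (f u) (fderiv ℝ (fderiv ℝ f) u a b)) := by
    intro a b
    have h1 : covHess g' Y' u a b = covHess g' (fun v => F (Y (f v))) u a b := by
      rw [covHess, covHess, h.eq.fderiv.fderiv_eq, h.eq.fderiv_eq, h.eq.self_of_nhds]
    rw [h1, LocalIsometry.covHess_comp (x := fun v => Y (f v)) h.isom h.imm.metric
      (h.value_eq ▸ h.imm'.metric) (h.imm.smooth.comp h.repar), covHess_comp h.imm.smooth h.repar,
      map_add]
  obtain ⟨z, hz⟩ := h.surjective (traceB (inducedMetric g' Y' u) fun a b =>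
    fderiv ℝ (fderiv ℝ f) u a b)
  obtain ⟨w, hw⟩ := h.surjective (traceB (inducedMetric g Y (f u))
    (chrV (inducedMetric g Y (f u)) (fderiv ℝ (inducedMetric g Y) (f u))))
  have htr : traceB (inducedMetric g' Y' u) (fun a b =>
      covHess g Y (f u) (fderiv ℝ f u a) (fderiv ℝ f u b)) =
      traceB (inducedMetric g Y (f u)) (covHess g Y (f u)) := by
    rw [h.inducedMetric_eq]
    exact traceB_comp h.injective (covHess_eq_sum g Y (f u))
  have key : traceB (inducedMetric g' Y' u) (covHess g' Y' u) =
      fderiv ℝ F (Y (f u)) (traceB (inducedMetric g Y (f u)) (covHess g Y (f u))) +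
        fderiv ℝ Y' u z := by
    rw [h.fderiv_eq, hz, ← htr]
    simp only [traceB, map_sum, map_smul, hcov, smul_add, Finset.sum_add_distrib]
  refine h.imm'.normal_unique h.imm'.inner_traceFF (fun v => ?_) (z := z + w -
    traceB (inducedMetric g' Y' u) (chrV (inducedMetric g' Y' u)
      (fderiv ℝ (inducedMetric g' Y') u))) ?_
  · rw [h.fderiv_eq, h.inner_eq, h.imm.inner_traceFF]
  · rw [h.imm'.traceFF_eq, h.imm.traceFF_eq, key, map_sub, map_sub, map_add, h.fderiv_eq w, hw]
    abel

/-- Covariance of the tangential gradient. -/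
theorem tangGrad_eq (h : RelatedImmersions g g' F f Y Y' u) {φ φ' : Coord p → ℝ}
    (hφ : DifferentiableAt ℝ φ (f u)) (hφ' : φ' =ᶠ[𝓝 u] fun v => φ (f v)) :
    (WithLp.toLp 2 (tangGrad g' Y' φ' u) : Coord d) =
      fderiv ℝ F (Y (f u)) (WithLp.toLp 2 (tangGrad g Y φ (f u))) := by
  rw [Defect.tangGrad_eq g' h.imm'.smooth.differentiableAt,
    Defect.tangGrad_eq g h.imm.smooth.differentiableAt, h.fderiv_eq]
  congr 2
  have hm := h.imm.metricNear_inducedMetric.isMetric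
  have hm' := h.imm'.metricNear_inducedMetric.isMetric
  refine hm.eq_of_inner fun z => ?_
  obtain ⟨w, rfl⟩ := h.surjective z
  rw [hm.inner_raise, ← innerL_pullG, ← h.inducedMetric_eq, hm'.inner_raise, hφ'.fderiv_eq,
    show (fun v => φ (f v)) = φ ∘ f from rfl, fderiv_comp u hφ h.repar.differentiableAt]
  rfl

end RelatedImmersions
end Submanifold

/-! ### The evolution equation in vector form -/

section Evolution

variable {p d : ℕ}

/-- `x` is a smooth family of maps near `(u, t)`, immersive at this point, into a space with the
smooth metric `g`. -/
structure FamilyNear (g : Coord d → Fin d → Fin d → ℝ) (x : Coord p → ℝ → Coord d) (u : Coord p)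
    (t : ℝ) : Prop where
  smooth : SmoothNear (Function.uncurry x) (u, t)
  metric : MetricNear g (x u t)
  injective : Function.Injective (fderiv ℝ (fun u' => x u' t) u)

/-- The velocity `∂_t x` as a vector. -/
noncomputable def velV (x : Coord p → ℝ → Coord d) (u : Coord p) (t : ℝ) : Coord d :=
  tderiv (Function.uncurry x) (u, t)

theorem velV_eq (x : Coord p → ℝ → Coord d) (u : Coord p) (t : ℝ) :
    velV x u t = fderiv ℝ (Function.uncurry x) (u, t) (0, 1) := rfl

theorem fderiv_space_apply {x : Coord p → ℝ → Coord d} {u : Coord p} {t : ℝ}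
    (h : DifferentiableAt ℝ (Function.uncurry x) (u, t)) (w : Coord p) :
    fderiv ℝ (fun u' => x u' t) u w = fderiv ℝ (Function.uncurry x) (u, t) (w, 0) := by
  have := (hasFDerivAt_space h).fderiv
  exact DFunLike.congr_fun this w

theorem vel_eq {x : Coord p → ℝ → Coord d} {u : Coord p} {t : ℝ}
    (h : DifferentiableAt ℝ (Function.uncurry x) (u, t)) : vel x u t = velV x u t := by
  ext μ
  exact ((EuclideanSpace.proj μ : Coord d →L[ℝ] ℝ).hasFDerivAt.comp_hasDerivAt t
    (hasDerivAt_slice h)).deriv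

namespace FamilyNear

variable {g : Coord d → Fin d → Fin d → ℝ} {x : Coord p → ℝ → Coord d} {u : Coord p} {t : ℝ}

theorem imm (h : FamilyNear g x u t) : ImmersionNear g (fun u' => x u' t) u :=
  ⟨h.smooth.space, h.metric, h.injective⟩

theorem fderiv_apply (h : FamilyNear g x u t) (w : Coord p) :
    fderiv ℝ (fun u' => x u' t) u w = fderiv ℝ (Function.uncurry x) (u, t) (w, 0) :=
  fderiv_space_apply h.smooth.differentiableAt w

theorem vel_eq (h : FamilyNear g x u t) : vel x u t = velV x u t :=
  Defect.vel_eq h.smooth.differentiableAt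

theorem eventually (h : FamilyNear g x u t) : ∀ᶠ q in 𝓝 (u, t), FamilyNear g x q.1 q.2 := by
  have hc : ContinuousAt (fun q => (fderiv ℝ (Function.uncurry x) q).comp
      (.inl ℝ (Coord p) ℝ)) (u, t) :=
    (h.smooth.fderiv.contDiffAt.clm_comp contDiffAt_const).continuousAt
  have hi : Function.Injective ((fderiv ℝ (Function.uncurry x) (u, t)).comp
      (.inl ℝ (Coord p) ℝ)) := by
    have := (hasFDerivAt_space h.smooth.differentiableAt).fderiv
    have h2 := h.injective
    rw [show (fun u' => x u' t) = fun u' => Function.uncurry x (u', (u, t).2) from rfl, this] at h2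
    exact h2
  filter_upwards [h.smooth.eventually,
    h.smooth.contDiffAt.continuousAt.eventually (f := Function.uncurry x) h.metric.eventually,
    eventually_injective hc hi] with q h1 h2 h3
  refine ⟨h1, h2, ?_⟩
  have := (hasFDerivAt_space h1.differentiableAt).fderiv
  rw [show (fun u' => x u' q.2) = fun u' => Function.uncurry x (u', q.2) from rfl, this]
  exact h3

theorem eventually_space (h : FamilyNear g x u t) : ∀ᶠ v in 𝓝 u, FamilyNear g x v t :=
  ((Continuous.prodMk_left t).tendsto' _ _ rfl).eventually h.eventually

theorem eventually_time (h : FamilyNear g x u t) : ∀ᶠ s in 𝓝 t, FamilyNear g x u s :=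
  ((Continuous.prodMk_right u).tendsto' _ _ rfl).eventually h.eventually

/-- The square of the velocity as a function on the submanifold. -/
theorem velSq_eventuallyEq (h : FamilyNear g x u t) :
    (fun u' => dot (g (x u' t)) (vel x u' t) (vel x u' t)) =ᶠ[𝓝 u]
      fun u' => gram g (Function.uncurry x) (0, 1) (0, 1) (u', t) := by
  filter_upwards [h.eventually_space] with v hv
  rw [hv.vel_eq, ← innerL_apply]
  rfl

theorem gram_smooth (h : FamilyNear g x u t) (a b : Coord p × ℝ) :
    SmoothNear (gram g (Function.uncurry x) a b) (u, t) := by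
  refine SmoothNear.innerL (SmoothNear.comp (f := Function.uncurry x) h.metric.smooth h.smooth) ?_ ?_
  · exact h.smooth.fderiv.clm_comp (ContinuousLinearMap.apply ℝ _ a)
  · exact h.smooth.fderiv.clm_comp (ContinuousLinearMap.apply ℝ _ b)

theorem fderiv_velSq (h : FamilyNear g x u t) (w : Coord p) :
    fderiv ℝ (fun u' => dot (g (x u' t)) (vel x u' t) (vel x u' t)) u w =
      fderiv ℝ (gram g (Function.uncurry x) (0, 1) (0, 1)) (u, t) (w, 0) := by
  rw [h.velSq_eventuallyEq.fderiv_eq]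
  have := (hasFDerivAt_space (h.gram_smooth (0, 1) (0, 1)).differentiableAt).fderiv
  exact DFunLike.congr_fun this w

theorem accel_eq (h : FamilyNear g x u t) :
    (WithLp.toLp 2 (accel g x u t) : Coord d) =
      covHess g (Function.uncurry x) (u, t) (0, 1) (0, 1) := by
  ext μ
  have e1 : deriv (fun s => vel x u s μ) t =
      fderiv ℝ (fderiv ℝ (Function.uncurry x)) (u, t) (0, 1) (0, 1) μ := by
    have he : (fun s => vel x u s μ) =ᶠ[𝓝 t] fun s => velV x u s μ := by
      filter_upwards [h.eventually_time] with s hs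
      rw [hs.vel_eq]
    have h2 : tderiv (tderiv (Function.uncurry x)) (u, t) =
        fderiv ℝ (fderiv ℝ (Function.uncurry x)) (u, t) (0, 1) (0, 1) := by
      have h3 := h.smooth.fderiv.differentiableAt.hasFDerivAt.clm_apply
        (hasFDerivAt_const ((0 : Coord p), (1 : ℝ)) (u, t))
      have h4 : fderiv ℝ (tderiv (Function.uncurry x)) (u, t) = _ := h3.fderiv
      rw [tderiv, h4]
      simp
    rw [he.deriv_eq, ← h2]
    exact ((EuclideanSpace.proj μ : Coord d →L[ℝ] ℝ).hasFDerivAt.comp_hasDerivAt t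
      (hasDerivAt_slice h.smooth.tderiv.differentiableAt)).deriv
  simp only [accel, e1, covHess, chrV, PiLp.add_apply, h.vel_eq,
    christoffel_eq h.metric.smooth.differentiableAt]
  rfl

/-- The vector form of the left-hand side of the evolution equation. -/
theorem evolutionLHS_eq (h : FamilyNear g x u t) :
    evolutionLHS g x u t = covHess g (Function.uncurry x) (u, t) (0, 1) (0, 1) +
      (2 / (p : ℝ) * innerL d (g (x u t)) (velV x u t)
        (WithLp.toLp 2 (traceFF g (fun u' => x u' t) u))) • velV x u t -
      (1 / (p : ℝ) * innerL d (g (x u t)) (velV x u t) (velV x u t)) •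
        (WithLp.toLp 2 (traceFF g (fun u' => x u' t) u) : Coord d) +
      (1 / 2 : ℝ) • (WithLp.toLp 2 (tangGrad g (fun u' => x u' t)
        (fun u' => dot (g (x u' t)) (vel x u' t) (vel x u' t)) u) : Coord d) := by
  rw [← h.accel_eq]
  ext μ
  simp only [evolutionLHS, h.vel_eq, innerL_apply, PiLp.add_apply, PiLp.sub_apply,
    PiLp.smul_apply, smul_eq_mul]
  ring

/-- The evolution law of the tangential components of the velocity, off shell. -/
theorem fderiv_inner_velocity (h : FamilyNear g x u t) (w : Coord p) :
    fderiv ℝ (gram g (Function.uncurry x) (0, 1) (w, 0)) (u, t) (0, 1) =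
      innerL d (g (x u t)) (evolutionLHS g x u t) (fderiv ℝ (fun u' => x u' t) u w) -
      2 / (p : ℝ) * innerL d (g (x u t)) (velV x u t)
        (WithLp.toLp 2 (traceFF g (fun u' => x u' t) u)) *
        innerL d (g (x u t)) (velV x u t) (fderiv ℝ (fun u' => x u' t) u w) := by
  have hK := inner_covHess (x := Function.uncurry x) (u := (u, t)) h.metric h.smooth (0, 1) (0, 1)
    (w, 0)
  have hm := h.imm.metricNear_inducedMetric.isMetric
  rw [h.evolutionLHS_eq, tangGrad_eq g h.imm.smooth.differentiableAt]
  simp only [map_add, map_sub, map_smul, add_apply, sub_apply, smul_apply, smul_eq_mul,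
    h.imm.inner_traceFF]
  rw [h.imm.inner_fderiv, hm.inner_raise, h.fderiv_velSq, h.fderiv_apply w]
  rw [show g (x u t) = g (Function.uncurry x (u, t)) from rfl, hK]
  ring

/-- The evolution law as a derivative in time. For solutions it is a linear homogeneous ordinary
differential equation. -/
theorem hasDerivAt_inner_velocity (h : FamilyNear g x u t) (w : Coord p) :
    HasDerivAt (fun s => innerL d (g (x u s)) (velV x u s) (fderiv ℝ (fun u' => x u' s) u w))
      (innerL d (g (x u t)) (evolutionLHS g x u t) (fderiv ℝ (fun u' => x u' t) u w) -
      2 / (p : ℝ) * innerL d (g (x u t)) (velV x u t)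
        (WithLp.toLp 2 (traceFF g (fun u' => x u' t) u)) *
        innerL d (g (x u t)) (velV x u t) (fderiv ℝ (fun u' => x u' t) u w)) t := by
  rw [← h.fderiv_inner_velocity w]
  refine (hasDerivAt_slice (h.gram_smooth (0, 1) (w, 0)).differentiableAt).congr_of_eventuallyEq ?_
  filter_upwards [h.eventually_time] with s hs
  rw [hs.fderiv_apply]
  rfl

end FamilyNear

/-! ### Covariance of the evolution equation -/

/-- The data of two families related by a local isometry `F` of the target and a reparametrisation
`f` of the source. -/
structure RelatedFamilies (g g' : Coord d → Fin d → Fin d → ℝ) (F : Coord d → Coord d)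
    (f : Coord p → Coord p) (x x' : Coord p → ℝ → Coord d) (u : Coord p) (t : ℝ) : Prop where
  fam : FamilyNear g x (f u) t
  fam' : FamilyNear g' x' u t
  isom : LocalIsometry g g' F (x (f u) t)
  repar : SmoothNear f u
  eq : ∀ᶠ q in 𝓝 (u, t), x' q.1 q.2 = F (x (f q.1) q.2)

namespace RelatedFamilies

variable {g g' : Coord d → Fin d → Fin d → ℝ} {F : Coord d → Coord d}
    {f : Coord p → Coord p} {x x' : Coord p → ℝ → Coord d} {u : Coord p} {t : ℝ}

theorem related (h : RelatedFamilies g g' F f x x' u t) :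
    RelatedImmersions g g' F f (fun u' => x u' t) (fun u' => x' u' t) u :=
  ⟨h.fam.imm, h.fam'.imm, h.isom, h.repar,
    ((Continuous.prodMk_left t).tendsto' _ _ rfl).eventually h.eq⟩

theorem smooth_prod (h : RelatedFamilies g g' F f x x' u t) :
    SmoothNear (fun q : Coord p × ℝ => (f q.1, q.2)) (u, t) := by
  refine SmoothNear.prodMk (SmoothNear.comp (f := Prod.fst) h.repar ?_) ?_
  · exact smoothNear_of_contDiff contDiff_fst
  · exact smoothNear_of_contDiff contDiff_snd

theorem fderiv_prod (h : RelatedFamilies g g' F f x x' u t) :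
    fderiv ℝ (fun q : Coord p × ℝ => (f q.1, q.2)) =ᶠ[𝓝 (u, t)] fun q =>
      (fderiv ℝ f q.1).prodMap (.id ℝ ℝ) := by
  have : ∀ᶠ q : Coord p × ℝ in 𝓝 (u, t), SmoothNear f q.1 :=
    continuousAt_fst.eventually h.repar.eventually
  filter_upwards [this] with q hq
  exact (HasFDerivAt.prodMap q hq.differentiableAt.hasFDerivAt (hasFDerivAt_id q.2)).fderiv

theorem smooth_uncurry (h : RelatedFamilies g g' F f x x' u t) :
    SmoothNear (fun q : Coord p × ℝ => Function.uncurry x (f q.1, q.2)) (u, t) :=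
  SmoothNear.comp (f := fun q : Coord p × ℝ => (f q.1, q.2)) h.fam.smooth h.smooth_prod

theorem velV_eq (h : RelatedFamilies g g' F f x x' u t) :
    velV x' u t = fderiv ℝ F (x (f u) t) (velV x (f u) t) := by
  have he : Function.uncurry x' =ᶠ[𝓝 (u, t)]
    fun q => F (Function.uncurry x (f q.1, q.2)) := h.eq
  rw [velV, tderiv, he.fderiv_eq, fderiv_comp_near
    (f := fun q : Coord p × ℝ => Function.uncurry x (f q.1, q.2)) h.isom.smooth h.smooth_uncurry,
    fderiv_comp_near (f := fun q : Coord p × ℝ => (f q.1, q.2)) h.fam.smooth h.smooth_prod,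
    h.fderiv_prod.self_of_nhds]
  simp [velV, tderiv]

theorem eventually (h : RelatedFamilies g g' F f x x' u t) :
    ∀ᶠ q in 𝓝 (u, t), RelatedFamilies g g' F f x x' q.1 q.2 := by
  have h0 : ∀ᶠ q : Coord p × ℝ in 𝓝 (u, t), SmoothNear f q.1 :=
    continuousAt_fst.eventually h.repar.eventually
  have h1 := h.smooth_prod.contDiffAt.continuousAt.eventually
    (f := fun q : Coord p × ℝ => (f q.1, q.2)) h.fam.eventually
  have h2 : ∀ᶠ y in 𝓝 (x (f u) t), LocalIsometry g g' F y := by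
    filter_upwards [h.isom.smooth.eventually, eventually_eventually_nhds.2 h.isom.isometry]
      with y a b using ⟨a, b⟩
  have h3 := h.smooth_uncurry.contDiffAt.continuousAt.eventually h2
  filter_upwards [h0, h1, h3, h.fam'.eventually, eventually_eventually_nhds.2 h.eq]
    with q a b c e k using ⟨b, e, c, a, k⟩

theorem velSq_eq (h : RelatedFamilies g g' F f x x' u t) :
    dot (g' (x' u t)) (vel x' u t) (vel x' u t) =
      dot (g (x (f u) t)) (vel x (f u) t) (vel x (f u) t) := by
  rw [h.fam'.vel_eq, h.fam.vel_eq, ← innerL_apply, ← innerL_apply, h.velV_eq]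
  exact h.related.inner_eq _ _

/-- Covariance of the evolution equation. -/
theorem evolutionLHS_eq (h : RelatedFamilies g g' F f x x' u t) :
    evolutionLHS g' x' u t = fderiv ℝ F (x (f u) t) (evolutionLHS g x (f u) t) := by
  have hcov : covHess g' (Function.uncurry x') (u, t) (0, 1) (0, 1) =
      fderiv ℝ F (x (f u) t) (covHess g (Function.uncurry x) (f u, t) (0, 1) (0, 1)) := by
    have he : Function.uncurry x' =ᶠ[𝓝 (u, t)]
      fun q => F (Function.uncurry x (f q.1, q.2)) := h.eq
    have h1 : covHess g' (Function.uncurry x') (u, t) (0, 1) (0, 1) =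
        covHess g' (fun q => F (Function.uncurry x (f q.1, q.2))) (u, t) (0, 1) (0, 1) := by
      rw [covHess, covHess, he.fderiv.fderiv_eq, he.fderiv_eq, he.self_of_nhds]
    have hmet : MetricNear g' (F (x (f u) t)) := by
      rw [← h.related.value_eq]; exact h.fam'.metric
    rw [h1, LocalIsometry.covHess_comp
      (x := fun q : Coord p × ℝ => Function.uncurry x (f q.1, q.2)) h.isom h.fam.metric hmet
      h.smooth_uncurry, Defect.covHess_comp (x := Function.uncurry x)
      (f := fun q : Coord p × ℝ => (f q.1, q.2)) h.fam.smooth h.smooth_prod,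
      h.fderiv_prod.self_of_nhds, h.fderiv_prod.fderiv_eq]
    have h2 : fderiv ℝ (fun q : Coord p × ℝ => (fderiv ℝ f q.1).prodMap (.id ℝ ℝ)) (u, t)
        (0, 1) (0, 1) = 0 := by
      have h3 := hasDerivAt_slice (q := (u, t)) (y := fun q : Coord p × ℝ =>
        (fderiv ℝ f q.1).prodMap (.id ℝ ℝ)) (by
          refine DifferentiableAt.congr_of_eventuallyEq ?_ h.fderiv_prod.symm
          exact h.smooth_prod.fderiv.differentiableAt)
      have h4 := h3.unique (hasDerivAt_const t
        ((fderiv ℝ f u).prodMap (ContinuousLinearMap.id ℝ ℝ)))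
      rw [tderiv] at h4
      rw [h4]
      rfl
    rw [h2, map_zero, add_zero]
    simp
  have htg := h.related.tangGrad_eq
    (φ := fun u' => dot (g (x u' t)) (vel x u' t) (vel x u' t))
    (φ' := fun u' => dot (g' (x' u' t)) (vel x' u' t) (vel x' u' t))
    ((h.fam.gram_smooth (0, 1) (0, 1)).space.differentiableAt.congr_of_eventuallyEq
      h.fam.velSq_eventuallyEq)
    (((Continuous.prodMk_left t).tendsto' _ _ rfl).eventually
      (h.eventually.mono fun q hq => hq.velSq_eq))
  rw [h.fam.evolutionLHS_eq, h.fam'.evolutionLHS_eq, hcov, htg, h.related.traceFF_eq, h.velV_eq]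
  simp only [map_add, map_sub, map_smul]
  have hi := h.related.inner_eq
  simp only [hi]

end RelatedFamilies
end Evolution

/-! ### Weyl rescalings of the metric -/

section Weyl

variable {p d : ℕ} {E : Type*} [NormedAddCommGroup E] [NormedSpace ℝ E]

/-- `g' = e^{2σ} g` near `y`, with a smooth function `σ`. -/
structure WeylNear (g g' : Coord d → Fin d → Fin d → ℝ) (σ : Coord d → ℝ) (y : Coord d) :
    Prop where
  metric : MetricNear g y
  smooth : SmoothNear σ y
  eq : ∀ᶠ y' in 𝓝 y, g' y' = Real.exp (2 * σ y') • g y'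

namespace WeylNear

variable {g g' : Coord d → Fin d → Fin d → ℝ} {σ : Coord d → ℝ} {y : Coord d}

theorem value (h : WeylNear g g' σ y) : g' y = Real.exp (2 * σ y) • g y := h.eq.self_of_nhds

theorem inner_eq (h : WeylNear g g' σ y) (ξ η : Coord d) :
    innerL d (g' y) ξ η = Real.exp (2 * σ y) * innerL d (g y) ξ η := by
  rw [h.value, map_smul]; rfl

theorem eventually (h : WeylNear g g' σ y) : ∀ᶠ y' in 𝓝 y, WeylNear g g' σ y' := by
  filter_upwards [h.metric.eventually, h.smooth.eventually, eventually_eventually_nhds.2 h.eq]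
    with y' a b c using ⟨a, b, c⟩

theorem metric' (h : WeylNear g g' σ y) : MetricNear g' y where
  smooth := by
    refine SmoothNear.congr (SmoothNear.smul ?_ h.metric.smooth) h.eq
    filter_upwards [h.smooth] with y' hy'
    exact (contDiffAt_const.mul hy').exp
  metric := by
    filter_upwards [h.eventually] with y' hy'
    refine ⟨fun ξ η => ?_, fun ξ hξ => ?_⟩
    · rw [hy'.inner_eq, hy'.inner_eq, hy'.metric.isMetric.symm]
    · rw [hy'.inner_eq]
      exact mul_pos (Real.exp_pos _) (hy'.metric.isMetric.pos ξ hξ)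

theorem fderiv_eq (h : WeylNear g g' σ y) (ξ : Coord d) :
    fderiv ℝ g' y ξ = Real.exp (2 * σ y) • ((2 * fderiv ℝ σ y ξ) • g y + fderiv ℝ g y ξ) := by
  have h1 := ((h.smooth.differentiableAt.hasFDerivAt.const_mul 2).exp).smul
    h.metric.smooth.differentiableAt.hasFDerivAt
  have h2 : HasFDerivAt g' _ y := h1.congr_of_eventuallyEq h.eq
  rw [h2.fderiv]
  simp [smul_smul, add_comm, mul_assoc]

/-- The Christoffel symbols of the rescaled metric; `raise (g y) (dσ)` is the gradient of `σ`. -/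
theorem chrV_eq (h : WeylNear g g' σ y) (ξ η : Coord d) :
    chrV (g' y) (fderiv ℝ g' y) ξ η = chrV (g y) (fderiv ℝ g y) ξ η + fderiv ℝ σ y ξ • η +
      fderiv ℝ σ y η • ξ - innerL d (g y) ξ η • raise (g y) (fderiv ℝ σ y) := by
  refine h.metric'.isMetric.eq_of_inner fun ζ => ?_
  have hm := h.metric.isMetric
  rw [inner_chrV h.metric'.isMetric h.metric'.fderiv_symm, h.inner_eq]
  simp only [h.fderiv_eq, map_smul, map_add, map_sub, smul_apply, add_apply, sub_apply, smul_eq_mul,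
    inner_chrV hm h.metric.fderiv_symm, hm.inner_raise]
  rw [hm.symm ξ ζ, hm.symm η ζ, hm.symm ζ η, hm.symm ζ ξ]
  ring

theorem covHess_eq {x : E → Coord d} {u : E} (h : WeylNear g g' σ (x u)) (a b : E) :
    covHess g' x u a b = covHess g x u a b + fderiv ℝ σ (x u) (fderiv ℝ x u a) • fderiv ℝ x u b +
      fderiv ℝ σ (x u) (fderiv ℝ x u b) • fderiv ℝ x u a -
      innerL d (g (x u)) (fderiv ℝ x u a) (fderiv ℝ x u b) •
        raise (g (x u)) (fderiv ℝ σ (x u)) := by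
  rw [covHess, h.chrV_eq, covHess]
  abel

end WeylNear

/-- The tangential part of the gradient of `σ`, as a vector in the parameter space. -/
noncomputable def tangSlope (g : Coord d → Fin d → Fin d → ℝ) (σ : Coord d → ℝ)
    (Y : Coord p → Coord d) (u : Coord p) : Coord p :=
  raise (inducedMetric g Y u) ((fderiv ℝ σ (Y u)).comp (fderiv ℝ Y u))

section Immersion

variable {g g' : Coord d → Fin d → Fin d → ℝ} {σ : Coord d → ℝ} {Y : Coord p → Coord d}
  {u : Coord p}

theorem ImmersionNear.weyl (hi : ImmersionNear g Y u) (h : WeylNear g g' σ (Y u)) :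
    ImmersionNear g' Y u := ⟨hi.smooth, h.metric', hi.injective⟩

theorem WeylNear.inducedMetric_eq (h : WeylNear g g' σ (Y u)) (hY : DifferentiableAt ℝ Y u) :
    inducedMetric g' Y u = Real.exp (2 * σ (Y u)) • inducedMetric g Y u := by
  ext a b
  rw [Defect.inducedMetric_eq g' hY, Defect.inducedMetric_eq g hY, pullG, h.inner_eq]
  rfl

/-- The trace of the second fundamental form of a submanifold, under a Weyl rescaling. -/
theorem WeylNear.traceFF_eq (h : WeylNear g g' σ (Y u)) (hi : ImmersionNear g Y u) :
    (WithLp.toLp 2 (traceFF g' Y u) : Coord d) = (Real.exp (2 * σ (Y u)))⁻¹ •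
      (WithLp.toLp 2 (traceFF g Y u) - (p : ℝ) •
        (raise (g (Y u)) (fderiv ℝ σ (Y u)) - fderiv ℝ Y u (tangSlope g σ Y u))) := by
  have hi' := hi.weyl h
  have hγ := hi.metricNear_inducedMetric.isMetric
  have hne := (Real.exp_pos (2 * σ (Y u))).ne'
  have hnorm : ∀ w, innerL d (g (Y u)) (raise (g (Y u)) (fderiv ℝ σ (Y u)) -
      fderiv ℝ Y u (tangSlope g σ Y u)) (fderiv ℝ Y u w) = 0 := by
    intro w
    rw [map_sub, sub_apply, h.metric.isMetric.inner_raise, hi.inner_fderiv, tangSlope,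
      hγ.inner_raise]
    exact sub_self _
  set B : Coord p → Coord p → Coord p := fun a b =>
    fderiv ℝ σ (Y u) (fderiv ℝ Y u a) • b + fderiv ℝ σ (Y u) (fderiv ℝ Y u b) • a with hB
  have htr : traceB (inducedMetric g Y u) (covHess g' Y u) =
      traceB (inducedMetric g Y u) (covHess g Y u) +
        fderiv ℝ Y u (traceB (inducedMetric g Y u) B) -
        (p : ℝ) • raise (g (Y u)) (fderiv ℝ σ (Y u)) := by
    rw [← traceB_self hγ, ← traceB_smul_const]
    simp only [traceB, map_sum, map_smul, hB, map_add, h.covHess_eq, hi.inner_fderiv, smul_sub,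
      smul_add, Finset.sum_add_distrib, Finset.sum_sub_distrib]
    abel
  refine hi'.normal_unique hi'.inner_traceFF (fun w => ?_) (z :=
    (Real.exp (2 * σ (Y u)))⁻¹ • (traceB (inducedMetric g Y u) B + traceB (inducedMetric g Y u)
        (chrV (inducedMetric g Y u) (fderiv ℝ (inducedMetric g Y) u)) -
        (p : ℝ) • tangSlope g σ Y u) -
      traceB (inducedMetric g' Y u)
        (chrV (inducedMetric g' Y u) (fderiv ℝ (inducedMetric g' Y) u))) ?_
  · rw [h.inner_eq, map_smul, map_sub, map_smul]
    simp only [smul_apply, sub_apply, hnorm, hi.inner_traceFF]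
    simp
  · rw [hi'.traceFF_eq, hi.traceFF_eq, h.inducedMetric_eq hi.smooth.differentiableAt,
      traceB_smul _ hne hγ.det_ne_zero, htr]
    simp only [map_sub, map_add, map_smul, smul_sub, smul_add]
    abel

end Immersion

section Family

variable {g g' : Coord d → Fin d → Fin d → ℝ} {σ : Coord d → ℝ} {x : Coord p → ℝ → Coord d}
  {u : Coord p} {t : ℝ}

theorem FamilyNear.weyl (hx : FamilyNear g x u t) (h : WeylNear g g' σ (x u t)) :
    FamilyNear g' x u t := ⟨hx.smooth, h.metric', hx.injective⟩

/-- The tangential gradient of the square of the velocity, under a Weyl rescaling of the metric in both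
places. -/
theorem WeylNear.tangGrad_eq (h : WeylNear g g' σ (x u t)) (hx : FamilyNear g x u t) :
    (WithLp.toLp 2 (tangGrad g' (fun u' => x u' t)
        (fun u' => dot (g' (x u' t)) (vel x u' t) (vel x u' t)) u) : Coord d) =
      WithLp.toLp 2 (tangGrad g (fun u' => x u' t)
        (fun u' => dot (g (x u' t)) (vel x u' t) (vel x u' t)) u) +
      (2 * innerL d (g (x u t)) (velV x u t) (velV x u t)) •
        fderiv ℝ (fun u' => x u' t) u (tangSlope g σ (fun u' => x u' t) u) := by
  have hγ := hx.imm.metricNear_inducedMetric.isMetric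
  have hγ' := (hx.imm.weyl h).metricNear_inducedMetric.isMetric
  have hne := (Real.exp_pos (2 * σ (x u t))).ne'
  rw [Defect.tangGrad_eq g' hx.imm.smooth.differentiableAt,
    Defect.tangGrad_eq g hx.imm.smooth.differentiableAt, ← map_smul, ← map_add]
  congr 1
  refine hγ'.eq_of_inner fun z => ?_
  have hev : (fun u' => dot (g' (x u' t)) (vel x u' t) (vel x u' t)) =ᶠ[𝓝 u]
      fun u' => Real.exp (2 * σ (x u' t)) *
        dot (g (x u' t)) (vel x u' t) (vel x u' t) := by
    filter_upwards [hx.imm.smooth.contDiffAt.continuousAt.eventually h.eventually,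
      hx.eventually_space] with v h1 h2
    rw [h2.vel_eq, ← innerL_apply, ← innerL_apply, h1.inner_eq]
  have hd : DifferentiableAt ℝ (fun u' => dot (g (x u' t)) (vel x u' t) (vel x u' t)) u :=
    (hx.gram_smooth (0, 1) (0, 1)).space.differentiableAt.congr_of_eventuallyEq
      hx.velSq_eventuallyEq
  have hσ : HasFDerivAt (fun u' => σ (x u' t))
      ((fderiv ℝ σ (x u t)).comp (fderiv ℝ (fun u' => x u' t) u)) u :=
    h.smooth.differentiableAt.hasFDerivAt.comp u hx.imm.smooth.differentiableAt.hasFDerivAt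
  have hder := (((hσ.const_mul 2).exp).mul hd.hasFDerivAt).fderiv
  rw [hγ'.inner_raise, hev.fderiv_eq]
  rw [show (fun u' => Real.exp (2 * σ (x u' t)) * dot (g (x u' t)) (vel x u' t) (vel x u' t)) =
    (fun u' => Real.exp (2 * σ (x u' t))) * fun u' => dot (g (x u' t)) (vel x u' t) (vel x u' t)
    from rfl, hder, WeylNear.inducedMetric_eq (Y := fun u' => x u' t) h
      hx.imm.smooth.differentiableAt]
  simp only [map_smul, map_add, smul_apply, add_apply, smul_eq_mul, hγ.inner_raise, tangSlope,
    hx.vel_eq, ← innerL_apply, ContinuousLinearMap.comp_apply]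
  ring

/-- The change of the evolution equation under a Weyl rescaling. -/
theorem WeylNear.evolutionLHS_eq (hp : 0 < p) (h : WeylNear g g' σ (x u t))
    (hx : FamilyNear g x u t) :
    evolutionLHS g' x u t = evolutionLHS g x u t +
      (2 * innerL d (g (x u t)) (velV x u t)
        (fderiv ℝ (fun u' => x u' t) u (tangSlope g σ (fun u' => x u' t) u))) • velV x u t := by
  have hp0 : (p : ℝ) ≠ 0 := by exact_mod_cast hp.ne'
  have hne := (Real.exp_pos (2 * σ (x u t))).ne'
  have hv : innerL d (g (x u t)) (velV x u t) (raise (g (x u t)) (fderiv ℝ σ (x u t))) =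
      fderiv ℝ σ (x u t) (velV x u t) := by
    rw [h.metric.isMetric.symm, h.metric.isMetric.inner_raise]
  rw [(hx.weyl h).evolutionLHS_eq, hx.evolutionLHS_eq, h.tangGrad_eq hx,
    WeylNear.traceFF_eq (Y := fun u' => x u' t) h hx.imm,
    WeylNear.covHess_eq (x := Function.uncurry x) (u := (u, t)) h, h.inner_eq, h.inner_eq]
  rw [show Function.uncurry x (u, t) = x u t from rfl, ← velV_eq]
  simp only [map_smul, map_sub, smul_eq_mul, hv]
  have e1 : ∀ a : ℝ, 2 / (p : ℝ) * (Real.exp (2 * σ (x u t)) * ((Real.exp (2 * σ (x u t)))⁻¹ * a))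
      = 2 / (p : ℝ) * a := fun a => by field_simp
  have e2 : ∀ (a : ℝ) (ξ : Coord d), (1 / (p : ℝ) * (Real.exp (2 * σ (x u t)) * a)) •
      (Real.exp (2 * σ (x u t)))⁻¹ • ξ = (1 / (p : ℝ) * a) • ξ := fun a ξ => by
    rw [smul_smul]; congr 1; field_simp
  rw [e1, e2]
  ext μ
  simp only [PiLp.add_apply, PiLp.sub_apply, PiLp.smul_apply, smul_eq_mul]
  field_simp
  ring

end Family
end Weyl

/-! ### The equation as a second order equation in time with lower order terms -/

section LowerOrder

variable {p d : ℕ} {E : Type*} [NormedAddCommGroup E] [NormedSpace ℝ E]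

theorem contDiffAt_det {n : ℕ} {A : E → Matrix (Fin n) (Fin n) ℝ} {u : E}
    (hA : ∀ i j, ContDiffAt ℝ ∞ (fun v => A v i j) u) : ContDiffAt ℝ ∞ (fun v => (A v).det) u := by
  simp only [Matrix.det_apply']
  exact ContDiffAt.sum fun s _ => contDiffAt_const.mul (contDiffAt_prod fun i _ => hA _ _)

theorem contDiffAt_inv {n : ℕ} {G : E → Fin n → Fin n → ℝ} {u : E} (hG : ContDiffAt ℝ ∞ G u)
    (h : (Matrix.of (G u)).det ≠ 0) (a b : Fin n) : ContDiffAt ℝ ∞ (fun v => inv (G v) a b) u := by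
  simp only [inv, Matrix.inv_def, Ring.inverse_eq_inv', Matrix.smul_apply, smul_eq_mul,
    Matrix.adjugate_apply]
  refine ((contDiffAt_det fun i j => contDiffAt_entry hG i j).inv h).mul
    (contDiffAt_det fun i j => ?_)
  simp only [Matrix.updateRow_apply]
  split
  · exact contDiffAt_const
  · exact contDiffAt_entry hG i j

theorem contDiffAt_toLp {ξ : E → Fin d → ℝ} {u : E}
    (hξ : ∀ k, ContDiffAt ℝ ∞ (fun v => ξ v k) u) :
    ContDiffAt ℝ ∞ (fun v => (WithLp.toLp 2 (ξ v) : Coord d)) u :=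
  contDiffAt_euclidean.2 hξ

theorem contDiffAt_chrV {G : E → Fin d → Fin d → ℝ} {DG : E → Coord d →L[ℝ] Fin d → Fin d → ℝ}
    {ξ η : E → Coord d} {u : E} (hG : ContDiffAt ℝ ∞ G u) (h : (Matrix.of (G u)).det ≠ 0)
    (hDG : ContDiffAt ℝ ∞ DG u) (hξ : ContDiffAt ℝ ∞ ξ u) (hη : ContDiffAt ℝ ∞ η u) :
    ContDiffAt ℝ ∞ (fun v => chrV (G v) (DG v) (ξ v) (η v)) u := by
  have hD : ∀ i j k, ContDiffAt ℝ ∞ (fun v => DG v (basisVec i) j k) u := fun i j k =>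
    contDiffAt_entry (hDG.clm_apply contDiffAt_const) j k
  refine contDiffAt_toLp fun k => ContDiffAt.sum fun i _ => ContDiffAt.sum fun j _ =>
    (ContDiffAt.mul ?_ (contDiffAt_coord hξ i)).mul (contDiffAt_coord hη j)
  simp only [christoffelJ]
  exact contDiffAt_const.mul (ContDiffAt.sum fun l _ => (contDiffAt_inv hG h k l).mul
    (((hD i l j).add (hD j l i)).sub (hD l i j)))

/-- The vector with components `G^{kl} λ_l`. -/
noncomputable def raiseV (G : Fin p → Fin p → ℝ) (l : Fin p → ℝ) : Coord p :=
  WithLp.toLp 2 fun k => ∑ i, inv G k i * l i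

theorem contDiffAt_raiseV {G : E → Fin p → Fin p → ℝ} {l : E → Fin p → ℝ} {u : E}
    (hG : ContDiffAt ℝ ∞ G u) (h : (Matrix.of (G u)).det ≠ 0)
    (hl : ∀ i, ContDiffAt ℝ ∞ (fun v => l v i) u) :
    ContDiffAt ℝ ∞ (fun v => raiseV (G v) (l v)) u :=
  contDiffAt_toLp fun k => ContDiffAt.sum fun i _ => (contDiffAt_inv hG h k i).mul (hl i)

variable (p d) in
/-- The arguments of the lower order terms: the values of the metric `G` and its first derivative,
the first derivative `P` of the family, and those second derivatives `Q` that involve at most one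
time derivative. -/
abbrev LowerJet := (Fin d → Fin d → ℝ) × (Coord d →L[ℝ] Fin d → Fin d → ℝ) ×
  (Coord p × ℝ →L[ℝ] Coord d) × (Coord p × ℝ →L[ℝ] Coord p →L[ℝ] Coord d)

namespace LowerJet

/-- The spatial derivative. -/
noncomputable def tang (J : LowerJet p d) : Coord p →L[ℝ] Coord d := J.2.2.1.comp (.inl ℝ _ ℝ)

/-- The velocity. -/
noncomputable def velo (J : LowerJet p d) : Coord d := J.2.2.1 (0, 1)

/-- The induced metric. -/
noncomputable def indMetric (J : LowerJet p d) : Fin p → Fin p → ℝ := pullG J.1 J.tang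

/-- The trace of the covariant Hessian (without the connection of the induced metric). -/
noncomputable def traceHess (J : LowerJet p d) : Coord d :=
  traceB J.indMetric fun a b => J.2.2.2 (a, 0) b + chrV J.1 J.2.1 (J.tang a) (J.tang b)

/-- The trace of the second fundamental form: the normal part of the trace of the Hessian. -/
noncomputable def traceSecond (J : LowerJet p d) : Coord d :=
  J.traceHess - J.tang (raiseV J.indMetric fun a => innerL d J.1 J.traceHess (J.tang (basisVec a)))

/-- The differential of the square of the velocity. -/
noncomputable def diffVelSq (J : LowerJet p d) (a : Fin p) : ℝ :=
  innerL d (J.2.1 (J.tang (basisVec a))) J.velo J.velo +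
    2 * innerL d J.1 (J.2.2.2 (0, 1) (basisVec a)) J.velo

/-- All terms of the equation other than the second time derivative. -/
noncomputable def lowerTerm (J : LowerJet p d) : Coord d :=
  chrV J.1 J.2.1 J.velo J.velo +
    (2 / (p : ℝ) * innerL d J.1 J.velo J.traceSecond) • J.velo -
    (1 / (p : ℝ) * innerL d J.1 J.velo J.velo) • J.traceSecond +
    (1 / 2 : ℝ) • J.tang (raiseV J.indMetric J.diffVelSq)

/-- The matrices `g_{μν}` and `γ_{ab}` are invertible. -/
def Nondeg (J : LowerJet p d) : Prop :=
  (Matrix.of J.1).det ≠ 0 ∧ (Matrix.of J.indMetric).det ≠ 0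

theorem contDiff_tang : ContDiff ℝ ∞ (tang : LowerJet p d → _) :=
  (contDiff_fst.comp (contDiff_snd.comp contDiff_snd)).clm_comp contDiff_const

theorem contDiff_velo : ContDiff ℝ ∞ (velo : LowerJet p d → _) :=
  (contDiff_fst.comp (contDiff_snd.comp contDiff_snd)).clm_apply contDiff_const

theorem contDiff_indMetric : ContDiff ℝ ∞ (indMetric : LowerJet p d → _) :=
  contDiff_pi.2 fun _ => contDiff_pi.2 fun _ => contDiff_iff_contDiffAt.2 fun _ =>
    contDiffAt_innerL contDiff_fst.contDiffAt (contDiff_tang.clm_apply contDiff_const).contDiffAt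
      (contDiff_tang.clm_apply contDiff_const).contDiffAt

theorem isOpen_nondeg : IsOpen {J : LowerJet p d | J.Nondeg} := by
  have h1 : Continuous fun J : LowerJet p d => (Matrix.of J.1).det :=
    continuous_iff_continuousAt.2 fun J => (contDiffAt_det fun i j =>
      contDiffAt_entry (G := fun J : LowerJet p d => J.1) contDiff_fst.contDiffAt i j).continuousAt
  have h2 : Continuous fun J : LowerJet p d => (Matrix.of J.indMetric).det :=
    continuous_iff_continuousAt.2 fun J => (contDiffAt_det fun i j =>
      contDiffAt_entry (G := fun J : LowerJet p d => J.indMetric)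
        contDiff_indMetric.contDiffAt i j).continuousAt
  exact (isOpen_ne.preimage h1).inter (isOpen_ne.preimage h2)

theorem contDiffAt_traceSecond {J : LowerJet p d} (h : J.Nondeg) :
    ContDiffAt ℝ ∞ (traceSecond : LowerJet p d → _) J := by
  have hG : ContDiffAt ℝ ∞ (fun J : LowerJet p d => J.1) J := contDiff_fst.contDiffAt
  have hDG : ContDiffAt ℝ ∞ (fun J : LowerJet p d => J.2.1) J :=
    (contDiff_fst.comp contDiff_snd).contDiffAt
  have hQ : ContDiffAt ℝ ∞ (fun J : LowerJet p d => J.2.2.2) J :=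
    (contDiff_snd.comp (contDiff_snd.comp contDiff_snd)).contDiffAt
  have hL : ContDiffAt ℝ ∞ (tang : LowerJet p d → _) J := contDiff_tang.contDiffAt
  have hLa : ∀ a, ContDiffAt ℝ ∞ (fun J : LowerJet p d => J.tang a) J := fun a =>
    hL.clm_apply contDiffAt_const
  have hγ : ContDiffAt ℝ ∞ (indMetric : LowerJet p d → _) J := contDiff_indMetric.contDiffAt
  have hS : ContDiffAt ℝ ∞ (traceHess : LowerJet p d → _) J := by
    unfold traceHess traceB
    exact ContDiffAt.sum fun a _ => ContDiffAt.sum fun b _ => (contDiffAt_inv hγ h.2 a b).smul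
      (((hQ.clm_apply contDiffAt_const).clm_apply contDiffAt_const).add
        (contDiffAt_chrV hG h.1 hDG (hLa _) (hLa _)))
  unfold traceSecond
  exact hS.sub (hL.clm_apply (contDiffAt_raiseV hγ h.2 fun a => contDiffAt_innerL hG hS (hLa _)))

theorem contDiffAt_lowerTerm {J : LowerJet p d} (h : J.Nondeg) :
    ContDiffAt ℝ ∞ (lowerTerm : LowerJet p d → _) J := by
  have hG : ContDiffAt ℝ ∞ (fun J : LowerJet p d => J.1) J := contDiff_fst.contDiffAt
  have hDG : ContDiffAt ℝ ∞ (fun J : LowerJet p d => J.2.1) J :=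
    (contDiff_fst.comp contDiff_snd).contDiffAt
  have hQ : ContDiffAt ℝ ∞ (fun J : LowerJet p d => J.2.2.2) J :=
    (contDiff_snd.comp (contDiff_snd.comp contDiff_snd)).contDiffAt
  have hL : ContDiffAt ℝ ∞ (tang : LowerJet p d → _) J := contDiff_tang.contDiffAt
  have hLa : ∀ a, ContDiffAt ℝ ∞ (fun J : LowerJet p d => J.tang a) J := fun a =>
    hL.clm_apply contDiffAt_const
  have hv : ContDiffAt ℝ ∞ (velo : LowerJet p d → _) J := contDiff_velo.contDiffAt
  have hγ : ContDiffAt ℝ ∞ (indMetric : LowerJet p d → _) J := contDiff_indMetric.contDiffAt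
  have hT := contDiffAt_traceSecond h
  unfold lowerTerm
  refine (((contDiffAt_chrV hG h.1 hDG hv hv).add
    ((contDiffAt_const.mul (contDiffAt_innerL hG hv hT)).smul hv)).sub
    ((contDiffAt_const.mul (contDiffAt_innerL hG hv hv)).smul hT)).add
    ((hL.clm_apply (contDiffAt_raiseV hγ h.2 fun a => ?_)).const_smul _)
  unfold diffVelSq
  exact (contDiffAt_innerL (hDG.clm_apply (hLa _)) hv hv).add
    (contDiffAt_const.mul (contDiffAt_innerL hG
      ((hQ.clm_apply contDiffAt_const).clm_apply contDiffAt_const) hv))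

/-- The jet of the family in which time runs `c` times as fast. -/
noncomputable def rescale (c : ℝ) (J : LowerJet p d) : LowerJet p d :=
  (J.1, J.2.1, J.2.2.1.comp ((ContinuousLinearMap.id ℝ _).prodMap (c • .id ℝ ℝ)),
    J.2.2.2.comp ((ContinuousLinearMap.id ℝ _).prodMap (c • .id ℝ ℝ)))

theorem rescale_tang (c : ℝ) (J : LowerJet p d) : (J.rescale c).tang = J.tang := by
  ext1 w
  simp [rescale, tang]

theorem rescale_velo (c : ℝ) (J : LowerJet p d) : (J.rescale c).velo = c • J.velo := by
  simp only [rescale, velo, ContinuousLinearMap.comp_apply, ← map_smul]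
  simp

theorem rescale_indMetric (c : ℝ) (J : LowerJet p d) : (J.rescale c).indMetric = J.indMetric := by
  rw [indMetric, rescale_tang]; rfl

theorem rescale_traceSecond (c : ℝ) (J : LowerJet p d) :
    (J.rescale c).traceSecond = J.traceSecond := by
  have : (J.rescale c).traceHess = J.traceHess := by
    rw [traceHess, rescale_indMetric, rescale_tang, traceHess]
    refine traceB_congr_basis fun a b => ?_
    simp [rescale]
  rw [traceSecond, this, rescale_indMetric, rescale_tang]
  rfl

theorem rescale_diffVelSq (c : ℝ) (J : LowerJet p d) (a : Fin p) :
    (J.rescale c).diffVelSq a = c ^ 2 * J.diffVelSq a := by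
  have h : (J.rescale c).2.2.2 (0, 1) (basisVec a) = c • J.2.2.2 (0, 1) (basisVec a) := by
    rw [← smul_apply, ← map_smul]
    simp [rescale]
  rw [diffVelSq, h, rescale_velo, rescale_tang, diffVelSq]
  simp only [rescale, map_smul, smul_apply, smul_eq_mul]
  ring

/-- The lower order terms are homogeneous of degree two in the time derivatives. -/
theorem rescale_lowerTerm (c : ℝ) (J : LowerJet p d) :
    (J.rescale c).lowerTerm = c ^ 2 • J.lowerTerm := by
  have h1 : raiseV J.indMetric (J.rescale c).diffVelSq = c ^ 2 • raiseV J.indMetric J.diffVelSq := by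
    ext k
    simp only [raiseV, rescale_diffVelSq, PiLp.smul_apply, smul_eq_mul, Finset.mul_sum]
    exact Finset.sum_congr rfl fun i _ => by ring
  have h2 : ∀ G : Fin d → Fin d → ℝ, ∀ DG : Coord d →L[ℝ] Fin d → Fin d → ℝ, ∀ ξ : Coord d,
      chrV G DG (c • ξ) (c • ξ) = c ^ 2 • chrV G DG ξ ξ := by
    intro G DG ξ
    rw [← chrVL_apply, map_smul, map_smul, LinearMap.smul_apply, smul_smul, chrVL_apply, sq]
  rw [lowerTerm, rescale_velo, rescale_traceSecond, rescale_tang, rescale_indMetric, h1, lowerTerm]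
  simp only [rescale, h2, map_smul, smul_apply, smul_eq_mul]
  ext μ
  simp only [PiLp.add_apply, PiLp.sub_apply, PiLp.smul_apply, smul_eq_mul]
  ring

end LowerJet

/-- The arguments of the lower order terms of a family, as a function of the point. -/
noncomputable def lowerJet (g : Coord d → Fin d → Fin d → ℝ) (y : Coord p × ℝ → Coord d)
    (q : Coord p × ℝ) : LowerJet p d :=
  (g (y q), fderiv ℝ g (y q), fderiv ℝ y q,
    fderiv ℝ (fun q => (fderiv ℝ y q).comp (.inl ℝ (Coord p) ℝ)) q)

/-- The left-hand side of the equation, with all inverse matrices written as such. It agrees with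
`evolutionLHS` for Riemannian metrics, and makes sense for all nondegenerate jets. -/
noncomputable def evo (g : Coord d → Fin d → Fin d → ℝ) (y : Coord p × ℝ → Coord d)
    (q : Coord p × ℝ) : Coord d :=
  tderiv (tderiv y) q + (lowerJet g y q).lowerTerm

theorem fderiv_inl_apply {y : Coord p × ℝ → Coord d} {q : Coord p × ℝ} (hy : SmoothNear y q)
    (a : Coord p × ℝ) (b : Coord p) :
    fderiv ℝ (fun q => (fderiv ℝ y q).comp (.inl ℝ (Coord p) ℝ)) q a b =
      fderiv ℝ (fderiv ℝ y) q a (b, 0) := by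
  have h := (((ContinuousLinearMap.compL ℝ (Coord p) (Coord p × ℝ) (Coord d)).flip
    (.inl ℝ (Coord p) ℝ)).hasFDerivAt.comp q hy.fderiv.differentiableAt.hasFDerivAt)
  have h2 : fderiv ℝ (fun q => (fderiv ℝ y q).comp (.inl ℝ (Coord p) ℝ)) q = _ := h.fderiv
  rw [h2]
  rfl

theorem tderiv_tderiv_eq {y : Coord p × ℝ → Coord d} {q : Coord p × ℝ} (hy : SmoothNear y q) :
    tderiv (tderiv y) q = fderiv ℝ (fderiv ℝ y) q (0, 1) (0, 1) := by
  have h3 := hy.fderiv.differentiableAt.hasFDerivAt.clm_apply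
    (hasFDerivAt_const ((0 : Coord p), (1 : ℝ)) q)
  have h4 : fderiv ℝ (tderiv y) q = _ := h3.fderiv
  rw [tderiv, h4]
  simp

namespace FamilyNear

variable {g : Coord d → Fin d → Fin d → ℝ} {x : Coord p → ℝ → Coord d} {u : Coord p} {t : ℝ}

theorem tang_eq (h : FamilyNear g x u t) :
    (lowerJet g (Function.uncurry x) (u, t)).tang = fderiv ℝ (fun u' => x u' t) u := by
  ext1 w
  rw [h.fderiv_apply]; rfl

theorem indMetric_eq (h : FamilyNear g x u t) :
    (lowerJet g (Function.uncurry x) (u, t)).indMetric = inducedMetric g (fun u' => x u' t) u := by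
  rw [LowerJet.indMetric, h.tang_eq, inducedMetric_eq g h.imm.smooth.differentiableAt]; rfl

theorem nondeg (h : FamilyNear g x u t) : (lowerJet g (Function.uncurry x) (u, t)).Nondeg := by
  refine ⟨h.metric.isMetric.det_ne_zero, ?_⟩
  rw [h.indMetric_eq]
  exact h.imm.metricNear_inducedMetric.isMetric.det_ne_zero

/-- Both sides are normal, and they differ by a tangential vector. -/
theorem traceSecond_eq (h : FamilyNear g x u t) :
    (lowerJet g (Function.uncurry x) (u, t)).traceSecond =
      WithLp.toLp 2 (traceFF g (fun u' => x u' t) u) := by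
  set J := lowerJet g (Function.uncurry x) (u, t) with hJ
  have hγ := h.imm.metricNear_inducedMetric.isMetric
  have hS : J.traceHess = traceB (inducedMetric g (fun u' => x u' t) u)
      (covHess g (fun u' => x u' t) u) := by
    rw [LowerJet.traceHess, h.indMetric_eq, h.tang_eq]
    refine traceB_congr_basis fun a b => ?_
    rw [covHess]
    congr 1
    have he : fderiv ℝ (fun u' => x u' t) =ᶠ[𝓝 u] fun u' =>
        (fderiv ℝ (Function.uncurry x) (u', t)).comp (.inl ℝ (Coord p) ℝ) := by
      filter_upwards [h.eventually_space] with v hv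
      ext1 w
      rw [hv.fderiv_apply]; rfl
    rw [he.fderiv_eq]
    have hd : SmoothNear (fun q => (fderiv ℝ (Function.uncurry x) q).comp
        (.inl ℝ (Coord p) ℝ)) (u, t) :=
      h.smooth.fderiv.clm_comp ((ContinuousLinearMap.compL ℝ (Coord p) (Coord p × ℝ) (Coord d)).flip
        (.inl ℝ (Coord p) ℝ))
    have := (hasFDerivAt_space hd.differentiableAt).fderiv
    rw [this]
    rfl
  have hT : J.traceSecond = J.traceHess - fderiv ℝ (fun u' => x u' t) u
      (raise (inducedMetric g (fun u' => x u' t) u)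
        ((innerL d (g (x u t)) J.traceHess).comp (fderiv ℝ (fun u' => x u' t) u))) := by
    rw [LowerJet.traceSecond, h.tang_eq, h.indMetric_eq]
    rfl
  refine h.imm.normal_unique (fun w => ?_) h.imm.inner_traceFF (z :=
    traceB (inducedMetric g (fun u' => x u' t) u) (chrV (inducedMetric g (fun u' => x u' t) u)
      (fderiv ℝ (inducedMetric g (fun u' => x u' t)) u)) -
      raise (inducedMetric g (fun u' => x u' t) u)
        ((innerL d (g (x u t)) J.traceHess).comp (fderiv ℝ (fun u' => x u' t) u))) ?_
  · rw [hT, map_sub, sub_apply, h.imm.inner_fderiv, hγ.inner_raise]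
    exact sub_self _
  · rw [hT, h.imm.traceFF_eq, hS, map_sub]
    abel

/-- For families of immersions, `evo` is the left-hand side of the evolution equation. -/
theorem evo_eq (h : FamilyNear g x u t) :
    evo g (Function.uncurry x) (u, t) = evolutionLHS g x u t := by
  rw [h.evolutionLHS_eq, evo, LowerJet.lowerTerm, h.traceSecond_eq, h.tang_eq, h.indMetric_eq,
    tderiv_tderiv_eq h.smooth, covHess, tangGrad_eq g h.imm.smooth.differentiableAt]
  have hdv : raiseV (inducedMetric g (fun u' => x u' t) u)
      (lowerJet g (Function.uncurry x) (u, t)).diffVelSq =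
      raise (inducedMetric g (fun u' => x u' t) u)
        (fderiv ℝ (fun u' => dot (g (x u' t)) (vel x u' t) (vel x u' t)) u) := by
    rw [raiseV, raise]
    congr 1
    ext k
    refine Finset.sum_congr rfl fun a _ => ?_
    congr 1
    have hs := h.smooth.contDiffAt.isSymmSndFDerivAt (by
      rw [minSmoothness_of_isRCLikeNormedField]; exact two_le_infty)
    rw [h.fderiv_velSq, fderiv_gram (x := Function.uncurry x) (u := (u, t)) h.metric.smooth h.smooth, LowerJet.diffVelSq, h.tang_eq,
      h.fderiv_apply]
    simp only [lowerJet, fderiv_inl_apply h.smooth]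
    rw [hs.eq (basisVec a, 0) (0, 1), LowerJet.velo]
    have hsy := h.metric.isMetric.symm
    rw [show g (Function.uncurry x (u, t)) = g (x u t) from rfl,
      hsy (fderiv ℝ (Function.uncurry x) (u, t) (0, 1)) _]
    ring
  rw [hdv]
  simp only [lowerJet, LowerJet.velo, velV, tderiv, Function.uncurry]
  abel

end FamilyNear

end LowerOrder

/-! ### Smooth dependence on parameters -/

section Parameters

variable {p d : ℕ} {Θ H F : Type*} [NormedAddCommGroup Θ] [NormedSpace ℝ Θ]
  [NormedAddCommGroup H] [NormedSpace ℝ H] [NormedAddCommGroup F] [NormedSpace ℝ F]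

theorem SmoothNear.fderiv_param {f : Θ → H → F} {θ : Θ} {q : H}
    (hf : SmoothNear (Function.uncurry f) (θ, q)) :
    SmoothNear (fun w : Θ × H => _root_.fderiv ℝ (f w.1) w.2) (θ, q) := by
  refine (hf.fderiv.clm_comp ((ContinuousLinearMap.compL ℝ H (Θ × H) F).flip
    (.inr ℝ Θ H))).congr ?_
  filter_upwards [hf.eventually] with w hw
  have h1 : HasFDerivAt (fun u : H => (w.1, u)) (.inr ℝ Θ H) w.2 :=
    (hasFDerivAt_const _ _).prodMk (hasFDerivAt_id _)
  have h2 : HasFDerivAt (f w.1) _ w.2 :=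
    (show HasFDerivAt (Function.uncurry f) _ (w.1, w.2) from
      hw.differentiableAt.hasFDerivAt).comp w.2 h1
  rw [h2.fderiv]
  rfl

theorem SmoothNear.tderiv_param {f : Θ → H × ℝ → F} {θ : Θ} {q : H × ℝ}
    (hf : SmoothNear (Function.uncurry f) (θ, q)) (k : ℕ) :
    SmoothNear (fun w : Θ × (H × ℝ) => (Defect.tderiv^[k] (f w.1)) w.2) (θ, q) := by
  induction k with
  | zero => exact hf
  | succ k ih =>
    simp only [Function.iterate_succ_apply']
    exact (SmoothNear.fderiv_param (f := fun θ => Defect.tderiv^[k] (f θ)) ih).clm_comp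
      (ContinuousLinearMap.apply ℝ F ((0, 1) : H × ℝ))

theorem SmoothNear.iteratedFDeriv_param {f : Θ → H → F} {θ : Θ} {q : H}
    (hf : SmoothNear (Function.uncurry f) (θ, q)) (n : ℕ) :
    SmoothNear (fun w : Θ × H => iteratedFDeriv ℝ n (f w.1) w.2) (θ, q) := by
  induction n with
  | zero =>
    exact hf.clm_comp
      (continuousMultilinearCurryFin0 ℝ H
        F).symm.toContinuousLinearEquiv.toContinuousLinearMap
  | succ n ih =>
    exact (SmoothNear.fderiv_param (f := fun θ => iteratedFDeriv ℝ n (f θ)) ih).clm_comp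
      (continuousMultilinearCurryLeftEquiv ℝ
        (fun _ : Fin (n + 1) => H) F).symm.toContinuousLinearEquiv.toContinuousLinearMap

theorem smoothNear_nondeg {J : LowerJet p d} (h : J.Nondeg) :
    SmoothNear (LowerJet.lowerTerm : LowerJet p d → _) J := by
  filter_upwards [LowerJet.isOpen_nondeg.mem_nhds h] with J' hJ'
    using LowerJet.contDiffAt_lowerTerm hJ'

theorem SmoothNear.lowerJet_param {g : Θ → Coord d → Fin d → Fin d → ℝ}
    {y : Θ → Coord p × ℝ → Coord d} {θ : Θ} {q : Coord p × ℝ}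
    (hg : SmoothNear (Function.uncurry g) (θ, y θ q))
    (hy : SmoothNear (Function.uncurry y) (θ, q)) :
    SmoothNear (fun w : Θ × (Coord p × ℝ) => lowerJet (g w.1) (y w.1) w.2) (θ, q) := by
  have hpair : SmoothNear (fun w : Θ × (Coord p × ℝ) => (w.1, y w.1 w.2)) (θ, q) :=
    SmoothNear.prodMk (smoothNear_of_contDiff contDiff_fst) hy
  have h1 := SmoothNear.comp (f := fun w : Θ × (Coord p × ℝ) => (w.1, y w.1 w.2)) hg hpair
  have h2 := SmoothNear.comp (f := fun w : Θ × (Coord p × ℝ) => (w.1, y w.1 w.2))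
    hg.fderiv_param hpair
  have h3 := hy.fderiv_param
  have h4 := SmoothNear.fderiv_param
    (f := fun θ q => (_root_.fderiv ℝ (y θ) q).comp (.inl ℝ (Coord p) ℝ))
    (h3.clm_comp ((ContinuousLinearMap.compL ℝ (Coord p) (Coord p × ℝ) (Coord d)).flip
    (.inl ℝ (Coord p) ℝ)))
  exact h1.prodMk (h2.prodMk (h3.prodMk h4))

theorem SmoothNear.evo_param {g : Θ → Coord d → Fin d → Fin d → ℝ}
    {y : Θ → Coord p × ℝ → Coord d} {θ : Θ} {q : Coord p × ℝ}
    (hg : SmoothNear (Function.uncurry g) (θ, y θ q))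
    (hy : SmoothNear (Function.uncurry y) (θ, q)) (hn : (lowerJet (g θ) (y θ) q).Nondeg) :
    SmoothNear (fun w : Θ × (Coord p × ℝ) => evo (g w.1) (y w.1) w.2) (θ, q) :=
  (hy.tderiv_param 2).add (SmoothNear.comp
    (f := fun w : Θ × (Coord p × ℝ) => lowerJet (g w.1) (y w.1) w.2)
    (smoothNear_nondeg hn) (hg.lowerJet_param hy))

end Parameters

/-! ### Formal solutions -/

section Formal

variable {p d : ℕ}

/-- A smooth family near the point `u` of the initial slice, with nondegenerate jet there. -/
structure FormalNear (g : Coord d → Fin d → Fin d → ℝ) (y : Coord p × ℝ → Coord d) (u : Coord p) :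
    Prop where
  smooth : SmoothNear y (u, 0)
  metric : SmoothNear g (y (u, 0))
  nondeg : (lowerJet g y (u, 0)).Nondeg

theorem FamilyNear.formalNear {g : Coord d → Fin d → Fin d → ℝ} {x : Coord p → ℝ → Coord d}
    {u : Coord p} (h : FamilyNear g x u 0) : FormalNear g (Function.uncurry x) u :=
  ⟨h.smooth, h.metric.smooth, h.nondeg⟩

theorem SmoothNear.lowerJet {g : Coord d → Fin d → Fin d → ℝ} {y : Coord p × ℝ → Coord d}
    {q : Coord p × ℝ} (hg : SmoothNear g (y q)) (hy : SmoothNear y q) :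
    SmoothNear (lowerJet g y) q := by
  have h1 := SmoothNear.comp (f := y) hg hy
  have h2 := SmoothNear.comp (f := y) hg.fderiv hy
  have h4 := (hy.fderiv.clm_comp ((ContinuousLinearMap.compL ℝ (Coord p) (Coord p × ℝ)
    (Coord d)).flip (.inl ℝ (Coord p) ℝ))).fderiv
  exact h1.prodMk (h2.prodMk (hy.fderiv.prodMk h4))

theorem FamilyNear.smooth_traceFF {g : Coord d → Fin d → Fin d → ℝ} {x : Coord p → ℝ → Coord d}
    {u : Coord p} {t : ℝ} (h : FamilyNear g x u t) : SmoothNear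
      (fun q => (WithLp.toLp 2 (traceFF g (fun u' => x u' q.2) q.1) : Coord d)) (u, t) := by
  have hT : SmoothNear (LowerJet.traceSecond : LowerJet p d → _)
      (Defect.lowerJet g (Function.uncurry x) (u, t)) := by
    filter_upwards [LowerJet.isOpen_nondeg.mem_nhds h.nondeg] with J hJ
      using LowerJet.contDiffAt_traceSecond hJ
  refine (SmoothNear.comp (f := Defect.lowerJet g (Function.uncurry x)) hT
    (SmoothNear.lowerJet h.metric.smooth h.smooth)).congr ?_
  filter_upwards [h.eventually] with q hq using hq.traceSecond_eq.symm

theorem tendsto_slice {H : Type*} [TopologicalSpace H] (u : H) :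
    Tendsto (fun v : H => (v, (0 : ℝ))) (𝓝 u) (𝓝 (u, 0)) :=
  (Continuous.prodMk_left 0).tendsto' _ _ rfl

namespace FormalNear

variable {g : Coord d → Fin d → Fin d → ℝ} {y y' : Coord p × ℝ → Coord d} {u : Coord p}

theorem smooth_lowerJet (h : FormalNear g y u) : SmoothNear (lowerJet g y) (u, 0) :=
  h.metric.lowerJet h.smooth

theorem smooth_lower (h : FormalNear g y u) :
    SmoothNear (fun q => (lowerJet g y q).lowerTerm) (u, 0) :=
  SmoothNear.comp (f := lowerJet g y) (smoothNear_nondeg h.nondeg) h.smooth_lowerJet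

theorem smooth_evo (h : FormalNear g y u) : SmoothNear (evo g y) (u, 0) :=
  h.smooth.tderiv.tderiv.add h.smooth_lower

theorem eventually (h : FormalNear g y u) : ∀ᶠ v in 𝓝 u, FormalNear g y v := by
  filter_upwards [(tendsto_slice u).eventually h.smooth.eventually,
    (tendsto_slice u).eventually
      (h.smooth.contDiffAt.continuousAt.eventually (f := y) h.metric.eventually),
    (tendsto_slice u).eventually (h.smooth_lowerJet.contDiffAt.continuousAt.eventually
      (LowerJet.isOpen_nondeg.mem_nhds h.nondeg))] with v a b c using ⟨a, b, c⟩

/-- The lower order terms contain at most one time derivative, so they cost one order in time. -/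
theorem sliceEq_lower (h : FormalNear g y u) (h' : FormalNear g y' u) {r : ℕ}
    (hs : SliceEq (r + 1) y y' u) :
    SliceEq r (fun q => (lowerJet g y q).lowerTerm) (fun q => (lowerJet g y' q).lowerTerm) u := by
  set C := (ContinuousLinearMap.compL ℝ (Coord p) (Coord p × ℝ) (Coord d)).flip
    (.inl ℝ (Coord p) ℝ)
  have hs0 := hs.mono r.le_succ
  have k1 := SmoothNear.comp (f := y) h.metric h.smooth
  have k1' := SmoothNear.comp (f := y') h'.metric h'.smooth
  have k2 := SmoothNear.comp (f := y) h.metric.fderiv h.smooth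
  have k2' := SmoothNear.comp (f := y') h'.metric.fderiv h'.smooth
  have k3 := h.smooth.fderiv
  have k3' := h'.smooth.fderiv
  have k4 := (k3.clm_comp C)
  have k4' := (k3'.clm_comp C)
  have s1 := hs0.comp_left g h.metric h.smooth h'.smooth
  have s2 := hs0.comp_left (fderiv ℝ g) h.metric.fderiv h.smooth h'.smooth
  have s3 := hs.fderiv_succ h.smooth h'.smooth
  have s4 := (hs.space_fderiv h.smooth h'.smooth).fderiv_succ k4 k4'
  exact SliceEq.comp_left _ (s1.prodMk (s2.prodMk (s3.prodMk s4 k3 k3' k4.fderiv k4'.fderiv) k2 k2'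
    (k3.prodMk k4.fderiv) (k3'.prodMk k4'.fderiv)) k1 k1' (k2.prodMk (k3.prodMk k4.fderiv))
    (k2'.prodMk (k3'.prodMk k4'.fderiv))) (smoothNear_nondeg h.nondeg) h.smooth_lowerJet
    h'.smooth_lowerJet

end FormalNear

theorem tderiv_iterate_congr {H F : Type*} [NormedAddCommGroup H] [NormedSpace ℝ H]
    [NormedAddCommGroup F] [NormedSpace ℝ F] {a b : H × ℝ → F} {q : H × ℝ} (h : a =ᶠ[𝓝 q] b)
    (k : ℕ) : tderiv^[k] a =ᶠ[𝓝 q] tderiv^[k] b := by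
  induction k with
  | zero => exact h
  | succ k ih =>
    simp only [Function.iterate_succ_apply']
    exact tderiv_congr ih

theorem tderiv_iterate_add {H F : Type*} [NormedAddCommGroup H] [NormedSpace ℝ H]
    [NormedAddCommGroup F] [NormedSpace ℝ F] {a b : H × ℝ → F} {q : H × ℝ}
    (ha : SmoothNear a q) (hb : SmoothNear b q) (k : ℕ) :
    tderiv^[k] (fun q => a q + b q) =ᶠ[𝓝 q] fun q => (tderiv^[k] a) q + (tderiv^[k] b) q := by
  induction k with
  | zero => exact EventuallyEq.rfl
  | succ k ih =>
    simp only [Function.iterate_succ_apply']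
    refine (tderiv_congr ih).trans ?_
    filter_upwards [ha.eventually, hb.eventually] with w h1 h2
    rw [tderiv, fderiv_fun_add (h1.tderiv_iterate k).differentiableAt
      (h2.tderiv_iterate k).differentiableAt]
    rfl

variable {g : Coord d → Fin d → Fin d → ℝ} {y y' : Coord p × ℝ → Coord d} {u : Coord p}

/-- The leading term of the equation: if two families agree to order `k + 2`, the `k`-th time
derivatives of the left-hand sides differ as the `(k + 2)`-nd time derivatives of the families. -/
theorem iterate_evo_sub (h : FormalNear g y u) (h' : FormalNear g y' u) {k : ℕ}
    (hs : SliceEq (k + 2) y y' u) : ∀ᶠ v in 𝓝 u,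
    (tderiv^[k] (evo g y)) (v, 0) - (tderiv^[k] (evo g y')) (v, 0) =
      (tderiv^[k + 2] y) (v, 0) - (tderiv^[k + 2] y') (v, 0) := by
  filter_upwards [(h.sliceEq_lower h' hs).eventually_iterate h.smooth_lower h'.smooth_lower,
    (tendsto_slice u).eventually (tderiv_iterate_add h.smooth.tderiv.tderiv h.smooth_lower k),
    (tendsto_slice u).eventually (tderiv_iterate_add h'.smooth.tderiv.tderiv h'.smooth_lower k)]
    with v h1 h2 h3
  have e1 : (tderiv^[k] (evo g y)) (v, 0) = _ := h2
  have e2 : (tderiv^[k] (evo g y')) (v, 0) = _ := h3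
  rw [e1, e2, h1 k (by omega), add_sub_add_right_eq_sub]
  rfl

theorem sliceEq_evo (h : FormalNear g y u) (h' : FormalNear g y' u) {r : ℕ}
    (hs : SliceEq (r + 2) y y' u) : SliceEq r (evo g y) (evo g y') u := by
  rw [sliceEq_iff h.smooth_evo h'.smooth_evo]
  refine (eventually_all_finite (Set.finite_lt_nat r)).2 fun j (hj : j < r) => ?_
  filter_upwards [iterate_evo_sub h h' (hs.mono (show j + 2 ≤ r + 2 by omega)),
    hs.eventually_iterate h.smooth h'.smooth] with v h1 h2
  rw [h2 (j + 2) (by omega), sub_self, sub_eq_zero] at h1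
  exact h1

/-- Uniqueness of formal solutions. -/
theorem sliceEq_of_evo (h : FormalNear g y u) (h' : FormalNear g y' u) {m : ℕ}
    (h2 : SliceEq 2 y y' u) (he : SliceEq m (evo g y) (evo g y') u) :
    SliceEq (m + 2) y y' u := by
  induction m with
  | zero => exact h2
  | succ m ih =>
    have hs := ih (he.mono m.le_succ)
    rw [sliceEq_iff h.smooth h'.smooth]
    filter_upwards [iterate_evo_sub h h' hs, hs.eventually_iterate h.smooth h'.smooth,
      he.eventually_iterate h.smooth_evo h'.smooth_evo] with v h1 h3 h4 j hj
    rcases Nat.lt_succ_iff_lt_or_eq.1 (show j < (m + 2) + 1 by omega) with hj | rfl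
    · exact h3 j hj
    · rw [h4 m (by omega), sub_self, eq_comm, sub_eq_zero] at h1
      exact h1

/-- The formal solution with initial data `Y`, `V`, up to terms of order `k + 2` in time. -/
noncomputable def approx (g : Coord d → Fin d → Fin d → ℝ) (Y V : Coord p → Coord d) :
    ℕ → Coord p × ℝ → Coord d
  | 0, q => Y q.1 + q.2 • V q.1
  | k + 1, q => approx g Y V k q -
      q.2 ^ (k + 2) • (((k + 2).factorial : ℝ)⁻¹ • (tderiv^[k] (evo g (approx g Y V k))) (q.1, 0))

theorem approx_zero_time (g : Coord d → Fin d → Fin d → ℝ) (Y V : Coord p → Coord d) (k : ℕ)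
    (v : Coord p) : approx g Y V k (v, 0) = Y v := by
  induction k with
  | zero => simp [approx]
  | succ k ih => simp [approx, ih]

/-- Smooth initial data with nondegenerate jet at `u`. -/
structure DataNear (g : Coord d → Fin d → Fin d → ℝ) (Y V : Coord p → Coord d) (u : Coord p) :
    Prop where
  metric : SmoothNear g (Y u)
  imm : SmoothNear Y u
  field : SmoothNear V u
  det_metric : (Matrix.of (g (Y u))).det ≠ 0
  det_induced : (Matrix.of (pullG (g (Y u)) (fderiv ℝ Y u))).det ≠ 0

theorem ImmersionNear.dataNear {Y V : Coord p → Coord d} (h : ImmersionNear g Y u)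
    (hV : SmoothNear V u) : DataNear g Y V u :=
  ⟨h.metric.smooth, h.smooth, hV, h.metric.isMetric.det_ne_zero,
    (h.metric.isMetric.pullG h.injective).det_ne_zero⟩

/-- The jet of a family along the initial slice is nondegenerate, since nondegeneracy involves only
spatial derivatives. -/
theorem nondeg_slice {Y V : Coord p → Coord d} (h : DataNear g Y V u)
    (hy : SmoothNear y (u, 0)) (h0 : ∀ᶠ v in 𝓝 u, y (v, 0) = Y v) :
    (lowerJet g y (u, 0)).Nondeg := by
  have h1 : (lowerJet g y (u, 0)).tang = fderiv ℝ Y u := by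
    rw [← EventuallyEq.fderiv_eq h0]
    exact (hasFDerivAt_space hy.differentiableAt).fderiv.symm
  have h2 : (lowerJet g y (u, 0)).1 = g (Y u) := by rw [← h0.self_of_nhds]; rfl
  refine ⟨?_, ?_⟩
  · rw [h2]; exact h.det_metric
  · rw [LowerJet.indMetric, h1, h2]; exact h.det_induced

/-- Smooth dependence of the formal solutions on parameters. -/
theorem approx_smooth_param {Θ : Type*} [NormedAddCommGroup Θ] [NormedSpace ℝ Θ]
    {g : Θ → Coord d → Fin d → Fin d → ℝ} {Y V : Θ → Coord p → Coord d} {θ : Θ} {u : Coord p}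
    (hg : SmoothNear (Function.uncurry g) (θ, Y θ u)) (hY : SmoothNear (Function.uncurry Y) (θ, u))
    (hV : SmoothNear (Function.uncurry V) (θ, u)) (hd : DataNear (g θ) (Y θ) (V θ) u) (k : ℕ)
    (t : ℝ) :
    SmoothNear (Function.uncurry fun θ => approx (g θ) (Y θ) (V θ) k) (θ, (u, t)) := by
  have hpr : ∀ t : ℝ, SmoothNear (fun w : Θ × (Coord p × ℝ) => (w.1, w.2.1)) (θ, (u, t)) :=
    fun t => smoothNear_of_contDiff (contDiff_fst.prodMk (contDiff_fst.comp contDiff_snd))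
  have htm : ContDiff ℝ ∞ (fun w : Θ × (Coord p × ℝ) => w.2.2) := contDiff_snd.comp contDiff_snd
  induction k generalizing t with
  | zero =>
    have h1 := SmoothNear.comp (f := fun w : Θ × (Coord p × ℝ) => (w.1, w.2.1)) hY (hpr t)
    have h2 := SmoothNear.comp (f := fun w : Θ × (Coord p × ℝ) => (w.1, w.2.1)) hV (hpr t)
    exact h1.add ((smoothNear_of_contDiff htm).smul h2)
  | succ k ih =>
    have hslice : SmoothNear (approx (g θ) (Y θ) (V θ) k) (u, 0) :=
      SmoothNear.comp (f := fun q => (θ, q)) (ih 0)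
        (smoothNear_of_contDiff (contDiff_const.prodMk contDiff_id))
    have hev := SmoothNear.evo_param (g := g) (y := fun θ => approx (g θ) (Y θ) (V θ) k)
      (θ := θ) (q := (u, 0)) (by rw [approx_zero_time]; exact hg) (ih 0)
      (nondeg_slice hd hslice (Eventually.of_forall fun v => approx_zero_time _ _ _ k v))
    have hit := SmoothNear.tderiv_param (f := fun θ => evo (g θ) (approx (g θ) (Y θ) (V θ) k)) hev k
    have h0 : SmoothNear (fun w : Θ × (Coord p × ℝ) => (w.1, (w.2.1, (0 : ℝ)))) (θ, (u, t)) :=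
      smoothNear_of_contDiff (contDiff_fst.prodMk ((contDiff_fst.comp contDiff_snd).prodMk
        contDiff_const))
    have h3 := SmoothNear.comp (f := fun w : Θ × (Coord p × ℝ) => (w.1, (w.2.1, (0 : ℝ)))) hit h0
    exact (ih t).sub ((smoothNear_of_contDiff (htm.pow (k + 2))).smul
      ((smoothNear_of_contDiff contDiff_const).smul h3))

namespace DataNear

variable {Y V : Coord p → Coord d}

theorem approx_smooth (h : DataNear g Y V u) (k : ℕ) (t : ℝ) :
    SmoothNear (approx g Y V k) (u, t) := by
  have hc : ∀ {E F : Type} [NormedAddCommGroup E] [NormedSpace ℝ E] [NormedAddCommGroup F]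
      [NormedSpace ℝ F] {f : E → F} {x : E}, SmoothNear f x →
      SmoothNear (Function.uncurry fun _ : ℝ => f) ((0 : ℝ), x) := fun {E F} _ _ _ _ {f x} hf =>
    SmoothNear.comp (f := fun w : ℝ × E => w.2) hf (smoothNear_of_contDiff contDiff_snd)
  have := approx_smooth_param (θ := (0 : ℝ)) (g := fun _ => g) (Y := fun _ => Y) (V := fun _ => V)
    (hc h.metric) (hc h.imm) (hc h.field) h k t
  exact SmoothNear.comp (f := fun q => ((0 : ℝ), q)) this
        (smoothNear_of_contDiff (contDiff_const.prodMk contDiff_id))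

theorem formalNear (h : DataNear g Y V u) (k : ℕ) : FormalNear g (approx g Y V k) u :=
  ⟨h.approx_smooth k 0, by rw [approx_zero_time]; exact h.metric,
    nondeg_slice h (h.approx_smooth k 0) (Eventually.of_forall fun v => approx_zero_time _ _ _ k v)⟩

theorem eventually (h : DataNear g Y V u) : ∀ᶠ v in 𝓝 u, DataNear g Y V v := by
  have h1 := (h.formalNear 0).eventually
  filter_upwards [h1, h.imm.eventually, h.field.eventually] with v a b c
  have hm := a.metric
  rw [approx_zero_time] at hm
  have h1 : (lowerJet g (approx g Y V 0) (v, 0)).tang = fderiv ℝ Y v := by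
    have hfun : (fun v => approx g Y V 0 (v, 0)) = Y := funext fun v => approx_zero_time g Y V 0 v
    rw [show fderiv ℝ Y v = fderiv ℝ (fun v => approx g Y V 0 (v, 0)) v by rw [hfun]]
    exact (hasFDerivAt_space a.smooth.differentiableAt).fderiv.symm
  have h2 : (lowerJet g (approx g Y V 0) (v, 0)).1 = g (Y v) := by
    rw [← approx_zero_time g Y V 0 v]; rfl
  refine ⟨hm, b, c, ?_, ?_⟩
  · rw [← h2]; exact a.nondeg.1
  · rw [← h1, ← h2]; exact a.nondeg.2

theorem _root_.Defect.iteratedDeriv_pow_smul {F : Type*} [NormedAddCommGroup F] [NormedSpace ℝ F]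
    (n j : ℕ) (c : F) : iteratedDeriv j (fun s : ℝ => s ^ n • c) 0 =
      if j = n then (n.factorial : ℝ) • c else 0 := by
  rw [iteratedDeriv_smul_const (contDiff_id.pow n).contDiffAt, iteratedDeriv_fun_pow_zero]
  split_ifs <;> simp_all

/-- The correction in the step from `k` to `k + 1` changes only the Taylor coefficient of order
`k + 2`. -/
theorem iteratedDeriv_approx_succ (h : DataNear g Y V u) (k j : ℕ) :
    iteratedDeriv j (fun s => approx g Y V (k + 1) (u, s)) 0 =
      iteratedDeriv j (fun s => approx g Y V k (u, s)) 0 -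
        if j = k + 2 then (tderiv^[k] (evo g (approx g Y V k))) (u, 0) else 0 := by
  have hf : ((k + 2).factorial : ℝ) ≠ 0 := by exact_mod_cast (k + 2).factorial_ne_zero
  have hsm : ContDiffAt ℝ j (fun s => approx g Y V k (u, s)) 0 :=
    (h.approx_smooth k 0).slice.contDiffAt.of_le (by exact_mod_cast le_top)
  have e := iteratedDeriv_sub (n := j) (x := (0 : ℝ)) hsm
    (g := fun s => s ^ (k + 2) • (((k + 2).factorial : ℝ)⁻¹ •
      (tderiv^[k] (evo g (approx g Y V k))) (u, 0)))
    ((contDiff_id.pow (k + 2)).smul contDiff_const).contDiffAt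
  have e2 : (fun s => approx g Y V (k + 1) (u, s)) = _ - _ := rfl
  rw [e2]
  refine e.trans ?_
  rw [iteratedDeriv_pow_smul, smul_smul, mul_inv_cancel₀ hf, one_smul]

theorem sliceEq_approx_succ (h : DataNear g Y V u) (k : ℕ) :
    SliceEq (k + 2) (approx g Y V (k + 1)) (approx g Y V k) u := by
  filter_upwards [h.eventually] with v hv
  refine JetEq.iff_iteratedDeriv.2 fun j hj => ?_
  rw [hv.iteratedDeriv_approx_succ, if_neg (by omega), sub_zero]

theorem sliceEq_approx (h : DataNear g Y V u) {k m : ℕ} (hkm : k ≤ m) :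
    SliceEq (k + 2) (approx g Y V m) (approx g Y V k) u := by
  induction m, hkm using Nat.le_induction with
  | base => exact Eventually.of_forall fun _ => JetEq.refl _ _
  | succ m hkm ih => exact ((h.sliceEq_approx_succ m).mono (by omega)).trans ih

/-- The formal solutions solve the equation to the order to which they are defined. -/
theorem approx_solves (h : DataNear g Y V u) (k : ℕ) :
    SliceEq k (evo g (approx g Y V k)) (fun _ => 0) u := by
  induction k with
  | zero => exact Eventually.of_forall fun _ => JetEq.zero
  | succ k ih =>
    have hk := h.formalNear k
    have hk' := h.formalNear (k + 1)
    have hs := h.sliceEq_approx_succ k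
    have h0 : SliceEq k (evo g (approx g Y V (k + 1))) (fun _ => 0) u :=
      (sliceEq_evo hk' hk hs).trans ih
    have hz : SmoothNear (fun _ : Coord p × ℝ => (0 : Coord d)) (u, 0) :=
      smoothNear_of_contDiff contDiff_const
    have hzero : ∀ j, ∀ q : Coord p × ℝ, (tderiv^[j] fun _ => (0 : Coord d)) q = 0 := by
      intro j
      induction j with
      | zero => intro q; rfl
      | succ j ihj =>
        intro q
        rw [Function.iterate_succ_apply', show tderiv^[j] (fun _ : Coord p × ℝ => (0 : Coord d)) =
          fun _ => 0 from funext ihj]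
        simp [tderiv]
    rw [sliceEq_iff hk'.smooth_evo hz]
    filter_upwards [h0.eventually_iterate hk'.smooth_evo hz, iterate_evo_sub hk' hk hs,
      h.eventually, (tendsto_slice u).eventually (iteratedDeriv_slice hk.smooth (k + 2)),
      (tendsto_slice u).eventually (iteratedDeriv_slice hk'.smooth (k + 2))]
      with v h1 h2 h3 h4 h5 j hj
    rcases Nat.lt_succ_iff_lt_or_eq.1 hj with hj | rfl
    · exact h1 j hj
    · rw [← h4, ← h5, h3.iteratedDeriv_approx_succ, if_pos rfl, sub_eq_iff_eq_add] at h2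
      rw [h2, hzero]
      abel

end DataNear

end Formal

/-! ### Homogeneity and locality of formal solutions -/

section Homogeneity

variable {p d : ℕ} {F : Type*} [NormedAddCommGroup F] [NormedSpace ℝ F]

/-- The change of the time scale, `(u, t) ↦ (u, c t)`. -/
noncomputable def timeScale (p : ℕ) (c : ℝ) : Coord p × ℝ →L[ℝ] Coord p × ℝ :=
  (ContinuousLinearMap.id ℝ _).prodMap (c • .id ℝ ℝ)

theorem timeScale_apply (c : ℝ) (q : Coord p × ℝ) : timeScale p c q = (q.1, c * q.2) := rfl

theorem fderiv_comp_clm {E E' : Type*} [NormedAddCommGroup E] [NormedSpace ℝ E]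
    [NormedAddCommGroup E'] [NormedSpace ℝ E'] {f : E' → F} (S : E →L[ℝ] E') {q : E}
    (hf : DifferentiableAt ℝ f (S q)) : fderiv ℝ (fun q => f (S q)) q = (fderiv ℝ f (S q)).comp S :=
  (hf.hasFDerivAt.comp q S.hasFDerivAt).fderiv

theorem tderiv_timeScale {f : Coord p × ℝ → F} {c : ℝ} {q : Coord p × ℝ}
    (hf : SmoothNear f (timeScale p c q)) (k : ℕ) :
    tderiv^[k] (fun q => f (timeScale p c q)) =ᶠ[𝓝 q] fun q =>
      c ^ k • (tderiv^[k] f) (timeScale p c q) := by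
  induction k with
  | zero => simp only [Function.iterate_zero, id, pow_zero, one_smul]; exact EventuallyEq.rfl
  | succ k ih =>
    simp only [Function.iterate_succ_apply']
    refine (tderiv_congr ih).trans ?_
    filter_upwards [(timeScale p c).continuous.continuousAt.eventually hf.eventually] with w hw
    have hd := (hw.tderiv_iterate k).differentiableAt
    rw [tderiv, fderiv_fun_const_smul (f := fun q => (tderiv^[k] f) (timeScale p c q))
      (DifferentiableAt.comp w hd (timeScale p c).differentiableAt), fderiv_comp_clm _ hd]
    have : timeScale p c (0, 1) = c • (0, 1) := by rw [timeScale_apply]; simp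
    rw [smul_apply, ContinuousLinearMap.comp_apply, this, map_smul, smul_smul, pow_succ]
    rfl

theorem lowerJet_timeScale {g : Coord d → Fin d → Fin d → ℝ} {y : Coord p × ℝ → Coord d} {c : ℝ}
    {q : Coord p × ℝ} (hy : SmoothNear y (timeScale p c q)) :
    lowerJet g (fun q => y (timeScale p c q)) q = (lowerJet g y (timeScale p c q)).rescale c := by
  have h1 : fderiv ℝ (fun q => y (timeScale p c q)) =ᶠ[𝓝 q] fun q =>
      (fderiv ℝ y (timeScale p c q)).comp (timeScale p c) := by
    filter_upwards [(timeScale p c).continuous.continuousAt.eventually hy.eventually] with w hw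
    exact fderiv_comp_clm _ hw.differentiableAt
  have h2 : (fun q => (fderiv ℝ (fun q => y (timeScale p c q)) q).comp (.inl ℝ (Coord p) ℝ))
      =ᶠ[𝓝 q] fun q => (fun q => (fderiv ℝ y q).comp (.inl ℝ (Coord p) ℝ)) (timeScale p c q) := by
    filter_upwards [h1] with w hw
    rw [hw]
    ext1 a
    simp [timeScale_apply]
  have hd : SmoothNear (fun q => (fderiv ℝ y q).comp (.inl ℝ (Coord p) ℝ)) (timeScale p c q) :=
    hy.fderiv.clm_comp ((ContinuousLinearMap.compL ℝ (Coord p) (Coord p × ℝ) (Coord d)).flip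
      (.inl ℝ (Coord p) ℝ))
  rw [lowerJet, h2.fderiv_eq, h1.self_of_nhds, fderiv_comp_clm _ hd.differentiableAt]
  rfl

/-- The equation is homogeneous of degree two in time derivatives. -/
theorem evo_timeScale {g : Coord d → Fin d → Fin d → ℝ} {y : Coord p × ℝ → Coord d} {c : ℝ}
    {q : Coord p × ℝ} (hy : SmoothNear y (timeScale p c q)) :
    evo g (fun q => y (timeScale p c q)) q = c ^ 2 • evo g y (timeScale p c q) := by
  rw [evo, lowerJet_timeScale hy, LowerJet.rescale_lowerTerm, evo, smul_add]
  congr 1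
  exact (tderiv_timeScale hy 2).self_of_nhds

/-- Rescaling the initial velocity amounts to rescaling time. -/
theorem DataNear.approx_smul {g : Coord d → Fin d → Fin d → ℝ} {Y V : Coord p → Coord d}
    {u : Coord p} (h : DataNear g Y V u) (c : ℝ) (k : ℕ) (t : ℝ) :
    approx g Y (fun v => c • V v) k (u, t) = approx g Y V k (u, c * t) := by
  induction k generalizing u t with
  | zero => simp [approx, smul_smul, mul_comm]
  | succ k ih =>
    have hev : approx g Y (fun v => c • V v) k =ᶠ[𝓝 (u, 0)] fun q =>
        approx g Y V k (timeScale p c q) := by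
      filter_upwards [continuousAt_fst.eventually h.eventually] with w hw using ih hw w.2
    have hS : timeScale p c (u, 0) = (u, 0) := by rw [timeScale_apply]; simp
    have hsm : SmoothNear (approx g Y V k) (timeScale p c (u, 0)) := by
      rw [hS]; exact h.approx_smooth k 0
    have h1 : evo g (approx g Y (fun v => c • V v) k) =ᶠ[𝓝 (u, 0)] fun q =>
        (fun q => c ^ 2 • evo g (approx g Y V k) q) (timeScale p c q) := by
      filter_upwards [hev.eventuallyEq_nhds,
        (timeScale p c).continuous.continuousAt.eventually hsm.eventually] with w h2 h3
      have h4 : (fun q => (fderiv ℝ (approx g Y (fun v => c • V v) k) q).comp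
          (.inl ℝ (Coord p) ℝ)) =ᶠ[𝓝 w] fun q => (fderiv ℝ (fun q =>
            approx g Y V k (timeScale p c q)) q).comp (.inl ℝ (Coord p) ℝ) := by
        filter_upwards [h2.eventuallyEq_nhds] with w' hw'
        rw [hw'.fderiv_eq]
      refine Eq.trans ?_ (evo_timeScale h3)
      rw [evo, evo, (tderiv_congr (tderiv_congr h2)).self_of_nhds, lowerJet, lowerJet,
        h2.self_of_nhds, h2.fderiv_eq, h4.fderiv_eq]
    have hevo : SmoothNear (fun q => c ^ 2 • evo g (approx g Y V k) q) (timeScale p c (u, 0)) := by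
      rw [hS]
      exact (smoothNear_of_contDiff contDiff_const).smul (h.formalNear k).smooth_evo
    have h5 := ((tderiv_iterate_congr h1 k).trans (tderiv_timeScale hevo k)).self_of_nhds
    have h6 : (tderiv^[k] fun q => c ^ 2 • evo g (approx g Y V k) q) (u, 0) =
        c ^ 2 • (tderiv^[k] (evo g (approx g Y V k))) (u, 0) := by
      have : ∀ j, tderiv^[j] (fun q => c ^ 2 • evo g (approx g Y V k) q) =ᶠ[𝓝 (u, 0)]
          fun q => c ^ 2 • (tderiv^[j] (evo g (approx g Y V k))) q := by
        intro j
        induction j with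
        | zero => exact EventuallyEq.rfl
        | succ j ihj =>
          simp only [Function.iterate_succ_apply']
          refine (tderiv_congr ihj).trans ?_
          filter_upwards [(h.formalNear k).smooth_evo.eventually] with w hw
          rw [tderiv, fderiv_fun_const_smul (hw.tderiv_iterate j).differentiableAt]
          rfl
      exact (this k).self_of_nhds
    beta_reduce at h5
    rw [hS, h6] at h5
    rw [approx, approx, ih h, h5, mul_pow]
    simp only [smul_smul]
    ring_nf

end Homogeneity

section Locality

variable {p d : ℕ}

theorem JetEq.comp_clm {E E' F : Type} [NormedAddCommGroup E] [NormedSpace ℝ E]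
    [NormedAddCommGroup E'] [NormedSpace ℝ E'] [NormedAddCommGroup F] [NormedSpace ℝ F] {r : ℕ}
    {f f' : E' → F} (S : E →L[ℝ] E') {x x' : E} (h : JetEq r f (S x) f' (S x'))
    (hf : ContDiffAt ℝ ∞ f (S x)) (hf' : ContDiffAt ℝ ∞ f' (S x')) :
    JetEq r (fun y => f (S y)) x (fun y => f' (S y)) x' := by
  induction r generalizing F with
  | zero => exact JetEq.zero
  | succ r ih =>
    refine JetEq.succ_iff.2 ⟨h.value r.succ_pos, ?_⟩
    have key : ∀ {k : E' → F} {y : E}, ContDiffAt ℝ ∞ k (S y) →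
        _root_.fderiv ℝ (fun y => k (S y)) =ᶠ[𝓝 y] fun y => (_root_.fderiv ℝ k (S y)).comp S := by
      intro k y hk
      filter_upwards [S.continuous.continuousAt.eventually
        ((hk.of_le (m := 1) (by simp)).eventually (by simp))] with z hz
      exact fderiv_comp_clm S (hz.differentiableAt (by simp))
    refine (JetEq.of_eventuallyEq (key hf)).trans
      (JetEq.trans ?_ (JetEq.of_eventuallyEq (key hf')).symm)
    have hD := hf.fderiv_right (m := ∞) (by simp)
    have hD' := hf'.fderiv_right (m := ∞) (by simp)
    exact (ih h.fderiv_succ hD hD').clm_comp ((ContinuousLinearMap.compL ℝ E E' F).flip S)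
      (hD.comp x S.contDiff.contDiffAt) (hD'.comp x' S.contDiff.contDiffAt)

/-- Time derivatives cost as many orders. -/
theorem JetEq.tderiv_iterate {H F : Type} [NormedAddCommGroup H] [NormedSpace ℝ H]
    [NormedAddCommGroup F] [NormedSpace ℝ F] {r : ℕ} {f f' : H × ℝ → F} {x x' : H × ℝ}
    (h : JetEq r f x f' x') (hf : SmoothNear f x) (hf' : SmoothNear f' x') (k : ℕ) :
    JetEq (r - k) (Defect.tderiv^[k] f) x (Defect.tderiv^[k] f') x' := by
  induction k with
  | zero => exact h
  | succ k ih =>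
    simp only [Function.iterate_succ_apply']
    exact (ih.fderiv_pred.clm_comp (ContinuousLinearMap.apply ℝ F ((0, 1) : H × ℝ))
      (hf.tderiv_iterate k).fderiv.contDiffAt (hf'.tderiv_iterate k).fderiv.contDiffAt)

/-- The equation is of second order. -/
theorem JetEq.evo {g g' : Coord d → Fin d → Fin d → ℝ} {y y' : Coord p × ℝ → Coord d}
    {u u' : Coord p} {r : ℕ} (h : FormalNear g y u) (h' : FormalNear g' y' u')
    (hg : JetEq r g (y (u, 0)) g' (y' (u', 0))) (hy : JetEq r y (u, 0) y' (u', 0)) :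
    JetEq (r - 2) (Defect.evo g y) (u, 0) (Defect.evo g' y') (u', 0) := by
  set C := (ContinuousLinearMap.compL ℝ (Coord p) (Coord p × ℝ) (Coord d)).flip
    (.inl ℝ (Coord p) ℝ)
  have k1 := SmoothNear.comp (f := y) h.metric h.smooth
  have k1' := SmoothNear.comp (f := y') h'.metric h'.smooth
  have k2 := SmoothNear.comp (f := y) h.metric.fderiv h.smooth
  have k2' := SmoothNear.comp (f := y') h'.metric.fderiv h'.smooth
  have k3 := h.smooth.fderiv
  have k3' := h'.smooth.fderiv
  have k4 := (k3.clm_comp C)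
  have k4' := (k3'.clm_comp C)
  have s1 := JetEq.comp hg hy h.metric.contDiffAt h'.metric.contDiffAt h.smooth.contDiffAt
    h'.smooth.contDiffAt
  have s2 := JetEq.comp hg.fderiv_pred (hy.mono (Nat.sub_le r 1)) h.metric.fderiv.contDiffAt
    h'.metric.fderiv.contDiffAt h.smooth.contDiffAt h'.smooth.contDiffAt
  have s3 := hy.fderiv_pred
  have s4 := (s3.clm_comp C k3.contDiffAt k3'.contDiffAt).fderiv_pred
  have hJ : JetEq (r - 2) (lowerJet g y) (u, 0) (lowerJet g' y') (u', 0) :=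
    (s1.mono (by omega)).prodMk ((s2.mono (by omega)).prodMk ((s3.mono (by omega)).prodMk
      (s4.mono (by omega)) k3.contDiffAt k3'.contDiffAt k4.fderiv.contDiffAt
      k4'.fderiv.contDiffAt) k2.contDiffAt k2'.contDiffAt (k3.prodMk k4.fderiv).contDiffAt
      (k3'.prodMk k4'.fderiv).contDiffAt) k1.contDiffAt k1'.contDiffAt
      (k2.prodMk (k3.prodMk k4.fderiv)).contDiffAt (k2'.prodMk (k3'.prodMk k4'.fderiv)).contDiffAt
  exact (hy.tderiv_iterate h.smooth h'.smooth 2).add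
    (hJ.comp_left _ (LowerJet.contDiffAt_lowerTerm h.nondeg) h.smooth_lowerJet.contDiffAt
      h'.smooth_lowerJet.contDiffAt) h.smooth.tderiv.tderiv.contDiffAt
      h'.smooth.tderiv.tderiv.contDiffAt h.smooth_lower.contDiffAt h'.smooth_lower.contDiffAt

/-- Locality: the jet of the formal solution of a given order depends only on the jets of the data
of the same order. The order lost in the derivatives is gained by the factor `t ^ (k + 2)`. -/
theorem JetEq.approx {g g' : Coord d → Fin d → Fin d → ℝ} {Y Y' V V' : Coord p → Coord d}
    {u u' : Coord p} {r : ℕ} (h : DataNear g Y V u) (h' : DataNear g' Y' V' u')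
    (hg : JetEq r g (Y u) g' (Y' u')) (hY : JetEq r Y u Y' u') (hV : JetEq r V u V' u') (k : ℕ) :
    JetEq r (Defect.approx g Y V k) (u, 0) (Defect.approx g' Y' V' k) (u', 0) := by
  set ℓ := ContinuousLinearMap.snd ℝ (Coord p) ℝ
  induction k with
  | zero =>
    set S := ContinuousLinearMap.fst ℝ (Coord p) ℝ
    have cY : ContDiffAt ℝ ∞ (fun q : Coord p × ℝ => Y (S q)) (u, 0) :=
      ContDiffAt.comp (u, 0) (f := S) (show ContDiffAt ℝ ∞ Y (S (u, 0)) from h.imm.contDiffAt) S.contDiff.contDiffAt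
    have cY' : ContDiffAt ℝ ∞ (fun q : Coord p × ℝ => Y' (S q)) (u', 0) :=
      ContDiffAt.comp (u', 0) (f := S) (show ContDiffAt ℝ ∞ Y' (S (u', 0)) from h'.imm.contDiffAt) S.contDiff.contDiffAt
    have cV : ContDiffAt ℝ ∞ (fun q : Coord p × ℝ => V (S q)) (u, 0) :=
      ContDiffAt.comp (u, 0) (f := S) (show ContDiffAt ℝ ∞ V (S (u, 0)) from h.field.contDiffAt) S.contDiff.contDiffAt
    have cV' : ContDiffAt ℝ ∞ (fun q : Coord p × ℝ => V' (S q)) (u', 0) :=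
      ContDiffAt.comp (u', 0) (f := S) (show ContDiffAt ℝ ∞ V' (S (u', 0)) from h'.field.contDiffAt) S.contDiff.contDiffAt
    have e1 := JetEq.comp_clm (x := (u, 0)) (x' := (u', 0)) S hY h.imm.contDiffAt h'.imm.contDiffAt
    have e2 := JetEq.comp_clm (x := (u, 0)) (x' := (u', 0)) S hV h.field.contDiffAt
      h'.field.contDiffAt
    have e3 := (JetEq.linear_smul ℓ (show ℓ (u, 0) = 0 from rfl) (show ℓ (u', 0) = 0 from rfl)
      cV cV' e2).mono r.le_succ
    exact e1.add e3 cY cY' (ℓ.contDiff.contDiffAt.smul cV) (ℓ.contDiff.contDiffAt.smul cV')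
  | succ k ih =>
    have hk := h.formalNear k
    have hk' := h'.formalNear k
    set S := (ContinuousLinearMap.inl ℝ (Coord p) ℝ).comp (ContinuousLinearMap.fst ℝ (Coord p) ℝ)
    have e1 := (JetEq.evo hk hk' (by rw [approx_zero_time, approx_zero_time]; exact hg)
      ih).tderiv_iterate hk.smooth_evo hk'.smooth_evo k
    have c1 := (hk.smooth_evo.tderiv_iterate k).contDiffAt
    have c1' := (hk'.smooth_evo.tderiv_iterate k).contDiffAt
    have e2 := JetEq.comp_clm (x := (u, 0)) (x' := (u', 0)) S e1 c1 c1'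
    have c2 : ContDiffAt ℝ ∞ (fun q => (tderiv^[k] (Defect.evo g (Defect.approx g Y V k))) (S q))
        (u, 0) := ContDiffAt.comp (u, 0) (f := S) (by exact c1) S.contDiff.contDiffAt
    have c2' : ContDiffAt ℝ ∞ (fun q =>
        (tderiv^[k] (Defect.evo g' (Defect.approx g' Y' V' k))) (S q)) (u', 0) :=
      ContDiffAt.comp (u', 0) (f := S) (by exact c1') S.contDiff.contDiffAt
    set L := (((k + 2).factorial : ℝ)⁻¹ • ContinuousLinearMap.id ℝ (Coord d))
    have e3 := e2.clm_comp L c2 c2'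
    have c3 := L.contDiff.contDiffAt.comp _ c2
    have c3' := L.contDiff.contDiffAt.comp _ c2'
    have e4 := (JetEq.linear_pow_smul ℓ (show ℓ (u, 0) = 0 from rfl) (show ℓ (u', 0) = 0 from rfl)
      c3 c3' e3 (k + 2)).mono (show r ≤ r - 2 - k + (k + 2) by omega)
    exact ih.sub e4 hk.smooth.contDiffAt hk'.smooth.contDiffAt
      ((ℓ.contDiff.contDiffAt.pow _).smul c3) ((ℓ.contDiff.contDiffAt.pow _).smul c3')

end Locality

/-! ### The local operators -/

section Operators

variable {n p d k : ℕ} {F : Type} [NormedAddCommGroup F] [NormedSpace ℝ F]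

/-- The polynomial with a given jet at the point `c`. -/
noncomputable def jetPoly (J : Jet n F k) (c y : Coord n) : F :=
  ∑ j : Fin (k + 1), ((j : ℕ).factorial : ℝ)⁻¹ • J j fun _ => y - c

theorem jetEq_jetPoly {f : Coord n → F} {x : Coord n} (hf : ContDiffAt ℝ ∞ f x) (c : Coord n) :
    JetEq (k + 1) f x (jetPoly (jet k f x) c) c := by
  have e : jetPoly (jet k f x) c = fun y => taylorPoly (k + 1) f x (y - c) := by
    ext y
    rw [jetPoly, taylorPoly, Finset.sum_range]
    rfl
  refine (jetEq_taylorPoly hf).trans fun j _ => ?_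
  rw [e, iteratedFDeriv_comp_sub, sub_self]

theorem contDiff_multilinear_apply (j : ℕ) {E : Type} [NormedAddCommGroup E] [NormedSpace ℝ E] :
    ContDiff ℝ ∞ fun w : (E [×j]→L[ℝ] F) × E => w.1 fun _ => w.2 := by
  induction j generalizing F with
  | zero =>
    have : (fun w : (E [×0]→L[ℝ] F) × E => w.1 fun _ => w.2) = fun w =>
        continuousMultilinearCurryFin0 ℝ E F w.1 := by
      ext w
      rw [continuousMultilinearCurryFin0_apply]
      congr
      exact Subsingleton.elim _ _
    rw [this]
    exact (continuousMultilinearCurryFin0 ℝ E F).contDiff.comp contDiff_fst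
  | succ j ih =>
    have : (fun w : (E [×(j + 1)]→L[ℝ] F) × E => w.1 fun _ => w.2) = fun w =>
        (continuousMultilinearCurryLeftEquiv ℝ (fun _ : Fin (j + 1) => E) F w.1 w.2)
          fun _ => w.2 := by
      ext w
      simp only [continuousMultilinearCurryLeftEquiv_apply]
      congr 1
      ext i
      refine Fin.cases rfl (fun i => rfl) i
    rw [this]
    have h1 : ContDiff ℝ ∞ fun w : (E [×(j + 1)]→L[ℝ] F) × E =>
        continuousMultilinearCurryLeftEquiv ℝ (fun _ : Fin (j + 1) => E) F w.1 w.2 :=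
      ((continuousMultilinearCurryLeftEquiv ℝ (fun _ : Fin (j + 1) => E) F).contDiff.comp
        contDiff_fst).clm_apply contDiff_snd
    exact ContDiff.comp (ih (F := F)) (h1.prodMk contDiff_snd)

theorem contDiff_jetPoly : ContDiff ℝ ∞ fun w : Jet n F k × Coord n × Coord n =>
    jetPoly w.1 w.2.1 w.2.2 := by
  refine ContDiff.sum fun j _ => contDiff_const.smul ?_
  have h1 : ContDiff ℝ ∞ fun w : Jet n F k × Coord n × Coord n => w.1 j :=
    (contDiff_pi.1 contDiff_fst j)
  have h2 : ContDiff ℝ ∞ fun w : Jet n F k × Coord n × Coord n => w.2.2 - w.2.1 :=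
    (contDiff_snd.comp contDiff_snd).sub (contDiff_fst.comp contDiff_snd)
  exact ContDiff.comp (contDiff_multilinear_apply (j : ℕ)) (h1.prodMk h2)

theorem contDiff_jetPoly_right (J : Jet n F k) (c : Coord n) : ContDiff ℝ ∞ (jetPoly J c) :=
  contDiff_jetPoly.comp (contDiff_const.prodMk (contDiff_const.prodMk contDiff_id))

theorem jetPoly_self (J : Jet n F k) (c : Coord n) : jetPoly J c c = J 0 fun _ => 0 := by
  rw [jetPoly, Finset.sum_eq_single 0]
  · simp
  · intro j _ hj
    have : (j : ℕ) ≠ 0 := fun h => hj (Fin.ext h)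
    rw [sub_self, (J j).map_coord_zero ⟨0, Nat.pos_of_ne_zero this⟩ rfl, smul_zero]
  · simp

theorem fderiv_jetPoly (J : Jet n F (k + 1)) (c a : Coord n) :
    fderiv ℝ (jetPoly J c) c a = J 1 fun _ => a := by
  have hder : ∀ j : Fin (k + 2), HasFDerivAt
      (fun y : Coord n => ((j : ℕ).factorial : ℝ)⁻¹ • J j fun _ => y - c)
      (((j : ℕ).factorial : ℝ)⁻¹ • (hasFDerivAt_diag (J j) (c - c)).choose) c := fun j => by
    have h1 := (hasFDerivAt_diag (J j) (c - c)).choose_spec.1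
    have h2 := (HasFDerivAt.comp c (f := fun y => y - c) h1 ((hasFDerivAt_id c).sub_const c)).const_smul
      (((j : ℕ).factorial : ℝ)⁻¹)
    exact h2
  have h3 : HasFDerivAt (jetPoly J c) _ c := HasFDerivAt.fun_sum fun j (_ : j ∈ Finset.univ) => hder j
  rw [h3.fderiv, sum_apply, Finset.sum_eq_single 1]
  · rw [smul_apply, (hasFDerivAt_diag (J 1) (c - c)).choose_spec.2]
    have h1 : (((1 : Fin (k + 2)) : ℕ).factorial : ℝ)⁻¹ = 1 := by simp
    rw [h1, one_smul, Finset.sum_eq_single ⟨0, by simp⟩]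
    · congr 1
      ext1 i
      have : i = ⟨0, by simp⟩ := Fin.ext (by have := i.2; simp at this; omega)
      rw [this, Function.update_self]
    · intro i _ hi
      exact absurd (Fin.ext (by have := i.2; simp at this; simpa using this)) hi
    · simp
  · intro j _ hj
    rw [smul_apply, (hasFDerivAt_diag (J j) (c - c)).choose_spec.2, Finset.sum_eq_zero, smul_zero]
    intro i _
    -- A second slot exists since `j ≠ 1`, and its entry is zero.
    have h2 : 1 < (j : ℕ) := by
      have h0 : (j : ℕ) ≠ 1 := fun h => hj (Fin.ext (by simpa using h))
      have := i.2
      omega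
    obtain ⟨i', hi'⟩ : ∃ i' : Fin (j : ℕ), i' ≠ i := by
      by_cases h : i = ⟨0, by omega⟩
      · exact ⟨⟨1, h2⟩, by rw [h]; simp⟩
      · exact ⟨⟨0, by omega⟩, fun h' => h h'.symm⟩
    exact (J j).map_coord_zero i' (by rw [Function.update_of_ne hi']; simp)
  · simp

/-- The `n`-th Taylor coefficient in time of the formal solution. -/
noncomputable def coeff (n : ℕ) (g : Coord d → Fin d → Fin d → ℝ) (Y V : Coord p → Coord d)
    (u : Coord p) : Coord d :=
  (n.factorial : ℝ)⁻¹ • (tderiv^[n] (approx g Y V n)) (u, 0)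

/-- Locality: the `n`-th Taylor coefficient is a derivative of order `n` of the formal solution, so it
depends only on the derivatives of the data of order at most `n`. -/
theorem coeff_eq_of_jetEq {g g' : Coord d → Fin d → Fin d → ℝ} {Y Y' V V' : Coord p → Coord d}
    {u u' : Coord p} (h : DataNear g Y V u) (h' : DataNear g' Y' V' u')
    (hg : JetEq (n + 1) g (Y u) g' (Y' u')) (hY : JetEq (n + 1) Y u Y' u')
    (hV : JetEq (n + 1) V u V' u') : coeff n g Y V u = coeff n g' Y' V' u' := by
  rw [coeff, coeff, ((JetEq.approx h h' hg hY hV n).tderiv_iterate (h.approx_smooth n 0)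
    (h'.approx_smooth n 0) n).value (by omega)]

/-- Homogeneity of the `n`-th Taylor coefficient in the velocity, by rescaling of time. -/
theorem DataNear.coeff_smul {g : Coord d → Fin d → Fin d → ℝ} {Y V : Coord p → Coord d}
    {u : Coord p} (h : DataNear g Y V u) (c : ℝ) (n : ℕ) :
    coeff n g Y (fun v => c • V v) u = c ^ n • coeff n g Y V u := by
  have hev : approx g Y (fun v => c • V v) n =ᶠ[𝓝 (u, 0)] fun q =>
      approx g Y V n (timeScale p c q) := by
    filter_upwards [continuousAt_fst.eventually h.eventually] with w hw using hw.approx_smul c n w.2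
  have hS : timeScale p c (u, 0) = (u, 0) := by rw [timeScale_apply]; simp
  have h1 := ((tderiv_iterate_congr hev n).trans (tderiv_timeScale (by
    rw [hS]; exact h.approx_smooth n 0) n)).self_of_nhds
  beta_reduce at h1
  rw [coeff, h1, hS, smul_comm, coeff]

/-- The coefficient as a function of the jets of the data. -/
noncomputable def jetCoeff (n : ℕ) (J : Jet d (Fin d → Fin d → ℝ) (n + 1) ×
    Jet p (Coord d) (n + 1)) (JV : Jet p (Coord d) (n + 1)) : Coord d :=
  coeff n (jetPoly J.1 (J.2 0 fun _ => 0)) (jetPoly J.2 0) (jetPoly JV 0) 0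

theorem dataNear_jetPoly {J : Jet d (Fin d → Fin d → ℝ) (n + 1) × Jet p (Coord d) (n + 1)}
    (hJ : J ∈ nondegenerateJets p d n) (JV : Jet p (Coord d) (n + 1)) :
    DataNear (jetPoly J.1 (J.2 0 fun _ => 0)) (jetPoly J.2 0) (jetPoly JV 0) 0 where
  metric := smoothNear_of_contDiff (contDiff_jetPoly_right _ _)
  imm := smoothNear_of_contDiff (contDiff_jetPoly_right _ _)
  field := smoothNear_of_contDiff (contDiff_jetPoly_right _ _)
  det_metric := by
    rw [jetPoly_self, jetPoly_self]
    exact hJ.1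
  det_induced := by
    rw [jetPoly_self, jetPoly_self]
    have := hJ.2
    unfold pullG
    simp only [fderiv_jetPoly, innerL_apply]
    exact this

theorem smoothNear_jetCoeff {J : Jet d (Fin d → Fin d → ℝ) (n + 1) × Jet p (Coord d) (n + 1)}
    (hJ : J ∈ nondegenerateJets p d n) (JV : Jet p (Coord d) (n + 1)) :
    SmoothNear (Function.uncurry fun J => jetCoeff (p := p) (d := d) n J) (J, JV) := by
  have hg : ContDiff ℝ ∞ (Function.uncurry fun (θ : (Jet d (Fin d → Fin d → ℝ) (n + 1) ×
      Jet p (Coord d) (n + 1)) × Jet p (Coord d) (n + 1)) =>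
        jetPoly θ.1.1 (θ.1.2 0 fun _ => 0)) := by
    have h0 : ContDiff ℝ ∞ fun w : ((Jet d (Fin d → Fin d → ℝ) (n + 1) ×
      Jet p (Coord d) (n + 1)) × Jet p (Coord d) (n + 1)) × Coord d => w.1.1.2 0 fun _ => 0 := by
      have h1 : ContDiff ℝ ∞ fun J : Jet p (Coord d) (n + 1) => J 0 := contDiff_pi.1 contDiff_id 0
      have h2 : ContDiff ℝ ∞ fun J : Jet p (Coord d) (n + 1) => J 0 fun _ => 0 :=
        (contDiff_multilinear_apply ((0 : Fin (n + 2)) : ℕ)).comp (h1.prodMk contDiff_const)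
      exact h2.comp (contDiff_snd.comp (contDiff_fst.comp contDiff_fst))
    exact contDiff_jetPoly.comp ((contDiff_fst.comp (contDiff_fst.comp contDiff_fst)).prodMk
      (h0.prodMk contDiff_snd))
  have hY : ContDiff ℝ ∞ (Function.uncurry fun (θ : (Jet d (Fin d → Fin d → ℝ) (n + 1) ×
      Jet p (Coord d) (n + 1)) × Jet p (Coord d) (n + 1)) => jetPoly θ.1.2 0) :=
    contDiff_jetPoly.comp ((contDiff_snd.comp (contDiff_fst.comp contDiff_fst)).prodMk
      (contDiff_const.prodMk contDiff_snd))
  have hV : ContDiff ℝ ∞ (Function.uncurry fun (θ : (Jet d (Fin d → Fin d → ℝ) (n + 1) ×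
      Jet p (Coord d) (n + 1)) × Jet p (Coord d) (n + 1)) => jetPoly θ.2 0) :=
    contDiff_jetPoly.comp ((contDiff_snd.comp contDiff_fst).prodMk
      (contDiff_const.prodMk contDiff_snd))
  have h1 := SmoothNear.tderiv_param (approx_smooth_param (θ := (J, JV)) (u := 0)
    (smoothNear_of_contDiff hg) (smoothNear_of_contDiff hY) (smoothNear_of_contDiff hV)
    (dataNear_jetPoly hJ JV) n 0) n
  have h2 := SmoothNear.comp (f := fun θ : (Jet d (Fin d → Fin d → ℝ) (n + 1) ×
      Jet p (Coord d) (n + 1)) × Jet p (Coord d) (n + 1) => (θ, ((0 : Coord p), (0 : ℝ)))) h1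
    (smoothNear_of_contDiff (x := (J, JV)) (contDiff_id.prodMk contDiff_const))
  exact (smoothNear_of_contDiff (contDiff_const (c := (n.factorial : ℝ)⁻¹))).smul h2

/-- The operators: the polarisations of the homogeneous functions `jetCoeff`. -/
noncomputable def operators (p d : ℕ) : LocalOperators p d := fun n Jg JY =>
  (n.factorial : ℝ)⁻¹ • iteratedFDeriv ℝ n (jetCoeff n (Jg, JY)) 0

theorem operators_smooth (p d : ℕ) : (operators p d).Smooth := by
  intro n J hJ
  have h1 := SmoothNear.iteratedFDeriv_param (smoothNear_jetCoeff hJ 0) n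
  have h2 := SmoothNear.comp (f := fun J : Jet d (Fin d → Fin d → ℝ) (n + 1) ×
      Jet p (Coord d) (n + 1) => (J, (0 : Jet p (Coord d) (n + 1)))) h1
    (smoothNear_of_contDiff (contDiff_id.prodMk contDiff_const))
  exact (h2.contDiffAt.const_smul ((n.factorial : ℝ)⁻¹)).contDiffWithinAt

theorem iteratedDeriv_smul_arg {E : Type} [NormedAddCommGroup E] [NormedSpace ℝ E] {f : E → F}
    (hf : ContDiff ℝ ∞ f) (x : E) (n : ℕ) :
    iteratedDeriv n (fun c : ℝ => f (c • x)) 0 = iteratedFDeriv ℝ n f 0 fun _ => x := by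
  set S := (ContinuousLinearMap.id ℝ ℝ).smulRight x
  have : (fun c : ℝ => f (c • x)) = f ∘ S := rfl
  rw [iteratedDeriv, this, S.iteratedFDeriv_comp_right hf 0 (by exact_mod_cast le_top), map_zero]
  simp [S]

/-- A smooth function that is homogeneous of degree `n` is recovered from its `n`-th derivative at
zero. -/
theorem operators_diag {J : Jet d (Fin d → Fin d → ℝ) (n + 1) × Jet p (Coord d) (n + 1)}
    (hJ : J ∈ nondegenerateJets p d n) (JV : Jet p (Coord d) (n + 1)) :
    operators p d n J.1 J.2 (fun _ => JV) = jetCoeff n J JV := by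
  have hn : (n.factorial : ℝ) ≠ 0 := by exact_mod_cast n.factorial_ne_zero
  have hsm : ContDiff ℝ ∞ (jetCoeff n J) := contDiff_iff_contDiffAt.2 fun JV =>
    ContDiffAt.comp JV (f := fun JV => (J, JV)) (smoothNear_jetCoeff hJ JV).contDiffAt
      (contDiffAt_const.prodMk contDiffAt_id)
  have hhom : ∀ c : ℝ, jetCoeff n J (c • JV) = c ^ n • jetCoeff n J JV := by
    intro c
    have : jetPoly (c • JV) 0 = fun v => c • jetPoly JV 0 v := by
      ext1 v
      simp only [jetPoly, Finset.smul_sum]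
      exact Finset.sum_congr rfl fun j _ => smul_comm _ _ _
    rw [jetCoeff, this, (dataNear_jetPoly hJ JV).coeff_smul, jetCoeff]
  -- Compare the `n`-th derivatives at `0` of `c ↦ f (c • JV) = c ^ n • f JV`.
  have h1 := iteratedDeriv_smul_arg hsm JV n
  simp only [hhom] at h1
  rw [iteratedDeriv_pow_smul, if_pos rfl] at h1
  rw [operators, smul_apply, ← h1, smul_smul, inv_mul_cancel₀ hn, one_smul]

/-- The operators give the Taylor coefficients of the formal solutions. -/
theorem DataNear.operators_eq {g : Coord d → Fin d → Fin d → ℝ} {Y V : Coord p → Coord d}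
    {u : Coord p} (h : DataNear g Y V u) (n : ℕ) :
    operators p d n (jet (n + 1) g (Y u)) (jet (n + 1) Y u) (fun _ => jet (n + 1) V u) =
      coeff n g Y V u := by
  have hY0 : jet (n + 1) Y u 0 (fun _ => 0) = Y u := rfl
  have hY1 : ∀ a, jet (n + 1) Y u 1 (fun _ => a) = fderiv ℝ Y u a := fun a =>
    iteratedFDeriv_one_apply fun _ => a
  have hJ : (jet (n + 1) g (Y u), jet (n + 1) Y u) ∈ nondegenerateJets p d n := by
    refine ⟨h.det_metric, ?_⟩
    have := h.det_induced
    unfold pullG at this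
    simp only [innerL_apply] at this
    simp only [hY1]
    exact this
  have hd := dataNear_jetPoly hJ (jet (n + 1) V u)
  rw [operators_diag (J := (jet (n + 1) g (Y u), jet (n + 1) Y u)) hJ, jetCoeff]
  refine (coeff_eq_of_jetEq h hd ?_ ?_ ?_).symm
  · rw [jetPoly_self]
    exact (jetEq_jetPoly (k := n + 1) h.metric.contDiffAt _).mono (by omega)
  · exact (jetEq_jetPoly (k := n + 1) h.imm.contDiffAt _).mono (by omega)
  · exact (jetEq_jetPoly (k := n + 1) h.field.contDiffAt _).mono (by omega)

end Operators

/-! ### Coordinate expressions on manifolds -/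

section Charts

set_option linter.unusedSectionVars false

variable {n p d : ℕ}
  {M : Type*} [TopologicalSpace M] [ChartedSpace (Coord d) M] [IsManifold (𝓡 d) ∞ M]
  {M' : Type*} [TopologicalSpace M'] [ChartedSpace (Coord d) M'] [IsManifold (𝓡 d) ∞ M']
  {N : Type*} [TopologicalSpace N] [ChartedSpace (Coord p) N] [IsManifold (𝓡 p) ∞ N]
  {N' : Type*} [TopologicalSpace N'] [ChartedSpace (Coord p) N'] [IsManifold (𝓡 p) ∞ N']
  {E : Type*} [NormedAddCommGroup E] [NormedSpace ℝ E]

theorem one_le_infty : (1 : ℕ∞ω) ≤ ∞ := by simp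

theorem infty_ne_zero : (∞ : ℕ∞ω) ≠ 0 := by simp

/-- The components of a tangent vector in the chart `φ`. -/
noncomputable def toChart (φ : OpenPartialHomeomorph M (Coord d)) (x : M)
    (ξ : TangentSpace (𝓡 d) x) : Coord d := mfderiv (𝓡 d) (𝓡 d) φ x ξ

/-- The tangent vector at `φ.symm y` with given components in the chart `φ`. -/
noncomputable def ofChart (φ : OpenPartialHomeomorph M (Coord d)) (y : Coord d) (a : Coord d) :
    TangentSpace (𝓡 d) (φ.symm y) := mfderiv (𝓡 d) (𝓡 d) φ.symm y a

namespace IsChart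

variable {φ : OpenPartialHomeomorph M (Coord d)}

theorem contMDiffAt (h : IsChart φ) {x : M} (hx : x ∈ φ.source) :
    ContMDiffAt (𝓡 d) (𝓡 d) ∞ φ x := contMDiffAt_of_mem_maximalAtlas h hx

theorem contMDiffAt_symm (h : IsChart φ) {y : Coord d} (hy : y ∈ φ.target) :
    ContMDiffAt (𝓡 d) (𝓡 d) ∞ φ.symm y := contMDiffAt_symm_of_mem_maximalAtlas h hy

theorem mdiff (h : IsChart φ) : φ.MDifferentiable (𝓡 d) (𝓡 d) :=
  ⟨fun _ hx => ((h.contMDiffAt hx).mdifferentiableAt infty_ne_zero).mdifferentiableWithinAt,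
    fun _ hy => ((h.contMDiffAt_symm hy).mdifferentiableAt infty_ne_zero).mdifferentiableWithinAt⟩

theorem ofChart_toChart (h : IsChart φ) {x : M} (hx : x ∈ φ.source) (ξ : TangentSpace (𝓡 d) x) :
    (ofChart φ (φ x) (toChart φ x ξ) : Coord d) = ξ :=
  DFunLike.congr_fun (h.mdiff.symm_comp_deriv hx) ξ

theorem toChart_ofChart (h : IsChart φ) {y : Coord d} (hy : y ∈ φ.target) (a : Coord d) :
    toChart φ (φ.symm y) (ofChart φ y a) = a :=
  DFunLike.congr_fun (h.mdiff.comp_symm_deriv hy) a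

/-- The derivative of the coordinate expression of a map. -/
theorem fderiv_comp (h : IsChart φ) {f : E → M} {u : E} (hf : MDifferentiableAt 𝓘(ℝ, E) (𝓡 d) f u)
    (hu : f u ∈ φ.source) (w : E) : fderiv ℝ (fun v => φ (f v)) u w =
      toChart φ (f u) (mfderiv 𝓘(ℝ, E) (𝓡 d) f u w) := by
  have h1 := mfderiv_comp u ((h.contMDiffAt hu).mdifferentiableAt infty_ne_zero) hf
  rw [← mfderiv_eq_fderiv]
  exact DFunLike.congr_fun h1 w

end IsChart

/-- The tangent map of a smooth map applied to a smooth family of vectors. -/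
theorem contMDiffAt_tangent {P : Type*} [TopologicalSpace P] {EP HP : Type*}
    [NormedAddCommGroup EP] [NormedSpace ℝ EP] [TopologicalSpace HP] {IP : ModelWithCorners ℝ EP HP}
    [ChartedSpace HP P] {s : Set M} (hs : IsOpen s) {f : M → M'}
    (hf : ContMDiffOn (𝓡 d) (𝓡 d) ∞ f s) {σ : P → TangentBundle (𝓡 d) M} {q : P}
    (hσ : ContMDiffAt IP (𝓡 d).tangent ∞ σ q) (hq : (σ q).1 ∈ s) :
    ContMDiffAt IP (𝓡 d).tangent ∞ (fun q =>
      (⟨f (σ q).1, mfderiv (𝓡 d) (𝓡 d) f (σ q).1 (σ q).2⟩ : TangentBundle (𝓡 d) M')) q := by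
  have : IsManifold (𝓡 d) 1 M := IsManifold.of_le one_le_infty
  have : IsManifold (𝓡 d) 1 M' := IsManifold.of_le one_le_infty
  have hopen : IsOpen (Bundle.TotalSpace.proj ⁻¹' s : Set (TangentBundle (𝓡 d) M)) :=
    hs.preimage (FiberBundle.continuous_proj _ _)
  have h1 := (hf.contMDiffOn_tangentMapWithin (m := ∞) (by simp) hs.uniqueMDiffOn).contMDiffAt
    (hopen.mem_nhds hq)
  have h2 := h1.comp q hσ
  refine h2.congr_of_eventuallyEq ?_
  filter_upwards [hσ.continuousAt.eventually (hopen.mem_nhds hq)] with q' hq'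
  simp only [Function.comp_apply, tangentMapWithin, mfderivWithin_of_isOpen hs hq']

theorem contMDiffAt_vectorSpace_mk {P : Type*} [TopologicalSpace P] {EP HP : Type*}
    [NormedAddCommGroup EP] [NormedSpace ℝ EP] [TopologicalSpace HP] {IP : ModelWithCorners ℝ EP HP}
    [ChartedSpace HP P] {f V : P → Coord d} {q : P} (hf : ContMDiffAt IP (𝓡 d) ∞ f q)
    (hV : ContMDiffAt IP (𝓡 d) ∞ V q) : ContMDiffAt IP (𝓡 d).tangent ∞ (fun q =>
      (⟨f q, V q⟩ : TangentBundle (𝓡 d) (Coord d))) q := by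
  apply Bundle.contMDiffAt_totalSpace.2
  refine ⟨hf, ?_⟩
  convert! hV with y
  simp

/-- The metric in coordinates. -/
theorem inner_chartMetric (g : Metric d M) (φ : OpenPartialHomeomorph M (Coord d)) (y a b : Coord d) :
    innerL d (chartMetric g φ y) a b =
      g.inner (φ.symm y) (ofChart φ y a) (ofChart φ y b) := by
  set L : Coord d →L[ℝ] Coord d := mfderiv (𝓡 d) (𝓡 d) φ.symm y
  set B : Coord d →L[ℝ] Coord d →L[ℝ] ℝ := g.inner (φ.symm y)
  have : innerL d (chartMetric g φ y) =
      (ContinuousLinearMap.compL ℝ (Coord d) (Coord d) ℝ).flip L ∘L B ∘L L := by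
    refine clm_ext_basis fun a => clm_ext_basis fun b => ?_
    rw [innerL_basis]; rfl
  rw [this]; rfl

theorem inner_eq_chartMetric (g : Metric d M) {φ : OpenPartialHomeomorph M (Coord d)}
    (hφ : IsChart φ) {x : M} (hx : x ∈ φ.source) (ξ η : TangentSpace (𝓡 d) x) :
    innerL d (chartMetric g φ (φ x)) (toChart φ x ξ) (toChart φ x η) =
      g.inner x ξ η := by
  have key : ∀ x', x' = x → ∀ ξ' η' : Coord d, ξ' = ξ → η' = η →
      g.inner x' ξ' η' = g.inner x ξ η := by
    rintro x' rfl ξ' η' rfl rfl; rfl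
  rw [inner_chartMetric]
  exact key _ (φ.left_inv hx) _ _ (hφ.ofChart_toChart hx ξ) (hφ.ofChart_toChart hx η)

theorem metricNear_chartMetric (g : Metric d M) {φ : OpenPartialHomeomorph M (Coord d)}
    (hφ : IsChart φ) {y : Coord d} (hy : y ∈ φ.target) : MetricNear (chartMetric g φ) y where
  smooth := by
    filter_upwards [φ.open_target.mem_nhds hy] with y hy
    refine contDiffAt_pi.2 fun μ => contDiffAt_pi.2 fun ν => ?_
    have hsec : ∀ a : Coord d, ContMDiffAt (𝓡 d) (𝓡 d).tangent ∞ (fun y =>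
        (⟨φ.symm y, mfderiv (𝓡 d) (𝓡 d) φ.symm y a⟩ : TangentBundle (𝓡 d) M)) y := fun a =>
      contMDiffAt_tangent (σ := fun y => (⟨y, a⟩ : TangentBundle (𝓡 d) (Coord d)))
        φ.open_target (contMDiffOn_symm_of_mem_maximalAtlas hφ)
        (contMDiffAt_vectorSpace_mk contMDiffAt_id contMDiffAt_const) hy
    have hg := (g.contMDiff (φ.symm y)).comp y (hφ.contMDiffAt_symm hy)
    have h1 := ContMDiffAt.clm_bundle_apply₂ (F₁ := Coord d) (F₂ := Coord d) (F₃ := ℝ)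
      (E₁ := fun x : M => TangentSpace (𝓡 d) x) (E₂ := fun x : M => TangentSpace (𝓡 d) x)
      (E₃ := Bundle.Trivial M ℝ) (b := φ.symm) (n := ∞) (ψ := fun y => g.inner (φ.symm y))
      hg (hsec (basisVec μ)) (hsec (basisVec ν))
    have h2 := (Bundle.contMDiffAt_totalSpace.1 h1).2
    exact contMDiffAt_iff_contDiffAt.1 h2
  metric := by
    filter_upwards [φ.open_target.mem_nhds hy] with y hy
    refine ⟨fun ξ η => ?_, fun ξ hξ => ?_⟩
    · rw [inner_chartMetric, inner_chartMetric, g.symm]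
    · rw [inner_chartMetric]
      refine g.pos _ _ fun h0 => hξ ?_
      rw [← hφ.toChart_ofChart hy ξ, h0]
      exact map_zero _

theorem IsWeylRescaling.weylNear {g g' : Metric d M} {σ : M → ℝ} (h : IsWeylRescaling g g' σ)
    {φ : OpenPartialHomeomorph M (Coord d)} (hφ : IsChart φ) {y : Coord d} (hy : y ∈ φ.target) :
    WeylNear (chartMetric g φ) (chartMetric g' φ) (fun y => σ (φ.symm y)) y where
  metric := metricNear_chartMetric g hφ hy
  smooth := by
    filter_upwards [φ.open_target.mem_nhds hy] with y hy
    exact contMDiffAt_iff_contDiffAt.1 ((h.1 _).comp y (hφ.contMDiffAt_symm hy))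
  eq := Eventually.of_forall fun y => by
    ext μ ν
    exact h.2 _ _ _

/-- The coordinate expression of a pair of charts of a diffeomorphism that preserves the metrics is
a local isometry. -/
theorem IsPullback.localIsometry {Φ : M ≃ₘ^∞⟮𝓡 d, 𝓡 d⟯ M'} {g : Metric d M} {g' : Metric d M'}
    (h : IsPullback Φ g g') {φ : OpenPartialHomeomorph M (Coord d)}
    {φ' : OpenPartialHomeomorph M' (Coord d)} (hφ : IsChart φ) (hφ' : IsChart φ') {y : Coord d}
    (hy : y ∈ φ.target) (hy' : Φ (φ.symm y) ∈ φ'.source) :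
    LocalIsometry (chartMetric g φ) (chartMetric g' φ') (fun y => φ' (Φ (φ.symm y))) y := by
  have hev : ∀ᶠ z in 𝓝 y, z ∈ φ.target ∧ Φ (φ.symm z) ∈ φ'.source := by
    refine (show ∀ᶠ z in 𝓝 y, z ∈ φ.target from φ.open_target.mem_nhds hy).and ?_
    exact (Φ.continuous.continuousAt.comp (φ.continuousAt_symm hy)).eventually
      (φ'.open_source.mem_nhds hy')
  constructor
  · refine hev.mono fun z hz => ?_
    exact contMDiffAt_iff_contDiffAt.1 ((hφ'.contMDiffAt hz.2).comp z
      ((Φ.contMDiff _).comp z (hφ.contMDiffAt_symm hz.1)))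
  · filter_upwards [hev] with z hz ξ η
    have hd1 : MDifferentiableAt (𝓡 d) (𝓡 d) φ.symm z :=
      (hφ.contMDiffAt_symm hz.1).mdifferentiableAt infty_ne_zero
    have hd2 : MDifferentiableAt (𝓡 d) (𝓡 d) Φ (φ.symm z) :=
      (Φ.contMDiff _).mdifferentiableAt infty_ne_zero
    have h1 : ∀ ξ : Coord d, fderiv ℝ (fun y => φ' (Φ (φ.symm y))) z ξ =
        toChart φ' (Φ (φ.symm z)) (mfderiv (𝓡 d) (𝓡 d) Φ (φ.symm z) (ofChart φ z ξ)) := by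
      intro ξ
      rw [hφ'.fderiv_comp (f := fun y => Φ (φ.symm y)) (hd2.comp z hd1) hz.2 ξ]
      congr 1
      exact DFunLike.congr_fun (mfderiv_comp z hd2 hd1) ξ
    rw [h1, h1, inner_eq_chartMetric g' hφ' hz.2, h, inner_chartMetric]

end Charts

/-! ### Families of submanifolds in charts -/

section Families

set_option linter.unusedSectionVars false

variable {n p d : ℕ}
  {M : Type*} [TopologicalSpace M] [ChartedSpace (Coord d) M] [IsManifold (𝓡 d) ∞ M]
  {M' : Type*} [TopologicalSpace M'] [ChartedSpace (Coord d) M'] [IsManifold (𝓡 d) ∞ M']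
  {N : Type*} [TopologicalSpace N] [ChartedSpace (Coord p) N] [IsManifold (𝓡 p) ∞ N]
  {N' : Type*} [TopologicalSpace N'] [ChartedSpace (Coord p) N'] [IsManifold (𝓡 p) ∞ N']
  {ψ : OpenPartialHomeomorph N (Coord p)} {φ : OpenPartialHomeomorph M (Coord d)}
  {ψ' : OpenPartialHomeomorph N' (Coord p)} {φ' : OpenPartialHomeomorph M' (Coord d)}
  {X : N → ℝ → M} {W : Set (N × ℝ)} {u : Coord p} {t : ℝ} {g : Metric d M} {g' : Metric d M'}

/-- The family `X`, which is defined in `W`, is described at the coordinates `u` and the time `t` by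
the charts `ψ` and `φ`. -/
structure InCharts (ψ : OpenPartialHomeomorph N (Coord p)) (φ : OpenPartialHomeomorph M (Coord d))
    (X : N → ℝ → M) (W : Set (N × ℝ)) (u : Coord p) (t : ℝ) : Prop where
  source : u ∈ ψ.target
  dom : (ψ.symm u, t) ∈ W
  target : X (ψ.symm u) t ∈ φ.source

theorem InCharts.of_mem {z : N} (h : (z, t) ∈ W) (hz : z ∈ ψ.source) (hx : X z t ∈ φ.source) :
    InCharts ψ φ X W (ψ z) t :=
  ⟨ψ.map_source hz, by rwa [ψ.left_inv hz], by rwa [ψ.left_inv hz]⟩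

theorem contMDiffAt_of_contMDiffOn (hW : IsOpen W)
    (hX : ContMDiffOn ((𝓡 p).prod 𝓘(ℝ, ℝ)) (𝓡 d) ∞ (Function.uncurry X) W) {q : N × ℝ} (hq : q ∈ W) :
    ContMDiffAt ((𝓡 p).prod 𝓘(ℝ, ℝ)) (𝓡 d) ∞ (Function.uncurry X) q :=
  hX.contMDiffAt (hW.mem_nhds hq)

namespace InCharts

theorem eventually (h : InCharts ψ φ X W u t) (hW : IsOpen W)
    (hX : ContMDiffOn ((𝓡 p).prod 𝓘(ℝ, ℝ)) (𝓡 d) ∞ (Function.uncurry X) W) :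
    ∀ᶠ q in 𝓝 (u, t), InCharts ψ φ X W q.1 q.2 := by
  have h1 : ContinuousAt (fun q : Coord p × ℝ => (ψ.symm q.1, q.2)) (u, t) :=
    ((ψ.continuousAt_symm h.source).comp (x := (u, t)) continuousAt_fst).prodMk continuousAt_snd
  have h2 : ContinuousAt (fun q : Coord p × ℝ => Function.uncurry X (ψ.symm q.1, q.2)) (u, t) :=
    ContinuousAt.comp (x := (u, t)) (f := fun q : Coord p × ℝ => (ψ.symm q.1, q.2))
      (g := Function.uncurry X) (contMDiffAt_of_contMDiffOn hW hX h.dom).continuousAt h1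
  filter_upwards [continuousAt_fst.eventually (ψ.open_target.mem_nhds h.source),
    h1.eventually (hW.mem_nhds h.dom), h2.eventually (φ.open_source.mem_nhds h.target)]
    with q h1 h2 h3 using ⟨h1, h2, h3⟩

theorem contDiffAt (h : InCharts ψ φ X W u t) (hψ : IsChart ψ) (hφ : IsChart φ) (hW : IsOpen W)
    (hX : ContMDiffOn ((𝓡 p).prod 𝓘(ℝ, ℝ)) (𝓡 d) ∞ (Function.uncurry X) W) :
    ContDiffAt ℝ ∞ (Function.uncurry (chartFamily ψ φ X)) (u, t) := by
  have h0 : ContMDiffAt 𝓘(ℝ, Coord p × ℝ) (𝓡 p) ∞ (fun q : Coord p × ℝ => ψ.symm q.1) (u, t) :=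
    (hψ.contMDiffAt_symm h.source).comp (u, t) contDiff_fst.contMDiff.contMDiffAt
  have h1 : ContMDiffAt 𝓘(ℝ, Coord p × ℝ) ((𝓡 p).prod 𝓘(ℝ, ℝ)) ∞
      (fun q : Coord p × ℝ => (ψ.symm q.1, q.2)) (u, t) :=
    h0.prodMk contDiff_snd.contMDiff.contMDiffAt
  have h2 := (contMDiffAt_of_contMDiffOn hW hX h.dom).comp (u, t) h1
  exact contMDiffAt_iff_contDiffAt.1 ((hφ.contMDiffAt h.target).comp (u, t) h2)

theorem smoothNear (h : InCharts ψ φ X W u t) (hψ : IsChart ψ) (hφ : IsChart φ) (hW : IsOpen W)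
    (hX : ContMDiffOn ((𝓡 p).prod 𝓘(ℝ, ℝ)) (𝓡 d) ∞ (Function.uncurry X) W) :
    SmoothNear (Function.uncurry (chartFamily ψ φ X)) (u, t) := by
  filter_upwards [h.eventually hW hX] with q hq using hq.contDiffAt hψ hφ hW hX

end InCharts

namespace IsSmoothFamily

theorem contMDiffAt_space (hX : IsSmoothFamily p d X W) {z : N} (hz : (z, t) ∈ W) :
    ContMDiffAt (𝓡 p) (𝓡 d) ∞ (fun z' => X z' t) z :=
  (contMDiffAt_of_contMDiffOn hX.isOpen hX.smooth hz).comp z (f := fun z' => (z', t))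
    (contMDiffAt_id.prodMk contMDiffAt_const)

theorem contMDiffAt_time (hX : IsSmoothFamily p d X W) {z : N} (hz : (z, t) ∈ W) :
    ContMDiffAt 𝓘(ℝ, ℝ) (𝓡 d) ∞ (fun s => X z s) t :=
  (contMDiffAt_of_contMDiffOn hX.isOpen hX.smooth hz).comp t (f := fun s => (z, s))
    (contMDiffAt_const.prodMk contMDiffAt_id)

theorem fderiv_chartFamily (hX : IsSmoothFamily p d X W) (hψ : IsChart ψ) (hφ : IsChart φ)
    (h : InCharts ψ φ X W u t) (w : Coord p) :
    fderiv ℝ (fun u' => chartFamily ψ φ X u' t) u w = toChart φ (X (ψ.symm u) t)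
      (mfderiv (𝓡 p) (𝓡 d) (fun z' => X z' t) (ψ.symm u) (ofChart ψ u w)) := by
  have h1 := (hX.contMDiffAt_space h.dom).mdifferentiableAt infty_ne_zero
  have h2 := (hψ.contMDiffAt_symm h.source).mdifferentiableAt infty_ne_zero
  have h3 := hφ.fderiv_comp (f := fun u' => X (ψ.symm u') t) (h1.comp u h2) h.target w
  refine h3.trans ?_
  congr 1
  exact DFunLike.congr_fun (mfderiv_comp u h1 h2) w

theorem familyNear (hX : IsSmoothFamily p d X W) (hψ : IsChart ψ) (hφ : IsChart φ)
    (h : InCharts ψ φ X W u t) (g : Metric d M) :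
    FamilyNear (chartMetric g φ) (chartFamily ψ φ X) u t where
  smooth := h.smoothNear hψ hφ hX.isOpen hX.smooth
  metric := metricNear_chartMetric g hφ (φ.map_source h.target)
  injective := by
    refine (injective_iff_map_eq_zero _).2 fun w hw => ?_
    rw [hX.fderiv_chartFamily hψ hφ h] at hw
    have h1 := hφ.ofChart_toChart h.target (mfderiv (𝓡 p) (𝓡 d) (fun z' => X z' t) (ψ.symm u)
      (ofChart ψ u w))
    rw [hw] at h1
    have h2 : mfderiv (𝓡 p) (𝓡 d) (fun z' => X z' t) (ψ.symm u) (ofChart ψ u w) = 0 :=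
      h1.symm.trans (map_zero (mfderiv (𝓡 d) (𝓡 d) φ.symm _))
    have h3 : ofChart ψ u w = 0 :=
      (injective_iff_map_eq_zero _).1 (hX.immersive _ _ h.dom) _ h2
    have h4 := hψ.toChart_ofChart h.source w
    rw [h3] at h4
    exact h4.symm.trans (map_zero (mfderiv (𝓡 p) (𝓡 p) ψ _))

theorem velV_chartFamily (hX : IsSmoothFamily p d X W) (hψ : IsChart ψ) (hφ : IsChart φ)
    (h : InCharts ψ φ X W u t) : velV (chartFamily ψ φ X) u t =
      toChart φ (X (ψ.symm u) t) (velocity X (ψ.symm u) t) := by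
  have h1 := (hX.contMDiffAt_time h.dom).mdifferentiableAt infty_ne_zero
  have h2 := hφ.fderiv_comp (f := fun s => X (ψ.symm u) s) h1 h.target (1 : ℝ)
  have h3 := hasDerivAt_slice (h.smoothNear hψ hφ hX.isOpen hX.smooth).differentiableAt
  exact h3.deriv.symm.trans (fderiv_apply_one_eq_deriv.symm.trans h2)

theorem isOrthogonalAt_iff (hX : IsSmoothFamily p d X W) (hψ : IsChart ψ) (hφ : IsChart φ)
    (h : InCharts ψ φ X W u t) (g : Metric d M) : IsOrthogonalAt p g X (ψ.symm u) t ↔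
      ∀ w, innerL d (chartMetric g φ (chartFamily ψ φ X u t)) (velV (chartFamily ψ φ X) u t)
        (fderiv ℝ (fun u' => chartFamily ψ φ X u' t) u w) = 0 := by
  have h1 : ∀ w, innerL d (chartMetric g φ (chartFamily ψ φ X u t)) (velV (chartFamily ψ φ X) u t)
      (fderiv ℝ (fun u' => chartFamily ψ φ X u' t) u w) = g.inner _ (velocity X (ψ.symm u) t)
        (mfderiv (𝓡 p) (𝓡 d) (fun z' => X z' t) (ψ.symm u) (ofChart ψ u w)) := by
    intro w
    rw [hX.velV_chartFamily hψ hφ h, hX.fderiv_chartFamily hψ hφ h]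
    exact inner_eq_chartMetric g hφ h.target _ _
  refine ⟨fun H w => (h1 w).trans (H _), fun H w => ?_⟩
  have h2 := H (toChart ψ (ψ.symm u) w)
  rw [h1] at h2
  have h3 : ofChart ψ u (toChart ψ (ψ.symm u) w) = w := by
    have := hψ.ofChart_toChart (ψ.map_target h.source) w
    rwa [ψ.right_inv h.source] at this
  rwa [h3] at h2

/-- A diffeomorphism of the ambient manifold and a diffeomorphism of the parameter manifold
transport smooth families. -/
theorem transport (hX : IsSmoothFamily p d X W) (Φ : M ≃ₘ^∞⟮𝓡 d, 𝓡 d⟯ M')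
    (Ψ : N' ≃ₘ^∞⟮𝓡 p, 𝓡 p⟯ N) : IsSmoothFamily p d (fun z t => Φ (X (Ψ z) t))
      {q : N' × ℝ | (Ψ q.1, q.2) ∈ W} where
  isOpen := hX.isOpen.preimage ((Ψ.continuous.comp continuous_fst).prodMk continuous_snd)
  smooth := by
    intro q hq
    have h1 : ContMDiffAt ((𝓡 p).prod 𝓘(ℝ, ℝ)) ((𝓡 p).prod 𝓘(ℝ, ℝ)) ∞
        (fun q : N' × ℝ => (Ψ q.1, q.2)) q :=
      (Ψ.contMDiff.contMDiffAt.comp q contMDiffAt_fst).prodMk contMDiffAt_snd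
    have h2 := ContMDiffAt.comp q (contMDiffAt_of_contMDiffOn hX.isOpen hX.smooth hq) h1
    exact (Φ.contMDiff.contMDiffAt.comp q h2).contMDiffWithinAt
  immersive := by
    intro z t hz
    have h1 := (hX.contMDiffAt_space hz).mdifferentiableAt infty_ne_zero
    have h2 := (Ψ.contMDiff z).mdifferentiableAt infty_ne_zero
    have h3 := (Φ.contMDiff (X (Ψ z) t)).mdifferentiableAt infty_ne_zero
    have e1 := mfderiv_comp z h3 (h1.comp z h2)
    have e2 := mfderiv_comp z h1 h2
    have i1 : Function.Injective (mfderiv (𝓡 d) (𝓡 d) Φ (X (Ψ z) t)) := by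
      rw [← Φ.mfderivToContinuousLinearEquiv_coe infty_ne_zero]
      exact (Φ.mfderivToContinuousLinearEquiv infty_ne_zero _).injective
    have i2 : Function.Injective (mfderiv (𝓡 p) (𝓡 p) Ψ z) := by
      rw [← Ψ.mfderivToContinuousLinearEquiv_coe infty_ne_zero]
      exact (Ψ.mfderivToContinuousLinearEquiv infty_ne_zero _).injective
    have i3 := i1.comp ((hX.immersive _ _ hz).comp i2)
    have e3 : ∀ w, mfderiv (𝓡 p) (𝓡 d) (fun z' => Φ (X (Ψ z') t)) z w =
        mfderiv (𝓡 d) (𝓡 d) Φ (X (Ψ z) t)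
          (mfderiv (𝓡 p) (𝓡 d) (fun z' => X z' t) (Ψ z) (mfderiv (𝓡 p) (𝓡 p) Ψ z w)) := fun w =>
      (DFunLike.congr_fun e1 w).trans
        (congrArg (mfderiv (𝓡 d) (𝓡 d) Φ (X (Ψ z) t)) (DFunLike.congr_fun e2 w))
    intro a b hab
    exact i3 ((e3 a).symm.trans (hab.trans (e3 b)))

/-- The coordinate expressions of a family and of the transported family are related. -/
theorem relatedFamilies (hX : IsSmoothFamily p d X W) {Φ : M ≃ₘ^∞⟮𝓡 d, 𝓡 d⟯ M'}
    (Ψ : N' ≃ₘ^∞⟮𝓡 p, 𝓡 p⟯ N) (h : IsPullback Φ g g') (hψ : IsChart ψ) (hφ : IsChart φ)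
    (hψ' : IsChart ψ') (hφ' : IsChart φ') (hu : u ∈ ψ'.target) (hz : Ψ (ψ'.symm u) ∈ ψ.source)
    (hW : (Ψ (ψ'.symm u), t) ∈ W) (hx : X (Ψ (ψ'.symm u)) t ∈ φ.source)
    (hx' : Φ (X (Ψ (ψ'.symm u)) t) ∈ φ'.source) :
    RelatedFamilies (chartMetric g φ) (chartMetric g' φ') (fun y => φ' (Φ (φ.symm y)))
      (fun v => ψ (Ψ (ψ'.symm v))) (chartFamily ψ φ X)
      (chartFamily ψ' φ' fun z t => Φ (X (Ψ z) t)) u t := by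
  have hin : InCharts ψ φ X W (ψ (Ψ (ψ'.symm u))) t := InCharts.of_mem hW hz hx
  have hin' : InCharts ψ' φ' (fun z t => Φ (X (Ψ z) t)) {q : N' × ℝ | (Ψ q.1, q.2) ∈ W} u t :=
    ⟨hu, hW, hx'⟩
  have hval : φ.symm (chartFamily ψ φ X (ψ (Ψ (ψ'.symm u))) t) = X (Ψ (ψ'.symm u)) t := by
    rw [chartFamily, ψ.left_inv hz, φ.left_inv hx]
  have hev : ∀ᶠ v in 𝓝 u, v ∈ ψ'.target ∧ Ψ (ψ'.symm v) ∈ ψ.source :=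
    (show ∀ᶠ v in 𝓝 u, v ∈ ψ'.target from ψ'.open_target.mem_nhds hu).and
      ((Ψ.continuous.continuousAt.comp (ψ'.continuousAt_symm hu)).eventually
        (ψ.open_source.mem_nhds hz))
  have hrep : SmoothNear (fun v => ψ (Ψ (ψ'.symm v))) u := hev.mono fun v hv =>
    contMDiffAt_iff_contDiffAt.1 ((hψ.contMDiffAt hv.2).comp v
      ((Ψ.contMDiff _).comp v (hψ'.contMDiffAt_symm hv.1)))
  refine ⟨hX.familyNear hψ hφ hin g, (hX.transport Φ Ψ).familyNear hψ' hφ' hin' g',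
    h.localIsometry hφ hφ' (φ.map_source hin.target) (by rwa [hval]), hrep, ?_⟩
  have hc : Tendsto (fun q : Coord p × ℝ => (ψ (Ψ (ψ'.symm q.1)), q.2)) (𝓝 (u, t))
      (𝓝 (ψ (Ψ (ψ'.symm u)), t)) :=
    ContinuousAt.prodMk (ContinuousAt.comp (x := (u, t)) (f := Prod.fst)
      hrep.contDiffAt.continuousAt continuousAt_fst) continuousAt_snd
  have hev' : ∀ᶠ q in 𝓝 (u, t), q.1 ∈ ψ'.target ∧ Ψ (ψ'.symm q.1) ∈ ψ.source :=
    (continuousAt_fst (p := (u, t))).eventually hev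
  filter_upwards [hc.eventually (hin.eventually hX.isOpen hX.smooth), hev'] with q h1 h2
  have h3 := h1.target
  rw [ψ.left_inv h2.2] at h3
  simp only [chartFamily]
  rw [ψ.left_inv h2.2, φ.left_inv h3]

end IsSmoothFamily

/-- An immersion is a family that does not depend on time. -/
theorem IsSmoothImmersion.isSmoothFamily {Y : N → M} (hY : IsSmoothImmersion p d Y) :
    IsSmoothFamily p d (fun z _ => Y z) Set.univ where
  isOpen := isOpen_univ
  smooth := fun _ _ => (hY.1.contMDiffAt.comp _ contMDiffAt_fst).contMDiffWithinAt
  immersive := fun z _ _ => hY.2 z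

theorem IsSmoothImmersion.immersionNear {Y : N → M} (hY : IsSmoothImmersion p d Y)
    (hψ : IsChart ψ) (hφ : IsChart φ) (hu : u ∈ ψ.target) (hx : Y (ψ.symm u) ∈ φ.source)
    (g : Metric d M) : ImmersionNear (chartMetric g φ) (chartMap ψ φ Y) u :=
  (hY.isSmoothFamily.familyNear (t := 0) hψ hφ ⟨hu, trivial, hx⟩ g).imm

theorem IsSmoothImmersion.fderiv_chartMap {Y : N → M} (hY : IsSmoothImmersion p d Y)
    (hψ : IsChart ψ) (hφ : IsChart φ) (hu : u ∈ ψ.target) (hx : Y (ψ.symm u) ∈ φ.source)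
    (w : Coord p) : fderiv ℝ (chartMap ψ φ Y) u w =
      toChart φ (Y (ψ.symm u)) (mfderiv (𝓡 p) (𝓡 d) Y (ψ.symm u) (ofChart ψ u w)) :=
  hY.isSmoothFamily.fderiv_chartFamily (t := 0) hψ hφ ⟨hu, trivial, hx⟩ w

theorem contDiffAt_chartField {Y : N → M} {v : ∀ z, TangentSpace (𝓡 d) (Y z)}
    (hv : ContMDiffAt (𝓡 p) (𝓡 d).tangent ∞
      (fun z => (⟨Y z, v z⟩ : TangentBundle (𝓡 d) M)) (ψ.symm u))
    (hψ : IsChart ψ) (hφ : IsChart φ) (hu : u ∈ ψ.target)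
    (hx : Y (ψ.symm u) ∈ φ.source) : ContDiffAt ℝ ∞ (chartField ψ φ Y v) u := by
  have h1 := ContMDiffAt.comp u hv (hψ.contMDiffAt_symm hu)
  have h2 := contMDiffAt_tangent φ.open_source (contMDiffOn_of_mem_maximalAtlas hφ) h1 hx
  have h3 := (Bundle.contMDiffAt_totalSpace.1 h2).2
  rw [← contMDiffAt_iff_contDiffAt]
  convert! h3 with y
  simp
  rfl

theorem IsSmoothField.continuous {Y : N → M} {v : ∀ z, TangentSpace (𝓡 d) (Y z)}
    (hv : IsSmoothField p Y v) : Continuous Y :=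
  (FiberBundle.continuous_proj (Coord d) (fun x : M => TangentSpace (𝓡 d) x)).comp
    (ContMDiff.continuous hv)

theorem eventually_chart {Y : N → M} (hY : Continuous Y) (hu : u ∈ ψ.target)
    (hx : Y (ψ.symm u) ∈ φ.source) : ∀ᶠ u in 𝓝 u, u ∈ ψ.target ∧ Y (ψ.symm u) ∈ φ.source :=
  (show ∀ᶠ v in 𝓝 u, v ∈ ψ.target from ψ.open_target.mem_nhds hu).and
    ((hY.continuousAt.comp (ψ.continuousAt_symm hu)).eventually (φ.open_source.mem_nhds hx))

theorem IsSmoothField.smoothNear {Y : N → M} {v : ∀ z, TangentSpace (𝓡 d) (Y z)}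
    (hv : IsSmoothField p Y v) (hψ : IsChart ψ) (hφ : IsChart φ) (hu : u ∈ ψ.target)
    (hx : Y (ψ.symm u) ∈ φ.source) : SmoothNear (chartField ψ φ Y v) u :=
  (eventually_chart hv.continuous hu hx).mono fun u' h =>
    contDiffAt_chartField (hv (ψ.symm u')) hψ hφ h.1 h.2

/-- A field is normal if and only if its coordinate expressions are normal. -/
theorem isNormal_chart_iff {Y : N → M} (hY : IsSmoothImmersion p d Y)
    {v : ∀ z, TangentSpace (𝓡 d) (Y z)} (hψ : IsChart ψ) (hφ : IsChart φ) (hu : u ∈ ψ.target)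
    (hx : Y (ψ.symm u) ∈ φ.source) (g : Metric d M) :
    (∀ w, g.inner (Y (ψ.symm u)) (v (ψ.symm u)) (mfderiv (𝓡 p) (𝓡 d) Y (ψ.symm u) w) = 0) ↔
      ∀ w, innerL d (chartMetric g φ (chartMap ψ φ Y u)) (chartField ψ φ Y v u)
        (fderiv ℝ (chartMap ψ φ Y) u w) = 0 := by
  have h1 : ∀ w, innerL d (chartMetric g φ (chartMap ψ φ Y u)) (chartField ψ φ Y v u)
      (fderiv ℝ (chartMap ψ φ Y) u w) = g.inner (Y (ψ.symm u)) (v (ψ.symm u))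
        (mfderiv (𝓡 p) (𝓡 d) Y (ψ.symm u) (ofChart ψ u w)) := by
    intro w
    rw [hY.fderiv_chartMap hψ hφ hu hx]
    exact inner_eq_chartMetric g hφ hx _ _
  refine ⟨fun H w => (h1 w).trans (H _), fun H w => ?_⟩
  have h2 := H (toChart ψ (ψ.symm u) w)
  rw [h1] at h2
  have h3 : ofChart ψ u (toChart ψ (ψ.symm u) w) = w := by
    have := hψ.ofChart_toChart (ψ.map_target hu) w
    rwa [ψ.right_inv hu] at this
  rwa [h3] at h2

theorem HasInitialData.value {X₁ : N → M} {v : ∀ z, TangentSpace (𝓡 d) (X₁ z)}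
    (h : HasInitialData X W X₁ v) {z : N} (hz : (z, (0 : ℝ)) ∈ W) : X z 0 = X₁ z :=
  congrArg Bundle.TotalSpace.proj (h z hz)

theorem HasInitialData.chart_value {X₁ : N → M} {v : ∀ z, TangentSpace (𝓡 d) (X₁ z)}
    (h : HasInitialData X W X₁ v) (hu : InCharts ψ φ X W u 0) :
    chartFamily ψ φ X u 0 = chartMap ψ φ X₁ u := by
  rw [chartFamily, chartMap, h.value hu.dom]

theorem HasInitialData.chart_velocity {X₁ : N → M} {v : ∀ z, TangentSpace (𝓡 d) (X₁ z)}
    (h : HasInitialData X W X₁ v) (hX : IsSmoothFamily p d X W) (hψ : IsChart ψ) (hφ : IsChart φ)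
    (hu : InCharts ψ φ X W u 0) :
    velV (chartFamily ψ φ X) u 0 = chartField ψ φ X₁ v u := by
  rw [hX.velV_chartFamily hψ hφ hu]
  exact congrArg (fun P : TangentBundle (𝓡 d) M => toChart φ P.1 P.2) (h _ hu.dom)

theorem IsSmoothImmersion.dataNear {X₁ : N → M} (hX₁ : IsSmoothImmersion p d X₁)
    {v : ∀ z, TangentSpace (𝓡 d) (X₁ z)} (hv : IsSmoothField p X₁ v) (hψ : IsChart ψ)
    (hφ : IsChart φ) (hu : u ∈ ψ.target) (hx : X₁ (ψ.symm u) ∈ φ.source) (g : Metric d M) :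
    DataNear (chartMetric g φ) (chartMap ψ φ X₁) (chartField ψ φ X₁ v) u :=
  (hX₁.immersionNear hψ hφ hu hx g).dataNear (hv.smoothNear hψ hφ hu hx)

theorem IsSmoothImmersion.term_eq {X₁ : N → M} (hX₁ : IsSmoothImmersion p d X₁)
    {v : ∀ z, TangentSpace (𝓡 d) (X₁ z)} (hv : IsSmoothField p X₁ v) (hψ : IsChart ψ)
    (hφ : IsChart φ) (hu : u ∈ ψ.target) (hx : X₁ (ψ.symm u) ∈ φ.source) (g : Metric d M) (k : ℕ) :
    term (operators p d) g X₁ v ψ φ k u =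
      coeff k (chartMetric g φ) (chartMap ψ φ X₁) (chartField ψ φ X₁ v) u :=
  (hX₁.dataNear hv hψ hφ hu hx g).operators_eq k

end Families

/-! ### Weyl invariance, orthogonality and covariance on manifolds -/

section Invariance

set_option linter.unusedSectionVars false

variable {p d : ℕ}
  {M : Type*} [TopologicalSpace M] [ChartedSpace (Coord d) M] [IsManifold (𝓡 d) ∞ M]
  {M' : Type*} [TopologicalSpace M'] [ChartedSpace (Coord d) M'] [IsManifold (𝓡 d) ∞ M']
  {N : Type*} [TopologicalSpace N] [ChartedSpace (Coord p) N] [IsManifold (𝓡 p) ∞ N]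
  {N' : Type*} [TopologicalSpace N'] [ChartedSpace (Coord p) N'] [IsManifold (𝓡 p) ∞ N']
  {ψ : OpenPartialHomeomorph N (Coord p)} {φ : OpenPartialHomeomorph M (Coord d)}
  {X : N → ℝ → M} {W : Set (N × ℝ)} {u : Coord p} {t : ℝ} {g g' : Metric d M} {σ : M → ℝ}

theorem exists_chart {n : ℕ} {P : Type*} [TopologicalSpace P] [ChartedSpace (Coord n) P]
    [IsManifold (𝓡 n) ∞ P] (x : P) :
    ∃ e : OpenPartialHomeomorph P (Coord n), IsChart e ∧ x ∈ e.source :=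
  ⟨chartAt (Coord n) x, IsManifold.chart_mem_maximalAtlas x, mem_chart_source _ x⟩

theorem IsWeylRescaling.symm (h : IsWeylRescaling g g' σ) :
    IsWeylRescaling g' g fun x => -σ x := by
  refine ⟨contDiff_neg.contMDiff.comp h.1, fun x ξ η => ?_⟩
  rw [h.2, ← mul_assoc, ← Real.exp_add]
  simp

theorem IsNormalField.weyl {Y : N → M} {v : ∀ z, TangentSpace (𝓡 d) (Y z)}
    (hv : IsNormalField p g Y v) (h : IsWeylRescaling g g' σ) : IsNormalField p g' Y v := by
  intro z w
  rw [h.2, hv z w, mul_zero]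

/-- Weyl invariance of the equation where the velocity is normal. -/
theorem chartLHS_weyl (hp : 0 < p) (hX : IsSmoothFamily p d X W) (hw : IsWeylRescaling g g' σ)
    (hψ : IsChart ψ) (hφ : IsChart φ) (h : InCharts ψ φ X W u t)
    (ho : IsOrthogonalAt p g X (ψ.symm u) t) :
    chartLHS g' X ψ φ u t = chartLHS g X ψ φ u t := by
  have h1 := (hw.weylNear hφ (φ.map_source h.target)).evolutionLHS_eq hp
    (hX.familyNear hψ hφ h g)
  rw [(hX.isOrthogonalAt_iff hψ hφ h g).1 ho] at h1
  rw [chartLHS, h1]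
  simp [chartLHS]

/-- The evolution law of the tangential components of the velocity of a solution, in charts. -/
theorem hasDerivAt_inner_frame (hX : IsSmoothFamily p d X W) (hψ : IsChart ψ) (hφ : IsChart φ)
    (h : InCharts ψ φ X W u t) (h0 : chartLHS g X ψ φ u t = 0) (a : Fin p) :
    HasDerivAt (fun s => dot (chartMetric g φ (chartFamily ψ φ X u s)) (vel (chartFamily ψ φ X) u s)
        (frame (fun u' => chartFamily ψ φ X u' s) u a))
      (-(2 / (p : ℝ)) * dot (chartMetric g φ (chartFamily ψ φ X u t)) (vel (chartFamily ψ φ X) u t)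
          (traceFF (chartMetric g φ) (fun u' => chartFamily ψ φ X u' t) u) *
        dot (chartMetric g φ (chartFamily ψ φ X u t)) (vel (chartFamily ψ φ X) u t)
          (frame (fun u' => chartFamily ψ φ X u' t) u a)) t := by
  have hF := hX.familyNear hψ hφ h g
  have h1 := hF.hasDerivAt_inner_velocity (basisVec a)
  have h2 : ∀ s, FamilyNear (chartMetric g φ) (chartFamily ψ φ X) u s →
      dot (chartMetric g φ (chartFamily ψ φ X u s)) (vel (chartFamily ψ φ X) u s)
        (frame (fun u' => chartFamily ψ φ X u' s) u a) =
      innerL d (chartMetric g φ (chartFamily ψ φ X u s)) (velV (chartFamily ψ φ X) u s)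
        (fderiv ℝ (fun u' => chartFamily ψ φ X u' s) u (basisVec a)) := by
    intro s hs
    rw [hs.vel_eq, frame_eq hs.imm.smooth.differentiableAt, innerL_apply]
  refine (h1.congr_of_eventuallyEq (hF.eventually_time.mono h2)).congr_deriv ?_
  rw [chartLHS] at h0
  rw [h0, h2 t hF, hF.vel_eq, innerL_apply, innerL_apply, innerL_apply]
  simp [dot]

/-- A solution of a homogeneous linear equation vanishes near a point if it vanishes at some point
nearby. -/
theorem eventually_eq_zero_iff {f c : ℝ → ℝ} {t : ℝ} (hc : ContinuousAt c t)
    (hf : ∀ᶠ s in 𝓝 t, HasDerivAt f (c s * f s) s) : ∀ᶠ s in 𝓝 t, f t = 0 ↔ f s = 0 := by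
  have hb : ∀ᶠ s in 𝓝 t, |c s| < |c t| + 1 :=
    hc.abs.eventually (gt_mem_nhds (lt_add_one _))
  obtain ⟨ε, hε, hball⟩ := Metric.eventually_nhds_iff_ball.1 (hf.and hb)
  have key : ∀ s₀ ∈ Set.Ioo (t - ε) (t + ε), f s₀ = 0 →
      ∀ s ∈ Set.Ioo (t - ε) (t + ε), f s = 0 := by
    rw [← Real.ball_eq_Ioo]
    intro s₀ hs₀ h0
    rw [Real.ball_eq_Ioo] at hs₀
    have := ODE_solution_unique_of_mem_Ioo (v := fun s y => c s * y) (s := fun _ => Set.univ)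
      (K := ⟨|c t| + 1, by positivity⟩) (f := f) (g := fun _ => 0) (a := t - ε) (b := t + ε)
      (fun s hs => ?_) hs₀ (fun s hs => ?_) (fun s _ => ?_) h0
    · rw [Real.ball_eq_Ioo]; exact this
    · refine LipschitzOnWith.of_dist_le_mul fun x _ y _ => ?_
      rw [Real.dist_eq, Real.dist_eq, ← mul_sub, abs_mul]
      exact mul_le_mul_of_nonneg_right (hball s (by rwa [Real.ball_eq_Ioo])).2.le (abs_nonneg _)
    · exact ⟨(hball s (by rwa [Real.ball_eq_Ioo])).1, trivial⟩
    · exact ⟨by simpa using hasDerivAt_const s (0 : ℝ), trivial⟩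
  have ht : t ∈ Set.Ioo (t - ε) (t + ε) := ⟨by linarith, by linarith⟩
  filter_upwards [Ioo_mem_nhds ht.1 ht.2] with s hs
  exact ⟨fun h => key t ht h s hs, fun h => key s hs h t ht⟩

/-- Along a solution, orthogonality at one time implies orthogonality at nearby times, and conversely. -/
theorem eventually_isOrthogonalAt_iff (hX : IsSmoothFamily p d X W) (hs : SolvesEvolution p g X W)
    {z : N} (hz : (z, t) ∈ W) :
    ∀ᶠ s in 𝓝 t, IsOrthogonalAt p g X z t ↔ IsOrthogonalAt p g X z s := by
  obtain ⟨ψ, hψ, hzψ⟩ := exists_chart (n := p) z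
  obtain ⟨φ, hφ, hxφ⟩ := exists_chart (n := d) (X z t)
  have h := InCharts.of_mem (ψ := ψ) (φ := φ) hz hzψ hxφ
  have hF := hX.familyNear hψ hφ h g
  have hev : ∀ᶠ s in 𝓝 t, InCharts ψ φ X W (ψ z) s :=
    (Continuous.prodMk_right (ψ z)).continuousAt.eventually
      (h.eventually hX.isOpen hX.smooth)
  set x := chartFamily ψ φ X
  set G := chartMetric g φ
  set f : Fin p → ℝ → ℝ := fun a s =>
    innerL d (G (x (ψ z) s)) (velV x (ψ z) s) (fderiv ℝ (fun u' => x u' s) (ψ z) (basisVec a))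
  have hder : ∀ a, ∀ᶠ s in 𝓝 t, HasDerivAt (f a) (-(2 / (p : ℝ) * innerL d (G (x (ψ z) s))
      (velV x (ψ z) s) (WithLp.toLp 2 (traceFF G (fun u' => x u' s) (ψ z)))) * f a s) s := by
    intro a
    filter_upwards [hev] with s h
    have h1 := (hX.familyNear hψ hφ h g).hasDerivAt_inner_velocity (basisVec a)
    have h0 := hs ψ φ hψ hφ (ψ.symm (ψ z)) s h.dom (ψ.map_target h.source) h.target
    rw [ψ.left_inv hzψ, chartLHS] at h0
    rw [h0] at h1
    refine h1.congr_deriv ?_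
    simp only [map_zero, zero_apply, zero_sub, f, neg_mul]
    rfl
  have hc : ContinuousAt (fun s => -(2 / (p : ℝ) * innerL d (G (x (ψ z) s)) (velV x (ψ z) s)
      (WithLp.toLp 2 (traceFF G (fun u' => x u' s) (ψ z))))) t := by
    have h1 := SmoothNear.innerL (SmoothNear.comp (f := Function.uncurry x) hF.metric.smooth
      hF.smooth) hF.smooth.tderiv hF.smooth_traceFF
    exact (continuousAt_const.mul h1.slice.contDiffAt.continuousAt).neg
  have hall := eventually_all.2 fun a => eventually_eq_zero_iff hc (hder a)
  have horth : ∀ s, InCharts ψ φ X W (ψ z) s →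
      (IsOrthogonalAt p g X z s ↔ ∀ a, f a s = 0) := by
    intro s h
    have h1 := hX.isOrthogonalAt_iff hψ hφ h g
    rw [ψ.left_inv hzψ] at h1
    refine h1.trans ⟨fun H a => H _, fun H w => ?_⟩
    have h2 : (innerL d (G (x (ψ z) s)) (velV x (ψ z) s)).comp
        (fderiv ℝ (fun u' => x u' s) (ψ z)) = 0 := clm_ext_basis fun a => by simpa using H a
    exact DFunLike.congr_fun h2 w
  filter_upwards [hall, hev] with s h1 h2
  rw [horth t h, horth s h2]
  exact forall_congr' h1

/-- Orthogonality of the velocity persists. -/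
theorem isOrthogonalAt_of_solves (hX : IsSmoothFamily p d X W) {X₁ : N → M}
    {v : ∀ z, TangentSpace (𝓡 d) (X₁ z)}
    (hW : ∀ z t, (z, t) ∈ W → ∀ s ∈ Set.uIcc 0 t, (z, s) ∈ W) (hi : HasInitialData X W X₁ v)
    (hv : IsNormalField p g X₁ v) (hs : SolvesEvolution p g X W) {z : N} (hz : (z, t) ∈ W) :
    IsOrthogonalAt p g X z t := by
  have h1 : IsOrthogonalAt p g X z 0 ↔ IsOrthogonalAt p g X z t := by
    -- The statement is locally constant in time, and the times between `0` and `t` are connected.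
    refine (isPreconnected_uIcc (a := (0 : ℝ)) (b := t)).induction₂
      (fun a b => IsOrthogonalAt p g X z a ↔ IsOrthogonalAt p g X z b) (fun s hs' => ?_)
      (fun _ _ _ _ _ _ h h' => h.trans h') (fun _ _ _ _ h => h.symm)
      Set.left_mem_uIcc Set.right_mem_uIcc
    exact (eventually_isOrthogonalAt_iff hX hs (hW z t hz s hs')).filter_mono nhdsWithin_le_nhds
  refine h1.1 ?_
  have hz0 := hW z t hz 0 Set.left_mem_uIcc
  obtain ⟨ψ, hψ, hzψ⟩ := exists_chart (n := p) z
  obtain ⟨φ, hφ, hxφ⟩ := exists_chart (n := d) (X z 0)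
  have h := InCharts.of_mem (ψ := ψ) (φ := φ) hz0 hzψ hxφ
  intro w
  have h2 : (fun z' => X z' 0) =ᶠ[𝓝 z] X₁ := by
    filter_upwards [((Continuous.prodMk_left (0 : ℝ)).continuousAt (x := z)).eventually
      (hX.isOpen.mem_nhds hz0)] with z' hz' using hi.value hz'
  have h3 : ∀ (P Q : TangentBundle (𝓡 d) M), P = Q → ∀ b : Coord d,
      g.inner P.1 P.2 b = g.inner Q.1 Q.2 b := by rintro P _ rfl b; rfl
  have h4 := h3 _ _ (hi z hz0) (mfderiv (𝓡 p) (𝓡 d) (fun z' => X z' 0) z w)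
  refine h4.trans ?_
  rw [h2.mfderiv_eq]
  exact hv z w

/-- A solution with normal initial velocity solves the equation for every metric in the Weyl class. -/
theorem SolvesEvolution.weyl (hp : 0 < p) (hX : IsSmoothFamily p d X W) {X₁ : N → M}
    {v : ∀ z, TangentSpace (𝓡 d) (X₁ z)}
    (hW : ∀ z t, (z, t) ∈ W → ∀ s ∈ Set.uIcc 0 t, (z, s) ∈ W) (hi : HasInitialData X W X₁ v)
    (hv : IsNormalField p g X₁ v) (hw : IsWeylRescaling g g' σ) (hs : SolvesEvolution p g X W) :
    SolvesEvolution p g' X W := by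
  intro ψ φ hψ hφ z t hz hzψ hxφ
  have h := InCharts.of_mem (ψ := ψ) (φ := φ) hz hzψ hxφ
  rw [chartLHS_weyl hp hX hw hψ hφ h]
  · exact hs ψ φ hψ hφ z t hz hzψ hxφ
  · rw [ψ.left_inv hzψ]
    exact isOrthogonalAt_of_solves hX hW hi hv hs hz

/-- Covariance of the equation under diffeomorphisms, in arbitrary charts. -/
theorem chartLHS_transport {g' : Metric d M'} {ψ' : OpenPartialHomeomorph N' (Coord p)}
    {φ' : OpenPartialHomeomorph M' (Coord d)} (hX : IsSmoothFamily p d X W)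
    {Φ : M ≃ₘ^∞⟮𝓡 d, 𝓡 d⟯ M'} (Ψ : N' ≃ₘ^∞⟮𝓡 p, 𝓡 p⟯ N) (h : IsPullback Φ g g') (hψ : IsChart ψ)
    (hφ : IsChart φ) (hψ' : IsChart ψ') (hφ' : IsChart φ') {z : N'} (hz : Ψ z ∈ ψ.source)
    (hz' : z ∈ ψ'.source) (hW : (Ψ z, t) ∈ W) (hx : X (Ψ z) t ∈ φ.source)
    (hx' : Φ (X (Ψ z) t) ∈ φ'.source) :
    chartLHS g' (fun z t => Φ (X (Ψ z) t)) ψ' φ' (ψ' z) t =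
      fderiv ℝ (fun y => φ' (Φ (φ.symm y))) (φ (X (Ψ z) t)) (chartLHS g X ψ φ (ψ (Ψ z)) t) := by
  have e := ψ'.left_inv hz'
  have h1 := (hX.relatedFamilies (u := ψ' z) (t := t) Ψ h hψ hφ hψ' hφ' (ψ'.map_source hz')
    (by rwa [e]) (by rwa [e]) (by rwa [e]) (by rwa [e])).evolutionLHS_eq
  rw [e] at h1
  rw [chartLHS, h1, chartFamily, ψ.left_inv hz]
  rfl

end Invariance

/-! ### Properties of the formal solutions -/

section Solutions

variable {p d : ℕ} {g g' : Coord d → Fin d → Fin d → ℝ} {Y V : Coord p → Coord d}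
  {y : Coord p × ℝ → Coord d} {x x' : Coord p → ℝ → Coord d} {u : Coord p} {t : ℝ} {m : ℕ}

theorem FamilyNear.smooth_evolutionLHS (h : FamilyNear g x u t) :
    SmoothNear (fun q => evolutionLHS g x q.1 q.2) (u, t) := by
  have h1 : SmoothNear (evo g (Function.uncurry x)) (u, t) := h.smooth.tderiv.tderiv.add
    (SmoothNear.comp (f := lowerJet g (Function.uncurry x)) (smoothNear_nondeg h.nondeg)
      (SmoothNear.lowerJet h.metric.smooth h.smooth))
  exact h1.congr (h.eventually.mono fun q hq => hq.evo_eq.symm)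

theorem FamilyNear.contDiffAt_evolutionLHS (h : FamilyNear g x u t) :
    ContDiffAt ℝ ∞ (fun s => evolutionLHS g x u s) t :=
  h.smooth_evolutionLHS.slice.contDiffAt

theorem FamilyNear.evo_slice (h : FamilyNear g x u t) :
    (fun s => evo g (Function.uncurry x) (u, s)) =ᶠ[𝓝 t] fun s => evolutionLHS g x u s :=
  h.eventually_time.mono fun _ hs => hs.evo_eq

theorem FamilyNear.sliceEq_evo_iff (h : FamilyNear g x u 0) :
    SliceEq m (evo g (Function.uncurry x)) (fun _ => 0) u ↔
      ∀ᶠ v in 𝓝 u, JetEq m (fun s => evolutionLHS g x v s) 0 (fun _ => 0) 0 :=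
  eventually_congr (h.eventually_space.mono fun _ hv =>
    ⟨fun H => (JetEq.of_eventuallyEq hv.evo_slice.symm).trans H,
      fun H => (JetEq.of_eventuallyEq hv.evo_slice).trans H⟩)

/-! ### Taylor coefficients -/

theorem DataNear.tderiv_approx (h : DataNear g Y V u) (k : ℕ) :
    tderiv (approx g Y V k) (u, 0) = V u := by
  have h1 := JetEq.iff_iteratedDeriv.1 (h.sliceEq_approx (Nat.zero_le k)).self_of_nhds 1 (by simp)
  rw [iteratedDeriv_one, iteratedDeriv_one] at h1
  rw [← (hasDerivAt_slice (h.approx_smooth k 0).differentiableAt).deriv, h1]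
  have h2 : HasDerivAt (fun s : ℝ => Y u + s • V u) ((1 : ℝ) • V u) 0 :=
    ((hasDerivAt_id (0 : ℝ)).smul_const (V u)).const_add (Y u)
  have h3 := h2.deriv
  rwa [one_smul] at h3

/-- The Taylor coefficients of the approximations have stabilised up to order `m + 1`. -/
theorem DataNear.coeff_eq (h : DataNear g Y V u) {k m : ℕ} (hk : k < m + 2) :
    iteratedDeriv k (fun s => approx g Y V m (u, s)) 0 = (k.factorial : ℝ) • coeff k g Y V u := by
  have hf : (k.factorial : ℝ) ≠ 0 := by exact_mod_cast k.factorial_ne_zero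
  rw [coeff, smul_smul, mul_inv_cancel₀ hf, one_smul,
    ← (iteratedDeriv_slice (h.approx_smooth k 0) k).self_of_nhds]
  rcases Nat.lt_succ_iff_lt_or_eq.1 hk with hk | rfl
  · exact JetEq.iff_iteratedDeriv.1 (h.sliceEq_approx (Nat.lt_succ_iff.1 hk)).self_of_nhds k (by omega)
  · exact (JetEq.iff_iteratedDeriv.1 (h.sliceEq_approx m.le_succ).self_of_nhds _ (by omega)).symm

theorem coeff_zero (g : Coord d → Fin d → Fin d → ℝ) (Y V : Coord p → Coord d) (u : Coord p) :
    coeff 0 g Y V u = Y u := by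
  simp [coeff, approx_zero_time]

theorem DataNear.coeff_one (h : DataNear g Y V u) : coeff 1 g Y V u = V u := by
  have := h.coeff_eq (m := 0) (show 1 < 0 + 2 by omega)
  rw [iteratedDeriv_one, (hasDerivAt_slice (h.approx_smooth 0 0).differentiableAt).deriv,
    h.tderiv_approx] at this
  simpa using this.symm

/-- The Taylor coefficients of every approximate solution are given by the operators. -/
theorem DataNear.iteratedDeriv_eq_coeff (h : DataNear g Y V u) (hy : FormalNear g y u)
    (h0 : ∀ᶠ v in 𝓝 u, y (v, 0) = Y v ∧ tderiv y (v, 0) = V v)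
    (hs : SliceEq m (evo g y) (fun _ => 0) u) {k : ℕ} (hk : k < m + 2) :
    iteratedDeriv k (fun s => y (u, s)) 0 = (k.factorial : ℝ) • coeff k g Y V u := by
  have h2 : SliceEq 2 y (approx g Y V m) u := by
    rw [sliceEq_iff hy.smooth (h.approx_smooth m 0)]
    filter_upwards [h0, h.eventually] with v hv hd j hj
    interval_cases j
    · simpa [approx_zero_time] using hv.1
    · simpa [hd.tderiv_approx] using hv.2
  have h3 := sliceEq_of_evo hy (h.formalNear m) h2 (hs.trans (h.approx_solves m).symm)
  rw [JetEq.iff_iteratedDeriv.1 h3.self_of_nhds k hk, h.coeff_eq hk]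

/-- The partial sum of order `m` of the formal solution. -/
noncomputable def series (g : Coord d → Fin d → Fin d → ℝ) (Y V : Coord p → Coord d) (m : ℕ) (t : ℝ)
    (u : Coord p) : Coord d := ∑ n ∈ Finset.range (m + 1), t ^ n • coeff n g Y V u

theorem iteratedDeriv_series {k : ℕ} (hk : k ≤ m) :
    iteratedDeriv k (fun t => series g Y V m t u) 0 = (k.factorial : ℝ) • coeff k g Y V u := by
  have h1 : ∀ n ∈ Finset.range (m + 1), ContDiffAt ℝ k (fun t : ℝ => t ^ n • coeff n g Y V u) 0 :=
    fun n _ => ((contDiff_id.pow n).smul contDiff_const).contDiffAt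
  simp only [series]
  rw [iteratedDeriv_fun_sum h1]
  simp only [iteratedDeriv_pow_smul]
  rw [Finset.sum_ite_eq, if_pos (Finset.mem_range.2 (by omega))]

theorem contDiff_series : ContDiff ℝ ∞ (fun t => series g Y V m t u) :=
  ContDiff.sum fun n _ => (contDiff_id.pow n).smul contDiff_const

theorem DataNear.jetEq_series (h : DataNear g Y V u) (m : ℕ) :
    JetEq (m + 1) (fun t => series g Y V m t u) 0 (fun t => approx g Y V m (u, t)) 0 := by
  refine JetEq.iff_iteratedDeriv.2 fun k hk => ?_
  rw [iteratedDeriv_series (by omega), h.coeff_eq (by omega)]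

/-- The formal solution with immersive initial data is a family of immersions near `t = 0`. -/
theorem ImmersionNear.familyNear_approx (h : ImmersionNear g Y u) (hV : SmoothNear V u) (k : ℕ) :
    FamilyNear g (Function.curry (approx g Y V k)) u 0 where
  smooth := (h.dataNear hV).approx_smooth k 0
  metric := by
    rw [Function.curry_apply, approx_zero_time]
    exact h.metric
  injective := by
    simp only [Function.curry_apply, approx_zero_time]
    exact h.injective

/-! ### Change of coordinates for approximate solutions -/

/-- The order to which the equation is solved is invariant under local isometries and
reparametrisations. -/
theorem RelatedFamilies.jetEq_evolutionLHS {F : Coord d → Coord d} {f : Coord p → Coord p}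
    (h : RelatedFamilies g g' F f x x' u 0)
    (h0 : JetEq m (fun s => evolutionLHS g x (f u) s) 0 (fun _ => 0) 0) :
    JetEq m (fun s => evolutionLHS g' x' u s) 0 (fun _ => 0) 0 := by
  have h1 : (fun s => evolutionLHS g' x' u s) =ᶠ[𝓝 0]
      fun s => fderiv ℝ F (x (f u) s) (evolutionLHS g x (f u) s) :=
    ((Continuous.prodMk_right u).continuousAt.eventually h.eventually).mono
      fun s hs => hs.evolutionLHS_eq
  refine (JetEq.of_eventuallyEq h1).trans (jetEq_bilin_flat ?_ h.fam.contDiffAt_evolutionLHS h0)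
  exact (SmoothNear.comp (f := fun s => x (f u) s) h.isom.smooth.fderiv
    h.fam.smooth.slice).contDiffAt

/-- The formal solutions for data related by a local isometry are related by it. -/
theorem jetEq_series_related {F : Coord d → Coord d} {f : Coord p → Coord p}
    {Y' V' : Coord p → Coord d} (hi : ImmersionNear g Y (f u)) (hV : SmoothNear V (f u))
    (hF : LocalIsometry g g' F (Y (f u))) (hf : SmoothNear f u) (hi' : ImmersionNear g' Y' u)
    (hV' : SmoothNear V' u) (hY : ∀ᶠ v in 𝓝 u, Y' v = F (Y (f v)))
    (hVV : ∀ᶠ v in 𝓝 u, V' v = fderiv ℝ F (Y (f v)) (V (f v))) (m : ℕ) :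
    JetEq (m + 1) (fun t => F (series g Y V m t (f u))) 0 (fun t => series g' Y' V' m t u) 0 := by
  set x := Function.curry (approx g Y V m)
  set x' : Coord p → ℝ → Coord d := fun v t => F (x (f v) t)
  have hx0 : ∀ v, x v 0 = Y v := fun v => approx_zero_time g Y V m v
  have hd := hi.dataNear hV
  have hfx := hi.familyNear_approx hV m
  have hsm : SmoothNear (Function.uncurry x') (u, 0) := by
    have h1 : SmoothNear (fun q : Coord p × ℝ => (f q.1, q.2)) (u, 0) :=
      SmoothNear.prodMk (SmoothNear.comp (f := Prod.fst) hf (smoothNear_of_contDiff contDiff_fst))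
        (smoothNear_of_contDiff contDiff_snd)
    have h2 := SmoothNear.comp (f := fun q : Coord p × ℝ => (f q.1, q.2)) hfx.smooth h1
    refine SmoothNear.comp (f := fun q : Coord p × ℝ => Function.uncurry x (f q.1, q.2)) ?_ h2
    rw [show Function.uncurry x (f (u, (0 : ℝ)).1, (u, (0 : ℝ)).2) = Y (f u) from hx0 (f u)]
    exact hF.smooth
  have hR : RelatedFamilies g g' F f x x' u 0 := by
    refine ⟨hfx, ⟨hsm, ?_, ?_⟩, (hx0 (f u)).symm ▸ hF, hf, Eventually.of_forall fun _ => rfl⟩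
    · have : x' u 0 = Y' u := by simp only [x', hx0, hY.self_of_nhds]
      rw [this]
      exact hi'.metric
    · have : (fun v => x' v 0) =ᶠ[𝓝 u] Y' := hY.mono fun v hv => by simp only [x', hx0, hv]
      rw [this.fderiv_eq]
      exact hi'.injective
  have hRs : ∀ᶠ v in 𝓝 u, RelatedFamilies g g' F f x x' v 0 := (tendsto_slice u).eventually hR.eventually
  have hsol : ∀ᶠ v in 𝓝 u, JetEq m (fun s => evolutionLHS g x (f v) s) 0 (fun _ => 0) 0 :=
    hf.contDiffAt.continuousAt.eventually (hfx.sliceEq_evo_iff.1 (hd.approx_solves m))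
  have hsol' : SliceEq m (evo g' (Function.uncurry x')) (fun _ => 0) u := by
    rw [hR.fam'.sliceEq_evo_iff]
    filter_upwards [hsol, hRs] with v h1 h2 using h2.jetEq_evolutionLHS h1
  have hdat : ∀ᶠ v in 𝓝 u, Function.uncurry x' (v, 0) = Y' v ∧
      tderiv (Function.uncurry x') (v, 0) = V' v := by
    filter_upwards [hY, hVV, hRs, hf.contDiffAt.continuousAt.eventually hd.eventually]
      with v h1 h2 h3 h4
    refine ⟨by simp only [Function.uncurry_apply_pair, x', hx0, h1], ?_⟩
    have h5 := h3.velV_eq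
    rw [hx0] at h5
    rw [h2, ← h4.tderiv_approx m]
    exact h5
  have hlast : JetEq (m + 1) (fun t => x' u t) 0 (fun t => series g' Y' V' m t u) 0 := by
    refine JetEq.iff_iteratedDeriv.2 fun k hk => ?_
    rw [iteratedDeriv_series (by omega)]
    exact (hi'.dataNear hV').iteratedDeriv_eq_coeff hR.fam'.formalNear hdat hsol' (by omega)
  refine JetEq.trans ?_ hlast
  refine JetEq.comp_left F (hd.jetEq_series m) ?_ contDiff_series.contDiffAt
    hfx.smooth.slice.contDiffAt
  have : series g Y V m 0 (f u) = Y (f u) := by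
    have := (hd.jetEq_series m).value (by omega)
    rw [this]
    exact hx0 _
  rw [this]
  exact hF.smooth.contDiffAt

/-! ### Weyl invariance of the formal solutions -/

theorem jetEq_succ_of_deriv {F : Type*} [NormedAddCommGroup F] [NormedSpace ℝ F] {f f' : ℝ → F}
    {r : ℕ} {a a' : ℝ} (h0 : f a = f' a') (h : JetEq r (deriv f) a (deriv f') a') :
    JetEq (r + 1) f a f' a' := by
  refine JetEq.iff_iteratedDeriv.2 fun j hj => ?_
  cases j with
  | zero => simpa using h0
  | succ j =>
    rw [iteratedDeriv_succ', iteratedDeriv_succ']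
    exact JetEq.iff_iteratedDeriv.1 h j (by omega)

theorem JetEq.innerL_flat {r : ℕ} {G : ℝ → Fin d → Fin d → ℝ} {ξ η : ℝ → Coord d}
    (h : JetEq r ξ t (fun _ => 0) t) (hG : ContDiffAt ℝ ∞ G t) (hξ : ContDiffAt ℝ ∞ ξ t)
    (hη : ContDiffAt ℝ ∞ η t) :
    JetEq r (fun s => innerL d (G s) (ξ s) (η s)) t (fun _ => 0) t := by
  have h1 := JetEq.comp_left
    (fun q : (Fin d → Fin d → ℝ) × Coord d × Coord d => innerL d q.1 q.2.1 q.2.2)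
    ((JetEq.refl G t).prodMk (h.prodMk (JetEq.refl η t) hξ contDiffAt_const hη hη) hG hG
      (hξ.prodMk hη) (contDiffAt_const.prodMk hη))
    (contDiffAt_innerL contDiff_fst.contDiffAt (contDiff_fst.comp contDiff_snd).contDiffAt
      (contDiff_snd.comp contDiff_snd).contDiffAt)
    (hG.prodMk (hξ.prodMk hη)) (hG.prodMk (contDiffAt_const.prodMk hη))
  simpa using h1

theorem JetEq.smul_flat {F : Type*} [NormedAddCommGroup F] [NormedSpace ℝ F] {r : ℕ} {c : ℝ → ℝ}
    {f : ℝ → F} (h : JetEq r f t (fun _ => 0) t) (hc : ContDiffAt ℝ ∞ c t)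
    (hf : ContDiffAt ℝ ∞ f t) : JetEq r (fun s => c s • f s) t (fun _ => 0) t := by
  simpa using (JetEq.refl c t).smul h hc hc hf contDiffAt_const

theorem JetEq.sum {E F ι : Type*} [NormedAddCommGroup E] [NormedSpace ℝ E] [NormedAddCommGroup F]
    [NormedSpace ℝ F] {r : ℕ} {f f' : ι → E → F} {a a' : E} (s : Finset ι)
    (h : ∀ i ∈ s, JetEq r (f i) a (f' i) a') (hf : ∀ i ∈ s, ContDiffAt ℝ ∞ (f i) a)
    (hf' : ∀ i ∈ s, ContDiffAt ℝ ∞ (f' i) a') :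
    JetEq r (fun b => ∑ i ∈ s, f i b) a (fun b => ∑ i ∈ s, f' i b) a' := by
  classical
  induction s using Finset.induction_on with
  | empty => simp only [Finset.sum_empty]; intro j _; simp
  | insert i s hi ih =>
    simp only [Finset.sum_insert hi]
    simp only [Finset.forall_mem_insert] at h hf hf'
    exact h.1.add (ih h.2 hf.2 hf'.2) hf.1 hf'.1 (ContDiffAt.sum hf.2) (ContDiffAt.sum hf'.2)

/-- An approximate solution with orthogonal initial velocity remains orthogonal to the same order,
and so it is an approximate solution for every metric in the Weyl class. -/
theorem FamilyNear.jetEq_weyl (hp : 0 < p) {σ : Coord d → ℝ} (hx : FamilyNear g x u 0)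
    (hw : WeylNear g g' σ (x u 0))
    (h0 : ∀ w, innerL d (g (x u 0)) (velV x u 0) (fderiv ℝ (fun u' => x u' 0) u w) = 0)
    (hs : JetEq m (fun s => evolutionLHS g x u s) 0 (fun _ => 0) 0) :
    JetEq m (fun s => evolutionLHS g' x u s) 0 (fun _ => 0) 0 := by
  have hG : SmoothNear (fun s => g (x u s)) 0 :=
    SmoothNear.comp (f := fun s => x u s) hx.metric.smooth hx.smooth.slice
  have hv : SmoothNear (fun s => velV x u s) 0 := hx.smooth.tderiv.slice
  set D : ℝ → Coord p → Coord d := fun s w => fderiv ℝ (Function.uncurry x) (u, s) (w, 0)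
  have hD : ∀ w, SmoothNear (fun s => D s w) 0 := fun w =>
    hx.smooth.fderiv.slice.clm_comp (ContinuousLinearMap.apply ℝ (Coord d) (w, (0 : ℝ)))
  have hDeq : ∀ᶠ s in 𝓝 (0 : ℝ), ∀ w, fderiv ℝ (fun u' => x u' s) u w = D s w :=
    hx.eventually_time.mono fun s hs => hs.fderiv_apply
  set f : Coord p → ℝ → ℝ := fun w s => innerL d (g (x u s)) (velV x u s) (D s w)
  have hf : ∀ w, SmoothNear (f w) 0 := fun w => SmoothNear.innerL hG hv (hD w)
  set c : ℝ → ℝ := fun s => 2 / (p : ℝ) * innerL d (g (x u s)) (velV x u s)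
    (WithLp.toLp 2 (traceFF g (fun u' => x u' s) u))
  have hc : SmoothNear c 0 := by
    filter_upwards [SmoothNear.innerL hG hv hx.smooth_traceFF.slice] with s hs
      using contDiffAt_const.mul hs
  have hder : ∀ w, deriv (f w) =ᶠ[𝓝 0] fun s =>
      innerL d (g (x u s)) (evolutionLHS g x u s) (D s w) - c s • f w s := by
    intro w
    filter_upwards [hDeq.eventually_nhds, hx.eventually_time] with s h1 h2
    have h3 := h2.hasDerivAt_inner_velocity w
    have h4 : f w =ᶠ[𝓝 s] fun s =>
        innerL d (g (x u s)) (velV x u s) (fderiv ℝ (fun u' => x u' s) u w) :=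
      h1.mono fun s' hs' => by simp only [f, hs']
    rw [(h3.congr_of_eventuallyEq h4).deriv, h1.self_of_nhds w]
    rfl
  -- The tangential components `f w` of the velocity satisfy a linear equation that is homogeneous
  -- to order `m`: each integration in time gains one order.
  have hflat : ∀ r ≤ m + 1, ∀ w, JetEq r (f w) 0 (fun _ => 0) 0 := by
    intro r hr w
    induction r with
    | zero => exact JetEq.zero
    | succ r ih =>
      refine jetEq_succ_of_deriv ?_ ?_
      · have := h0 w
        rwa [hDeq.self_of_nhds w] at this
      · have h1 := (hs.mono (show r ≤ m by omega)).innerL_flat hG.contDiffAt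
          hx.contDiffAt_evolutionLHS (hD w).contDiffAt
        have h2 := (ih (by omega)).smul_flat hc.contDiffAt (hf w).contDiffAt
        have h3 := h1.sub h2 (contDiffAt_innerL hG.contDiffAt hx.contDiffAt_evolutionLHS
          (hD w).contDiffAt) contDiffAt_const (hc.contDiffAt.smul (hf w).contDiffAt) contDiffAt_const
        have h4 := (JetEq.of_eventuallyEq (hder w)).trans h3
        have h5 : deriv (fun _ : ℝ => (0 : ℝ)) = fun _ => (0 : ℝ) - 0 := by ext; simp
        rwa [h5]
  set τ : ℝ → Coord p := fun s => raiseV (fun a b => innerL d (g (x u s)) (D s (basisVec a))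
    (D s (basisVec b))) (fun i => fderiv ℝ σ (x u s) (D s (basisVec i)))
  have hdσ : SmoothNear (fun s => fderiv ℝ σ (x u s)) 0 :=
    SmoothNear.comp (f := fun s => x u s) hw.smooth.fderiv hx.smooth.slice
  have hind : ∀ s, FamilyNear g x u s → (fun a b => innerL d (g (x u s)) (D s (basisVec a))
      (D s (basisVec b))) = inducedMetric g (fun u' => x u' s) u := by
    intro s hs
    rw [inducedMetric_eq g hs.imm.smooth.differentiableAt]
    ext a b
    rw [pullG, hs.fderiv_apply, hs.fderiv_apply]
  have hτ : ContDiffAt ℝ ∞ τ 0 := by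
    refine contDiffAt_raiseV (contDiffAt_pi.2 fun a => contDiffAt_pi.2 fun b =>
      contDiffAt_innerL hG.contDiffAt (hD _).contDiffAt (hD _).contDiffAt) ?_
      fun i => hdσ.contDiffAt.clm_apply (hD _).contDiffAt
    rw [hind 0 hx]
    exact hx.imm.metricNear_inducedMetric.isMetric.det_ne_zero
  -- The equation changes by the velocity times a linear combination of the components `f`, with
  -- coefficients `2 τ`.
  have hE : (fun s => evolutionLHS g' x u s) =ᶠ[𝓝 0] fun s =>
      evolutionLHS g x u s + (2 * ∑ i, τ s i • f (basisVec i) s) • velV x u s := by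
    filter_upwards [hx.eventually_time, hx.smooth.slice.contDiffAt.continuousAt.eventually
      hw.eventually, hDeq] with s h1 h2 h3
    rw [h2.evolutionLHS_eq hp h1]
    have h4 : tangSlope g σ (fun u' => x u' s) u = τ s := by
      rw [tangSlope, raise, ← hind s h1]
      simp only [ContinuousLinearMap.comp_apply, h3]
      rfl
    congr 4
    rw [h4]
    conv_lhs => rw [← sum_basis (τ s)]
    rw [map_sum, map_sum]
    refine Finset.sum_congr rfl fun i _ => ?_
    rw [map_smul, map_smul, h3]
  have hsum := JetEq.sum (r := m) (f := fun i s => τ s i • f (basisVec i) s) (f' := fun _ _ => 0)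
    Finset.univ
    (fun i _ => (hflat m m.le_succ _).smul_flat (contDiffAt_coord hτ i) (hf _).contDiffAt)
    (fun i _ => (contDiffAt_coord hτ i).smul (hf _).contDiffAt) (fun _ _ => contDiffAt_const)
  simp only [Finset.sum_const_zero] at hsum
  have hsm : ContDiffAt ℝ ∞ (fun s => ∑ i, τ s i • f (basisVec i) s) 0 :=
    ContDiffAt.sum fun i _ => (contDiffAt_coord hτ i).smul (hf _).contDiffAt
  have hsm2 : ContDiffAt ℝ ∞ (fun s => (2 : ℝ) • ∑ i, τ s i • f (basisVec i) s) 0 :=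
    (contDiffAt_const (c := (2 : ℝ))).smul hsm
  have h2 := (hsum.smul_flat (c := fun _ => (2 : ℝ)) contDiffAt_const hsm).smul
    (JetEq.refl (fun s => velV x u s) 0) hsm2 contDiffAt_const hv.contDiffAt hv.contDiffAt
  refine (JetEq.of_eventuallyEq hE).trans ?_
  simpa using hs.add h2 hx.contDiffAt_evolutionLHS contDiffAt_const
    (hsm2.smul hv.contDiffAt) ((contDiffAt_const (c := (0 : ℝ))).smul hv.contDiffAt)

/-- The Taylor coefficients of the formal solutions with normal initial velocity are the same for
all metrics in the Weyl class. -/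
theorem coeff_weyl (hp : 0 < p) {σ : Coord d → ℝ} (hi : ImmersionNear g Y u) (hV : SmoothNear V u)
    (hn : ∀ᶠ v in 𝓝 u, ∀ w, innerL d (g (Y v)) (V v) (fderiv ℝ Y v w) = 0)
    (hw : WeylNear g g' σ (Y u)) (k : ℕ) : coeff k g' Y V u = coeff k g Y V u := by
  have hf : (k.factorial : ℝ) ≠ 0 := by exact_mod_cast k.factorial_ne_zero
  set x := Function.curry (approx g Y V k)
  have hx0 : ∀ v, x v 0 = Y v := fun v => approx_zero_time g Y V k v
  have hd := hi.dataNear hV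
  have hfx : FamilyNear g x u 0 := hi.familyNear_approx hV k
  have hfx' : FamilyNear g' x u 0 := hfx.weyl (by rw [hx0]; exact hw)
  have hsol : SliceEq k (evo g' (Function.uncurry x)) (fun _ => 0) u := by
    rw [hfx'.sliceEq_evo_iff]
    filter_upwards [hfx.sliceEq_evo_iff.1 (hd.approx_solves k), hfx.eventually_space, hn,
      hi.smooth.contDiffAt.continuousAt.eventually hw.eventually, hd.eventually]
      with v h1 h2 h3 h4 h5
    refine h2.jetEq_weyl hp (by rw [hx0]; exact h4) (fun w => ?_) h1
    have h6 : velV x v 0 = V v := h5.tderiv_approx k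
    rw [h6, hx0]
    simp only [hx0]
    exact h3 w
  have h1 := ((hi.weyl hw).dataNear hV).iteratedDeriv_eq_coeff hfx'.formalNear (hd.eventually.mono
    fun v hv => ⟨hx0 v, hv.tderiv_approx k⟩) hsol (show k < k + 2 by omega)
  have h2 := hd.coeff_eq (show k < k + 2 by omega)
  exact smul_right_injective _ hf (h1.symm.trans h2)

/-! ### The expansion to second order -/

/-- The coefficient of order two is read off from the equation at `t = 0`. -/
theorem series_two_eq (hi : ImmersionNear g Y u) (hV : SmoothNear V u) :
    series g Y V 2 1 u = secondOrderDisplacement g Y V u := by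
  have hd := hi.dataNear hV
  set x := Function.curry (approx g Y V 2)
  have hx0 : ∀ v, x v 0 = Y v := fun v => approx_zero_time g Y V 2 v
  have hfx : FamilyNear g x u 0 := hi.familyNear_approx hV 2
  have hvel : ∀ᶠ v in 𝓝 u, vel x v 0 = V v := by
    filter_upwards [hfx.eventually_space, hd.eventually] with v h1 h2
    rw [h1.vel_eq]
    exact congrArg _ (h2.tderiv_approx 2)
  have h0 : evolutionLHS g x u 0 = 0 := by
    have := (hfx.sliceEq_evo_iff.1 (hd.approx_solves 2)).self_of_nhds.value (by omega)
    exact this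
  have hc2 : ∀ μ, deriv (fun s => vel x u s μ) 0 = 2 * coeff 2 g Y V u μ := by
    intro μ
    have h1 := hd.coeff_eq (m := 2) (show 2 < 2 + 2 by omega)
    rw [(iteratedDeriv_slice (hd.approx_smooth 2 0) 2).self_of_nhds] at h1
    have h2 : HasDerivAt (fun s => velV x u s) (tderiv (tderiv (approx g Y V 2)) (u, 0)) 0 :=
      hasDerivAt_slice (q := (u, 0)) hfx.smooth.tderiv.differentiableAt
    have h3 : HasDerivAt (fun s => vel x u s μ) _ 0 :=
      ((EuclideanSpace.proj μ : Coord d →L[ℝ] ℝ).hasFDerivAt.comp_hasDerivAt 0 h2).congr_of_eventuallyEq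
        (hfx.eventually_time.mono fun s hs => congrArg (fun ξ => ξ μ) hs.vel_eq)
    rw [h3.deriv]
    have h4 : tderiv (tderiv (approx g Y V 2)) (u, 0) = _ := h1
    rw [h4]
    simp
  have hgrad : tangGrad g (fun u' => x u' 0) (fun u' => dot (g (x u' 0)) (vel x u' 0) (vel x u' 0)) u =
      tangGrad g Y (fun u' => dot (g (Y u')) (V u') (V u')) u := by
    have hfun : (fun u' => x u' 0) = Y := funext hx0
    have hev : (fun u' => dot (g (x u' 0)) (vel x u' 0) (vel x u' 0)) =ᶠ[𝓝 u]
        fun u' => dot (g (Y u')) (V u') (V u') := hvel.mono fun v hv => by simp only [hv, hx0]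
    rw [hfun]
    ext μ
    simp only [tangGrad, pderiv, hev.fderiv_eq]
  ext μ
  have h1 := congrArg (fun ξ : Coord d => ξ μ) h0
  simp only [evolutionLHS, accel, hc2, hgrad] at h1
  simp only [hvel.self_of_nhds, hx0] at h1
  simp only [series, Finset.sum_range_succ, Finset.sum_range_zero, coeff_zero, hd.coeff_one, one_pow, one_smul,
    zero_add, secondOrderDisplacement, PiLp.add_apply]
  have h2 : (2 : ℝ) / p = 2 * (1 / p) := by ring
  have h3 : (1 : ℝ) / (2 * p) = 1 / 2 * (1 / p) := by rw [one_div_mul_one_div]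
  rw [h2] at h1
  rw [h3]
  have h4 : (0 : Coord d) μ = 0 := rfl
  rw [h4] at h1
  linear_combination (1 / 2) * h1

end Solutions

/-! ### Solutions order by order on manifolds -/

section FormalManifold

set_option linter.unusedSectionVars false

variable {p d : ℕ}
  {M : Type*} [TopologicalSpace M] [ChartedSpace (Coord d) M] [IsManifold (𝓡 d) ∞ M]
  {M' : Type*} [TopologicalSpace M'] [ChartedSpace (Coord d) M'] [IsManifold (𝓡 d) ∞ M']
  {N : Type*} [TopologicalSpace N] [ChartedSpace (Coord p) N] [IsManifold (𝓡 p) ∞ N]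
  {N' : Type*} [TopologicalSpace N'] [ChartedSpace (Coord p) N'] [IsManifold (𝓡 p) ∞ N']
  {ψ : OpenPartialHomeomorph N (Coord p)} {φ : OpenPartialHomeomorph M (Coord d)}
  {X : N → ℝ → M} {W : Set (N × ℝ)} {u : Coord p} {t : ℝ} {g g' : Metric d M} {m : ℕ}
  {X₁ : N → M} {v : ∀ z, TangentSpace (𝓡 d) (X₁ z)}

theorem isPullback_refl (g : Metric d M) : IsPullback (Diffeomorph.refl (𝓡 d) M ∞) g g := by
  intro x ξ η
  change g.inner x (mfderiv (𝓡 d) (𝓡 d) id x ξ) (mfderiv (𝓡 d) (𝓡 d) id x η) = _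
  rw [mfderiv_id]
  rfl

theorem tangent_ext {P Q : TangentBundle (𝓡 d) M} (h1 : P.1 = Q.1) (h2 : (P.2 : Coord d) = Q.2) :
    P = Q := by
  obtain ⟨a, b⟩ := P
  obtain ⟨a', b'⟩ := Q
  obtain rfl : a = a' := h1
  obtain rfl : b = b' := h2
  rfl

/-- The order to which a family solves the equation does not depend on the charts. -/
theorem IsSmoothFamily.jetEq_chartLHS (hX : IsSmoothFamily p d X W) (hψ : IsChart ψ)
    (hφ : IsChart φ) {ψ' : OpenPartialHomeomorph N (Coord p)}
    {φ' : OpenPartialHomeomorph M (Coord d)} (hψ' : IsChart ψ') (hφ' : IsChart φ') {z : N}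
    (hW : (z, (0 : ℝ)) ∈ W) (hz : z ∈ ψ.source) (hx : X z 0 ∈ φ.source) (hz' : z ∈ ψ'.source)
    (hx' : X z 0 ∈ φ'.source) (h : JetEq m (fun t => chartLHS g X ψ φ (ψ z) t) 0 (fun _ => 0) 0) :
    JetEq m (fun t => chartLHS g X ψ' φ' (ψ' z) t) 0 (fun _ => 0) 0 := by
  have e := ψ'.left_inv hz'
  have hR := hX.relatedFamilies (u := ψ' z) (t := 0) (Diffeomorph.refl (𝓡 p) N ∞)
    (isPullback_refl g) hψ hφ hψ' hφ' (ψ'.map_source hz') (by rw [e]; exact hz)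
    (by rw [e]; exact hW) (by rw [e]; exact hx) (by rw [e]; exact hx')
  refine hR.jetEq_evolutionLHS ?_
  rw [e]
  exact h

theorem SolvesToOrder.jetEq (h : SolvesToOrder p g X W m) (hψ : IsChart ψ) (hφ : IsChart φ)
    (hu : InCharts ψ φ X W u 0) : JetEq m (fun t => chartLHS g X ψ φ u t) 0 (fun _ => 0) 0 := by
  refine JetEq.iff_iteratedDeriv.2 fun j hj => ?_
  have := h ψ φ hψ hφ _ hu.dom (ψ.map_target hu.source) hu.target j hj
  rw [ψ.right_inv hu.source] at this
  rw [this]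
  simp

/-- The family with the coordinate expression `y` in the charts `ψ` and `φ`. -/
noncomputable def ofCharts (ψ : OpenPartialHomeomorph N (Coord p))
    (φ : OpenPartialHomeomorph M (Coord d)) (y : Coord p × ℝ → Coord d) (z : N) (t : ℝ) : M :=
  φ.symm (y (ψ z, t))

/-- The set of points whose coordinates lie in `O`. -/
def chartDomain (ψ : OpenPartialHomeomorph N (Coord p)) (O : Set (Coord p × ℝ)) : Set (N × ℝ) :=
  {q | q.1 ∈ ψ.source ∧ (ψ q.1, q.2) ∈ O}

theorem isOpen_chartDomain {O : Set (Coord p × ℝ)} (hO : IsOpen O) : IsOpen (chartDomain ψ O) := by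
  have h1 : ContinuousOn (fun q : N × ℝ => (ψ q.1, q.2)) (Prod.fst ⁻¹' ψ.source) :=
    (ψ.continuousOn.comp continuousOn_fst fun _ h => h).prodMk continuousOn_snd
  exact h1.isOpen_inter_preimage (ψ.open_source.preimage continuous_fst) hO

theorem contMDiffOn_ofCharts {y : Coord p × ℝ → Coord d} {O : Set (Coord p × ℝ)}
    (hψ : IsChart ψ) (hφ : IsChart φ) (hy : ∀ q ∈ O, ContDiffAt ℝ ∞ y q)
    (hT : ∀ q ∈ O, y q ∈ φ.target) : ContMDiffOn ((𝓡 p).prod 𝓘(ℝ, ℝ)) (𝓡 d) ∞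
      (Function.uncurry (ofCharts ψ φ y)) (chartDomain ψ O) := by
  rintro ⟨z, t⟩ ⟨hz, hq⟩
  have h1 : ContMDiffAt ((𝓡 p).prod 𝓘(ℝ, ℝ)) 𝓘(ℝ, Coord p × ℝ) ∞
      (fun q : N × ℝ => (ψ q.1, q.2)) (z, t) :=
    ((hψ.contMDiffAt hz).comp (z, t) contMDiffAt_fst).prodMk_space contMDiffAt_snd
  have h2 := (contMDiffAt_iff_contDiffAt.2 (hy _ hq)).comp (z, t) h1
  exact ((hφ.contMDiffAt_symm (hT _ hq)).comp (z, t) h2).contMDiffWithinAt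

theorem isSmoothFamily_ofCharts {y : Coord p × ℝ → Coord d} {O : Set (Coord p × ℝ)}
    (hψ : IsChart ψ) (hφ : IsChart φ) (hO : IsOpen O) (hy : ∀ q ∈ O, ContDiffAt ℝ ∞ y q)
    (hT : ∀ q ∈ O, y q ∈ φ.target)
    (hI : ∀ q ∈ O, Function.Injective (fderiv ℝ (fun u => y (u, q.2)) q.1)) :
    IsSmoothFamily p d (ofCharts ψ φ y) (chartDomain ψ O) where
  isOpen := isOpen_chartDomain hO
  smooth := contMDiffOn_ofCharts hψ hφ hy hT
  immersive := by
    rintro z t ⟨hz, hq⟩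
    have h0 : ContDiffAt ℝ ∞ (fun u => y (u, t)) (ψ z) :=
      (hy _ hq).comp (ψ z) (f := fun u => (u, t)) (contDiffAt_id.prodMk contDiffAt_const)
    have h1 := (contMDiffAt_iff_contDiffAt.2 h0).mdifferentiableAt infty_ne_zero
    have h2 := (hψ.contMDiffAt hz).mdifferentiableAt infty_ne_zero
    have h3 := (hφ.contMDiffAt_symm (hT _ hq)).mdifferentiableAt infty_ne_zero
    have e1 := mfderiv_comp z h3 (h1.comp z h2)
    have e2 := mfderiv_comp z h1 h2
    have i1 : Function.Injective (ofChart φ (y (ψ z, t))) := fun a b hab => by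
      rw [← hφ.toChart_ofChart (hT _ hq) a, hab, hφ.toChart_ofChart (hT _ hq)]
    have i2 : Function.Injective (toChart ψ z) := fun a b hab => by
      have ha := hψ.ofChart_toChart hz a
      rw [hab, hψ.ofChart_toChart hz] at ha
      exact ha.symm
    have i3 := i1.comp ((hI _ hq).comp i2)
    have e3 : ∀ w, mfderiv (𝓡 p) (𝓡 d) (fun z' => ofCharts ψ φ y z' t) z w =
        ofChart φ (y (ψ z, t)) (fderiv ℝ (fun u => y (u, t)) (ψ z) (toChart ψ z w)) := fun w => by
      refine (DFunLike.congr_fun e1 w).trans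
        (congrArg (ofChart φ (y (ψ z, t))) ((DFunLike.congr_fun e2 w).trans ?_))
      rw [mfderiv_eq_fderiv]
      rfl
    intro a b hab
    exact i3 ((e3 a).symm.trans (hab.trans (e3 b)))

/-- Existence of solutions to every order, near every point. -/
theorem exists_solvesToOrder (hX₁ : IsSmoothImmersion p d X₁) (hv : IsSmoothField p X₁ v)
    (g : Metric d M) (m : ℕ) (z₀ : N) :
    ∃ (W : Set (N × ℝ)) (X : N → ℝ → M), (z₀, (0 : ℝ)) ∈ W ∧ IsSmoothFamily p d X W ∧
      HasInitialData X W X₁ v ∧ SolvesToOrder p g X W m := by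
  obtain ⟨ψ, hψ, hz₀⟩ := exists_chart (n := p) z₀
  obtain ⟨φ, hφ, hx₀⟩ := exists_chart (n := d) (X₁ z₀)
  set u₀ := ψ z₀
  have hu₀ : u₀ ∈ ψ.target := ψ.map_source hz₀
  have hx₀' : X₁ (ψ.symm u₀) ∈ φ.source := by rwa [ψ.left_inv hz₀]
  set G := chartMetric g φ
  set Y := chartMap ψ φ X₁
  set V := chartField ψ φ X₁ v
  -- The formal solution in one pair of charts is a solution to order `m`; the order does not depend
  -- on the charts.
  set y := approx G Y V m
  have hy0 : ∀ u, y (u, 0) = Y u := approx_zero_time G Y V m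
  have hi := hX₁.immersionNear hψ hφ hu₀ hx₀' g
  have hV : SmoothNear V u₀ := hv.smoothNear hψ hφ hu₀ hx₀'
  have hd : DataNear G Y V u₀ := hi.dataNear hV
  have hfx : FamilyNear G (Function.curry y) u₀ 0 := hi.familyNear_approx hV m
  have htgt : ∀ᶠ q in 𝓝 (u₀, (0 : ℝ)), y q ∈ φ.target := by
    refine (hd.approx_smooth m 0).contDiffAt.continuousAt.eventually (φ.open_target.mem_nhds ?_)
    have : approx G Y V m (u₀, 0) = φ (X₁ (ψ.symm u₀)) := hy0 u₀
    rw [this]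
    exact φ.map_source hx₀'
  -- All conditions are open, so they hold on a common neighbourhood `O` in the charts.
  have hslice := (eventually_chart hX₁.1.continuous hu₀ hx₀').and (hd.eventually.and
    (hfx.sliceEq_evo_iff.1 (hd.approx_solves m)))
  have hev := ((hd.approx_smooth m 0).and hfx.eventually).and (htgt.and
    ((continuousAt_fst (p := (u₀, (0 : ℝ)))).eventually hslice))
  obtain ⟨O, hO, hOo, hO₀⟩ := eventually_nhds_iff.1 hev
  have hfam := isSmoothFamily_ofCharts (y := y) hψ hφ hOo (fun q hq => (hO q hq).1.1)
    (fun q hq => (hO q hq).2.1) (fun q hq => (hO q hq).1.2.injective)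
  have hval : ∀ z, z ∈ ψ.source → X₁ z ∈ φ.source → ofCharts ψ φ y z 0 = X₁ z := by
    intro z hz hx
    have : y (ψ z, 0) = φ (X₁ (ψ.symm (ψ z))) := hy0 _
    rw [ofCharts, this, ψ.left_inv hz, φ.left_inv hx]
  refine ⟨chartDomain ψ O, ofCharts ψ φ y, ⟨hz₀, hO₀⟩, hfam,
    ?_, ?_⟩
  · rintro z ⟨hz, hq⟩
    obtain ⟨-, -, ⟨-, hx⟩, hdz, -⟩ := hO _ hq
    replace hx : X₁ z ∈ φ.source := by simpa [ψ.left_inv hz] using hx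
    refine tangent_ext (hval z hz hx) ?_
    have h1 : HasDerivAt (fun s => y (ψ z, s)) (V (ψ z)) 0 := by
      have := hasDerivAt_slice (hdz.approx_smooth m 0).differentiableAt
      rwa [hdz.tderiv_approx] at this
    have h2 : MDifferentiableAt 𝓘(ℝ, ℝ) (𝓡 d) (fun s => y (ψ z, s)) 0 :=
      mdifferentiableAt_iff_differentiableAt.2 h1.differentiableAt
    have h3 := (hφ.contMDiffAt_symm (hO _ hq).2.1).mdifferentiableAt infty_ne_zero
    have h4 := DFunLike.congr_fun (mfderiv_comp (0 : ℝ) h3 h2) (1 : ℝ)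
    have h5 : (velocity (ofCharts ψ φ y) z 0 : Coord d) =
        ofChart φ (y (ψ z, 0)) (V (ψ z)) := by
      refine h4.trans (congrArg (ofChart φ (y (ψ z, 0))) ?_)
      rw [mfderiv_eq_fderiv]
      exact (fderiv_apply_one_eq_deriv (𝕜 := ℝ)).trans h1.deriv
    refine h5.trans ?_
    have h6 : ∀ z', z' = z → (ofChart φ (φ (X₁ z')) (toChart φ (X₁ z') (v z')) : Coord d) = v z := by
      rintro z' rfl
      exact hφ.ofChart_toChart hx _
    rw [hy0]
    exact h6 _ (ψ.left_inv hz)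
  · rintro ψ' φ' hψ' hφ' z ⟨hz, hq⟩ hz' hx' j hj
    obtain ⟨⟨-, hF⟩, -, ⟨-, hx⟩, hdz, hsol⟩ := hO _ hq
    replace hx : X₁ z ∈ φ.source := by simpa [ψ.left_inv hz] using hx
    have hx2 : ofCharts ψ φ y z 0 ∈ φ.source := by rwa [hval z hz hx]
    have hin : InCharts ψ φ (ofCharts ψ φ y) (chartDomain ψ O)
      (ψ z) 0 := InCharts.of_mem ⟨hz, hq⟩ hz hx2
    have hloc : Function.uncurry (chartFamily ψ φ (ofCharts ψ φ y)) =ᶠ[𝓝 (ψ z, 0)] y := by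
      filter_upwards [hOo.mem_nhds hq, hin.eventually hfam.isOpen hfam.smooth] with q h1 h2
      simp only [Function.uncurry, chartFamily, ofCharts]
      rw [ψ.right_inv h2.source, φ.right_inv (hO q h1).2.1]
    have hev2 : (fun t => chartLHS g (ofCharts ψ φ y) ψ φ (ψ z) t) =ᶠ[𝓝 0]
        fun t => evolutionLHS G (Function.curry y) (ψ z) t := by
      have hF2 := hfam.familyNear hψ hφ hin g
      filter_upwards [(Continuous.prodMk_right (ψ z)).continuousAt.eventually
        (eventually_eventually_nhds.2 hloc), hF2.eventually_time, hF.eventually_time]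
        with t h1 h2 h3
      have h4 : Function.uncurry (chartFamily ψ φ (ofCharts ψ φ y)) =ᶠ[𝓝 (ψ z, t)]
          Function.uncurry (Function.curry y) := h1
      rw [chartLHS, ← h2.evo_eq, ← h3.evo_eq]
      have h5 : lowerJet G (Function.uncurry (chartFamily ψ φ (ofCharts ψ φ y))) (ψ z, t) =
          lowerJet G (Function.uncurry (Function.curry y)) (ψ z, t) := by
        have h6 : (fun q => (fderiv ℝ (Function.uncurry (chartFamily ψ φ (ofCharts ψ φ y))) q).comp
            (.inl ℝ (Coord p) ℝ)) =ᶠ[𝓝 (ψ z, t)] fun q =>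
            (fderiv ℝ (Function.uncurry (Function.curry y)) q).comp (.inl ℝ (Coord p) ℝ) :=
          h4.fderiv.mono fun q hq => congrArg
            (fun L : Coord p × ℝ →L[ℝ] Coord d => L.comp (.inl ℝ (Coord p) ℝ)) hq
        rw [lowerJet, lowerJet, h4.fderiv_eq, h6.fderiv_eq, h4.self_of_nhds]
      have h7 := (tderiv_congr (tderiv_congr h4)).self_of_nhds
      rw [evo, evo, h5]
      exact congrArg (· + _) h7
    have h8 := hfam.jetEq_chartLHS hψ hφ hψ' hφ' ⟨hz, hq⟩ hz hx2 hz' hx'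
      ((JetEq.of_eventuallyEq hev2).trans hsol)
    rw [JetEq.iff_iteratedDeriv.1 h8 j hj]
    simp

/-- Uniqueness to every order: the Taylor coefficients are given by the operators. -/
theorem iteratedDeriv_eq_term (hX₁ : IsSmoothImmersion p d X₁) (hv : IsSmoothField p X₁ v)
    (hX : IsSmoothFamily p d X W) (hi : HasInitialData X W X₁ v) (hs : SolvesToOrder p g X W m)
    (hψ : IsChart ψ) (hφ : IsChart φ) (hu : InCharts ψ φ X W u 0) {k : ℕ} (hk : k < m + 2) :
    iteratedDeriv k (fun t => chartFamily ψ φ X u t) 0 =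
      (k.factorial : ℝ) • term (operators p d) g X₁ v ψ φ k u := by
  have hx : X₁ (ψ.symm u) ∈ φ.source := by
    rw [← hi.value hu.dom]
    exact hu.target
  have hev : ∀ᶠ w in 𝓝 u, InCharts ψ φ X W w 0 :=
    (tendsto_slice u).eventually (hu.eventually hX.isOpen hX.smooth)
  have hF := hX.familyNear hψ hφ hu g
  rw [hX₁.term_eq hv hψ hφ hu.source hx]
  refine (hX₁.dataNear hv hψ hφ hu.source hx g).iteratedDeriv_eq_coeff hF.formalNear ?_ ?_ hk
  · filter_upwards [hev] with w hw
    exact ⟨hi.chart_value hw, hi.chart_velocity hX hψ hφ hw⟩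
  · rw [hF.sliceEq_evo_iff]
    filter_upwards [hev] with w hw using hs.jetEq hψ hφ hw

theorem expansion_eq_series (hX₁ : IsSmoothImmersion p d X₁) (hv : IsSmoothField p X₁ v)
    (hψ : IsChart ψ) (hφ : IsChart φ) (hu : u ∈ ψ.target) (hx : X₁ (ψ.symm u) ∈ φ.source)
    (g : Metric d M) (m : ℕ) (t : ℝ) : expansion (operators p d) g X₁ v ψ φ m t u =
      series (chartMetric g φ) (chartMap ψ φ X₁) (chartField ψ φ X₁ v) m t u :=
  Finset.sum_congr rfl fun n _ => by rw [hX₁.term_eq hv hψ hφ hu hx]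

theorem IsNormalField.eventually_chart (hn : IsNormalField p g X₁ v)
    (hX₁ : IsSmoothImmersion p d X₁) (hψ : IsChart ψ) (hφ : IsChart φ) (hu : u ∈ ψ.target)
    (hx : X₁ (ψ.symm u) ∈ φ.source) :
    ∀ᶠ u' in 𝓝 u, ∀ w, innerL d (chartMetric g φ (chartMap ψ φ X₁ u')) (chartField ψ φ X₁ v u')
      (fderiv ℝ (chartMap ψ φ X₁) u' w) = 0 := by
  filter_upwards [Defect.eventually_chart hX₁.1.continuous hu hx] with u' hu'
  exact (isNormal_chart_iff hX₁ hψ hφ hu'.1 hu'.2 g).1 fun w => hn _ w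

/-- The operators on normal fields are the same for all metrics in the Weyl class. -/
theorem term_weyl (hp : 0 < p) {σ : M → ℝ} (hw : IsWeylRescaling g g' σ)
    (hX₁ : IsSmoothImmersion p d X₁) (hv : IsSmoothField p X₁ v) (hn : IsNormalField p g X₁ v)
    (hψ : IsChart ψ) (hφ : IsChart φ) (hu : u ∈ ψ.target) (hx : X₁ (ψ.symm u) ∈ φ.source) (n : ℕ) :
    term (operators p d) g' X₁ v ψ φ n u = term (operators p d) g X₁ v ψ φ n u := by
  rw [hX₁.term_eq hv hψ hφ hu hx, hX₁.term_eq hv hψ hφ hu hx]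
  exact coeff_weyl hp (hX₁.immersionNear hψ hφ hu hx g) (hv.smoothNear hψ hφ hu hx)
    (hn.eventually_chart hX₁ hψ hφ hu hx) (hw.weylNear hφ (φ.map_source hx)) n

theorem IsSmoothImmersion.transport (hX₁ : IsSmoothImmersion p d X₁) (Φ : M ≃ₘ^∞⟮𝓡 d, 𝓡 d⟯ M')
    (Ψ : N' ≃ₘ^∞⟮𝓡 p, 𝓡 p⟯ N) : IsSmoothImmersion p d fun z => Φ (X₁ (Ψ z)) :=
  ⟨Φ.contMDiff.comp (hX₁.1.comp Ψ.contMDiff), fun z =>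
    (hX₁.isSmoothFamily.transport Φ Ψ).immersive z 0 trivial⟩

theorem IsSmoothField.transport (hv : IsSmoothField p X₁ v) (Φ : M ≃ₘ^∞⟮𝓡 d, 𝓡 d⟯ M')
    (Ψ : N' ≃ₘ^∞⟮𝓡 p, 𝓡 p⟯ N) : IsSmoothField p (fun z => Φ (X₁ (Ψ z)))
      fun z => mfderiv (𝓡 d) (𝓡 d) Φ (X₁ (Ψ z)) (v (Ψ z)) := fun z =>
  contMDiffAt_tangent isOpen_univ Φ.contMDiff.contMDiffOn
    ((hv (Ψ z)).comp z Ψ.contMDiff.contMDiffAt) trivial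

/-- Covariance of the expansion under diffeomorphisms, in arbitrary charts. -/
theorem jetEq_expansion_transport {g' : Metric d M'} {ψ' : OpenPartialHomeomorph N' (Coord p)}
    {φ' : OpenPartialHomeomorph M' (Coord d)} (hX₁ : IsSmoothImmersion p d X₁)
    (hv : IsSmoothField p X₁ v) {Φ : M ≃ₘ^∞⟮𝓡 d, 𝓡 d⟯ M'} (Ψ : N' ≃ₘ^∞⟮𝓡 p, 𝓡 p⟯ N)
    (h : IsPullback Φ g g') (hψ : IsChart ψ) (hφ : IsChart φ) (hψ' : IsChart ψ')
    (hφ' : IsChart φ') (hu : u ∈ ψ'.target) (hz : Ψ (ψ'.symm u) ∈ ψ.source)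
    (hx : X₁ (Ψ (ψ'.symm u)) ∈ φ.source) (hx' : Φ (X₁ (Ψ (ψ'.symm u))) ∈ φ'.source) (m : ℕ) :
    JetEq (m + 1) (fun t => φ' (Φ (φ.symm (expansion (operators p d) g X₁ v ψ φ m t
        (ψ (Ψ (ψ'.symm u))))))) 0
      (fun t => expansion (operators p d) g' (fun z => Φ (X₁ (Ψ z)))
        (fun z => mfderiv (𝓡 d) (𝓡 d) Φ (X₁ (Ψ z)) (v (Ψ z))) ψ' φ' m t u) 0 := by
  have hR := hX₁.isSmoothFamily.relatedFamilies (u := u) (t := 0) Ψ h hψ hφ hψ' hφ' hu hz trivial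
    hx hx'
  have hs : X₁ (ψ.symm (ψ (Ψ (ψ'.symm u)))) ∈ φ.source := by rwa [ψ.left_inv hz]
  have hX' := hX₁.transport Φ Ψ
  have hv' := hv.transport Φ Ψ
  have hsm := hv'.smoothNear hψ' hφ' hu hx'
  have key := jetEq_series_related (F := fun y => φ' (Φ (φ.symm y)))
    (f := fun v => ψ (Ψ (ψ'.symm v))) (hX₁.immersionNear hψ hφ (ψ.map_source hz) hs g)
    (hv.smoothNear hψ hφ (ψ.map_source hz) hs) hR.isom hR.repar
    (hX'.immersionNear hψ' hφ' hu hx' g') hsm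
    (hR.related.eq) ?_ m
  · simp only [expansion_eq_series hX₁ hv hψ hφ (ψ.map_source hz) hs,
      expansion_eq_series hX' hv' hψ' hφ' hu hx']
    exact key
  · filter_upwards [(tendsto_slice u).eventually hR.eventually,
      eventually_chart (Y := fun z => Φ (X₁ (Ψ z))) hX'.1.continuous hu hx',
      eventually_chart (Y := Ψ) Ψ.continuous hu hz,
      eventually_chart (Y := fun z => X₁ (Ψ z)) (hX₁.1.continuous.comp Ψ.continuous) hu hx]
      with w h1 h2 h3 h4
    have hd1 : MDifferentiableAt (𝓡 d) (𝓡 d) Φ (X₁ (Ψ (ψ'.symm w))) :=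
      (Φ.contMDiff _).mdifferentiableAt infty_ne_zero
    have hd2 := (hφ.contMDiffAt_symm (φ.map_source h4.2)).mdifferentiableAt infty_ne_zero
    have e := φ.left_inv h4.2
    have hd1' : MDifferentiableAt (𝓡 d) (𝓡 d) Φ (φ.symm (φ (X₁ (Ψ (ψ'.symm w))))) := by rwa [e]
    have h5 := fun ξ => hφ'.fderiv_comp (f := fun y => Φ (φ.symm y)) (hd1'.comp _ hd2)
      (by rw [e]; exact h2.2) ξ
    have h6 := fun ξ => DFunLike.congr_fun (mfderiv_comp _ hd1' hd2) ξ
    have h7 : ∀ x, x = X₁ (Ψ (ψ'.symm w)) → ∀ η : Coord d, η = v (Ψ (ψ'.symm w)) →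
        toChart φ' (Φ x) (mfderiv (𝓡 d) (𝓡 d) Φ x η) =
        toChart φ' (Φ (X₁ (Ψ (ψ'.symm w)))) (mfderiv (𝓡 d) (𝓡 d) Φ (X₁ (Ψ (ψ'.symm w)))
          (v (Ψ (ψ'.symm w)))) := by
      rintro x rfl η rfl
      rfl
    have h8 := h7 _ e _ (hφ.ofChart_toChart h4.2 (v (Ψ (ψ'.symm w))))
    have h9 : ∀ z, z = Ψ (ψ'.symm w) → fderiv ℝ (fun y => φ' (Φ (φ.symm y))) (φ (X₁ z))
        (toChart φ (X₁ z) (v z)) = fderiv ℝ (fun y => φ' (Φ (φ.symm y)))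
          (φ (X₁ (Ψ (ψ'.symm w)))) (toChart φ _ (v (Ψ (ψ'.symm w)))) := by
      rintro z rfl
      rfl
    refine Eq.symm ((h9 _ (ψ.left_inv h3.2)).trans ((h5 _).trans ?_))
    refine Eq.trans ?_ h8
    exact congrArg (toChart φ' _) (h6 _)

end FormalManifold

/-! ### Displacement by fields that depend on a parameter -/

section Parametric

variable {p d : ℕ} {Θ : Type*} [NormedAddCommGroup Θ] [NormedSpace ℝ Θ]
  {g g' : Coord d → Fin d → Fin d → ℝ} {Y Y' V : Coord p → Coord d}
  {u : Coord p} {m n k : ℕ}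

/-- Smooth dependence of the Taylor coefficients on a parameter of the field. -/
theorem smooth_coeff_param {U : Θ → Coord p → Coord d} {θ : Θ} (hi : ImmersionNear g Y u)
    (hU : SmoothNear (Function.uncurry U) (θ, u)) (n : ℕ) :
    SmoothNear (fun w : Θ × Coord p => coeff n g Y (U w.1) w.2) (θ, u) := by
  have hUθ : SmoothNear (U θ) u := SmoothNear.comp (f := fun v => (θ, v)) hU
    (smoothNear_of_contDiff (contDiff_const.prodMk contDiff_id))
  have h1 := approx_smooth_param (g := fun _ : Θ => g) (Y := fun _ : Θ => Y) (V := U) (θ := θ)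
    (SmoothNear.comp (f := Prod.snd) hi.metric.smooth (smoothNear_of_contDiff contDiff_snd))
    (SmoothNear.comp (f := Prod.snd) hi.smooth (smoothNear_of_contDiff contDiff_snd)) hU
    (hi.dataNear hUθ) n 0
  have h2 := h1.tderiv_param (f := fun θ => approx g Y (U θ) n) n
  have h3 := SmoothNear.comp (f := fun w : Θ × Coord p => (w.1, (w.2, (0 : ℝ)))) (x := (θ, u)) h2
    (smoothNear_of_contDiff (contDiff_fst.prodMk (contDiff_snd.prodMk contDiff_const)))
  exact (smoothNear_of_contDiff contDiff_const).smul h3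

theorem smooth_series_param {U : Θ → Coord p → Coord d} {θ : Θ} (hi : ImmersionNear g Y u)
    (hU : SmoothNear (Function.uncurry U) (θ, u)) (m : ℕ) (t : ℝ) :
    SmoothNear (fun w : (Θ × Coord p) × ℝ => series g Y (U w.1.1) m w.2 w.1.2) ((θ, u), t) := by
  have h1 := eventually_all_finset (Finset.range (m + 1)) |>.2 fun n _ =>
    ((smoothNear_of_contDiff (contDiff_snd.pow n)).smul (SmoothNear.comp
      (f := Prod.fst) (x := ((θ, u), t)) (smooth_coeff_param hi hU n)
        (smoothNear_of_contDiff contDiff_fst)) : SmoothNear (fun w : (Θ × Coord p) × ℝ =>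
          w.2 ^ n • coeff n g Y (U w.1.1) w.1.2) ((θ, u), t))
  exact h1.mono fun w hw => ContDiffAt.sum fun n hn => hw n hn

/-- Equality of jets in `t` for all values of the parameter implies equality of jets on the
diagonal. -/
theorem jetEq_diag {F : Type*} [NormedAddCommGroup F] [NormedSpace ℝ F] {y y' : ℝ × ℝ → F} {r : ℕ}
    (h : ∀ᶠ η in 𝓝 (0 : ℝ), JetEq r (fun t => y (η, t)) 0 (fun t => y' (η, t)) 0)
    (hy : SmoothNear y (0, 0)) (hy' : SmoothNear y' (0, 0)) :
    JetEq r (fun ε => y (ε, ε)) 0 (fun ε => y' (ε, ε)) 0 := by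
  have h1 : SliceEq r y y' (0 : ℝ) := h
  have hd : ContDiffAt ℝ ∞ (fun ε : ℝ => (ε, ε)) 0 := contDiffAt_id.prodMk contDiffAt_id
  exact JetEq.comp (f := fun ε : ℝ => (ε, ε)) (f' := fun ε : ℝ => (ε, ε)) (h1.jetEq hy hy')
    (JetEq.refl _ _) hy.contDiffAt hy'.contDiffAt hd hd

theorem smooth_series_diag {U : ℝ → Coord p → Coord d} (hi : ImmersionNear g Y u)
    (hU : SmoothNear (Function.uncurry U) (0, u)) (m : ℕ) :
    SmoothNear (fun w : Coord p × ℝ => series g Y (U w.2) m w.2 w.1) (u, 0) :=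
  SmoothNear.comp (f := fun w : Coord p × ℝ => ((w.2, w.1), w.2)) (x := (u, 0))
    (smooth_series_param hi hU m 0)
    (smoothNear_of_contDiff ((contDiff_snd.prodMk contDiff_fst).prodMk contDiff_snd))

/-- The displaced submanifolds for field families related by a local isometry are related by it, to
every order in the parameter. -/
theorem jetEq_series_diag {F : Coord d → Coord d} {f : Coord p → Coord p}
    {U U' : ℝ → Coord p → Coord d} (hi : ImmersionNear g Y (f u))
    (hU : SmoothNear (Function.uncurry U) (0, f u)) (hF : LocalIsometry g g' F (Y (f u)))
    (hf : SmoothNear f u) (hi' : ImmersionNear g' Y' u)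
    (hU' : SmoothNear (Function.uncurry U') (0, u)) (hY : ∀ᶠ v in 𝓝 u, Y' v = F (Y (f v)))
    (hUU : ∀ᶠ v in 𝓝 u, ∀ ε, U' ε v = fderiv ℝ F (Y (f v)) (U ε (f v))) (m : ℕ) :
    JetEq (m + 1) (fun ε => F (series g Y (U ε) m ε (f u))) 0
      (fun ε => series g' Y' (U' ε) m ε u) 0 := by
  have hsec : ∀ {V : ℝ → Coord p → Coord d} {w : Coord p},
      SmoothNear (Function.uncurry V) (0, w) → ∀ᶠ η in 𝓝 (0 : ℝ), SmoothNear (V η) w := by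
    intro V w hV
    filter_upwards [(Continuous.prodMk_left w).continuousAt.eventually hV.eventually] with η hη
    exact SmoothNear.comp (f := fun v => (η, v)) hη
      (smoothNear_of_contDiff (contDiff_const.prodMk contDiff_id))
  have hpair : SmoothNear (fun q : ℝ × ℝ => ((q.1, f u), q.2)) (0, 0) :=
    smoothNear_of_contDiff ((contDiff_fst.prodMk contDiff_const).prodMk contDiff_snd)
  have hpair' : SmoothNear (fun q : ℝ × ℝ => ((q.1, u), q.2)) (0, 0) :=
    smoothNear_of_contDiff ((contDiff_fst.prodMk contDiff_const).prodMk contDiff_snd)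
  have h0 : series g Y (U 0) m 0 (f u) = Y (f u) := by
    simp [series, Finset.sum_range_succ', coeff_zero]
  refine jetEq_diag (y := fun q : ℝ × ℝ => F (series g Y (U q.1) m q.2 (f u)))
    (y' := fun q : ℝ × ℝ => series g' Y' (U' q.1) m q.2 u) ?_ ?_ ?_
  · filter_upwards [hsec hU, hsec hU'] with η h1 h2
    exact jetEq_series_related hi h1 hF hf hi' h2 hY (hUU.mono fun v hv => hv η) m
  · refine SmoothNear.comp (f := fun q : ℝ × ℝ => series g Y (U q.1) m q.2 (f u)) ?_
      (SmoothNear.comp (f := fun q : ℝ × ℝ => ((q.1, f u), q.2)) (smooth_series_param hi hU m 0)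
        hpair)
    rw [h0]
    exact hF.smooth
  · exact SmoothNear.comp (f := fun q : ℝ × ℝ => ((q.1, u), q.2)) (smooth_series_param hi' hU' m 0)
      hpair'

theorem jetEq_pow_zero (k : ℕ) : JetEq k (fun ε : ℝ => ε ^ k) 0 (fun _ => (0 : ℝ)) 0 := by
  refine JetEq.iff_iteratedDeriv.2 fun j hj => ?_
  rw [iteratedDeriv_fun_pow_zero, if_neg (by omega)]
  simp

/-- A field of order `ε^k` contributes to the displacement by `ε • U` only linearly, to order
`k + 1`. -/
theorem jetEq_series_add {U : ℝ → Coord p → Coord d} (hi : ImmersionNear g Y u)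
    (hU : SmoothNear (Function.uncurry U) (0, u)) (hV : SmoothNear V u) (k : ℕ) (hm : 0 < m) :
    JetEq (k + 2) (fun ε => series g Y (fun v => U ε v + ε ^ k • V v) m ε u) 0
      (fun ε => series g Y (U ε) m ε u + ε ^ (k + 1) • V u) 0 := by
  -- the coefficients, with the weight of the additional field as an independent parameter
  set W : ℝ × ℝ → Coord p → Coord d := fun θ v => U θ.1 v + θ.2 • V v
  have hW : ∀ δ : ℝ, SmoothNear (Function.uncurry W) ((0, δ), u) := by
    intro δ
    have h1 : SmoothNear (fun w : (ℝ × ℝ) × Coord p => U w.1.1 w.2) ((0, δ), u) :=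
      SmoothNear.comp (f := fun w : (ℝ × ℝ) × Coord p => (w.1.1, w.2)) (x := ((0, δ), u)) hU
        (smoothNear_of_contDiff ((contDiff_fst.comp contDiff_fst).prodMk contDiff_snd))
    exact h1.add ((smoothNear_of_contDiff (contDiff_snd.comp contDiff_fst)).smul
      (SmoothNear.comp (f := Prod.snd) (x := ((0, δ), u)) hV (smoothNear_of_contDiff contDiff_snd)))
  set C : ℕ → ℝ × ℝ → Coord d := fun n θ => coeff n g Y (W θ) u
  have hC : ∀ n δ, ContDiffAt ℝ ∞ (C n) (0, δ) := fun n δ =>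
    (SmoothNear.comp (f := fun θ : ℝ × ℝ => (θ, u)) (x := (0, δ)) (smooth_coeff_param hi (hW δ) n)
      (smoothNear_of_contDiff (contDiff_id.prodMk contDiff_const))).contDiffAt
  have hc1 : ContDiffAt ℝ ∞ (fun ε : ℝ => (ε, ε ^ k)) 0 := contDiffAt_id.prodMk (contDiffAt_id.pow k)
  have hc2 : ContDiffAt ℝ ∞ (fun ε : ℝ => (ε, (0 : ℝ))) 0 := contDiffAt_id.prodMk contDiffAt_const
  have hC1 : ∀ n, ContDiffAt ℝ ∞ (fun ε => C n (ε, ε ^ k)) 0 := fun n =>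
    ContDiffAt.comp (g := C n) (0 : ℝ) (hC n (0 ^ k)) hc1
  have hC2 : ∀ n, ContDiffAt ℝ ∞ (fun ε => C n (ε, 0)) 0 := fun n =>
    ContDiffAt.comp (g := C n) (0 : ℝ) (hC n 0) hc2
  have hpow : ∀ n, ContDiffAt ℝ ∞ (fun ε : ℝ => ε ^ n) 0 := fun n => contDiffAt_id.pow n
  have hUε : ∀ ε : ℝ, W (ε, 0) = U ε := fun ε => by ext v; simp [W]
  have hterm : ∀ n ∈ Finset.range (m + 1), JetEq (k + 2) (fun ε => ε ^ n • C n (ε, ε ^ k)) 0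
      (fun ε => ε ^ n • C n (ε, 0) + if n = 1 then ε ^ (k + 1) • V u else 0) 0 := by
    intro n _
    rcases n with _ | _ | n
    · simp only [C, coeff_zero]
      simpa using JetEq.refl _ _
    · refine JetEq.of_eventuallyEq ?_
      have h1 : ∀ᶠ ε in 𝓝 (0 : ℝ), SmoothNear (W (ε, ε ^ k)) u := by
        have h2 : ContinuousAt (fun ε : ℝ => ((ε, ε ^ k), u)) 0 :=
          hc1.continuousAt.prodMk continuousAt_const
        filter_upwards [h2.eventually (hW (0 ^ k)).eventually] with ε hε
        exact SmoothNear.comp (f := fun v => ((ε, ε ^ k), v)) hε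
          (smoothNear_of_contDiff (contDiff_const.prodMk contDiff_id))
      have h3 : ∀ᶠ ε in 𝓝 (0 : ℝ), SmoothNear (W (ε, 0)) u := by
        have h2 : ContinuousAt (fun ε : ℝ => ((ε, (0 : ℝ)), u)) 0 :=
          hc2.continuousAt.prodMk continuousAt_const
        filter_upwards [h2.eventually (hW 0).eventually] with ε hε
        exact SmoothNear.comp (f := fun v => ((ε, (0 : ℝ)), v)) hε
          (smoothNear_of_contDiff (contDiff_const.prodMk contDiff_id))
      filter_upwards [h1, h3] with ε h1 h3
      simp only [C, zero_add, (hi.dataNear h1).coeff_one, (hi.dataNear h3).coeff_one, if_true, W]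
      rw [zero_smul, add_zero, smul_add, smul_smul, pow_one, ← pow_succ']
    · have h1 : JetEq k (fun ε => C (n + 2) (ε, ε ^ k)) 0 (fun ε => C (n + 2) (ε, 0)) 0 := by
        rcases k.eq_zero_or_pos with rfl | hk
        · exact JetEq.zero
        · have h2 : JetEq k (fun ε : ℝ => (ε, ε ^ k)) 0 (fun ε : ℝ => (ε, (0 : ℝ))) 0 :=
            (JetEq.refl (fun ε : ℝ => ε) 0).prodMk (jetEq_pow_zero k) contDiffAt_id contDiffAt_id
              (hpow k) contDiffAt_const
          exact JetEq.comp_left (C (n + 2)) h2 (hC (n + 2) (0 ^ k)) hc1 hc2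
      have h3 := JetEq.linear_pow_smul (ContinuousLinearMap.id ℝ ℝ) (by simp) (by simp)
        (hC1 (n + 2)) (hC2 (n + 2)) h1 (n + 2)
      simpa using h3.mono (show k + 2 ≤ k + (n + 2) by omega)
  have hsum := JetEq.sum _ hterm (fun n _ => (hpow n).smul (hC1 n)) fun n _ => by
    refine ((hpow n).smul (hC2 n)).add ?_
    split_ifs
    · exact (hpow (k + 1)).smul contDiffAt_const
    · exact contDiffAt_const
  have e : (fun ε => ∑ n ∈ Finset.range (m + 1),
      (ε ^ n • C n (ε, 0) + if n = 1 then ε ^ (k + 1) • V u else 0)) =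
      fun ε => series g Y (U ε) m ε u + ε ^ (k + 1) • V u := by
    ext1 ε
    rw [Finset.sum_add_distrib, Finset.sum_ite_eq', if_pos (Finset.mem_range.2 (by omega))]
    simp only [C, hUε]
    rfl
  rw [e] at hsum
  exact hsum

/-! ### Normal displacements of curves of reparametrisations -/

theorem iteratedDeriv_clm_comp {E F : Type*} [NormedAddCommGroup E] [NormedSpace ℝ E]
    [NormedAddCommGroup F] [NormedSpace ℝ F] (L : E →L[ℝ] F) {f : ℝ → E} {t : ℝ}
    (hf : ContDiffAt ℝ ∞ f t) (n : ℕ) :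
    iteratedDeriv n (fun s => L (f s)) t = L (iteratedDeriv n f t) := by
  rw [iteratedDeriv_eq_iteratedFDeriv, iteratedDeriv_eq_iteratedFDeriv,
    show (fun s => L (f s)) = L ∘ f from rfl,
    L.iteratedFDeriv_comp_left (n := ∞) hf (by exact_mod_cast le_top)]
  rfl

/-- Two curves of points of the submanifolds `x₂(·, ε)`: the first derivatives in which they can
differ are related by the differential of the parametrisation. -/
theorem iteratedDeriv_family_sub {x₂ : Coord p × ℝ → Coord d} {r r' : ℝ → Coord p} {n : ℕ}
    (hn : 0 < n) (hx : SmoothNear x₂ (u, 0)) (hr : ContDiffAt ℝ ∞ r 0) (hr' : ContDiffAt ℝ ∞ r' 0)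
    (h0 : r 0 = u) (h : JetEq n r 0 r' 0) :
    iteratedDeriv n (fun ε => x₂ (r ε, ε)) 0 - iteratedDeriv n (fun ε => x₂ (r' ε, ε)) 0 =
      fderiv ℝ (fun v => x₂ (v, 0)) u (iteratedDeriv n r 0 - iteratedDeriv n r' 0) := by
  have hp : ContDiffAt ℝ ∞ (fun ε => (r ε, ε)) 0 := hr.prodMk contDiffAt_id
  have hp' : ContDiffAt ℝ ∞ (fun ε => (r' ε, ε)) 0 := hr'.prodMk contDiffAt_id
  have hj : JetEq n (fun ε => (r ε, ε)) 0 (fun ε => (r' ε, ε)) 0 :=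
    h.prodMk (JetEq.refl (fun ε => ε) 0) hr hr' contDiffAt_id contDiffAt_id
  have h1 := iteratedDeriv_comp_sub hn hj (k := x₂) (by rw [h0]; exact hx.contDiffAt) hp hp'
  rw [h1, h0, (hasFDerivAt_space hx.differentiableAt).fderiv]
  refine congrArg (fderiv ℝ x₂ (u, 0)) (Prod.ext ?_ ?_)
  · have e1 := iteratedDeriv_clm_comp (.fst ℝ (Coord p) ℝ) hp n
    have e2 := iteratedDeriv_clm_comp (.fst ℝ (Coord p) ℝ) hp' n
    exact congrArg₂ (· - ·) e1.symm e2.symm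
  · have e1 := iteratedDeriv_clm_comp (.snd ℝ (Coord p) ℝ) hp n
    have e2 := iteratedDeriv_clm_comp (.snd ℝ (Coord p) ℝ) hp' n
    exact (congrArg₂ (· - ·) e1.symm e2.symm).trans (sub_self _)

theorem iteratedDeriv_add_pow_smul {F : Type*} [NormedAddCommGroup F] [NormedSpace ℝ F]
    {c : ℝ → F} (hc : ContDiffAt ℝ ∞ c 0) (n j : ℕ) (a : F) :
    iteratedDeriv j (fun ε => c ε + ε ^ n • a) 0 =
      iteratedDeriv j c 0 + if j = n then (n.factorial : ℝ) • a else 0 := by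
  rw [← iteratedDeriv_pow_smul n j a]
  exact iteratedDeriv_add (hc.of_le (by exact_mod_cast le_top))
    ((contDiff_id.pow n).smul contDiff_const).contDiffAt

/-- The normal displacement in the top order is determined by the submanifolds, whatever the
parametrisations are. -/
theorem normal_eq_of_jetEq {x₂ : Coord p × ℝ → Coord d} {r r' : ℝ → Coord p} {c : ℝ → Coord d}
    {a a' : Coord d} {G : Fin d → Fin d → ℝ} (hG : IsMetric G) (hx : SmoothNear x₂ (u, 0))
    (hL : Function.Injective (fderiv ℝ (fun v => x₂ (v, 0)) u)) (hr : ContDiffAt ℝ ∞ r 0)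
    (hr' : ContDiffAt ℝ ∞ r' 0) (h0 : r 0 = u) (h0' : r' 0 = u) (hc : ContDiffAt ℝ ∞ c 0)
    (h : JetEq (k + 2) (fun ε => x₂ (r ε, ε)) 0 (fun ε => c ε + ε ^ (k + 1) • a) 0)
    (h' : JetEq (k + 2) (fun ε => x₂ (r' ε, ε)) 0 (fun ε => c ε + ε ^ (k + 1) • a') 0)
    (ha : ∀ w, innerL d G a (fderiv ℝ (fun v => x₂ (v, 0)) u w) = 0)
    (ha' : ∀ w, innerL d G a' (fderiv ℝ (fun v => x₂ (v, 0)) u w) = 0) : a = a' := by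
  have hd : ∀ n < k + 2, 0 < n → JetEq n r 0 r' 0 →
      (if n = k + 1 then ((k + 1).factorial : ℝ) • (a - a') else 0) =
        fderiv ℝ (fun v => x₂ (v, 0)) u (iteratedDeriv n r 0 - iteratedDeriv n r' 0) := by
    intro n hn hn0 hj
    rw [← iteratedDeriv_family_sub hn0 hx hr hr' h0 hj, JetEq.iff_iteratedDeriv.1 h n hn,
      JetEq.iff_iteratedDeriv.1 h' n hn, iteratedDeriv_add_pow_smul hc,
      iteratedDeriv_add_pow_smul hc, add_sub_add_left_eq_sub]
    split_ifs <;> simp [smul_sub]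
  -- Up to order `k` the two curves in the target agree. As the differential of the parametrisation
  -- is injective, the reparametrisations agree to the same order.
  have hj : ∀ n ≤ k, JetEq (n + 1) r 0 r' 0 := by
    intro n hn
    induction n with
    | zero =>
      refine JetEq.iff_iteratedDeriv.2 fun j hj => ?_
      obtain rfl : j = 0 := by omega
      simp [h0, h0']
    | succ n ih =>
      have h1 := hd (n + 1) (by omega) (by omega) (ih (by omega))
      rw [if_neg (by omega), ← map_zero (fderiv ℝ (fun v => x₂ (v, 0)) u)] at h1
      have h2 := sub_eq_zero.1 (hL h1).symm
      refine JetEq.iff_iteratedDeriv.2 fun j hj => ?_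
      rcases Nat.lt_succ_iff_lt_or_eq.1 hj with hj | rfl
      · exact JetEq.iff_iteratedDeriv.1 (ih (by omega)) j hj
      · exact h2
  have h1 := hd (k + 1) (by omega) (by omega) (hj k le_rfl)
  rw [if_pos rfl] at h1
  have hf : ((k + 1).factorial : ℝ) ≠ 0 := by exact_mod_cast (k + 1).factorial_ne_zero
  have h2 : innerL d G (a - a') (((k + 1).factorial : ℝ) • (a - a')) = 0 := by
    rw [h1, map_sub, sub_apply, ha, ha', sub_zero]
  rw [map_smul, smul_eq_mul, mul_eq_zero, or_iff_right hf] at h2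
  by_contra hne
  exact (hG.pos _ (sub_ne_zero.2 hne)).ne' h2

end Parametric

/-! ### The relative position of nearby submanifolds, in coordinates -/

section Placement

variable {p d : ℕ} {g g' : Coord d → Fin d → Fin d → ℝ} {Y Y' : Coord p → Coord d}
  {x₂ x₂' : Coord p × ℝ → Coord d} {u : Coord p} {m k : ℕ}

/-- The coordinates `τ` of the component of `ξ` tangent to the image of `L`. -/
noncomputable def tangCoord (G : Fin d → Fin d → ℝ) (L : Coord p →L[ℝ] Coord d) (ξ : Coord d) :
    Coord p := raise (pullG G L) ((innerL d G ξ).comp L)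

/-- The component of `ξ` normal to the image of `L`. -/
noncomputable def normalPart (G : Fin d → Fin d → ℝ) (L : Coord p →L[ℝ] Coord d) (ξ : Coord d) :
    Coord d := ξ - L (tangCoord G L ξ)

theorem inner_normalPart {G : Fin d → Fin d → ℝ} (hG : IsMetric G) {L : Coord p →L[ℝ] Coord d}
    (hL : Function.Injective L) (ξ : Coord d) (w : Coord p) :
    innerL d G (normalPart G L ξ) (L w) = 0 := by
  rw [normalPart, map_sub, sub_apply, ← innerL_pullG, tangCoord, (hG.pullG hL).inner_raise,
    ContinuousLinearMap.comp_apply, sub_self]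

/-- `x₂(·, ε)` is a smooth family of maps near `u`, that starts from the immersion `Y`. -/
structure PlacementNear (g : Coord d → Fin d → Fin d → ℝ) (Y : Coord p → Coord d)
    (x₂ : Coord p × ℝ → Coord d) (u : Coord p) : Prop where
  imm : ImmersionNear g Y u
  smooth : SmoothNear x₂ (u, 0)
  zero : ∀ᶠ v in 𝓝 u, x₂ (v, 0) = Y v

namespace PlacementNear

theorem eventually (h : PlacementNear g Y x₂ u) : ∀ᶠ v in 𝓝 u, PlacementNear g Y x₂ v := by
  filter_upwards [h.imm.eventually, (tendsto_slice u).eventually h.smooth.eventually,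
    eventually_eventually_nhds.2 h.zero] with v h1 h2 h3 using ⟨h1, h2, h3⟩

theorem fderiv_eq (h : PlacementNear g Y x₂ u) :
    fderiv ℝ (fun v => x₂ (v, 0)) u = fderiv ℝ Y u := EventuallyEq.fderiv_eq h.zero

theorem contDiffAt_tangCoord {D : Coord p → Coord d} (h : ImmersionNear g Y u)
    (hD : ContDiffAt ℝ ∞ D u) :
    ContDiffAt ℝ ∞ (fun v => tangCoord (g (Y v)) (fderiv ℝ Y v) (D v)) u := by
  have hG : ContDiffAt ℝ ∞ (fun v => g (Y v)) u :=
    (SmoothNear.comp (f := Y) h.metric.smooth h.smooth).contDiffAt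
  have hL : ∀ a, ContDiffAt ℝ ∞ (fun v => fderiv ℝ Y v (basisVec a)) u := fun a =>
    h.smooth.fderiv.contDiffAt.clm_apply contDiffAt_const
  exact contDiffAt_raiseV (contDiffAt_pi.2 fun a => contDiffAt_pi.2 fun b =>
    contDiffAt_innerL hG (hL a) (hL b)) (h.metric.isMetric.pullG h.injective).det_ne_zero
    fun i => contDiffAt_innerL hG hD (hL i)

end PlacementNear

/-- The Taylor coefficient of order `m + 1` of the difference between `x₂` in the parametrisation
`r` and the submanifold displaced by `ε • U`. -/
noncomputable def mismatch (g : Coord d → Fin d → Fin d → ℝ) (Y : Coord p → Coord d)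
    (x₂ : Coord p × ℝ → Coord d) (r : Coord p × ℝ → Coord p) (U : ℝ → Coord p → Coord d) (m : ℕ)
    (v : Coord p) : Coord d :=
  ((m + 1).factorial : ℝ)⁻¹ • iteratedDeriv (m + 1)
    (fun ε => x₂ (r (v, ε), ε) - series g Y (U ε) (m + 1) ε v) 0

/-- The reparametrisation `r` and the normal field `ε • U` to order `m` in `ε`: at each order, the
normal component of the mismatch is added to the field, and the tangential component is absorbed in
the parametrisation. -/
noncomputable def placement (g : Coord d → Fin d → Fin d → ℝ) (Y : Coord p → Coord d)
    (x₂ : Coord p × ℝ → Coord d) : ℕ → (Coord p × ℝ → Coord p) × (ℝ → Coord p → Coord d)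
  | 0 => (Prod.fst, fun _ _ => 0)
  | m + 1 =>
    (fun q => (placement g Y x₂ m).1 q - q.2 ^ (m + 1) • tangCoord (g (Y q.1)) (fderiv ℝ Y q.1)
        (mismatch g Y x₂ (placement g Y x₂ m).1 (placement g Y x₂ m).2 m q.1),
      fun ε v => (placement g Y x₂ m).2 ε v + ε ^ m • normalPart (g (Y v)) (fderiv ℝ Y v)
        (mismatch g Y x₂ (placement g Y x₂ m).1 (placement g Y x₂ m).2 m v))

/-- The term of order `k + 1` of the normal field that describes the position of `x₂`. -/
noncomputable def posField (g : Coord d → Fin d → Fin d → ℝ) (Y : Coord p → Coord d)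
    (x₂ : Coord p × ℝ → Coord d) (k : ℕ) (v : Coord p) : Coord d :=
  normalPart (g (Y v)) (fderiv ℝ Y v)
    (mismatch g Y x₂ (placement g Y x₂ k).1 (placement g Y x₂ k).2 k v)

/-- The field `∑_{j < m} ε^j V_j`. -/
noncomputable def polyField (V : ℕ → Coord p → Coord d) (m : ℕ) (ε : ℝ) (v : Coord p) : Coord d :=
  ∑ j ∈ Finset.range m, ε ^ j • V j v

theorem polyField_succ (V : ℕ → Coord p → Coord d) (m : ℕ) (ε : ℝ) :
    polyField V (m + 1) ε = fun v => polyField V m ε v + ε ^ m • V m v :=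
  funext fun _ => Finset.sum_range_succ _ _

theorem smooth_polyField {V : ℕ → Coord p → Coord d} (hV : ∀ j < m, SmoothNear (V j) u) (ε : ℝ) :
    SmoothNear (Function.uncurry (polyField V m)) (ε, u) := by
  have h1 := eventually_all_finset (Finset.range m) |>.2 fun j hj =>
    ((smoothNear_of_contDiff (contDiff_fst.pow j)).smul (SmoothNear.comp
      (f := Prod.snd) (x := (ε, u)) (hV j (Finset.mem_range.1 hj))
      (smoothNear_of_contDiff contDiff_snd)) : SmoothNear (fun w : ℝ × Coord p =>
          w.1 ^ j • V j w.2) (ε, u))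
  exact h1.mono fun w hw => ContDiffAt.sum fun n hn => hw n hn

theorem placement_snd (m : ℕ) : (placement g Y x₂ m).2 = polyField (posField g Y x₂) m := by
  induction m with
  | zero => ext; simp [placement, polyField]
  | succ m ih =>
    ext1 ε
    rw [polyField_succ, ← ih]
    rfl

theorem placement_zero (m : ℕ) (v : Coord p) : (placement g Y x₂ m).1 (v, 0) = v := by
  induction m with
  | zero => rfl
  | succ m ih => simp [placement, ih]

theorem iteratedDeriv_sub_pow_smul {F : Type*} [NormedAddCommGroup F] [NormedSpace ℝ F]
    {c : ℝ → F} (hc : ContDiffAt ℝ ∞ c 0) (n j : ℕ) (a : F) :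
    iteratedDeriv j (fun ε => c ε - ε ^ n • a) 0 =
      iteratedDeriv j c 0 - if j = n then (n.factorial : ℝ) • a else 0 := by
  have := iteratedDeriv_add_pow_smul hc n j (-a)
  simp only [smul_neg, ← sub_eq_add_neg] at this
  rw [this, sub_eq_add_neg]
  split_ifs <;> simp

namespace PlacementNear

theorem inner_posField (h : PlacementNear g Y x₂ u) (k : ℕ) (w : Coord p) :
    innerL d (g (Y u)) (posField g Y x₂ k u) (fderiv ℝ Y u w) = 0 :=
  inner_normalPart h.imm.metric.isMetric h.imm.injective _ w

theorem smooth_mismatch (h : PlacementNear g Y x₂ u)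
    (hr : SmoothNear (placement g Y x₂ m).1 (u, 0))
    (hV : ∀ j < m, SmoothNear (posField g Y x₂ j) u) :
    ContDiffAt ℝ ∞ (fun w : Coord p × ℝ => x₂ ((placement g Y x₂ m).1 w, w.2) -
      series g Y ((placement g Y x₂ m).2 w.2) (m + 1) w.2 w.1) (u, 0) := by
  have h1 : SmoothNear (fun w : Coord p × ℝ => ((placement g Y x₂ m).1 w, w.2)) (u, 0) :=
    hr.prodMk (smoothNear_of_contDiff contDiff_snd)
  have h2 := SmoothNear.comp (g := x₂) (f := fun w : Coord p × ℝ => ((placement g Y x₂ m).1 w, w.2))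
    (x := (u, 0)) (by rw [placement_zero]; exact h.smooth) h1
  rw [placement_snd]
  exact h2.contDiffAt.sub (smooth_series_diag h.imm (smooth_polyField hV 0) (m + 1)).contDiffAt

/-- Smoothness of the recursive construction. The induction hypothesis is used at all nearby points, as
`SmoothNear` is a statement about them. -/
theorem smooth_placement (m : ℕ) (h : PlacementNear g Y x₂ u) :
    SmoothNear (placement g Y x₂ m).1 (u, 0) ∧ ∀ j < m, SmoothNear (posField g Y x₂ j) u := by
  induction m generalizing u with
  | zero => exact ⟨smoothNear_of_contDiff contDiff_fst, fun _ hj => absurd hj (Nat.not_lt_zero _)⟩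
  | succ m ih =>
    have hD : ∀ v, PlacementNear g Y x₂ v → ContDiffAt ℝ ∞
        (mismatch g Y x₂ (placement g Y x₂ m).1 (placement g Y x₂ m).2 m) v := fun v hv =>
      (contDiffAt_const (c := ((m + 1).factorial : ℝ)⁻¹)).smul
        (contDiffAt_iteratedDeriv_zero (hv.smooth_mismatch (ih hv).1 (ih hv).2) (m + 1))
    have hT := h.eventually.mono fun v hv => contDiffAt_tangCoord hv.imm (hD v hv)
    have hT' : SmoothNear (fun v => tangCoord (g (Y v)) (fderiv ℝ Y v)
      (mismatch g Y x₂ (placement g Y x₂ m).1 (placement g Y x₂ m).2 m v)) u := hT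
    refine ⟨(ih h).1.sub ((smoothNear_of_contDiff (contDiff_snd.pow (m + 1))).smul
      (SmoothNear.comp (f := Prod.fst) (x := (u, (0 : ℝ))) hT'
        (smoothNear_of_contDiff contDiff_fst))), fun j hj => ?_⟩
    rcases Nat.lt_succ_iff_lt_or_eq.1 hj with hj | rfl
    · exact (ih h).2 j hj
    · have hDn := h.eventually.mono hD
      filter_upwards [hDn, hT', h.imm.smooth.fderiv] with v h1 h2 h3
      exact h1.sub (h3.clm_apply h2)

theorem smooth_posField (h : PlacementNear g Y x₂ u) (k : ℕ) : SmoothNear (posField g Y x₂ k) u :=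
  (h.smooth_placement (k + 1)).2 k k.lt_succ_self

theorem smooth_repar (h : PlacementNear g Y x₂ u) (m : ℕ) :
    ContDiffAt ℝ ∞ (fun ε => (placement g Y x₂ m).1 (u, ε)) 0 :=
  (h.smooth_placement m).1.slice.contDiffAt

theorem smooth_curve (h : PlacementNear g Y x₂ u) {r : ℝ → Coord p} (hr : ContDiffAt ℝ ∞ r 0)
    (h0 : r 0 = u) : ContDiffAt ℝ ∞ (fun ε => x₂ (r ε, ε)) 0 := by
  have h1 : ContDiffAt ℝ ∞ x₂ (r 0, 0) := by rw [h0]; exact h.smooth.contDiffAt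
  exact ContDiffAt.comp (0 : ℝ) (f := fun ε => (r ε, ε)) h1 (hr.prodMk contDiffAt_id)

theorem smooth_series (h : PlacementNear g Y x₂ u) (k m : ℕ) :
    ContDiffAt ℝ ∞ (fun ε => series g Y (polyField (posField g Y x₂) k ε) m ε u) 0 :=
  (smooth_series_diag h.imm (smooth_polyField (fun j _ => h.smooth_posField j) 0) m).slice.contDiffAt

theorem jetEq_succ (h : PlacementNear g Y x₂ u) (k : ℕ) (hm : 0 < m) :
    JetEq (k + 2) (fun ε => series g Y (polyField (posField g Y x₂) (k + 1) ε) m ε u) 0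
      (fun ε => series g Y (polyField (posField g Y x₂) k ε) m ε u +
        ε ^ (k + 1) • posField g Y x₂ k u) 0 := by
  have := jetEq_series_add h.imm (smooth_polyField (fun j _ => h.smooth_posField j) 0)
    (h.smooth_posField k) k hm (U := polyField (posField g Y x₂) k)
  simpa only [polyField_succ] using this

/-- The operator of index `m + 1` does not contribute to the deformation by `ε • U` to order `m` in
`ε`. -/
theorem jetEq_series_succ {U : ℝ → Coord p → Coord d} (hi : ImmersionNear g Y u)
    (hU : SmoothNear (Function.uncurry U) (0, u)) (m : ℕ) :
    JetEq (m + 1) (fun ε => series g Y (U ε) (m + 1) ε u) 0 (fun ε => series g Y (U ε) m ε u) 0 := by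
  have hc : ContDiffAt ℝ ∞ (fun ε => coeff (m + 1) g Y (U ε) u) 0 :=
    (SmoothNear.comp (f := fun ε : ℝ => (ε, u)) (smooth_coeff_param hi hU (m + 1))
      (smoothNear_of_contDiff (contDiff_id.prodMk contDiff_const))).contDiffAt
  have hs := (smooth_series_diag hi hU m).slice.contDiffAt
  have hz : JetEq 0 (fun ε => coeff (m + 1) g Y (U ε) u) 0 (fun _ : ℝ => (0 : Coord d)) 0 :=
    JetEq.zero
  have h1 := JetEq.linear_pow_smul (ContinuousLinearMap.id ℝ ℝ) (by simp) (by simp) hc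
    contDiffAt_const hz (m + 1)
  have h2 := (JetEq.refl (fun ε => series g Y (U ε) m ε u) 0).add (h1.mono (show m + 1 ≤ 0 + (m + 1) by omega)) hs hs
    ((contDiffAt_id.pow (m + 1)).smul hc) ((contDiffAt_id.pow (m + 1)).smul contDiffAt_const)
  have e : (fun ε => series g Y (U ε) (m + 1) ε u) = fun ε => series g Y (U ε) m ε u +
      (ContinuousLinearMap.id ℝ ℝ) ε ^ (m + 1) • coeff (m + 1) g Y (U ε) u :=
    funext fun ε => Finset.sum_range_succ _ _
  rw [e]
  simpa using h2

/-- The displaced submanifold agrees with `x₂` to every order. -/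
theorem jetEq_placement (h : PlacementNear g Y x₂ u) (m : ℕ) :
    JetEq (m + 1) (fun ε => x₂ ((placement g Y x₂ m).1 (u, ε), ε)) 0
      (fun ε => series g Y (polyField (posField g Y x₂) m ε) m ε u) 0 := by
  induction m with
  | zero =>
    refine JetEq.iff_iteratedDeriv.2 fun j hj => ?_
    obtain rfl : j = 0 := by omega
    simp [placement, series, coeff_zero, h.zero.self_of_nhds]
  | succ m ih =>
    set r := fun ε => (placement g Y x₂ m).1 (u, ε)
    set τ := tangCoord (g (Y u)) (fderiv ℝ Y u)
      (mismatch g Y x₂ (placement g Y x₂ m).1 (placement g Y x₂ m).2 m u)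
    set c := fun ε => series g Y (polyField (posField g Y x₂) m ε) (m + 1) ε u
    have hr : ContDiffAt ℝ ∞ r 0 := h.smooth_repar m
    have hr0 : r 0 = u := placement_zero m u
    have hc : ContDiffAt ℝ ∞ c 0 := h.smooth_series m (m + 1)
    have hr' : ContDiffAt ℝ ∞ (fun ε => r ε - ε ^ (m + 1) • τ) 0 :=
      hr.sub ((contDiffAt_id.pow (m + 1)).smul contDiffAt_const)
    have hjc : JetEq (m + 1) (fun ε => x₂ (r ε, ε)) 0 c 0 :=
      ih.trans (jetEq_series_succ h.imm (smooth_polyField (fun j _ => h.smooth_posField j) 0) m).symm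
    have hjr : JetEq (m + 1) (fun ε => r ε - ε ^ (m + 1) • τ) 0 r 0 := by
      refine JetEq.iff_iteratedDeriv.2 fun j hj => ?_
      rw [iteratedDeriv_sub_pow_smul hr, if_neg (by omega), sub_zero]
    -- The new term of the reparametrisation changes the derivative of order `m + 1` by minus the
    -- tangential vector with coordinates `τ`.
    have htop := iteratedDeriv_family_sub (m.succ_pos) h.smooth hr' hr (by simp [hr0]) hjr
    rw [iteratedDeriv_sub_pow_smul hr, if_pos rfl, sub_sub_cancel_left, h.fderiv_eq, map_neg,
      map_smul] at htop
    have hf : ((m + 1).factorial : ℝ) ≠ 0 := by exact_mod_cast (m + 1).factorial_ne_zero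
    have hmis : iteratedDeriv (m + 1) (fun ε => x₂ (r ε, ε)) 0 - iteratedDeriv (m + 1) c 0 =
        ((m + 1).factorial : ℝ) •
          mismatch g Y x₂ (placement g Y x₂ m).1 (placement g Y x₂ m).2 m u := by
      rw [mismatch, smul_smul, mul_inv_cancel₀ hf, one_smul, placement_snd]
      exact (iteratedDeriv_sub ((h.smooth_curve hr hr0).of_le (by exact_mod_cast le_top))
        (hc.of_le (by exact_mod_cast le_top))).symm
    have hpos : posField g Y x₂ m u =
        mismatch g Y x₂ (placement g Y x₂ m).1 (placement g Y x₂ m).2 m u - fderiv ℝ Y u τ := rfl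
    -- The new term of the field changes it by the normal part of the mismatch; the lower derivatives
    -- are not affected by either change.
    refine JetEq.trans ?_ (h.jetEq_succ m m.succ_pos).symm
    refine JetEq.iff_iteratedDeriv.2 fun j hj => ?_
    rw [iteratedDeriv_add_pow_smul hc]
    have hlow := JetEq.iff_iteratedDeriv.1 (JetEq.comp_left (f := fun ε => (r ε - ε ^ (m + 1) • τ, ε))
      (f' := fun ε => (r ε, ε)) x₂ (hjr.prodMk (JetEq.refl (fun ε => ε) 0) hr' hr contDiffAt_id
      contDiffAt_id) (by simpa [hr0] using h.smooth.contDiffAt) (hr'.prodMk contDiffAt_id)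
      (hr.prodMk contDiffAt_id))
    rcases Nat.lt_succ_iff_lt_or_eq.1 hj with hj | rfl
    · rw [if_neg (by omega), add_zero, ← JetEq.iff_iteratedDeriv.1 hjc j hj]
      exact hlow j hj
    · rw [if_pos rfl, hpos, smul_sub, ← hmis]
      have e : iteratedDeriv (m + 1) (fun ε => x₂ ((placement g Y x₂ (m + 1)).1 (u, ε), ε)) 0 =
        iteratedDeriv (m + 1) (fun ε => x₂ (r ε - ε ^ (m + 1) • τ, ε)) 0 := rfl
      rw [e, eq_add_of_sub_eq htop]
      abel

end PlacementNear

/-! ### Independence of the relative position of the coordinates -/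

/-- The data for two coordinate expressions of the same family of submanifolds: `F` is the change of
coordinates of the target, `f` that of the parameters, with inverse `h`. -/
structure RelatedPlacements (g g' : Coord d → Fin d → Fin d → ℝ) (F : Coord d → Coord d)
    (f h : Coord p → Coord p) (Y Y' : Coord p → Coord d) (x₂ x₂' : Coord p × ℝ → Coord d)
    (u : Coord p) : Prop where
  pl : PlacementNear g Y x₂ (f u)
  pl' : PlacementNear g' Y' x₂' u
  isom : LocalIsometry g g' F (Y (f u))
  repar : SmoothNear f u
  inv : SmoothNear h (f u)
  left_inv : ∀ᶠ v in 𝓝 u, h (f v) = v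
  right_inv : ∀ᶠ v in 𝓝 (f u), f (h v) = v
  eq : ∀ᶠ q in 𝓝 (u, 0), x₂' q = F (x₂ (f q.1, q.2))

namespace RelatedPlacements

variable {F : Coord d → Coord d} {f h : Coord p → Coord p}

theorem eventually (H : RelatedPlacements g g' F f h Y Y' x₂ x₂' u) :
    ∀ᶠ v in 𝓝 u, RelatedPlacements g g' F f h Y Y' x₂ x₂' v := by
  have hf := H.repar.contDiffAt.continuousAt
  have hY : ContinuousAt (fun v => Y (f v)) u :=
    (SmoothNear.comp (f := f) H.pl.imm.smooth H.repar).contDiffAt.continuousAt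
  filter_upwards [hf.eventually H.pl.eventually, H.pl'.eventually,
    hY.eventually H.isom.smooth.eventually,
    hY.eventually (eventually_eventually_nhds.2 H.isom.isometry), H.repar.eventually,
    hf.eventually H.inv.eventually, eventually_eventually_nhds.2 H.left_inv,
    hf.eventually (eventually_eventually_nhds.2 H.right_inv),
    (tendsto_slice u).eventually (eventually_eventually_nhds.2 H.eq)]
    with v h1 h2 h3 h4 h5 h6 h7 h8 h9 using ⟨h1, h2, ⟨h3, h4⟩, h5, h6, h7, h8, h9⟩

theorem relatedImmersions (H : RelatedPlacements g g' F f h Y Y' x₂ x₂' u) :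
    RelatedImmersions g g' F f Y Y' u where
  imm := H.pl.imm
  imm' := H.pl'.imm
  isom := H.isom
  repar := H.repar
  eq := by
    filter_upwards [H.eventually] with v hv
    have := hv.eq.self_of_nhds
    rwa [hv.pl'.zero.self_of_nhds, hv.pl.zero.self_of_nhds] at this

/-- If `x₂` is the deformation by `ε • U` in the parametrisation `r`, the same holds in the other
coordinates. -/
theorem jetEq_transfer (H : RelatedPlacements g g' F f h Y Y' x₂ x₂' u)
    {r : ℝ → Coord p} (hr : ContDiffAt ℝ ∞ r 0) (h0 : r 0 = f u) {U U' : ℝ → Coord p → Coord d}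
    (hU : SmoothNear (Function.uncurry U) (0, f u)) (hU' : SmoothNear (Function.uncurry U') (0, u))
    (hUU : ∀ᶠ v in 𝓝 u, ∀ ε, U' ε v = fderiv ℝ F (Y (f v)) (U ε (f v)))
    (hj : JetEq (m + 1) (fun ε => x₂ (r ε, ε)) 0 (fun ε => series g Y (U ε) m ε (f u)) 0) :
    JetEq (m + 1) (fun ε => x₂' (h (r ε), ε)) 0 (fun ε => series g' Y' (U' ε) m ε u) 0 := by
  have hhr : ContDiffAt ℝ ∞ (fun ε => h (r ε)) 0 := by
    have : ContDiffAt ℝ ∞ h (r 0) := by rw [h0]; exact H.inv.contDiffAt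
    exact this.comp 0 hr
  have hhr0 : h (r 0) = u := by rw [h0]; exact H.left_inv.self_of_nhds
  have hev : (fun ε => x₂' (h (r ε), ε)) =ᶠ[𝓝 0] fun ε => F (x₂ (r ε, ε)) := by
    have h1 : Tendsto (fun ε => (h (r ε), ε)) (𝓝 0) (𝓝 (u, 0)) :=
      (hhr.continuousAt.prodMk continuousAt_id).tendsto.trans (by rw [hhr0]; rfl)
    have h2 : Tendsto r (𝓝 0) (𝓝 (f u)) := h0 ▸ hr.continuousAt.tendsto
    filter_upwards [h1.eventually H.eq, h2.eventually H.right_inv] with ε h3 h4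
    rw [h3, h4]
  have hs := (smooth_series_diag H.pl.imm hU m).slice.contDiffAt
  have hx0 : x₂ (r 0, 0) = Y (f u) := by rw [h0, H.pl.zero.self_of_nhds]
  have h1 := JetEq.comp_left F hj (by rw [hx0]; exact H.isom.smooth.contDiffAt)
    (H.pl.smooth_curve hr h0) hs
  exact (JetEq.of_eventuallyEq hev).trans (h1.trans (jetEq_series_diag H.pl.imm hU H.isom H.repar
    H.pl'.imm hU' H.relatedImmersions.eq hUU m))

/-- The field that describes the relative position is independent of the coordinates. -/
theorem posField_eq (k : ℕ) (H : RelatedPlacements g g' F f h Y Y' x₂ x₂' u) :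
    posField g' Y' x₂' k u = fderiv ℝ F (Y (f u)) (posField g Y x₂ k (f u)) := by
  induction k using Nat.strong_induction_on generalizing u with
  | _ k ih =>
    set V : ℕ → Coord p → Coord d := posField g Y x₂
    set V' : ℕ → Coord p → Coord d := posField g' Y' x₂'
    set W : Coord p → Coord d := fun v => fderiv ℝ F (Y (f v)) (V k (f v))
    have hRI := H.relatedImmersions
    have hYf : SmoothNear (fun v => Y (f v)) u := SmoothNear.comp (f := f) H.pl.imm.smooth H.repar
    have hW : SmoothNear W u := by
      have h1 := SmoothNear.comp (f := fun v => Y (f v)) H.isom.smooth.fderiv hYf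
      have h2 := SmoothNear.comp (f := f) (H.pl.smooth_posField k) H.repar
      filter_upwards [h1, h2] with v h3 h4 using h3.clm_apply h4
    have hU := smooth_polyField (m := k + 1) (fun j _ => H.pl.smooth_posField j) 0
    have hk' := smooth_polyField (m := k) (fun j _ => H.pl'.smooth_posField j) 0
    have hU' : SmoothNear (Function.uncurry fun ε v => polyField V' k ε v + ε ^ k • W v) (0, u) :=
      hk'.add ((smoothNear_of_contDiff (contDiff_fst.pow k)).smul (SmoothNear.comp
        (f := Prod.snd) (x := ((0 : ℝ), u)) hW (smoothNear_of_contDiff contDiff_snd)))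
    have hUU : ∀ᶠ v in 𝓝 u, ∀ ε : ℝ, polyField V' k ε v + ε ^ k • W v =
        fderiv ℝ F (Y (f v)) (polyField V (k + 1) ε (f v)) := by
      filter_upwards [H.eventually] with v hv ε
      rw [polyField_succ, map_add, map_smul, polyField, polyField, map_sum]
      congr 1
      refine Finset.sum_congr rfl fun j hj => ?_
      rw [map_smul]
      exact congrArg _ (ih j (Finset.mem_range.1 hj) hv)
    -- The image of the field of the first coordinates and the field of the second ones both place `x₂`
    -- and agree in lower orders, so the normal terms of order `k + 1` agree.
    have h1 := H.jetEq_transfer (H.pl.smooth_repar (k + 1)) (placement_zero _ _) hU hU' hUU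
      (H.pl.jetEq_placement (k + 1))
    have h2 := h1.trans (jetEq_series_add H.pl'.imm hk' hW k k.succ_pos)
    have h3 := (H.pl'.jetEq_placement (k + 1)).trans (H.pl'.jetEq_succ k k.succ_pos)
    have hhr : ContDiffAt ℝ ∞ (fun ε => h ((placement g Y x₂ (k + 1)).1 (f u, ε))) 0 := by
      have : ContDiffAt ℝ ∞ h ((placement g Y x₂ (k + 1)).1 (f u, 0)) := by
        rw [placement_zero]; exact H.inv.contDiffAt
      exact this.comp 0 (H.pl.smooth_repar (k + 1))
    refine normal_eq_of_jetEq H.pl'.imm.metric.isMetric H.pl'.smooth ?_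
      (H.pl'.smooth_repar (k + 1)) hhr (placement_zero _ _) ?_ (H.pl'.smooth_series k (k + 1)) h3 h2
      ?_ ?_
    · rw [H.pl'.fderiv_eq]
      exact H.pl'.imm.injective
    · rw [placement_zero]
      exact H.left_inv.self_of_nhds
    · intro w
      rw [H.pl'.fderiv_eq]
      exact H.pl'.inner_posField k w
    · intro w
      rw [H.pl'.fderiv_eq, hRI.fderiv_eq]
      exact (hRI.inner_eq _ _).trans (H.pl.inner_posField k _)

end RelatedPlacements

end Placement

/-! ### The relative position of nearby submanifolds, on manifolds -/

section Position

set_option linter.unusedSectionVars false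

variable {p d : ℕ}
  {M : Type*} [TopologicalSpace M] [ChartedSpace (Coord d) M] [IsManifold (𝓡 d) ∞ M]
  {N : Type*} [TopologicalSpace N] [ChartedSpace (Coord p) N] [IsManifold (𝓡 p) ∞ N]
  {ψ ψ' : OpenPartialHomeomorph N (Coord p)} {φ φ' : OpenPartialHomeomorph M (Coord d)}
  {X₁ : N → M} {X₂ : N → ℝ → M} {W : Set (N × ℝ)} {u : Coord p} {g g' : Metric d M} {m : ℕ}
  {w w' : ℕ → ∀ z, TangentSpace (𝓡 d) (X₁ z)}

variable (p d) in
/-- `X₂(·, ε)` is a smooth family of maps, defined near `ε = 0`, that starts from the immersion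
`X₁`. -/
structure IsDeformation (X₁ : N → M) (X₂ : N → ℝ → M) (W : Set (N × ℝ)) : Prop where
  imm : IsSmoothImmersion p d X₁
  isOpen : IsOpen W
  slice : ∀ z, (z, (0 : ℝ)) ∈ W
  smooth : ContMDiffOn ((𝓡 p).prod 𝓘(ℝ, ℝ)) (𝓡 d) ∞ (Function.uncurry X₂) W
  zero : ∀ z, X₂ z 0 = X₁ z

namespace IsDeformation

theorem inCharts (h : IsDeformation p d X₁ X₂ W) (hu : u ∈ ψ.target) (hx : X₁ (ψ.symm u) ∈ φ.source) :
    InCharts ψ φ X₂ W u 0 := ⟨hu, h.slice _, by rwa [h.zero]⟩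

theorem placementNear (h : IsDeformation p d X₁ X₂ W) (hψ : IsChart ψ) (hφ : IsChart φ)
    (hu : u ∈ ψ.target) (hx : X₁ (ψ.symm u) ∈ φ.source) (g : Metric d M) :
    PlacementNear (chartMetric g φ) (chartMap ψ φ X₁) (Function.uncurry (chartFamily ψ φ X₂)) u where
  imm := h.imm.immersionNear hψ hφ hu hx g
  smooth := (h.inCharts hu hx).smoothNear hψ hφ h.isOpen h.smooth
  zero := Eventually.of_forall fun _ => congrArg φ (h.zero _)

/-- The coordinate expressions of a deformation in two pairs of charts are related. -/
theorem relatedPlacements (h : IsDeformation p d X₁ X₂ W) (hψ : IsChart ψ) (hφ : IsChart φ)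
    (hψ' : IsChart ψ') (hφ' : IsChart φ') (hu : u ∈ ψ'.target) (hz : ψ'.symm u ∈ ψ.source)
    (hx : X₁ (ψ'.symm u) ∈ φ.source) (hx' : X₁ (ψ'.symm u) ∈ φ'.source) (g : Metric d M) :
    RelatedPlacements (chartMetric g φ) (chartMetric g φ') (fun y => φ' (φ.symm y))
      (fun v => ψ (ψ'.symm v)) (fun v => ψ' (ψ.symm v)) (chartMap ψ φ X₁) (chartMap ψ' φ' X₁)
      (Function.uncurry (chartFamily ψ φ X₂)) (Function.uncurry (chartFamily ψ' φ' X₂)) u := by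
  have hfu : ψ (ψ'.symm u) ∈ ψ.target := ψ.map_source hz
  have hsf : ψ.symm (ψ (ψ'.symm u)) = ψ'.symm u := ψ.left_inv hz
  have hxf : X₁ (ψ.symm (ψ (ψ'.symm u))) ∈ φ.source := by rwa [hsf]
  have hev : ∀ᶠ v in 𝓝 u, v ∈ ψ'.target ∧ ψ'.symm v ∈ ψ.source :=
    eventually_chart (Y := id) continuous_id hu hz
  have hev' : ∀ᶠ v in 𝓝 (ψ (ψ'.symm u)), v ∈ ψ.target ∧ ψ.symm v ∈ ψ'.source :=
    eventually_chart (Y := id) continuous_id hfu (by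
      rw [id, hsf]; exact ψ'.map_target hu)
  refine ⟨h.placementNear hψ hφ hfu hxf g, h.placementNear hψ' hφ' hu hx' g,
    (isPullback_refl g).localIsometry hφ hφ' (φ.map_source hxf) ?_, ?_, ?_, ?_, ?_, ?_⟩
  · rw [chartMap, φ.left_inv hxf, hsf]
    exact hx'
  · exact hev.mono fun v hv => contMDiffAt_iff_contDiffAt.1
      ((hψ.contMDiffAt hv.2).comp v (hψ'.contMDiffAt_symm hv.1))
  · exact hev'.mono fun v hv => contMDiffAt_iff_contDiffAt.1
      ((hψ'.contMDiffAt hv.2).comp v (hψ.contMDiffAt_symm hv.1))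
  · filter_upwards [hev] with v hv
    rw [ψ.left_inv hv.2, ψ'.right_inv hv.1]
  · filter_upwards [hev'] with v hv
    rw [ψ'.left_inv hv.2, ψ.right_inv hv.1]
  · filter_upwards [(h.inCharts hu hx).eventually h.isOpen h.smooth,
      (continuousAt_fst (p := (u, (0 : ℝ)))).eventually hev] with q hq hq'
    simp only [Function.uncurry, chartFamily]
    rw [ψ.left_inv hq'.2, φ.left_inv hq.target]

end IsDeformation

variable (p) in
/-- The term of order `k + 1` of the normal field that describes the position of the submanifolds
`X₂(·, ε)` relative to `X₁`, computed in the preferred charts. -/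
noncomputable def position (g : Metric d M) (X₁ : N → M) (X₂ : N → ℝ → M) (k : ℕ) (z : N) :
    TangentSpace (𝓡 d) (X₁ z) :=
  (ofChart (chartAt (Coord d) (X₁ z)) (chartAt (Coord d) (X₁ z) (X₁ z))
    (posField (chartMetric g (chartAt (Coord d) (X₁ z)))
      (chartMap (chartAt (Coord p) z) (chartAt (Coord d) (X₁ z)) X₁)
      (Function.uncurry (chartFamily (chartAt (Coord p) z) (chartAt (Coord d) (X₁ z)) X₂)) k
      (chartAt (Coord p) z z)) : Coord d)

/-- The components of the position field in arbitrary charts. -/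
theorem IsDeformation.chartField_position (h : IsDeformation p d X₁ X₂ W) (hψ : IsChart ψ)
    (hφ : IsChart φ) (hu : u ∈ ψ.target) (hx : X₁ (ψ.symm u) ∈ φ.source) (g : Metric d M) (k : ℕ) :
    chartField ψ φ X₁ (position p g X₁ X₂ k) u = posField (chartMetric g φ) (chartMap ψ φ X₁)
      (Function.uncurry (chartFamily ψ φ X₂)) k u := by
  set ψ₀ := chartAt (Coord p) (ψ.symm u)
  set φ₀ := chartAt (Coord d) (X₁ (ψ.symm u))
  have hψ₀ : IsChart ψ₀ := IsManifold.chart_mem_maximalAtlas _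
  have hφ₀ : IsChart φ₀ := IsManifold.chart_mem_maximalAtlas _
  have hz₀ : ψ.symm u ∈ ψ₀.source := mem_chart_source _ _
  have hx₀ : X₁ (ψ.symm u) ∈ φ₀.source := mem_chart_source _ _
  have H := h.relatedPlacements hψ₀ hφ₀ hψ hφ hu hz₀ hx₀ hx g
  rw [H.posField_eq k]
  have e : chartMap ψ₀ φ₀ X₁ (ψ₀ (ψ.symm u)) = φ₀ (X₁ (ψ.symm u)) := by
    rw [chartMap, ψ₀.left_inv hz₀]
  rw [e]
  have hsrc : φ₀.symm (φ₀ (X₁ (ψ.symm u))) = X₁ (ψ.symm u) := φ₀.left_inv hx₀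
  refine Eq.trans ?_ (hφ.fderiv_comp (f := fun y => φ₀.symm y)
    ((hφ₀.contMDiffAt_symm (φ₀.map_source hx₀)).mdifferentiableAt infty_ne_zero)
    (by rw [hsrc]; exact hx) _).symm
  have key : ∀ x, x = X₁ (ψ.symm u) → ∀ a : Coord d,
      toChart φ (X₁ (ψ.symm u)) a = toChart φ x a := by rintro x rfl a; rfl
  exact key _ hsrc _

/-- A field is smooth if its coordinate expressions are. -/
theorem isSmoothField_of_chartField {v : ∀ z, TangentSpace (𝓡 d) (X₁ z)}
    (hX₁ : IsSmoothImmersion p d X₁) (h : ∀ (ψ : OpenPartialHomeomorph N (Coord p))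
      (φ : OpenPartialHomeomorph M (Coord d)), IsChart ψ → IsChart φ → ∀ u ∈ ψ.target,
      X₁ (ψ.symm u) ∈ φ.source → ContDiffAt ℝ ∞ (chartField ψ φ X₁ v) u) :
    IsSmoothField p X₁ v := by
  intro z
  obtain ⟨ψ, hψ, hz⟩ := exists_chart (n := p) z
  obtain ⟨φ, hφ, hx⟩ := exists_chart (n := d) (X₁ z)
  have hx' : X₁ (ψ.symm (ψ z)) ∈ φ.source := by rwa [ψ.left_inv hz]
  have h1 := (contMDiffAt_iff_contDiffAt.2 (h ψ φ hψ hφ (ψ z) (ψ.map_source hz) hx')).comp z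
    (hψ.contMDiffAt hz)
  have h2 := ((hφ.contMDiffAt hx).comp z (hX₁.1 z))
  have h3 := contMDiffAt_tangent φ.open_target (contMDiffOn_symm_of_mem_maximalAtlas hφ)
    (contMDiffAt_vectorSpace_mk h2 h1) (φ.map_source hx)
  refine h3.congr_of_eventuallyEq ?_
  filter_upwards [ψ.open_source.mem_nhds hz,
    hX₁.1.continuous.continuousAt.eventually (φ.open_source.mem_nhds hx)] with z' hz' hx'
  have key : ∀ z'', z'' = z' →
      (ofChart φ (φ (X₁ z')) (toChart φ (X₁ z'') (v z'')) : Coord d) = v z' := by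
    rintro z'' rfl
    exact hφ.ofChart_toChart hx' _
  exact tangent_ext (φ.left_inv hx').symm (key _ (ψ.left_inv hz')).symm

/-- The partial sum `∑_{j < m} ε^{j+1} w_j`. -/
noncomputable def partialSum (w : ℕ → ∀ z, TangentSpace (𝓡 d) (X₁ z)) (m : ℕ) (ε : ℝ) (z : N) :
    TangentSpace (𝓡 d) (X₁ z) := ∑ j ∈ Finset.range m, ε ^ (j + 1) • w j z

theorem chartField_partialSum (ψ : OpenPartialHomeomorph N (Coord p))
    (φ : OpenPartialHomeomorph M (Coord d)) (w : ℕ → ∀ z, TangentSpace (𝓡 d) (X₁ z)) (m : ℕ) (ε : ℝ) :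
    chartField ψ φ X₁ (partialSum w m ε) =
      fun u => ε • polyField (fun j => chartField ψ φ X₁ (w j)) m ε u := by
  ext1 u
  have h1 : chartField ψ φ X₁ (partialSum w m ε) u =
      ∑ j ∈ Finset.range m, ε ^ (j + 1) • chartField ψ φ X₁ (w j) u := by
    refine (map_sum (mfderiv (𝓡 d) (𝓡 d) φ (X₁ (ψ.symm u))) _ _).trans
      (Finset.sum_congr rfl fun j _ => ?_)
    exact map_smul (mfderiv (𝓡 d) (𝓡 d) φ (X₁ (ψ.symm u))) _ _
  rw [h1, polyField, Finset.smul_sum]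
  exact Finset.sum_congr rfl fun j _ => by rw [smul_smul, pow_succ']

theorem smoothNear_polyField (hw : ∀ k, IsSmoothField p X₁ (w k)) (hψ : IsChart ψ) (hφ : IsChart φ)
    (hu : u ∈ ψ.target) (hx : X₁ (ψ.symm u) ∈ φ.source) (ε : ℝ) (m : ℕ) :
    SmoothNear (Function.uncurry (polyField (fun j => chartField ψ φ X₁ (w j)) m)) (ε, u) :=
  smooth_polyField (fun j _ => (hw j).smoothNear hψ hφ hu hx) ε

theorem polyField_slice {V : ℕ → Coord p → Coord d} {ε : ℝ}
    (h : SmoothNear (Function.uncurry (polyField V m)) (ε, u)) : SmoothNear (polyField V m ε) u :=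
  SmoothNear.comp (f := fun v => (ε, v)) h
    (smoothNear_of_contDiff (contDiff_const.prodMk contDiff_id))

theorem isSmoothField_partialSum (hX₁ : IsSmoothImmersion p d X₁)
    (hw : ∀ k, IsSmoothField p X₁ (w k)) (m : ℕ) (ε : ℝ) :
    IsSmoothField p X₁ (partialSum w m ε) := by
  refine isSmoothField_of_chartField hX₁ fun ψ φ hψ hφ u hu hx => ?_
  rw [chartField_partialSum]
  exact (contDiffAt_const (c := ε)).smul
    (polyField_slice (smoothNear_polyField hw hψ hφ hu hx ε m)).contDiffAt

theorem isNormalField_partialSum (hw : ∀ k, IsNormalField p g X₁ (w k)) (m : ℕ) (ε : ℝ) :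
    IsNormalField p g X₁ (partialSum w m ε) := by
  intro z ξ
  have h1 : g.inner (X₁ z) (partialSum w m ε z) =
      ∑ j ∈ Finset.range m, ε ^ (j + 1) • g.inner (X₁ z) (w j z) :=
    (map_sum (g.inner (X₁ z)) _ _).trans (Finset.sum_congr rfl fun j _ => map_smul _ _ _)
  rw [h1, _root_.sum_apply]
  refine Finset.sum_eq_zero fun j _ => ?_
  rw [smul_apply, hw j z ξ, smul_zero]

/-- The deformation of `X₁` by the field `∑_{j < m} ε^{j+1} w_j`, in charts. -/
theorem expansion_partialSum (hX₁ : IsSmoothImmersion p d X₁) (hw : ∀ k, IsSmoothField p X₁ (w k))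
    (hψ : IsChart ψ) (hφ : IsChart φ) (hu : u ∈ ψ.target) (hx : X₁ (ψ.symm u) ∈ φ.source)
    (g : Metric d M) (m n : ℕ) (ε : ℝ) :
    expansion (operators p d) g X₁ (partialSum w m ε) ψ φ n 1 u =
      series (chartMetric g φ) (chartMap ψ φ X₁)
        (polyField (fun j => chartField ψ φ X₁ (w j)) m ε) n ε u := by
  rw [expansion_eq_series hX₁ (isSmoothField_partialSum hX₁ hw m ε) hψ hφ hu hx,
    chartField_partialSum, series, series]
  have hd := (hX₁.immersionNear hψ hφ hu hx g).dataNear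
    (polyField_slice (smoothNear_polyField hw hψ hφ hu hx ε m))
  exact Finset.sum_congr rfl fun n _ => by rw [hd.coeff_smul, one_pow, one_smul]

namespace IsDeformation

theorem smooth_position (h : IsDeformation p d X₁ X₂ W) (g : Metric d M) (k : ℕ) :
    IsSmoothField p X₁ (position p g X₁ X₂ k) := by
  refine isSmoothField_of_chartField h.imm fun ψ φ hψ hφ u hu hx => ?_
  refine ((h.placementNear hψ hφ hu hx g).smooth_posField k).contDiffAt.congr_of_eventuallyEq ?_
  filter_upwards [eventually_chart h.imm.1.continuous hu hx] with v hv
  exact h.chartField_position hψ hφ hv.1 hv.2 g k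

theorem isNormal_position (h : IsDeformation p d X₁ X₂ W) (g : Metric d M) (k : ℕ) :
    IsNormalField p g X₁ (position p g X₁ X₂ k) := by
  intro z
  obtain ⟨ψ, hψ, hz⟩ := exists_chart (n := p) z
  obtain ⟨φ, hφ, hx⟩ := exists_chart (n := d) (X₁ z)
  have e := ψ.left_inv hz
  have hx' : X₁ (ψ.symm (ψ z)) ∈ φ.source := by rwa [e]
  rw [← e]
  refine (isNormal_chart_iff h.imm hψ hφ (ψ.map_source hz) hx' g).2 fun ξ => ?_
  rw [h.chartField_position hψ hφ (ψ.map_source hz) hx' g k]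
  exact (h.placementNear hψ hφ (ψ.map_source hz) hx' g).inner_posField k ξ

/-- Existence: the position field displaces `X₁` to `X₂`. -/
theorem isRelativePosition (h : IsDeformation p d X₁ X₂ W) (g : Metric d M) :
    IsRelativePosition (operators p d) g X₁ X₂ (position p g X₁ X₂) := by
  refine ⟨fun k => ⟨h.smooth_position g k, h.isNormal_position g k⟩, fun m z₀ => ?_⟩
  obtain ⟨ψ, hψ, hz₀⟩ := exists_chart (n := p) z₀
  obtain ⟨φ, hφ, hx₀⟩ := exists_chart (n := d) (X₁ z₀)
  have hu₀ : ψ z₀ ∈ ψ.target := ψ.map_source hz₀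
  have hx₀' : X₁ (ψ.symm (ψ z₀)) ∈ φ.source := by rwa [ψ.left_inv hz₀]
  set r := (placement (chartMetric g φ) (chartMap ψ φ X₁)
    (Function.uncurry (chartFamily ψ φ X₂)) m).1
  have hr0 : ∀ v, r (v, 0) = v := placement_zero m
  have hsm : SmoothNear r (ψ z₀, 0) := ((h.placementNear hψ hφ hu₀ hx₀' g).smooth_placement m).1
  have hev := (hsm.and (hsm.contDiffAt.continuousAt.eventually
    (ψ.open_target.mem_nhds (by rwa [hr0])))).and
      ((continuousAt_fst (p := (ψ z₀, (0 : ℝ)))).eventually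
        (eventually_chart h.imm.1.continuous hu₀ hx₀'))
  obtain ⟨O, hO, hOo, hO₀⟩ := eventually_nhds_iff.1 hev
  refine ⟨chartDomain ψ O, ofCharts ψ ψ r, isOpen_chartDomain hOo, ⟨hz₀, hO₀⟩,
    contMDiffOn_ofCharts hψ hψ (fun q hq => (hO q hq).1.1) (fun q hq => (hO q hq).1.2), ?_⟩
  rintro z ⟨hz, hq⟩
  have hρ0 : ofCharts ψ ψ r z 0 = z := by rw [ofCharts, hr0, ψ.left_inv hz]
  refine ⟨hρ0, fun ψ' φ' hψ' hφ' hz' hx' k hk => ?_⟩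
  have e := ψ'.left_inv hz'
  have hu' := ψ'.map_source hz'
  have hx : X₁ z ∈ φ.source := by
    have := (hO _ hq).2.2
    rwa [ψ.left_inv hz] at this
  have hxs : X₁ (ψ'.symm (ψ' z)) ∈ φ'.source := by rwa [e]
  have H := h.relatedPlacements hψ hφ hψ' hφ' hu' (by rwa [e]) (by rwa [e]) hxs g
  have hrz : ContDiffAt ℝ ∞ (fun ε => r (ψ (ψ'.symm (ψ' z)), ε)) 0 := H.pl.smooth_repar m
  have hw := h.smooth_position g
  have hU' := smoothNear_polyField (m := m) hw hψ' hφ' hu' hxs 0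
  have hUU : ∀ᶠ v in 𝓝 (ψ' z), ∀ ε : ℝ,
      polyField (fun j => chartField ψ' φ' X₁ (position p g X₁ X₂ j)) m ε v =
        fderiv ℝ (fun y => φ' (φ.symm y)) (chartMap ψ φ X₁ (ψ (ψ'.symm v)))
          (polyField (posField (chartMetric g φ) (chartMap ψ φ X₁)
            (Function.uncurry (chartFamily ψ φ X₂))) m ε (ψ (ψ'.symm v))) := by
    filter_upwards [H.eventually, eventually_chart h.imm.1.continuous hu' hxs] with v hv hv' ε
    rw [polyField, polyField, map_sum]
    refine Finset.sum_congr rfl fun j _ => ?_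
    rw [map_smul, ← hv.posField_eq j, h.chartField_position hψ' hφ' hv'.1 hv'.2 g j]
  have key := H.jetEq_transfer hrz (hr0 _)
    (smooth_polyField (m := m) (fun j _ => H.pl.smooth_posField j) 0) hU' hUU
    (H.pl.jetEq_placement m)
  have hloc : (fun ε => φ' (X₂ (ofCharts ψ ψ r z ε) ε)) =ᶠ[𝓝 0] fun ε =>
      Function.uncurry (chartFamily ψ' φ' X₂) (ψ' (ψ.symm (r (ψ (ψ'.symm (ψ' z)), ε))), ε) := by
    have h1 : ContinuousAt (fun ε => ofCharts ψ ψ r z ε) 0 := by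
      refine ContinuousAt.comp (f := fun ε => r (ψ z, ε)) (g := ψ.symm) ?_ ?_
      · rw [hr0]
        exact ψ.continuousAt_symm (ψ.map_source hz)
      · rw [e] at hrz
        exact hrz.continuousAt
    have h2 : ofCharts ψ ψ r z 0 ∈ ψ'.source := by rwa [hρ0]
    filter_upwards [h1.eventually (ψ'.open_source.mem_nhds h2)] with ε hε
    have hε' : ψ.symm (r (ψ z, ε)) ∈ ψ'.source := hε
    simp only [Function.uncurry, chartFamily, e]
    rw [ψ'.left_inv hε', ofCharts]
  have hfin := (JetEq.of_eventuallyEq hloc).trans key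
  rw [JetEq.iff_iteratedDeriv.1 hfin k (Nat.lt_succ_of_le hk)]
  exact congrArg (fun f => iteratedDeriv k f 0)
    (funext fun ε => (expansion_partialSum h.imm hw hψ' hφ' hu' hxs g m m ε).symm)

/-- At a given point and order, in charts, the displaced submanifold is `X₂` in a suitable
parametrisation. -/
theorem exists_repar (h : IsDeformation p d X₁ X₂ W)
    (hw : IsRelativePosition (operators p d) g X₁ X₂ w) (hψ : IsChart ψ) (hφ : IsChart φ)
    (hu : u ∈ ψ.target) (hx : X₁ (ψ.symm u) ∈ φ.source) (k : ℕ) :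
    ∃ r : ℝ → Coord p, ContDiffAt ℝ ∞ r 0 ∧ r 0 = u ∧
      JetEq (k + 2) (fun ε => Function.uncurry (chartFamily ψ φ X₂) (r ε, ε)) 0
        (fun ε => series (chartMetric g φ) (chartMap ψ φ X₁)
          (polyField (fun j => chartField ψ φ X₁ (w j)) k ε) (k + 1) ε u +
            ε ^ (k + 1) • chartField ψ φ X₁ (w k) u) 0 := by
  obtain ⟨O, ρ, hO, h0, hρ, H⟩ := hw.2 (k + 1) (ψ.symm u)
  obtain ⟨hρ0, H⟩ := H _ h0
  have hz := ψ.map_target hu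
  have hs := H ψ φ hψ hφ hz hx
  have hρs : ContMDiffAt 𝓘(ℝ, ℝ) (𝓡 p) ∞ (fun ε => ρ (ψ.symm u) ε) 0 :=
    (hρ.contMDiffAt (hO.mem_nhds h0)).comp (0 : ℝ) (f := fun ε => (ψ.symm u, ε))
      (contMDiffAt_const.prodMk contMDiffAt_id)
  have hsrc : ρ (ψ.symm u) 0 ∈ ψ.source := by rwa [hρ0]
  refine ⟨fun ε => ψ (ρ (ψ.symm u) ε), contMDiffAt_iff_contDiffAt.1
    ((hψ.contMDiffAt hsrc).comp (0 : ℝ) hρs), (congrArg ψ hρ0).trans (ψ.right_inv hu), ?_⟩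
  have hloc : (fun ε => Function.uncurry (chartFamily ψ φ X₂) (ψ (ρ (ψ.symm u) ε), ε)) =ᶠ[𝓝 0]
      fun ε => φ (X₂ (ρ (ψ.symm u) ε) ε) := by
    filter_upwards [hρs.continuousAt.eventually (ψ.open_source.mem_nhds hsrc)] with ε hε
    simp only [Function.uncurry, chartFamily]
    rw [ψ.left_inv hε]
  have hws := fun j => (hw.1 j).1
  have h1 : JetEq (k + 2) (fun ε => φ (X₂ (ρ (ψ.symm u) ε) ε)) 0
      (fun ε => series (chartMetric g φ) (chartMap ψ φ X₁)
        (polyField (fun j => chartField ψ φ X₁ (w j)) (k + 1) ε) (k + 1) ε u) 0 := by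
    refine JetEq.iff_iteratedDeriv.2 fun j hj => ?_
    rw [hs j (by omega), ψ.right_inv hu]
    exact congrArg (fun f => iteratedDeriv j f 0)
      (funext fun ε => expansion_partialSum h.imm hws hψ hφ hu hx g (k + 1) (k + 1) ε)
  refine (JetEq.of_eventuallyEq hloc).trans (h1.trans ?_)
  have h2 := jetEq_series_add (h.imm.immersionNear hψ hφ hu hx g)
    (smoothNear_polyField hws hψ hφ hu hx 0 k) ((hws k).smoothNear hψ hφ hu hx) k k.succ_pos
  simpa only [polyField_succ] using h2

/-- Uniqueness of the field that describes the relative position. -/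
theorem relativePosition_unique (h : IsDeformation p d X₁ X₂ W)
    (hw : IsRelativePosition (operators p d) g X₁ X₂ w)
    (hw' : IsRelativePosition (operators p d) g X₁ X₂ w') : w = w' := by
  funext k
  induction k using Nat.strong_induction_on with
  | _ k ih =>
    funext z
    obtain ⟨ψ, hψ, hz⟩ := exists_chart (n := p) z
    obtain ⟨φ, hφ, hx⟩ := exists_chart (n := d) (X₁ z)
    have e := ψ.left_inv hz
    have hu := ψ.map_source hz
    have hx' : X₁ (ψ.symm (ψ z)) ∈ φ.source := by rwa [e]
    obtain ⟨r, hr, hr0, hj⟩ := h.exists_repar hw hψ hφ hu hx' k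
    obtain ⟨r', hr', hr0', hj'⟩ := h.exists_repar hw' hψ hφ hu hx' k
    have hpoly : polyField (fun j => chartField ψ φ X₁ (w' j)) k =
        polyField (fun j => chartField ψ φ X₁ (w j)) k := by
      ext1 ε
      ext1 v
      exact Finset.sum_congr rfl fun j hj =>
        congrArg (fun v' => ε ^ j • chartField ψ φ X₁ v' v) (ih j (Finset.mem_range.1 hj)).symm
    rw [hpoly] at hj'
    have hpl := h.placementNear hψ hφ hu hx' g
    have hn := fun (v : ∀ z, TangentSpace (𝓡 d) (X₁ z)) (hv : IsNormalField p g X₁ v) =>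
      (isNormal_chart_iff h.imm hψ hφ hu hx' g).1 fun ξ => hv _ ξ
    have key := normal_eq_of_jetEq hpl.imm.metric.isMetric hpl.smooth
      (by rw [hpl.fderiv_eq]; exact hpl.imm.injective) hr hr' hr0 hr0'
      (smooth_series_diag hpl.imm (smoothNear_polyField (fun j => (hw.1 j).1) hψ hφ hu hx' 0 k)
        (k + 1)).slice.contDiffAt hj hj'
      (by rw [hpl.fderiv_eq]; exact hn _ (hw.1 k).2) (by rw [hpl.fderiv_eq]; exact hn _ (hw'.1 k).2)
    have h1 : ∀ z', z' = z → toChart φ (X₁ z') (w k z') = toChart φ (X₁ z') (w' k z') →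
        w k z = w' k z := by
      rintro z' rfl hzz
      refine (hφ.ofChart_toChart hx (w k z')).symm.trans (Eq.trans ?_ (hφ.ofChart_toChart hx (w' k z')))
      rw [hzz]
    exact h1 _ e key

end IsDeformation

/-- The relative position is described by the same field for all metrics in the Weyl class, since the
partial sums of the field are normal and the operators on normal fields are invariant. -/
theorem IsRelativePosition.weyl (hp : 0 < p) (hX₁ : IsSmoothImmersion p d X₁) {σ : M → ℝ}
    (hσ : IsWeylRescaling g g' σ) (hw : IsRelativePosition (operators p d) g X₁ X₂ w) :
    IsRelativePosition (operators p d) g' X₁ X₂ w := by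
  refine ⟨fun k => ⟨(hw.1 k).1, (hw.1 k).2.weyl hσ⟩, fun m z₀ => ?_⟩
  obtain ⟨O, ρ, hO, h0, hρ, H⟩ := hw.2 m z₀
  refine ⟨O, ρ, hO, h0, hρ, fun z hz => ⟨(H z hz).1, fun ψ φ hψ hφ hz' hx k hk => ?_⟩⟩
  rw [(H z hz).2 ψ φ hψ hφ hz' hx k hk]
  refine congrArg (fun f => iteratedDeriv k f 0) (funext fun ε => Finset.sum_congr rfl fun n _ => ?_)
  congr 1
  exact (term_weyl hp hσ hX₁ (isSmoothField_partialSum hX₁ (fun j => (hw.1 j).1) m ε)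
    (isNormalField_partialSum (fun j => (hw.1 j).2) m ε) hψ hφ (ψ.map_source hz')
    (by rwa [ψ.left_inv hz']) n).symm

end Position

end Defect

theorem mainTheorem5 (p d : ℕ) (hp : 0 < p) :
    -- Weyl invariance of the equation and preservation of orthogonality
    (∀ (M : Type u₁) [TopologicalSpace M] [ChartedSpace (Coord d) M] [IsManifold (𝓡 d) ∞ M]
      (N : Type u₂) [TopologicalSpace N] [ChartedSpace (Coord p) N] [IsManifold (𝓡 p) ∞ N]
      (g : Metric d M) (X : N → ℝ → M) (W : Set (N × ℝ)), IsSmoothFamily p d X W →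
      -- the left-hand side is unchanged wherever the velocity is orthogonal
      (∀ (g' : Metric d M) (σ : M → ℝ), IsWeylRescaling g g' σ →
        ∀ (ψ : OpenPartialHomeomorph N (Coord p)) (φ : OpenPartialHomeomorph M (Coord d)),
        IsChart ψ → IsChart φ → ∀ z t, (z, t) ∈ W → z ∈ ψ.source → X z t ∈ φ.source →
        IsOrthogonalAt p g X z t → chartLHS g' X ψ φ (ψ z) t = chartLHS g X ψ φ (ψ z) t) ∧
      -- the evolution law of the inner products of the velocity with the tangent vectors
      (SolvesEvolution p g X W →
        ∀ (ψ : OpenPartialHomeomorph N (Coord p)) (φ : OpenPartialHomeomorph M (Coord d)),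
        IsChart ψ → IsChart φ → ∀ z t, (z, t) ∈ W → z ∈ ψ.source → X z t ∈ φ.source →
        ∀ a : Fin p,
          let G := chartMetric g φ
          let x := chartFamily ψ φ X
          let u := ψ z
          HasDerivAt (fun s => dot (G (x u s)) (vel x u s) (frame (fun u' => x u' s) u a))
            (-(2 / (p : ℝ)) * dot (G (x u t)) (vel x u t) (traceFF G (fun u' => x u' t) u) *
              dot (G (x u t)) (vel x u t) (frame (fun u' => x u' t) u a)) t) ∧
      -- for normal initial velocity, orthogonality persists and the solutions are the same for
      -- all metrics of the Weyl class
      (∀ (X₁ : N → M) (v : ∀ z, TangentSpace (𝓡 d) (X₁ z)),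
        (∀ z t, (z, t) ∈ W → ∀ s ∈ Set.uIcc 0 t, (z, s) ∈ W) →
        HasInitialData X W X₁ v → IsNormalField p g X₁ v →
        (SolvesEvolution p g X W → ∀ z t, (z, t) ∈ W → IsOrthogonalAt p g X z t) ∧
        (∀ (g' : Metric d M) (σ : M → ℝ), IsWeylRescaling g g' σ →
          (SolvesEvolution p g X W ↔ SolvesEvolution p g' X W)))) ∧
    -- diffeomorphism covariance of the equation
    (∀ (M : Type u₁) [TopologicalSpace M] [ChartedSpace (Coord d) M] [IsManifold (𝓡 d) ∞ M]
      (M' : Type u₃) [TopologicalSpace M'] [ChartedSpace (Coord d) M'] [IsManifold (𝓡 d) ∞ M']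
      (N : Type u₂) [TopologicalSpace N] [ChartedSpace (Coord p) N] [IsManifold (𝓡 p) ∞ N]
      (N' : Type u₄) [TopologicalSpace N'] [ChartedSpace (Coord p) N'] [IsManifold (𝓡 p) ∞ N']
      (Φ : M ≃ₘ^∞⟮𝓡 d, 𝓡 d⟯ M') (Ψ : N' ≃ₘ^∞⟮𝓡 p, 𝓡 p⟯ N)
      (g : Metric d M) (g' : Metric d M'), IsPullback Φ g g' →
      ∀ (X : N → ℝ → M) (W : Set (N × ℝ)), IsSmoothFamily p d X W →
      ∀ (ψ : OpenPartialHomeomorph N (Coord p)) (φ : OpenPartialHomeomorph M (Coord d))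
        (ψ' : OpenPartialHomeomorph N' (Coord p)) (φ' : OpenPartialHomeomorph M' (Coord d)),
      IsChart ψ → IsChart φ → IsChart ψ' → IsChart φ' →
      ∀ z t, (Ψ z, t) ∈ W → Ψ z ∈ ψ.source → z ∈ ψ'.source → X (Ψ z) t ∈ φ.source →
      Φ (X (Ψ z) t) ∈ φ'.source →
      chartLHS g' (fun z' t' => Φ (X (Ψ z') t')) ψ' φ' (ψ' z) t =
        fderiv ℝ (fun y => φ' (Φ (φ.symm y))) (φ (X (Ψ z) t)) (chartLHS g X ψ φ (ψ (Ψ z)) t)) ∧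
    -- solution order by order through local operators that depend on `p` and `d` only
    ∃ A : LocalOperators p d, A.Smooth ∧
    (∀ (M : Type u₁) [TopologicalSpace M] [ChartedSpace (Coord d) M] [IsManifold (𝓡 d) ∞ M]
      (N : Type u₂) [TopologicalSpace N] [ChartedSpace (Coord p) N] [IsManifold (𝓡 p) ∞ N]
      (g : Metric d M) (X₁ : N → M), IsSmoothImmersion p d X₁ →
      (∀ v : (∀ z, TangentSpace (𝓡 d) (X₁ z)), IsSmoothField p X₁ v →
        -- existence to every order, near every point
        (∀ (m : ℕ) (z₀ : N), ∃ (W : Set (N × ℝ)) (X : N → ℝ → M), (z₀, (0 : ℝ)) ∈ W ∧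
          IsSmoothFamily p d X W ∧ HasInitialData X W X₁ v ∧ SolvesToOrder p g X W m) ∧
        -- uniqueness to every order: the Taylor coefficients are given by the operators
        (∀ (m : ℕ) (W : Set (N × ℝ)) (X : N → ℝ → M),
          IsSmoothFamily p d X W → HasInitialData X W X₁ v → SolvesToOrder p g X W m →
          ∀ (ψ : OpenPartialHomeomorph N (Coord p)) (φ : OpenPartialHomeomorph M (Coord d)),
          IsChart ψ → IsChart φ → ∀ z, (z, (0 : ℝ)) ∈ W → z ∈ ψ.source → X z 0 ∈ φ.source →
          ∀ k < m + 2, iteratedDeriv k (fun t => φ (X z t)) 0 =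
            (k.factorial : ℝ) • term A g X₁ v ψ φ k (ψ z)) ∧
        -- the expansion to second order
        (∀ (ψ : OpenPartialHomeomorph N (Coord p)) (φ : OpenPartialHomeomorph M (Coord d)),
          IsChart ψ → IsChart φ → ∀ z, z ∈ ψ.source → X₁ z ∈ φ.source →
          expansion A g X₁ v ψ φ 2 1 (ψ z) =
            secondOrderDisplacement (chartMetric g φ) (chartMap ψ φ X₁)
              (chartField ψ φ X₁ v) (ψ z)) ∧
        -- Weyl invariance of every term
        (IsNormalField p g X₁ v → ∀ (g' : Metric d M) (σ : M → ℝ), IsWeylRescaling g g' σ →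
          ∀ (ψ : OpenPartialHomeomorph N (Coord p)) (φ : OpenPartialHomeomorph M (Coord d)),
          IsChart ψ → IsChart φ → ∀ z, z ∈ ψ.source → X₁ z ∈ φ.source →
          ∀ n, term A g' X₁ v ψ φ n (ψ z) = term A g X₁ v ψ φ n (ψ z))) ∧
      -- parametrisation of nearby submanifolds, up to reparametrisation, by normal fields
      (∀ (X₂ : N → ℝ → M) (W : Set (N × ℝ)), IsOpen W → (∀ z, (z, (0 : ℝ)) ∈ W) →
        ContMDiffOn ((𝓡 p).prod 𝓘(ℝ, ℝ)) (𝓡 d) ∞ (Function.uncurry X₂) W →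
        (∀ z, X₂ z 0 = X₁ z) →
        (∃! w : ℕ → ∀ z, TangentSpace (𝓡 d) (X₁ z), IsRelativePosition A g X₁ X₂ w) ∧
        (∀ (g' : Metric d M) (σ : M → ℝ), IsWeylRescaling g g' σ →
          ∀ w : ℕ → ∀ z, TangentSpace (𝓡 d) (X₁ z),
            IsRelativePosition A g X₁ X₂ w ↔ IsRelativePosition A g' X₁ X₂ w))) ∧
    -- diffeomorphism covariance of the expansion
    (∀ (M : Type u₁) [TopologicalSpace M] [ChartedSpace (Coord d) M] [IsManifold (𝓡 d) ∞ M]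
      (M' : Type u₃) [TopologicalSpace M'] [ChartedSpace (Coord d) M'] [IsManifold (𝓡 d) ∞ M']
      (N : Type u₂) [TopologicalSpace N] [ChartedSpace (Coord p) N] [IsManifold (𝓡 p) ∞ N]
      (N' : Type u₄) [TopologicalSpace N'] [ChartedSpace (Coord p) N'] [IsManifold (𝓡 p) ∞ N']
      (Φ : M ≃ₘ^∞⟮𝓡 d, 𝓡 d⟯ M') (Ψ : N' ≃ₘ^∞⟮𝓡 p, 𝓡 p⟯ N)
      (g : Metric d M) (g' : Metric d M'), IsPullback Φ g g' →
      ∀ (X₁ : N → M), IsSmoothImmersion p d X₁ →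
      ∀ v : (∀ z, TangentSpace (𝓡 d) (X₁ z)), IsSmoothField p X₁ v →
      ∀ (ψ : OpenPartialHomeomorph N (Coord p)) (φ : OpenPartialHomeomorph M (Coord d))
        (ψ' : OpenPartialHomeomorph N' (Coord p)) (φ' : OpenPartialHomeomorph M' (Coord d)),
      IsChart ψ → IsChart φ → IsChart ψ' → IsChart φ' →
      ∀ z, Ψ z ∈ ψ.source → z ∈ ψ'.source → X₁ (Ψ z) ∈ φ.source → Φ (X₁ (Ψ z)) ∈ φ'.source →
      ∀ m, ∀ k ≤ m,
        iteratedDeriv k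
          (fun t : ℝ => φ' (Φ (φ.symm (expansion A g X₁ v ψ φ m t (ψ (Ψ z)))))) 0 =
        iteratedDeriv k
          (fun t : ℝ => expansion A g' (fun z' => Φ (X₁ (Ψ z')))
            (fun z' => mfderiv (𝓡 d) (𝓡 d) Φ (X₁ (Ψ z')) (v (Ψ z'))) ψ' φ' m t (ψ' z)) 0) := by
  refine ⟨?_, ?_, operators p d, operators_smooth p d, ?_, ?_⟩
  · intro M _ _ _ N _ _ _ g X W hX
    refine ⟨fun g' σ hσ ψ φ hψ hφ z t hW hz hx ho => ?_,
      fun hs ψ φ hψ hφ z t hW hz hx a => ?_, fun X₁ v hW hi hv => ⟨fun hs z t hz =>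
        isOrthogonalAt_of_solves hX hW hi hv hs hz, fun g' σ hσ => ⟨fun hs =>
        hs.weyl hp hX hW hi hv hσ, fun hs => hs.weyl hp hX hW hi (hv.weyl hσ) hσ.symm⟩⟩⟩
    · exact chartLHS_weyl hp hX hσ hψ hφ (InCharts.of_mem hW hz hx) (by rwa [ψ.left_inv hz])
    · exact hasDerivAt_inner_frame hX hψ hφ (InCharts.of_mem hW hz hx)
        (hs ψ φ hψ hφ z t hW hz hx) a
  · intro M _ _ _ M' _ _ _ N _ _ _ N' _ _ _ Φ Ψ g g' h X W hX ψ φ ψ' φ' hψ hφ hψ' hφ' z t hW hz hz'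
      hx hx'
    exact chartLHS_transport hX Ψ h hψ hφ hψ' hφ' hz hz' hW hx hx'
  · intro M _ _ _ N _ _ _ g X₁ hX₁
    refine ⟨fun v hv => ⟨fun m z₀ => exists_solvesToOrder hX₁ hv g m z₀,
      fun m W X hX hi hs ψ φ hψ hφ z hW hz hx k hk => ?_,
      fun ψ φ hψ hφ z hz hx => ?_, fun hn g' σ hσ ψ φ hψ hφ z hz hx n => ?_⟩,
      fun X₂ W hW h0 hX₂ hX₂0 => ?_⟩
    · have h1 := iteratedDeriv_eq_term hX₁ hv hX hi hs hψ hφ (InCharts.of_mem hW hz hx) hk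
      simp only [chartFamily, ψ.left_inv hz] at h1
      exact h1
    · have hx' : X₁ (ψ.symm (ψ z)) ∈ φ.source := by rwa [ψ.left_inv hz]
      rw [expansion_eq_series hX₁ hv hψ hφ (ψ.map_source hz) hx']
      exact series_two_eq (hX₁.immersionNear hψ hφ (ψ.map_source hz) hx' g)
        (hv.smoothNear hψ hφ (ψ.map_source hz) hx')
    · exact term_weyl hp hσ hX₁ hv hn hψ hφ (ψ.map_source hz) (by rwa [ψ.left_inv hz]) n
    · have h : IsDeformation p d X₁ X₂ W := ⟨hX₁, hW, h0, hX₂, hX₂0⟩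
      exact ⟨⟨position p g X₁ X₂, h.isRelativePosition g, fun w hw =>
        h.relativePosition_unique hw (h.isRelativePosition g)⟩,
        fun g' σ hσ w => ⟨fun hw => hw.weyl hp hX₁ hσ, fun hw => hw.weyl hp hX₁ hσ.symm⟩⟩
  · intro M _ _ _ M' _ _ _ N _ _ _ N' _ _ _ Φ Ψ g g' h X₁ hX₁ v hv ψ φ ψ' φ' hψ hφ hψ' hφ' z hz hz'
      hx hx' m k hk
    have e := ψ'.left_inv hz'
    have h1 := jetEq_expansion_transport hX₁ hv Ψ h hψ hφ hψ' hφ' (ψ'.map_source hz')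
      (by rwa [e]) (by rwa [e]) (by rwa [e]) m
    rw [e] at h1
    exact JetEq.iff_iteratedDeriv.1 h1 k (Nat.lt_succ_of_le hk)
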